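/- Let $H$ be a real separable Hilbert space with norm $|\cdot|$, continuously and densely embedded in a Hilbert space $U$. Let $(\Omega,\mathscr F,(\mathscr F_t)_{t\ge0},\mathbb P)$ be a stochastic basis satisfying the usual conditions. Let $A$ be the generator of a $C_0$-semigroup $(S_t)_{t\ge0}$ on $H$, let $a\in U$, and let $Q:\mathrm{dom}(Q)\subset H\to H$ be self-adjoint and nonnegative (possibly unbounded). Let $W$ be a standard cylindrical Wiener process in $H$ and $Y$ a $U$-valued pure jump Lévy process (that is, a Lévy process without Gaussian part), both with respect to $(\mathscr F_t)$, independent of each other, and such that the increments of the pair $(W,Y)$ after any time $s$ are independent of $\mathscr F_s$. Consider, for $x\in H$ and the noise $Z_t=ta+Q^{1/2}W_t+Y_t$, the equation $$dX_t=(AX_t+F(X_t))\,dt+dZ_t,\quad t>0,\qquad X_0=x. \tag{1}$$ Assume the following. (h1) For every $t\in(0,1]$ the operator $S_t$ extends to a bounded operator $S_t:U\to H$ (hence this holds for all $t>0$), and $\int_0^1|S_sa|\,ds<\infty$; for every $t>0$ the operator $S_tQ^{1/2}$ extends to a bounded operator on $H$, and $\int_0^1\|S_sQ^{1/2}\|_{HS}^2\,ds<\infty$,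 where $\|\cdot\|_{HS}$ is the Hilbert–Schmidt norm. (h2) For every $t\in(0,1]$ the stochastic integral $\int_0^tS_s\,dY_s$ is a well defined $H$-valued random variable, as a limit in probability of Stieltjes sums (namely as the limit in probability, as $c\downarrow0$, of the integrals over $[c,t]$, each of which is the limit in probability of its Stieltjes sums as the mesh tends to $0$), and there is $p>0$ such that $\sup_{t\in(0,1]}\mathbb E\big|\int_0^tS_s\,dY_s\big|^p<\infty$ and $\lim_{t\downarrow0}\mathbb E\big|\int_0^tS_s\,dY_s\big|^p=0$. (h3) $F:H\to H$ is bounded and Lipschitz continuous. Then the stochastic convolution $$Z_A(t)=\int_0^tS_s a\,ds+\int_0^tS_{t-s}Q^{1/2}\,dW_s+\int_0^tS_{t-s}\,dY_s,\qquad t\ge0,$$ where the last integral is the limit in probability, as $d\uparrow t$, of the Stieltjes integrals over $[0,d]$, is well defined and has a predictable version. Fix any such version $Z_A$. For every $x\in H$ equation (1) has a unique mild solution $X^x$, that is, a predictable $H$-valued process such that $$X^x_t=S_tx+\int_0^tS_{t-s}F(X^x_s)\,ds+Z_A(t),\qquad t\ge0,\quad \mathbb P\text{-a.s.}$$ More precisely: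 there is a solution for which this identity holds almost surely for all $t\ge0$ simultaneously; it is unique up to indistinguishability among such solutions, and it is unique up to modification among the predictable processes that satisfy the identity for each $t\ge0$ almost surely. Moreover, the solution $X^x$ is Markov and Feller: the laws $\mu^x_t$ of $X^x_t$ form a transition semigroup of probability kernels on $H$; for all $s,t\ge0$ and Borel $B\subset H$ one has $\mathbb P(X^x_{s+t}\in B\mid\mathscr F_s)=\mu_t^{X^x_s}(B)$ almost surely; and for all $t\ge0$ and all bounded continuous $f:H\to\mathbb R$ the function $x\mapsto\mathbb E f(X^x_t)$ is continuous. For every $x\in H$ and the $p$ of (h2), $\mathbb E|X^x_t|^p<\infty$ for all $t\ge0$, and $t\mapsto X^x_t$ is continuous in $p$-th mean on $[0,\infty)$, i.e. $\lim_{s\to t}\mathbb E|X^x_s-X^x_t|^p=0$ for every $t\ge0$. -/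

import Mathlib

open MeasureTheory ProbabilityTheory Filter Topology Set
open scoped NNReal ENNReal InnerProductSpace

noncomputable section

namespace LevySPDE

/-! ### Filtrations -/

/-- The usual conditions for a filtration: right-continuity, and `ℱ 0` contains every subset of
every `P`-null set (so that in particular `P` is complete). -/
structure UsualConditions {Ω : Type*} {mΩ : MeasurableSpace Ω} (ℱ : Filtration ℝ≥0 mΩ)
    (P : Measure Ω) : Prop where
  rightContinuous : ℱ.IsRightContinuous
  complete : ∀ N : Set Ω, P N = 0 → MeasurableSet[ℱ 0] N

/-! ### Semigroups and operators on `H` -/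

section Operators

variable {H : Type*} [NormedAddCommGroup H] [InnerProductSpace ℝ H]

/-- `S` is a `C₀`-semigroup of bounded linear operators on `H`. -/
structure IsC0Semigroup (S : ℝ≥0 → H →L[ℝ] H) : Prop where
  zero : S 0 = ContinuousLinearMap.id ℝ H
  add : ∀ s t, S (s + t) = (S s).comp (S t)
  continuous : ∀ x, Continuous fun t => S t x

/-- `A` is the infinitesimal generator of `S`: `x ∈ dom A` and `A x = y` if and only if
`(S_h x - x) / h → y` as `h ↓ 0`. -/
def IsGenerator (S : ℝ≥0 → H →L[ℝ] H) (A : H →ₗ.[ℝ] H) : Prop :=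
  ∀ x y : H, (x, y) ∈ A.graph ↔
    Tendsto (fun h : ℝ≥0 => (h : ℝ)⁻¹ • (S h x - x)) (𝓝[>] 0) (𝓝 y)

/-- `Q : dom Q ⊆ H → H` is (possibly unbounded,) self-adjoint and nonnegative.
Self-adjointness includes that the domain is dense. -/
structure IsNonnegSelfAdjoint [CompleteSpace H] (Q : H →ₗ.[ℝ] H) : Prop where
  selfAdjoint : IsSelfAdjoint Q
  nonneg : ∀ x : Q.domain, 0 ≤ ⟪Q x, (x : H)⟫_ℝ

/-- `R = Q^{1/2}`: the nonnegative self-adjoint operator with `R ∘ R = Q`, where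
`dom (R ∘ R) = {x ∈ dom R | R x ∈ dom R}`. -/
structure IsSqrtOf [CompleteSpace H] (R Q : H →ₗ.[ℝ] H) : Prop where
  nonnegSelfAdjoint : IsNonnegSelfAdjoint R
  sq_eq : ∀ x y : H, (x, y) ∈ Q.graph ↔ ∃ z, (x, z) ∈ R.graph ∧ (z, y) ∈ R.graph

/-- `T : U → H` extends `B : H → H` along the embedding `ι : H → U`. -/
def IsExtensionAlong {U : Type*} [NormedAddCommGroup U] [InnerProductSpace ℝ U]
    (ι : H →L[ℝ] U) (B : H →L[ℝ] H) (T : U →L[ℝ] H) : Prop :=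
  ∀ h : H, T (ι h) = B h

open Classical in
/-- The bounded extension of `B : H → H` to an operator `U → H`; it is unique when `ι` has dense
range (and it is `0` by convention if there is no bounded extension). -/
def extendAlong {U : Type*} [NormedAddCommGroup U] [InnerProductSpace ℝ U]
    (ι : H →L[ℝ] U) (B : H →L[ℝ] H) : U →L[ℝ] H :=
  if h : ∃ T, IsExtensionAlong ι B T then h.choose else 0

/-- `G` is a bounded operator on `H` extending `B ∘ R : dom R → H`. -/
def IsBoundedExtension (B : H →L[ℝ] H) (R : H →ₗ.[ℝ] H) (G : H →L[ℝ] H) : Prop :=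
  ∀ x : R.domain, G x = B (R x)

open Classical in
/-- The bounded extension to `H` of `B ∘ R : dom R → H`; it is unique when `dom R` is dense
(and it is `0` by convention if there is no bounded extension). -/
def boundedComp (B : H →L[ℝ] H) (R : H →ₗ.[ℝ] H) : H →L[ℝ] H :=
  if h : ∃ G, IsBoundedExtension B R G then h.choose else 0

/-- The squared Hilbert-Schmidt norm `∑ |K e_i|²` (possibly `∞`), for a complete orthonormal system
`(e_i)` of `H`; the value does not depend on the choice of the system. -/
def hilbertSchmidtSq [CompleteSpace H] (K : H →L[ℝ] H) : ℝ≥0∞ :=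
  ∑' e : (exists_hilbertBasis ℝ H).choose, ‖K (e : H)‖ₑ ^ 2

end Operators

/-! ### The driving noise -/

section Noise

variable {Ω : Type*} {mΩ : MeasurableSpace Ω}

/-- `W` is a standard cylindrical Wiener process in `H` with respect to `ℱ`; `W t h` stands for
`⟨W_t, h⟩`. -/
structure IsCylindricalWiener {H : Type*} [NormedAddCommGroup H] [InnerProductSpace ℝ H]
    (W : ℝ≥0 → H → Ω → ℝ) (ℱ : Filtration ℝ≥0 mΩ) (P : Measure Ω) : Prop where
  adapted : ∀ t h, Measurable[ℱ t] (W t h)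
  zero : ∀ h, W 0 h =ᵐ[P] 0
  linear : ∀ t (c : ℝ) (h k : H),
    (fun ω => W t (c • h + k) ω) =ᵐ[P] fun ω => c * W t h ω + W t k ω
  indep : ∀ s t h, s ≤ t →
    Indep (MeasurableSpace.comap (fun ω => W t h ω - W s h ω) inferInstance) (ℱ s) P
  gaussian : ∀ s t h, s ≤ t →
    P.map (fun ω => W t h ω - W s h ω) = gaussianReal 0 ((t - s) * ‖h‖₊ ^ 2)
  continuous : ∀ h, ∀ᵐ ω ∂P, Continuous fun t => W t h ω

variable {U : Type*} [NormedAddCommGroup U] [InnerProductSpace ℝ U]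
  [MeasurableSpace U] [BorelSpace U]

/-- `Y` is a `U`-valued Lévy process with respect to `ℱ`. -/
structure IsLevyProcess (Y : ℝ≥0 → Ω → U) (ℱ : Filtration ℝ≥0 mΩ) (P : Measure Ω) : Prop where
  adapted : StronglyAdapted ℱ Y
  zero : Y 0 =ᵐ[P] 0
  indep : ∀ s t, s ≤ t →
    Indep (MeasurableSpace.comap (fun ω => Y t ω - Y s ω) inferInstance) (ℱ s) P
  stationary : ∀ s t, P.map (fun ω => Y (s + t) ω - Y s ω) = P.map (Y t)
  stochContinuous : ∀ t, TendstoInMeasure P Y (𝓝 t) (Y t)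

/-- `M` is a Lévy measure on `U`. -/
structure IsLevyMeasure (M : Measure U) : Prop where
  zero : M {0} = 0
  integrable : ∫⁻ x, ENNReal.ofReal (min 1 (‖x‖ ^ 2)) ∂M < ∞

/-- A Lévy process is of pure jump type if there is no Gaussian part in its Lévy-Khintchine
formula. The vector `b` makes the notion independent of how small jumps are compensated. -/
def IsPureJump (Y : ℝ≥0 → Ω → U) (P : Measure Ω) : Prop :=
  ∃ (b : U) (M : Measure U), IsLevyMeasure M ∧ ∀ (t : ℝ≥0) (u : U),
    charFun (P.map (Y t)) u =
      Complex.exp (((t : ℝ) : ℂ) * (Complex.I * (⟪b, u⟫_ℝ : ℝ) +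
        ∫ x, (Complex.exp (Complex.I * (⟪x, u⟫_ℝ : ℝ)) - 1 -
          if ‖x‖ ≤ 1 then Complex.I * (⟪x, u⟫_ℝ : ℝ) else 0) ∂M))

/-- The driving noise `Z_t = t a + Q^{1/2} W_t + Y_t` on the stochastic basis `(Ω, ℱ, P)`: a
standard cylindrical Wiener process `W` in `H` and a `U`-valued pure jump Lévy process `Y` that are
independent of each other and such that the increments of the pair `(W, Y)` after time `s` are
independent of `ℱ s`. -/
structure IsLevyNoise {H : Type*} [NormedAddCommGroup H] [InnerProductSpace ℝ H]
    (W : ℝ≥0 → H → Ω → ℝ) (Y : ℝ≥0 → Ω → U) (ℱ : Filtration ℝ≥0 mΩ) (P : Measure Ω) : Prop where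
  wiener : IsCylindricalWiener W ℱ P
  levy : IsLevyProcess Y ℱ P
  pureJump : IsPureJump Y P
  indep : Indep (⨆ t, ⨆ h, MeasurableSpace.comap (W t h) inferInstance)
    (⨆ t, MeasurableSpace.comap (Y t) inferInstance) P
  jointIndep : ∀ s t, s ≤ t →
    Indep ((⨆ h, MeasurableSpace.comap (fun ω => W t h ω - W s h ω) inferInstance) ⊔
      MeasurableSpace.comap (fun ω => Y t ω - Y s ω) inferInstance) (ℱ s) P

end Noise

/-! ### Integrals with respect to the Lévy process: limits of Stieltjes sums -/

/-- Tagged partitions `c = r_0 ≤ r_1 ≤ … ≤ r_n = d` with tags `ξ_i ∈ [r_i, r_{i+1}]`. -/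
structure TaggedPartition (c d : ℝ≥0) where
  n : ℕ
  pt : ℕ → ℝ≥0
  tag : ℕ → ℝ≥0
  mono : Monotone pt
  pt_zero : pt 0 = c
  pt_n : pt n = d
  tag_mem : ∀ i, tag i ∈ Icc (pt i) (pt (i + 1))

/-- The mesh of a tagged partition. -/
def TaggedPartition.mesh {c d : ℝ≥0} (π : TaggedPartition c d) : ℝ≥0 :=
  (Finset.range π.n).sup fun i => π.pt (i + 1) - π.pt i

section Integrals

variable {Ω : Type*} {mΩ : MeasurableSpace Ω}
  {H : Type*} [NormedAddCommGroup H] [InnerProductSpace ℝ H]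
  {U : Type*} [NormedAddCommGroup U] [InnerProductSpace ℝ U]

/-- The Stieltjes sum `∑ Φ(ξ_i) (Y_{r_{i+1}} - Y_{r_i})`. -/
def stieltjesSum (Φ : ℝ≥0 → U →L[ℝ] H) (Y : ℝ≥0 → Ω → U) {c d : ℝ≥0} (π : TaggedPartition c d)
    (ω : Ω) : H :=
  ∑ i ∈ Finset.range π.n, Φ (π.tag i) (Y (π.pt (i + 1)) ω - Y (π.pt i) ω)

/-- `I = ∫_c^d Φ(s) dY_s` as a limit in probability of Stieltjes sums: the sums converge to `I` in
probability along every sequence of tagged partitions of `[c, d]` whose mesh tends to `0`. -/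
def IsStieltjesIntegral (P : Measure Ω) (Φ : ℝ≥0 → U →L[ℝ] H) (Y : ℝ≥0 → Ω → U) (c d : ℝ≥0)
    (I : Ω → H) : Prop :=
  ∀ π : ℕ → TaggedPartition c d, Tendsto (fun n => (π n).mesh) atTop (𝓝 0) →
    TendstoInMeasure P (fun n => stieltjesSum Φ Y (π n)) atTop I

/-- `I = ∫_0^t T(s) dY_s` for `t > 0` and operators `T(s) : U → H`, `s > 0`, that may be singular
at `s = 0`: the limit in probability, as `c ↓ 0`, of the Stieltjes integrals over `[c, t]`. -/
def IsJumpIntegral (P : Measure Ω) (T : ℝ≥0 → U →L[ℝ] H) (Y : ℝ≥0 → Ω → U) (t : ℝ≥0)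
    (I : Ω → H) : Prop :=
  ∃ J : ℝ≥0 → Ω → H,
    (∀ c, 0 < c → c < t → IsStieltjesIntegral P T Y c t (J c)) ∧
    TendstoInMeasure P J (𝓝[>] 0) I

/-- `I = ∫_0^t T(t - s) dY_s` for operators `T(s) : U → H`, `s > 0`, that may be singular at
`s = 0`: the limit in probability, as `d ↑ t`, of the Stieltjes integrals over `[0, d]`
(and `0` if `t = 0`). -/
def IsJumpConvolution (P : Measure Ω) (T : ℝ≥0 → U →L[ℝ] H) (Y : ℝ≥0 → Ω → U) (t : ℝ≥0)
    (I : Ω → H) : Prop :=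
  (t = 0 → I =ᵐ[P] 0) ∧
  (0 < t → ∃ J : ℝ≥0 → Ω → H,
    (∀ d, d < t → IsStieltjesIntegral P (fun s => T (t - s)) Y 0 d (J d)) ∧
    TendstoInMeasure P J (𝓝[<] t) I)

/-! ### Integrals with respect to the cylindrical Wiener process -/

/-- Elementary operator-valued integrands `∑ 1_{(a_i, b_i]}(s) ⟨u_i, ·⟩ h_i`. -/
structure ElementaryIntegrand (H : Type*) where
  n : ℕ
  a : Fin n → ℝ≥0
  b : Fin n → ℝ≥0
  u : Fin n → H
  h : Fin n → H
  le : ∀ i, a i ≤ b i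

/-- The operator `∑ 1_{(a_i, b_i]}(s) ⟨u_i, ·⟩ h_i` at time `s`. -/
def ElementaryIntegrand.toFun (φ : ElementaryIntegrand H) (s : ℝ≥0) : H →L[ℝ] H :=
  ∑ i, (Ioc (φ.a i) (φ.b i)).indicator
    (fun _ => InnerProductSpace.rankOne ℝ (φ.h i) (φ.u i)) s

/-- The elementary stochastic integral `∑ (W_{b_i}(u_i) - W_{a_i}(u_i)) h_i`. -/
def ElementaryIntegrand.integral (φ : ElementaryIntegrand H) (W : ℝ≥0 → H → Ω → ℝ) (ω : Ω) : H :=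
  ∑ i, (W (φ.b i) (φ.u i) ω - W (φ.a i) (φ.u i) ω) • φ.h i

/-- `I = ∫_0^t Φ(s) dW_s` for a deterministic integrand `Φ` with
`∫_0^t ‖Φ(s)‖²_{HS} ds < ∞`: the `L²(Ω; H)`-limit of the elementary integrals of elementary
integrands that approximate `Φ` in `L²((0, t]; HS)`. -/
def IsWienerIntegral [CompleteSpace H] (P : Measure Ω) (Φ : ℝ≥0 → H →L[ℝ] H)
    (W : ℝ≥0 → H → Ω → ℝ) (t : ℝ≥0) (I : Ω → H) : Prop :=
  AEStronglyMeasurable I P ∧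
  ∃ φ : ℕ → ElementaryIntegrand H,
    (∀ n i, (φ n).b i ≤ t) ∧
    Tendsto (fun n => ∫⁻ s in Ioc (0 : ℝ) t,
      hilbertSchmidtSq (Φ s.toNNReal - (φ n).toFun s.toNNReal)) atTop (𝓝 0) ∧
    Tendsto (fun n => ∫⁻ ω, ‖(φ n).integral W ω - I ω‖ₑ ^ 2 ∂P) atTop (𝓝 0)

/-! ### Hypotheses on the coefficients -/

/-- The assumptions on the semigroup, the drift vector `a` and `R = Q^{1/2}`. -/
structure SemigroupHypothesis [CompleteSpace H] (ι : H →L[ℝ] U) (S : ℝ≥0 → H →L[ℝ] H) (a : U)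
    (R : H →ₗ.[ℝ] H) : Prop where
  exists_extension : ∀ t, 0 < t → t ≤ 1 → ∃ T, IsExtensionAlong ι (S t) T
  drift_integrable : ∫⁻ s in Ioc (0 : ℝ) 1, ‖extendAlong ι (S s.toNNReal) a‖ₑ < ∞
  exists_boundedComp : ∀ t, 0 < t → ∃ G, IsBoundedExtension (S t) R G
  hilbertSchmidt_integrable :
    ∫⁻ s in Ioc (0 : ℝ) 1, hilbertSchmidtSq (boundedComp (S s.toNNReal) R) < ∞

/-- For every `t ∈ (0, 1]` the integral `I t = ∫_0^t S_s dY_s` is a well defined `H`-valued random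
variable, `sup_{t ∈ (0, 1]} E |I t|^p < ∞`, and `E |I t|^p → 0` as `t ↓ 0`. -/
def JumpHypothesis (P : Measure Ω) (ι : H →L[ℝ] U) (S : ℝ≥0 → H →L[ℝ] H) (Y : ℝ≥0 → Ω → U)
    (p : ℝ) : Prop :=
  ∃ I : ℝ≥0 → Ω → H,
    (∀ t, 0 < t → t ≤ 1 → IsJumpIntegral P (fun s => extendAlong ι (S s)) Y t (I t)) ∧
    (⨆ t ∈ Ioc (0 : ℝ≥0) 1, ∫⁻ ω, ‖I t ω‖ₑ ^ p ∂P) < ∞ ∧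
    Tendsto (fun t => ∫⁻ ω, ‖I t ω‖ₑ ^ p ∂P) (𝓝[>] 0) (𝓝 0)

/-! ### The equation and its solutions -/

/-- `ZA` is a predictable version of the stochastic convolution
`Z_A(t) = ∫_0^t S_s a ds + ∫_0^t S_{t-s} Q^{1/2} dW_s + ∫_0^t S_{t-s} dY_s`, `t ≥ 0`. -/
structure IsStochasticConvolution [CompleteSpace H] (ℱ : Filtration ℝ≥0 mΩ) (P : Measure Ω)
    (ι : H →L[ℝ] U) (S : ℝ≥0 → H →L[ℝ] H) (a : U) (R : H →ₗ.[ℝ] H) (W : ℝ≥0 → H → Ω → ℝ)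
    (Y : ℝ≥0 → Ω → U) (ZA : ℝ≥0 → Ω → H) : Prop where
  predictable : IsStronglyPredictable ℱ ZA
  eq : ∀ t : ℝ≥0, ∃ IW IY : Ω → H,
    IsWienerIntegral P (fun s => boundedComp (S (t - s)) R) W t IW ∧
    IsJumpConvolution P (fun s => extendAlong ι (S s)) Y t IY ∧
    ∀ᵐ ω ∂P, ZA t ω = (∫ s in (0 : ℝ)..t, extendAlong ι (S s.toNNReal) a) + IW ω + IY ω

/-- The identity `X_t = S_t x + ∫_0^t S_{t-s} F(X_s) ds + Z_A(t)` at time `t` and outcome `ω`,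
where the integral exists. -/
def MildEquationAt (S : ℝ≥0 → H →L[ℝ] H) (F : H → H) (ZA : ℝ≥0 → Ω → H) (x : H)
    (X : ℝ≥0 → Ω → H) (t : ℝ≥0) (ω : Ω) : Prop :=
  IntervalIntegrable (fun s : ℝ => S (t - s.toNNReal) (F (X s.toNNReal ω))) volume 0 t ∧
  X t ω = S t x + (∫ s in (0 : ℝ)..t, S (t - s.toNNReal) (F (X s.toNNReal ω))) + ZA t ω

/-- `X` is a mild solution started at `x`: it is predictable and, for every `t ≥ 0`, the mild
equation holds at time `t` almost surely. -/
structure IsMildSolution (ℱ : Filtration ℝ≥0 mΩ) (P : Measure Ω) (S : ℝ≥0 → H →L[ℝ] H)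
    (F : H → H) (ZA : ℝ≥0 → Ω → H) (x : H) (X : ℝ≥0 → Ω → H) : Prop where
  predictable : IsStronglyPredictable ℱ X
  eq : ∀ t, ∀ᵐ ω ∂P, MildEquationAt S F ZA x X t ω

/-- `X` is a mild solution in the pathwise sense: it is predictable and, almost surely, the mild
equation holds for all `t ≥ 0` simultaneously. -/
structure IsPathwiseMildSolution (ℱ : Filtration ℝ≥0 mΩ) (P : Measure Ω) (S : ℝ≥0 → H →L[ℝ] H)
    (F : H → H) (ZA : ℝ≥0 → Ω → H) (x : H) (X : ℝ≥0 → Ω → H) : Prop where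
  predictable : IsStronglyPredictable ℱ X
  eq : ∀ᵐ ω ∂P, ∀ t, MildEquationAt S F ZA x X t ω

variable [MeasurableSpace H]

/-- The family `X x`, `x ∈ H`, is Markov with respect to `ℱ`: the laws `μ_t^x` of `X x t` form a
transition semigroup of kernels and
`P (X x (s + t) ∈ B | ℱ s) = μ_t^{X x s}(B)` almost surely. -/
def IsMarkovFamily (ℱ : Filtration ℝ≥0 mΩ) (P : Measure Ω) (X : H → ℝ≥0 → Ω → H) : Prop :=
  ∃ κ : ℝ≥0 → Kernel H H,
    (∀ t x, κ t x = P.map (X x t)) ∧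
    κ 0 = Kernel.id ∧
    (∀ s t, κ (s + t) = κ t ∘ₖ κ s) ∧
    ∀ (x : H) (s t : ℝ≥0) (B : Set H), MeasurableSet B →
      P⟦X x (s + t) ⁻¹' B | ℱ s⟧ =ᵐ[P] fun ω => (κ t (X x s ω)).real B

/-- The Feller property: `x ↦ E f(X x t)` is (bounded and) continuous for every bounded continuous
`f : H → ℝ` and every `t`. -/
def IsFellerFamily (P : Measure Ω) (X : H → ℝ≥0 → Ω → H) : Prop :=
  ∀ (t : ℝ≥0) (f : BoundedContinuousFunction H ℝ), Continuous fun x => ∫ ω, f (X x t ω) ∂P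

end Integrals

end LevySPDE

end

open LevySPDE

set_option linter.unusedSectionVars false
open MeasureTheory ProbabilityTheory Filter Topology Set
open scoped NNReal ENNReal InnerProductSpace
open LevySPDE

/-! The noise enters the mild equation additively, so for a fixed outcome the equation is
deterministic: x(t) = g(t) + ∫_0^t S_{t-s} F(x(s)) ds with g(t) = S_t x + Z_A(t). Since F is bounded
and Lipschitz, successive approximation in a sup norm with an exponential weight converges
(`exists_mild`), and a Gronwall argument in the same norm gives uniqueness and Lipschitz dependence
on x (`enorm_sub_le_of_mild`). Of the path of Z_A only measurability is used. All the probability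
therefore concerns Z_A, and what is needed of it is collected in `HasInnovations`: it is adapted,
the innovation Z_A(s + h) - S_h Z_A(s) is independent of `ℱ s` and distributed as Z_A(h), and
E|Z_A(t)|^p is finite and vanishes as t ↓ 0.

Innovations: the characteristic function of a finite sum of increments of (W, Y) is a product over
the cells of a common grid and sees only the lengths of the cells and the directions attached to
them (`integral_mul_exp_grid`). Hence such sums are invariant in law under shifts, with independence
of the past (`integral_mul_exp_shift`), and under time reversal (`integral_exp_reverse`). By the
orbit relation K(s + r) = S_s K(r), the random parts of Z_A(h) and of the innovation are limits in
probability of the same sums, unshifted and shifted by s, and the two claims pass to the limit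
(`IsConvolutionAt.setIntegral_exp`). Time reversal is what links hypothesis (h2), which is about ∫
S_s dY_s, to the convolution, which contains S_{t-s}: it preserves the laws of differences of
Stieltjes sums, hence the Cauchy property and the law of the limit
(`IsJumpIntegral.exists_isJumpConvolution`).

Moments: the jump part inherits its moments from (h2) through equality in law; the Wiener part is
Gaussian, and its moments are controlled by the Hilbert-Schmidt integral
(`exists_lintegral_rpow_le_of_isWienerIntegral`). Since innovations over short times are small, Z_A
is continuous in p-th mean (`HasInnovations.tendsto_lintegral_sub`), thus stochastically continuous,
and so has a predictable modification. The difference X - Z_A has continuous paths and is bounded on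
compact time intervals uniformly in the outcome, so X shares moments and continuity in mean with
Z_A.

Markov property: instead of representing the solution after time s as a functional of the later
noise, it is approximated by the exponential Euler scheme restarted at X_s, which converges in mean.
Each step adds one innovation independent of the past, so expectations over an event of `ℱ s` become
integrals of an iterated transition operator at X_s (`setIntegral_eulerScheme`). The same iterates
evaluated at y converge to E f(X^y_t), by the case s = 0, and this identifies the limit
(`setIntegral_markov`). The Feller property is the Lipschitz dependence on x; it also shows that the
laws form a kernel. -/

namespace LevySPDE

/-! ### Convergence in probability -/

section ConvergenceInProbability

variable {Ω : Type*} {mΩ : MeasurableSpace Ω} {P : Measure Ω}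
  {E : Type*} [NormedAddCommGroup E] {ι : Type*}

/-- The size `E min(1, ‖f‖)`, which metrizes convergence in probability. -/
noncomputable def probNorm (P : Measure Ω) (f : Ω → E) : ℝ≥0∞ := ∫⁻ ω, min 1 ‖f ω‖ₑ ∂P

lemma aemeasurable_min_enorm {f : Ω → E} (hf : AEStronglyMeasurable f P) :
    AEMeasurable (fun ω => min 1 ‖f ω‖ₑ) P :=
  aemeasurable_const.min hf.enorm

lemma min_one_add_le (a b : ℝ≥0∞) : min 1 (a + b) ≤ min 1 a + min 1 b := by
  rcases le_total 1 a with ha | ha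
  · calc min 1 (a + b) ≤ 1 := min_le_left _ _
      _ ≤ min 1 a + min 1 b := by rw [min_eq_left ha]; exact le_self_add
  · rcases le_total 1 b with hb | hb
    · calc min 1 (a + b) ≤ 1 := min_le_left _ _
        _ ≤ min 1 a + min 1 b := by rw [min_eq_left hb]; exact le_add_self
    · rw [min_eq_right ha, min_eq_right hb]; exact min_le_right _ _

lemma probNorm_add_le {f g : Ω → E} (hf : AEStronglyMeasurable f P) :
    probNorm P (f + g) ≤ probNorm P f + probNorm P g := by
  unfold probNorm
  rw [← lintegral_add_left' (aemeasurable_min_enorm hf)]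
  refine lintegral_mono fun ω => ?_
  exact (min_le_min_left 1 (enorm_add_le _ _)).trans (min_one_add_le _ _)

lemma probNorm_neg (f : Ω → E) : probNorm P (-f) = probNorm P f := by
  simp [probNorm]

lemma probNorm_sub_comm (f g : Ω → E) : probNorm P (f - g) = probNorm P (g - f) := by
  rw [← probNorm_neg, neg_sub]

lemma probNorm_sub_le {f g h : Ω → E} (hf : AEStronglyMeasurable f P)
    (hg : AEStronglyMeasurable g P) :
    probNorm P (f - h) ≤ probNorm P (f - g) + probNorm P (g - h) := by
  rw [← sub_add_sub_cancel f g h]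
  exact probNorm_add_le (hf.sub hg)

lemma mul_measure_le_probNorm {f : Ω → E} (hf : AEStronglyMeasurable f P) (ε : ℝ≥0∞) :
    min 1 ε * P {ω | ε ≤ ‖f ω‖ₑ} ≤ probNorm P f := by
  refine le_trans ?_ (mul_meas_ge_le_lintegral₀ (aemeasurable_min_enorm hf) (min 1 ε))
  exact mul_le_mul' le_rfl (measure_mono fun ω (h : ε ≤ ‖f ω‖ₑ) =>
    show min 1 ε ≤ min 1 ‖f ω‖ₑ from min_le_min_left 1 h)

lemma probNorm_le_add_measure [IsProbabilityMeasure P] {f : Ω → E}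
    (hf : AEStronglyMeasurable f P) (ε : ℝ≥0∞) :
    probNorm P f ≤ ε + P {ω | ε ≤ ‖f ω‖ₑ} := by
  have hm : NullMeasurableSet {ω | ε ≤ ‖f ω‖ₑ} P :=
    nullMeasurableSet_le aemeasurable_const hf.enorm
  calc probNorm P f ≤ ∫⁻ ω, (ε + {ω | ε ≤ ‖f ω‖ₑ}.indicator 1 ω) ∂P := by
        refine lintegral_mono fun ω => ?_
        by_cases h : ε ≤ ‖f ω‖ₑ
        · have h' : ω ∈ {ω | ε ≤ ‖f ω‖ₑ} := h
          rw [indicator_of_mem h']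
          exact (min_le_left _ _).trans le_add_self
        · have h' : ω ∉ {ω | ε ≤ ‖f ω‖ₑ} := h
          rw [indicator_of_notMem h', add_zero]
          exact (min_le_right _ _).trans (le_of_not_ge h)
    _ = ε + P {ω | ε ≤ ‖f ω‖ₑ} := by
        rw [lintegral_add_left measurable_const, lintegral_const, measure_univ, mul_one,
          lintegral_indicator_one₀ hm]

/-- Markov's inequality in one direction, cutting at a small level in the other. The metric form is
used because `probNorm` depends only on the law and obeys a triangle inequality, so Cauchy
properties can be moved between families with equal laws. -/
lemma tendstoInMeasure_iff_probNorm [IsProbabilityMeasure P] {l : Filter ι} {f : ι → Ω → E}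
    {g : Ω → E} (hf : ∀ᶠ i in l, AEStronglyMeasurable (f i - g) P) :
    TendstoInMeasure P f l g ↔ Tendsto (fun i => probNorm P (f i - g)) l (𝓝 0) := by
  rw [tendstoInMeasure_iff_enorm]
  constructor
  · intro h
    rw [ENNReal.tendsto_nhds_zero]
    intro ε hε
    -- The minimum with 1 keeps the level finite even when ε is infinite; the criterion for
    -- convergence in measure tests finite levels only.
    have hε2 : 0 < min 1 ε / 2 := ENNReal.half_pos (by simpa using hε.ne')
    have hne : min 1 ε / 2 ≠ ∞ :=
      (ENNReal.div_lt_top (ne_top_of_le_ne_top ENNReal.one_ne_top (min_le_left _ _))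
        two_ne_zero).ne
    filter_upwards [hf, (ENNReal.tendsto_nhds_zero.1 (h _ hε2 hne)) _ hε2] with i hi h2
    refine (probNorm_le_add_measure hi (min 1 ε / 2)).trans ?_
    calc min 1 ε / 2 + P {ω | min 1 ε / 2 ≤ ‖(f i - g) ω‖ₑ} ≤ min 1 ε / 2 + min 1 ε / 2 := by
          gcongr; exact h2
      _ = min 1 ε := ENNReal.add_halves _
      _ ≤ ε := min_le_right _ _
  · intro h ε hε _
    have h0 : min 1 ε ≠ 0 := (lt_min one_pos hε).ne'
    have ht : min 1 ε ≠ ∞ := ne_top_of_le_ne_top ENNReal.one_ne_top (min_le_left _ _)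
    have h' : Tendsto (fun i => (min 1 ε)⁻¹ * probNorm P (f i - g)) l (𝓝 0) := by
      simpa using ENNReal.Tendsto.const_mul h (Or.inr (ENNReal.inv_ne_top.2 h0))
    refine tendsto_of_tendsto_of_tendsto_of_le_of_le' tendsto_const_nhds h'
      (Eventually.of_forall fun _ => zero_le) ?_
    filter_upwards [hf] with i hi
    rw [← ENNReal.mul_le_iff_le_inv h0 ht]
    exact mul_measure_le_probNorm hi ε

lemma tendstoInMeasure_add {l : Filter ι} {f f' : ι → Ω → E} {g g' : Ω → E}
    (h : TendstoInMeasure P f l g) (h' : TendstoInMeasure P f' l g') :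
    TendstoInMeasure P (fun i => f i + f' i) l (g + g') := by
  rw [tendstoInMeasure_iff_enorm] at *
  intro ε hε ht
  have h2 : 0 < ε / 2 := ENNReal.half_pos hε.ne'
  have h2t : ε / 2 ≠ ∞ := (ENNReal.div_lt_top ht two_ne_zero).ne
  have := (h _ h2 h2t).add (h' _ h2 h2t)
  rw [add_zero] at this
  refine tendsto_of_tendsto_of_tendsto_of_le_of_le tendsto_const_nhds this
    (fun _ => zero_le) fun i => ?_
  refine (measure_mono ?_).trans (measure_union_le _ _)
  intro ω hω
  by_contra hc
  simp only [mem_union, not_or, mem_ofPred_eq, not_le] at hc hω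
  have : ‖(f i + f' i) ω - (g + g') ω‖ₑ < ε := by
    calc ‖(f i + f' i) ω - (g + g') ω‖ₑ = ‖(f i ω - g ω) + (f' i ω - g' ω)‖ₑ := by
          congr 1; simp only [Pi.add_apply]; abel
      _ ≤ _ := enorm_add_le _ _
      _ < ε / 2 + ε / 2 := ENNReal.add_lt_add hc.1 hc.2
      _ = ε := ENNReal.add_halves _
  exact absurd hω (not_le.2 this)

lemma tendstoInMeasure_neg {l : Filter ι} {f : ι → Ω → E} {g : Ω → E}
    (h : TendstoInMeasure P f l g) : TendstoInMeasure P (fun i => -f i) l (-g) := by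
  intro ε hε
  simpa [edist_neg_neg] using h ε hε

lemma tendstoInMeasure_sub {l : Filter ι} {f f' : ι → Ω → E} {g g' : Ω → E}
    (h : TendstoInMeasure P f l g) (h' : TendstoInMeasure P f' l g') :
    TendstoInMeasure P (fun i => f i - f' i) l (g - g') := by
  simp_rw [sub_eq_add_neg]
  exact tendstoInMeasure_add h (tendstoInMeasure_neg h')

lemma tendstoInMeasure_const (l : Filter ι) (g : Ω → E) :
    TendstoInMeasure P (fun _ => g) l g := by
  intro ε hε
  simp [hε.ne', tendsto_const_nhds]

lemma tendstoInMeasure_clm {F : Type*} [NormedAddCommGroup F] [NormedSpace ℝ E] [NormedSpace ℝ F]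
    (L : E →L[ℝ] F) {l : Filter ι} {f : ι → Ω → E} {g : Ω → E} (h : TendstoInMeasure P f l g) :
    TendstoInMeasure P (fun i ω => L (f i ω)) l (fun ω => L (g ω)) := by
  rw [tendstoInMeasure_iff_norm] at *
  intro ε hε
  have hpos : 0 < ‖L‖ + 1 := by positivity
  refine tendsto_of_tendsto_of_tendsto_of_le_of_le tendsto_const_nhds
    (h (ε / (‖L‖ + 1)) (by positivity)) (fun _ => zero_le) fun i => measure_mono ?_
  intro ω hω
  simp only [mem_ofPred_eq] at hω ⊢
  rw [div_le_iff₀ hpos, mul_comm]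
  rw [← map_sub] at hω
  refine hω.trans ((L.le_opNorm _).trans ?_)
  gcongr
  linarith

lemma aestronglyMeasurable_of_tendstoInMeasure {l : Filter ι} [NeBot l] [IsCountablyGenerated l]
    {f : ι → Ω → E} {g : Ω → E} (hf : ∀ᶠ i in l, AEStronglyMeasurable (f i) P)
    (h : TendstoInMeasure P f l g) : AEStronglyMeasurable g P := by
  obtain ⟨ns, hns, hae⟩ := h.exists_seq_tendsto_ae'
  obtain ⟨N, hN⟩ := eventually_atTop.1 (hns.eventually hf)
  refine aestronglyMeasurable_of_tendsto_ae atTop (f := fun n => f (ns (n + N)))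
    (fun n => hN _ (by omega)) ?_
  filter_upwards [hae] with ω hω
  exact hω.comp (tendsto_add_atTop_nat N)

/-- The sum of the truncated increments has finite expectation, so it is finite almost surely. Its
terms then tend to 0, the truncation at 1 eventually does nothing, and the increments themselves are
summable. -/
lemma tendsto_ae_of_tsum_probNorm [CompleteSpace E] {f : ℕ → Ω → E}
    (hf : ∀ n, AEStronglyMeasurable (f n) P)
    (h : ∑' n, probNorm P (f (n + 1) - f n) ≠ ∞) :
    ∀ᵐ ω ∂P, ∃ x, Tendsto (fun n => f n ω) atTop (𝓝 x) := by
  have hm : ∀ n, AEMeasurable (fun ω => min 1 ‖(f (n + 1) - f n) ω‖ₑ) P :=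
    fun n => aemeasurable_min_enorm ((hf _).sub (hf _))
  unfold probNorm at h
  rw [← lintegral_tsum hm] at h
  filter_upwards [ae_lt_top' (AEMeasurable.tsum hm) h] with ω hω
  have hz : Tendsto (fun n => min 1 ‖(f (n + 1) - f n) ω‖ₑ) atTop (𝓝 0) :=
    ENNReal.tendsto_atTop_zero_of_tsum_ne_top hω.ne
  obtain ⟨N, hN⟩ := eventually_atTop.1 (hz.eventually (gt_mem_nhds one_pos))
  have heq : ∀ n, min 1 ‖(f (n + N + 1) - f (n + N)) ω‖ₑ = edist (f (n + N) ω) (f (n + N + 1) ω) := by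
    intro n
    have := hN (n + N) (by omega)
    rw [min_eq_right (le_of_not_ge fun hc => by rw [min_eq_left hc] at this; exact lt_irrefl _ this),
      edist_comm, edist_eq_enorm_sub]
    rfl
  have hs : ∑' n, edist (f (n + N) ω) (f (n + N + 1) ω) ≠ ∞ := by
    simp_rw [← heq]
    refine ne_top_of_le_ne_top hω.ne ?_
    exact ENNReal.tsum_comp_le_tsum_of_injective (add_left_injective N)
      (fun n => min 1 ‖(f (n + 1) - f n) ω‖ₑ)
  have hs' : ∑' n, edist (f (n + N) ω) (f ((n + 1) + N) ω) ≠ ∞ := by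
    simpa only [Nat.add_right_comm _ 1 N] using hs
  have hc := cauchySeq_of_edist_le_of_tsum_ne_top (f := fun n => f (n + N) ω)
    (fun n => edist (f (n + N) ω) (f ((n + 1) + N) ω)) (fun n => le_rfl) hs'
  obtain ⟨x, hx⟩ := cauchySeq_tendsto_of_complete hc
  exact ⟨x, (tendsto_add_atTop_iff_nat N).1 hx⟩

/-- Completeness for convergence in probability along a filter: a sequence of indices with summable
distances converges almost surely, and the triangle inequality through this sequence gives
convergence along the whole filter. -/
lemma exists_tendstoInMeasure_of_cauchy [CompleteSpace E] [IsProbabilityMeasure P]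
    {l : Filter ι} [NeBot l] [IsCountablyGenerated l] {f : ι → Ω → E}
    (hf : ∀ᶠ i in l, AEStronglyMeasurable (f i) P)
    (hc : Tendsto (fun q : ι × ι => probNorm P (f q.1 - f q.2)) (l ×ˢ l) (𝓝 0)) :
    ∃ g, StronglyMeasurable g ∧ TendstoInMeasure P f l g := by
  have hsel : ∀ n : ℕ, ∃ s ∈ l, (∀ i ∈ s, AEStronglyMeasurable (f i) P) ∧
      ∀ i ∈ s, ∀ j ∈ s, probNorm P (f i - f j) ≤ (2⁻¹ : ℝ≥0∞) ^ n := by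
    intro n
    have h1 := (ENNReal.tendsto_nhds_zero.1 hc) ((2⁻¹ : ℝ≥0∞) ^ n)
      (ENNReal.pow_pos (by simp) n)
    obtain ⟨s, hs, t, ht, hst⟩ := Filter.eventually_prod_iff.1 h1
    refine ⟨{i | s i} ∩ {i | t i} ∩ {i | AEStronglyMeasurable (f i) P},
      inter_mem (inter_mem hs ht) hf, fun i hi => hi.2, fun i hi j hj => hst hi.1.1 hj.1.2⟩
  choose s hs hsm hsc using hsel
  obtain ⟨u, hu⟩ := l.exists_antitone_basis
  have hsel' : ∀ n : ℕ, ∃ i, i ∈ u n ∩ ⋂ k ≤ n, s k := fun n =>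
    Filter.nonempty_of_mem (inter_mem (hu.1.mem_of_mem trivial)
      ((Filter.biInter_mem (finite_le_nat n)).2 fun k _ => hs k))
  choose x hx using hsel'
  have hxs : ∀ n k, k ≤ n → x n ∈ s k := fun n k hk => by
    have := (hx n).2
    simp only [mem_iInter] at this
    exact this k hk
  have hxm : ∀ n, AEStronglyMeasurable (f (x n)) P := fun n => hsm 0 _ (hxs n 0 (Nat.zero_le _))
  have hsum : ∑' n, probNorm P (f (x (n + 1)) - f (x n)) ≠ ∞ := by
    refine ne_top_of_le_ne_top ?_ (ENNReal.tsum_le_tsum fun n =>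
      hsc n _ (hxs (n + 1) n (by omega)) _ (hxs n n le_rfl))
    simp [ENNReal.tsum_geometric]
  have hae := tendsto_ae_of_tsum_probNorm hxm hsum
  obtain ⟨g, hgm, hg⟩ := exists_stronglyMeasurable_limit_of_tendsto_ae hxm hae
  refine ⟨g, hgm, ?_⟩
  have hfx : TendstoInMeasure P (fun n => f (x n)) atTop g :=
    tendstoInMeasure_of_tendsto_ae hxm hg
  rw [tendstoInMeasure_iff_probNorm
    (Eventually.of_forall fun n => (hxm n).sub hgm.aestronglyMeasurable)] at hfx
  rw [tendstoInMeasure_iff_probNorm (hf.mono fun i hi => hi.sub hgm.aestronglyMeasurable),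
    ENNReal.tendsto_nhds_zero]
  intro ε hε
  have hε2 : 0 < ε / 2 := ENNReal.half_pos hε.ne'
  obtain ⟨n, hn⟩ := ENNReal.exists_inv_two_pow_lt hε2.ne'
  obtain ⟨m, hm⟩ := ((ENNReal.tendsto_nhds_zero.1 hfx _ hε2).and (eventually_ge_atTop n)).exists
  filter_upwards [hs n] with i hi
  calc probNorm P (f i - g) ≤ probNorm P (f i - f (x m)) + probNorm P (f (x m) - g) :=
        probNorm_sub_le (hsm _ _ hi) (hxm m)
    _ ≤ ε / 2 + ε / 2 := by
        gcongr
        · exact (hsc n _ hi _ (hxs m n hm.2)).trans hn.le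
        · exact hm.1
    _ = ε := ENNReal.add_halves _

/-- It is enough to find, inside every sequence, a subsequence that converges almost surely, to
which dominated convergence applies. With exponentials as test functions this carries equality in
law and independence of `ℱ s` to limits in probability. -/
lemma tendsto_setIntegral_of_tendstoInMeasure [IsFiniteMeasure P] {G : Type*}
    [NormedAddCommGroup G] [NormedSpace ℝ G] {l : Filter ι} [IsCountablyGenerated l]
    {f : ι → Ω → E} {g : Ω → E} (hf : ∀ᶠ i in l, AEStronglyMeasurable (f i) P)
    (h : TendstoInMeasure P f l g) {φ : E → G} (hφ : Continuous φ) {C : ℝ}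
    (hC : ∀ x, ‖φ x‖ ≤ C) (A : Set Ω) :
    Tendsto (fun i => ∫ ω in A, φ (f i ω) ∂P) l (𝓝 (∫ ω in A, φ (g ω) ∂P)) := by
  refine tendsto_of_seq_tendsto fun ns hns => ?_
  obtain ⟨N, hN⟩ := eventually_atTop.1 (hns.eventually hf)
  -- The functions are measurable only eventually along the filter, hence the shift of the sequence
  -- by N.
  rw [← tendsto_add_atTop_iff_nat N]
  refine tendsto_of_subseq_tendsto fun ms hms => ?_
  have hcomp : TendstoInMeasure P (fun n => f (ns (ms n + N))) atTop g :=
    (h.comp hns).comp ((tendsto_add_atTop_nat N).comp hms)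
  obtain ⟨ks, -, hks⟩ := hcomp.exists_seq_tendsto_ae
  refine ⟨ks, ?_⟩
  refine tendsto_integral_of_dominated_convergence (fun _ => C) (fun n => ?_)
    (integrable_const C) (fun n => Eventually.of_forall fun ω => hC _) ?_
  · exact hφ.comp_aestronglyMeasurable ((hN _ (by omega)).restrict)
  · filter_upwards [ae_restrict_of_ae hks] with ω hω
    exact (hφ.tendsto _).comp hω

lemma probNorm_map [MeasurableSpace E] [BorelSpace E] {f : Ω → E} (hf : AEMeasurable f P) :
    probNorm P f = ∫⁻ x, min 1 ‖x‖ₑ ∂(P.map f) := by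
  rw [lintegral_map' (by fun_prop) hf]; rfl

end ConvergenceInProbability

end LevySPDE

namespace LevySPDE

/-! ### Cylindrical processes with independent stationary increments -/

section Increments

/-- A sorted grid that contains the end points of finitely many intervals. -/
lemma exists_grid {J : Type*} [Fintype J] {a b : J → ℝ≥0} {s t : ℝ≥0} (hst : s ≤ t)
    (hab : ∀ j, a j ≤ b j) (ha : ∀ j, s ≤ a j) (hb : ∀ j, b j ≤ t) :
    ∃ (r : ℕ → ℝ≥0) (N : ℕ) (p q : J → ℕ), Monotone r ∧ (∀ k, s ≤ r k) ∧ (∀ k, r k ≤ t) ∧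
      (∀ j, r (p j) = a j) ∧ (∀ j, r (q j) = b j) ∧ (∀ j, p j ≤ q j) ∧ ∀ j, q j ≤ N := by
  classical
  let I : Finset ℝ≥0 := insert s (Finset.univ.image a ∪ Finset.univ.image b)
  have hI : ∀ x ∈ I, s ≤ x ∧ x ≤ t := by
    intro x hx
    simp only [I, Finset.mem_insert, Finset.mem_union, Finset.mem_image, Finset.mem_univ,
      true_and] at hx
    rcases hx with rfl | ⟨j, rfl⟩ | ⟨j, rfl⟩
    · exact ⟨le_rfl, hst⟩
    · exact ⟨ha j, (hab j).trans (hb j)⟩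
    · exact ⟨(ha j).trans (hab j), hb j⟩
  have hpos : 0 < I.card := Finset.card_pos.2 ⟨s, Finset.mem_insert_self _ _⟩
  let e := I.orderEmbOfFin rfl
  -- Past the last point of the finite set the enumeration is constant, which makes it monotone on
  -- all of ℕ.
  let r : ℕ → ℝ≥0 := fun k => e ⟨min k (I.card - 1), by omega⟩
  have hr : Monotone r := fun k l hkl => e.monotone (by
    simp only [Fin.mk_le_mk]; exact min_le_min_right _ hkl)
  have hrI : ∀ k, r k ∈ I := fun k => Finset.orderEmbOfFin_mem _ _ _
  have hex : ∀ x ∈ I, ∃ k < I.card, r k = x := by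
    intro x hx
    have : x ∈ Set.range e := by rw [Finset.range_orderEmbOfFin]; exact hx
    obtain ⟨i, hi⟩ := this
    refine ⟨i, i.2, ?_⟩
    rw [← hi]
    refine congrArg e (Fin.ext ?_)
    have := i.2
    change min (i : ℕ) (I.card - 1) = i
    omega
  have hinj : ∀ k l, k < I.card → l < I.card → r k ≤ r l → k ≤ l := by
    intro k l hk hl h
    have := e.le_iff_le.1 h
    simp only [Fin.mk_le_mk] at this
    omega
  have haI : ∀ j, a j ∈ I := fun j => by simp [I]
  have hbI : ∀ j, b j ∈ I := fun j => by simp [I]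
  choose p hp hpa using fun j => hex _ (haI j)
  choose q hq hqb using fun j => hex _ (hbI j)
  refine ⟨r, I.card, p, q, hr, fun k => (hI _ (hrI k)).1, fun k => (hI _ (hrI k)).2, hpa, hqb,
    fun j => hinj _ _ (hp j) (hq j) (by rw [hpa, hqb]; exact hab j), fun j => (hq j).le⟩

variable {Ω : Type*} {mΩ : MeasurableSpace Ω} {G : Type*} [AddCommGroup G]

/-- A linear family `X t q` of real processes whose increments after time `s` are independent of
`ℱ s`, with characteristic function `ψ (t - s) q`. -/
structure HasCylindricalIncrements (X : ℝ≥0 → G → Ω → ℝ) (ℱ : Filtration ℝ≥0 mΩ)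
    (P : Measure Ω) (ψ : ℝ≥0 → G → ℂ) : Prop where
  meas : ∀ t q, Measurable[ℱ t] (X t q)
  add : ∀ t q q', (fun ω => X t (q + q') ω) =ᵐ[P] fun ω => X t q ω + X t q' ω
  indep : ∀ s t q, s ≤ t →
    Indep (MeasurableSpace.comap (fun ω => X t q ω - X s q ω) inferInstance) (ℱ s) P
  char : ∀ s t q, s ≤ t →
    ∫ ω, Complex.exp (((X t q ω - X s q ω : ℝ) : ℂ) * Complex.I) ∂P = ψ (t - s) q

variable {X : ℝ≥0 → G → Ω → ℝ} {ℱ : Filtration ℝ≥0 mΩ} {P : Measure Ω} {ψ : ℝ≥0 → G → ℂ}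

/-- The increment `∑ (X (b j) (q j) - X (a j) (q j))`. -/
noncomputable def incrementSum {J : Type*} [Fintype J] (X : ℝ≥0 → G → Ω → ℝ) (a b : J → ℝ≥0)
    (q : J → G) (ω : Ω) : ℝ := ∑ j, (X (b j) (q j) ω - X (a j) (q j) ω)

namespace HasCylindricalIncrements

lemma zero_ae (hX : HasCylindricalIncrements X ℱ P ψ) (t : ℝ≥0) : X t 0 =ᵐ[P] 0 := by
  filter_upwards [hX.add t 0 0] with ω hω
  simpa using hω

lemma sum_ae (hX : HasCylindricalIncrements X ℱ P ψ) (t : ℝ≥0) {J : Type*} (s : Finset J)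
    (q : J → G) : (fun ω => X t (∑ j ∈ s, q j) ω) =ᵐ[P] fun ω => ∑ j ∈ s, X t (q j) ω := by
  classical
  induction s using Finset.induction_on with
  | empty =>
    simp only [Finset.sum_empty]
    exact hX.zero_ae t
  | insert j s hj ih =>
    filter_upwards [ih, hX.add t (q j) (∑ j ∈ s, q j)] with ω h1 h2
    rw [Finset.sum_insert hj, Finset.sum_insert hj, h2, h1]

lemma measurable_exp (hX : HasCylindricalIncrements X ℱ P ψ) {s t u : ℝ≥0} (hs : s ≤ u)
    (ht : t ≤ u) (q : G) : Measurable[ℱ u] fun ω => ((X t q ω - X s q ω : ℝ) : ℂ) :=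
  Complex.measurable_ofReal.comp
    (((hX.meas t q).mono (ℱ.mono ht) le_rfl).sub ((hX.meas s q).mono (ℱ.mono hs) le_rfl))

lemma integral_mul_exp (hX : HasCylindricalIncrements X ℱ P ψ) {s t : ℝ≥0} (hst : s ≤ t) (q : G)
    {ξ : Ω → ℂ} (hξ : Measurable[ℱ s] ξ) :
    ∫ ω, ξ ω * Complex.exp (((X t q ω - X s q ω : ℝ) : ℂ) * Complex.I) ∂P =
      (∫ ω, ξ ω ∂P) * ψ (t - s) q := by
  have hi : IndepFun (fun ω => X t q ω - X s q ω) ξ P := by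
    rw [IndepFun_iff_Indep]
    exact indep_of_indep_of_le_right (hX.indep s t q hst) (measurable_iff_comap_le.1 hξ)
  have hi2 : IndepFun ξ
      (fun ω => Complex.exp (((X t q ω - X s q ω : ℝ) : ℂ) * Complex.I)) P :=
    (hi.comp (φ := fun x : ℝ => Complex.exp ((x : ℂ) * Complex.I)) (ψ := id) (by fun_prop)
      measurable_id).symm
  rw [hi2.integral_fun_mul_eq_mul_integral, hX.char s t q hst]
  · exact (hξ.mono (ℱ.le s) le_rfl).aestronglyMeasurable
  · have : Measurable fun ω => ((X t q ω - X s q ω : ℝ) : ℂ) :=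
      (hX.measurable_exp hst le_rfl q).mono (ℱ.le t) le_rfl
    exact (Complex.measurable_exp.comp (this.mul_const _)).aestronglyMeasurable

/-- The last increment is split off and the earlier ones are absorbed into the factor that is
measurable with respect to the past. -/
lemma integral_mul_exp_sum (hX : HasCylindricalIncrements X ℱ P ψ) {r : ℕ → ℝ≥0}
    (hr : Monotone r) (q : ℕ → G) {ξ : Ω → ℂ} (hξ : Measurable[ℱ (r 0)] ξ) (n : ℕ) :
    ∫ ω, ξ ω * Complex.exp (((∑ k ∈ Finset.range n,
      (X (r (k + 1)) (q k) ω - X (r k) (q k) ω) : ℝ) : ℂ) * Complex.I) ∂P =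
      (∫ ω, ξ ω ∂P) * ∏ k ∈ Finset.range n, ψ (r (k + 1) - r k) (q k) := by
  induction n with
  | zero => simp
  | succ n ih =>
    rw [Finset.prod_range_succ, ← mul_assoc, ← ih,
      ← hX.integral_mul_exp (hr (n.le_add_right 1)) (q n) (ξ := fun ω => ξ ω *
        Complex.exp (((∑ k ∈ Finset.range n,
          (X (r (k + 1)) (q k) ω - X (r k) (q k) ω) : ℝ) : ℂ) * Complex.I))]
    · congr 1 with ω
      rw [Finset.sum_range_succ, mul_assoc, ← Complex.exp_add, ← add_mul,
        ← Complex.ofReal_add]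
    · refine (hξ.mono (ℱ.mono (hr (Nat.zero_le n))) le_rfl).mul ?_
      refine Complex.measurable_exp.comp (Measurable.mul_const ?_ _)
      push_cast
      refine Finset.measurable_sum _ fun k hk => ?_
      have hk' : k + 1 ≤ n := Finset.mem_range.1 hk
      have := hX.measurable_exp (hr ((Nat.le_succ k).trans hk')) (hr hk') (q k)
      push_cast at this
      exact this

/-- The total direction of the intervals that contain the `k`-th cell of the grid. -/
noncomputable def cellSum {J : Type*} [Fintype J] (p q : J → ℕ) (v : J → G) (k : ℕ) : G := by
  classical exact ∑ j, if k ∈ Finset.Ico (p j) (q j) then v j else 0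

/-- Each increment telescopes over the cells of its interval, and the order of summation is
exchanged. The identity is only almost sure because additivity in the direction is. -/
lemma incrementSum_ae_eq (hX : HasCylindricalIncrements X ℱ P ψ) {J : Type*} [Fintype J]
    {r : ℕ → ℝ≥0} {N : ℕ} {p q : J → ℕ} (hpq : ∀ j, p j ≤ q j) (hqN : ∀ j, q j ≤ N)
    (v : J → G) :
    incrementSum X (fun j => r (p j)) (fun j => r (q j)) v =ᵐ[P] fun ω =>
      ∑ k ∈ Finset.range N, (X (r (k + 1)) (cellSum p q v k) ω - X (r k) (cellSum p q v k) ω) := by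
  classical
  have h1 : ∀ᵐ ω ∂P, ∀ k ∈ Finset.range N, ∀ t ∈ ({r (k + 1), r k} : Finset ℝ≥0),
      X t (cellSum p q v k) ω =
        ∑ j, X t (if k ∈ Finset.Ico (p j) (q j) then v j else 0) ω := by
    refine (ae_ball_iff (Finset.countable_toSet _)).2 fun k _ =>
      (ae_ball_iff (Finset.countable_toSet _)).2 fun t _ => ?_
    filter_upwards [hX.sum_ae t Finset.univ
      (fun j => if k ∈ Finset.Ico (p j) (q j) then v j else 0)] with ω hω
    rw [← hω]
    congr 1
  have h0 : ∀ᵐ ω ∂P, ∀ k ∈ Finset.range (N + 1), X (r k) 0 ω = 0 :=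
    (ae_ball_iff (Finset.countable_toSet _)).2 fun k _ => hX.zero_ae (r k)
  filter_upwards [h1, h0] with ω h1 h0
  have hcell : ∀ k ∈ Finset.range N, X (r (k + 1)) (cellSum p q v k) ω -
      X (r k) (cellSum p q v k) ω =
      ∑ j, if k ∈ Finset.Ico (p j) (q j) then X (r (k + 1)) (v j) ω - X (r k) (v j) ω else 0 := by
    intro k hk
    rw [h1 k hk _ (by simp), h1 k hk _ (by simp), ← Finset.sum_sub_distrib]
    refine Finset.sum_congr rfl fun j _ => ?_
    split_ifs with h
    · rfl
    · have hk' := Finset.mem_range.1 hk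
      rw [h0 _ (Finset.mem_range.2 (by omega)), h0 _ (Finset.mem_range.2 (by omega)), sub_zero]
  rw [Finset.sum_congr rfl hcell, Finset.sum_comm]
  refine Finset.sum_congr rfl fun j _ => ?_
  rw [← Finset.sum_filter]
  have hf : (Finset.range N).filter (fun k => k ∈ Finset.Ico (p j) (q j)) =
      Finset.Ico (p j) (q j) := by
    ext k
    have := hqN j
    simp only [Finset.mem_filter, Finset.mem_range, Finset.mem_Ico]
    omega
  rw [hf, Finset.sum_Ico_sub (fun k => X (r k) (v j) ω) (hpq j)]

/-- The product depends on the grid only through the cell lengths and the total direction in each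
cell. Both symmetries below, shift and reversal, are read off from this. -/
lemma integral_mul_exp_grid (hX : HasCylindricalIncrements X ℱ P ψ) {J : Type*} [Fintype J]
    {r : ℕ → ℝ≥0} (hr : Monotone r) {N : ℕ} {p q : J → ℕ} (hpq : ∀ j, p j ≤ q j)
    (hqN : ∀ j, q j ≤ N) (v : J → G) {ξ : Ω → ℂ} (hξ : Measurable[ℱ (r 0)] ξ) :
    ∫ ω, ξ ω * Complex.exp ((incrementSum X (fun j => r (p j)) (fun j => r (q j)) v ω : ℂ) *
      Complex.I) ∂P =
      (∫ ω, ξ ω ∂P) * ∏ k ∈ Finset.range N, ψ (r (k + 1) - r k) (cellSum p q v k) := by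
  rw [← hX.integral_mul_exp_sum hr _ hξ]
  refine integral_congr_ae ?_
  filter_upwards [hX.incrementSum_ae_eq (r := r) hpq hqN v] with ω hω
  rw [hω]

/-- The increments after time `s` are independent of `ℱ s` and stationary. -/
lemma integral_mul_exp_shift (hX : HasCylindricalIncrements X ℱ P ψ) [IsProbabilityMeasure P]
    {J : Type*} [Fintype J] {a b : J → ℝ≥0} (hab : ∀ j, a j ≤ b j) (v : J → G) (s : ℝ≥0)
    {ξ : Ω → ℂ} (hξ : Measurable[ℱ s] ξ) :
    ∫ ω, ξ ω * Complex.exp ((incrementSum X (fun j => s + a j) (fun j => s + b j) v ω : ℂ) *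
      Complex.I) ∂P =
      (∫ ω, ξ ω ∂P) * ∫ ω, Complex.exp ((incrementSum X a b v ω : ℂ) * Complex.I) ∂P := by
  obtain ⟨r, N, p, q, hr, -, -, hra, hrb, hpq, hqN⟩ :=
    exists_grid (s := 0) (t := Finset.univ.sup b) bot_le hab (fun _ => bot_le)
      (fun j => Finset.le_sup (Finset.mem_univ j))
  obtain rfl : (fun j => r (p j)) = a := funext hra
  obtain rfl : (fun j => r (q j)) = b := funext hrb
  have h1 := hX.integral_mul_exp_grid (r := fun k => s + r k)
    (fun k l hkl => add_le_add le_rfl (hr hkl)) hpq hqN v (ξ := ξ)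
    (hξ.mono (ℱ.mono le_self_add) le_rfl)
  have h2 := hX.integral_mul_exp_grid hr hpq hqN v (ξ := fun _ => 1) measurable_const
  simp only [one_mul, integral_const, probReal_univ, one_smul] at h2
  rw [h1, h2]
  simp only [add_tsub_add_eq_tsub_left]

/-- The increments are invariant in law under time reversal. -/
lemma integral_exp_reverse (hX : HasCylindricalIncrements X ℱ P ψ) [IsProbabilityMeasure P]
    {J : Type*} [Fintype J] {a b : J → ℝ≥0} (hab : ∀ j, a j ≤ b j) (v : J → G) {t : ℝ≥0}
    (hb : ∀ j, b j ≤ t) :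
    ∫ ω, Complex.exp ((incrementSum X (fun j => t - b j) (fun j => t - a j) v ω : ℂ) *
      Complex.I) ∂P =
      ∫ ω, Complex.exp ((incrementSum X a b v ω : ℂ) * Complex.I) ∂P := by
  obtain ⟨r, N, p, q, hr, -, hrt, hra, hrb, hpq, hqN⟩ :=
    exists_grid (s := 0) (t := t) bot_le hab (fun _ => bot_le) hb
  obtain rfl : (fun j => r (p j)) = a := funext hra
  obtain rfl : (fun j => r (q j)) = b := funext hrb
  have h2 := hX.integral_mul_exp_grid hr hpq hqN v (ξ := fun _ => 1) measurable_const
  -- On the reversed grid the interval with index `j` fills the cells from `N - q j` to `N - p j`;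
  -- the old cell `k` becomes the cell `N - 1 - k`, and reflecting the product restores the original
  -- order.
  have h1 := hX.integral_mul_exp_grid (r := fun k => t - r (N - k)) (N := N)
    (fun k l hkl => tsub_le_tsub_left (hr (by omega)) _)
    (p := fun j => N - q j) (q := fun j => N - p j)
    (fun j => by have := hpq j; omega) (fun j => by omega) v (ξ := fun _ => 1) measurable_const
  simp only [one_mul, integral_const, probReal_univ, one_smul] at h1 h2
  have e1 : ∀ j, N - (N - q j) = q j := fun j => by have := hqN j; omega
  have e2 : ∀ j, N - (N - p j) = p j := fun j => by have := hqN j; have := hpq j; omega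
  simp only [e1, e2] at h1
  rw [h1, h2, ← Finset.prod_range_reflect]
  refine Finset.prod_congr rfl fun k hk => ?_
  have hk' := Finset.mem_range.1 hk
  have e3 : N - (N - 1 - k + 1) = k := by omega
  have e4 : N - (N - 1 - k) = k + 1 := by omega
  rw [e3, e4]
  congr 1
  · rw [tsub_tsub_tsub_cancel_left (hrt _)]
  · simp only [cellSum]
    refine Finset.sum_congr rfl fun j _ => ?_
    have := hqN j
    have := hpq j
    congr 1
    simp only [Finset.mem_Ico, eq_iff_iff]
    omega

end HasCylindricalIncrements

end Increments

end LevySPDE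

namespace LevySPDE

/-! ### The pair of the Wiener process and the Lévy process -/

section NoisePair

variable {Ω : Type*} {mΩ : MeasurableSpace Ω} {P : Measure Ω} {ℱ : Filtration ℝ≥0 mΩ}
  {H : Type*} [NormedAddCommGroup H] [InnerProductSpace ℝ H]
  {U : Type*} [NormedAddCommGroup U] [InnerProductSpace ℝ U]
  [MeasurableSpace U] [BorelSpace U]
  {W : ℝ≥0 → H → Ω → ℝ} {Y : ℝ≥0 → Ω → U}

/-- The pair `(W, Y)` as a family of real processes. -/
noncomputable def noisePair (W : ℝ≥0 → H → Ω → ℝ) (Y : ℝ≥0 → Ω → U) (t : ℝ≥0) (q : H × U)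
    (ω : Ω) : ℝ := W t q.1 ω + ⟪Y t ω, q.2⟫_ℝ

lemma IsLevyProcess.stronglyMeasurable (hY : IsLevyProcess Y ℱ P) (t : ℝ≥0) :
    StronglyMeasurable (Y t) := (hY.adapted t).mono (ℱ.le t)

/-- Treating (W, Y) as one linear family gives joint statements about both noises at once.
Independence of the past is the joint hypothesis on the pair; the characteristic function factorizes
because W and Y are independent. -/
lemma IsLevyNoise.hasCylindricalIncrements [IsProbabilityMeasure P] (h : IsLevyNoise W Y ℱ P) :
    HasCylindricalIncrements (noisePair W Y) ℱ P fun r q =>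
      charFun (gaussianReal 0 (r * ‖q.1‖₊ ^ 2)) 1 * charFun (P.map (Y r)) q.2 where
  meas t q := by
    refine (h.wiener.adapted t q.1).add ?_
    exact ((h.levy.adapted t).inner stronglyMeasurable_const).measurable
  add t q q' := by
    have hl := h.wiener.linear t 1 q.1 q'.1
    filter_upwards [hl] with ω hω
    simp only [one_smul, one_mul] at hω
    simp only [noisePair, Prod.fst_add, Prod.snd_add, inner_add_right, hω]
    ring
  indep s t q hst := by
    refine indep_of_indep_of_le_left (h.jointIndep s t hst) ?_
    rw [← measurable_iff_comap_le]
    set m1 := ⨆ h, MeasurableSpace.comap (fun ω => W t h ω - W s h ω) inferInstance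
    set m2 := MeasurableSpace.comap (fun ω => Y t ω - Y s ω) inferInstance
    have e : (fun ω => noisePair W Y t q ω - noisePair W Y s q ω) = fun ω =>
        (W t q.1 ω - W s q.1 ω) + ⟪Y t ω - Y s ω, q.2⟫_ℝ := by
      ext ω
      simp only [noisePair, inner_sub_left]
      ring
    rw [e]
    have h1 : Measurable[m1 ⊔ m2] fun ω => W t q.1 ω - W s q.1 ω :=
      measurable_iff_comap_le.2 ((le_iSup (fun h =>
        MeasurableSpace.comap (fun ω => W t h ω - W s h ω) inferInstance) q.1).trans le_sup_left)
    have h2 : Measurable[m1 ⊔ m2] fun ω => Y t ω - Y s ω := measurable_iff_comap_le.2 le_sup_right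
    have h3 : Measurable fun x : U => ⟪x, q.2⟫_ℝ :=
      (Continuous.inner continuous_id continuous_const).measurable
    exact h1.add (h3.comp h2)
  char s t q hst := by
    have hW : ∀ t, Measurable (W t q.1) := fun t => (h.wiener.adapted t q.1).mono (ℱ.le t) le_rfl
    have hY := fun t => h.levy.stronglyMeasurable t
    have hind : IndepFun (fun ω => W t q.1 ω - W s q.1 ω) (fun ω => Y t ω - Y s ω) P := by
      rw [IndepFun_iff_Indep]
      refine indep_of_indep_of_le_left (indep_of_indep_of_le_right h.indep ?_) ?_
      · rw [← measurable_iff_comap_le]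
        set m2 := ⨆ t, MeasurableSpace.comap (Y t) inferInstance
        -- No separability of `U` is assumed here, so differences of measurable maps need not be
        -- measurable. The separable range of the strongly measurable `Y u` repairs this for the
        -- smaller σ-algebra.
        have hm : ∀ t, StronglyMeasurable[m2] (Y t) := fun u => by
          have : Measurable[m2] (Y u) := measurable_iff_comap_le.2
            (le_iSup (fun t => MeasurableSpace.comap (Y t) inferInstance) u)
          exact stronglyMeasurable_iff_measurable_separable.2 ⟨this, (hY u).isSeparable_range⟩
        exact ((hm t).sub (hm s)).measurable
      · rw [← measurable_iff_comap_le]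
        set m1 := ⨆ t, ⨆ h, MeasurableSpace.comap (W t h) inferInstance
        have hm : ∀ t, Measurable[m1] (W t q.1) := fun u => measurable_iff_comap_le.2
          ((le_iSup (fun h => MeasurableSpace.comap (W u h) inferInstance) q.1).trans
            (le_iSup (fun t => ⨆ h, MeasurableSpace.comap (W t h) inferInstance) u))
        exact (hm t).sub (hm s)
    have hφ : Measurable fun x : U => Complex.exp ((⟪x, q.2⟫_ℝ : ℂ) * Complex.I) :=
      (by fun_prop : Continuous fun x : U =>
        Complex.exp (((⟪x, q.2⟫_ℝ : ℝ) : ℂ) * Complex.I)).measurable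
    have hψ : Measurable fun x : ℝ => Complex.exp ((x : ℂ) * Complex.I) := by fun_prop
    have e : ∀ ω, Complex.exp (((noisePair W Y t q ω - noisePair W Y s q ω : ℝ) : ℂ) * Complex.I) =
        Complex.exp (((W t q.1 ω - W s q.1 ω : ℝ) : ℂ) * Complex.I) *
        Complex.exp ((⟪Y t ω - Y s ω, q.2⟫_ℝ : ℂ) * Complex.I) := by
      intro ω
      rw [← Complex.exp_add]
      congr 1
      simp only [noisePair, inner_sub_left]
      push_cast
      ring
    simp_rw [e]
    have hmY : Measurable fun ω => Y t ω - Y s ω := ((hY t).sub (hY s)).measurable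
    have hmW : Measurable fun ω => W t q.1 ω - W s q.1 ω := (hW t).sub (hW s)
    refine ((hind.comp hψ hφ).integral_fun_mul_eq_mul_integral
      (hψ.comp hmW).aestronglyMeasurable (hφ.comp hmY).aestronglyMeasurable).trans ?_
    congr 1
    · rw [← h.wiener.gaussian s t q.1 hst, charFun_apply_real,
        integral_map hmW.aemeasurable (by fun_prop)]
      simp
    · have := h.levy.stationary s (t - s)
      rw [add_tsub_cancel_of_le hst] at this
      rw [← this, charFun_apply, integral_map hmY.aemeasurable hφ.aestronglyMeasurable]
      rfl

end NoisePair

end LevySPDE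

namespace LevySPDE

/-! ### Semigroup orbits of operators -/

section Semigroup

variable {H : Type*} [NormedAddCommGroup H] [InnerProductSpace ℝ H]
  {E : Type*} [NormedAddCommGroup E] [InnerProductSpace ℝ E]
  {S : ℝ≥0 → H →L[ℝ] H}

namespace IsC0Semigroup

lemma add_apply (hS : IsC0Semigroup S) (s t : ℝ≥0) (x : H) : S (s + t) x = S s (S t x) := by
  rw [hS.add]; rfl

lemma zero_apply (hS : IsC0Semigroup S) (x : H) : S 0 x = x := by
  rw [hS.zero]; rfl

/-- Orbits are continuous, hence bounded on compact intervals, and the uniform boundedness principle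
applies. -/
lemma exists_norm_le [CompleteSpace H] (hS : IsC0Semigroup S) (t : ℝ≥0) :
    ∃ M : ℝ, 1 ≤ M ∧ ∀ s ≤ t, ‖S s‖ ≤ M := by
  obtain ⟨C, hC⟩ := banach_steinhaus (g := fun s : Iic t => S s) (fun x => by
    have hc : IsCompact (Iic t) := by rw [← Icc_bot]; exact isCompact_Icc
    obtain ⟨C, hC⟩ := hc.exists_bound_of_continuousOn (hS.continuous x).continuousOn
    exact ⟨C, fun s => hC s s.2⟩)
  exact ⟨max 1 C, le_max_left _ _, fun s hs => (hC ⟨s, hs⟩).trans (le_max_right _ _)⟩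

lemma continuous_uncurry [CompleteSpace H] (hS : IsC0Semigroup S) :
    Continuous fun q : ℝ≥0 × H => S q.1 q.2 := by
  rw [continuous_iff_continuousAt]
  rintro ⟨t, x⟩
  obtain ⟨M, hM1, hM⟩ := hS.exists_norm_le (t + 1)
  have h1 : Tendsto (fun q : ℝ≥0 × H => S q.1 x) (𝓝 (t, x)) (𝓝 (S t x)) :=
    ((hS.continuous x).tendsto t).comp continuous_fst.continuousAt
  have h2 : Tendsto (fun q : ℝ≥0 × H => S q.1 (q.2 - x)) (𝓝 (t, x)) (𝓝 0) := by
    have h3 : Tendsto (fun q : ℝ≥0 × H => M * ‖q.2 - x‖) (𝓝 (t, x)) (𝓝 0) := by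
      have : Continuous fun q : ℝ≥0 × H => M * ‖q.2 - x‖ := by fun_prop
      simpa using this.tendsto (t, x)
    refine squeeze_zero_norm' ?_ h3
    have : ∀ᶠ q : ℝ≥0 × H in 𝓝 (t, x), q.1 < t + 1 :=
      continuous_fst.continuousAt.eventually (gt_mem_nhds (lt_add_one t))
    filter_upwards [this] with q hq
    exact (ContinuousLinearMap.le_opNorm _ _).trans
      (mul_le_mul_of_nonneg_right (hM _ hq.le) (norm_nonneg _))
  have := h1.add h2
  simp only [add_zero] at this
  refine this.congr fun q => ?_
  rw [← map_add, add_sub_cancel]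

end IsC0Semigroup

/-- `K (s + r) = S s ∘ K r` for all `r > 0`. -/
def IsOrbit (S : ℝ≥0 → H →L[ℝ] H) (K : ℝ≥0 → E →L[ℝ] H) : Prop :=
  ∀ s r, 0 < r → K (s + r) = (S s).comp (K r)

namespace IsOrbit

variable {K : ℝ≥0 → E →L[ℝ] H}

lemma apply (hK : IsOrbit S K) (s : ℝ≥0) {r : ℝ≥0} (hr : 0 < r) (x : E) :
    K (s + r) x = S s (K r x) := by rw [hK s r hr]; rfl

/-- Near t > 0 the orbit factors through the fixed positive time t/2, so strong continuity of the
semigroup suffices even though K may be singular at 0. -/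
lemma continuousOn (hK : IsOrbit S K) (hS : IsC0Semigroup S) (x : E) :
    ContinuousOn (fun t => K t x) (Ioi 0) := by
  intro t ht
  refine ContinuousAt.continuousWithinAt ?_
  have hc : (0 : ℝ≥0) < t / 2 := half_pos ht
  have hc2 : t / 2 < t := half_lt_self ht
  have : ContinuousAt (fun r => S (r - t / 2) (K (t / 2) x)) t :=
    ((hS.continuous _).comp (continuous_sub_right (t / 2))).continuousAt
  refine this.congr ?_
  filter_upwards [lt_mem_nhds hc2] with r hr
  rw [← hK.apply _ hc, tsub_add_cancel_of_le hr.le]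

lemma exists_norm_le [CompleteSpace H] (hK : IsOrbit S K) (hS : IsC0Semigroup S) {c : ℝ≥0}
    (hc : 0 < c) (d : ℝ≥0) : ∃ M : ℝ, 0 ≤ M ∧ ∀ r, c ≤ r → r ≤ d → ‖K r‖ ≤ M := by
  obtain ⟨M, hM1, hM⟩ := hS.exists_norm_le d
  refine ⟨M * ‖K c‖, by positivity, fun r hr hrd => ?_⟩
  rw [← tsub_add_cancel_of_le hr, hK _ _ hc]
  refine (ContinuousLinearMap.opNorm_comp_le _ _).trans ?_
  gcongr
  exact hM _ (tsub_le_self.trans hrd)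

end IsOrbit

/-! ### Extensions of the semigroup -/

section Extensions

variable {ι : H →L[ℝ] E}

lemma extendAlong_apply {B : H →L[ℝ] H} (h : ∃ T, IsExtensionAlong ι B T) (x : H) :
    extendAlong ι B (ι x) = B x := by
  unfold extendAlong
  rw [dif_pos h]
  exact h.choose_spec x

lemma IsExtensionAlong.eq_extendAlong (hι : DenseRange ι) {B : H →L[ℝ] H} {T : E →L[ℝ] H}
    (hT : IsExtensionAlong ι B T) : T = extendAlong ι B := by
  have : (fun x => T x) = fun x => extendAlong ι B x :=
    hι.equalizer T.continuous (extendAlong ι B).continuous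
      (funext fun x => (hT x).trans (extendAlong_apply ⟨T, hT⟩ x).symm)
  exact ContinuousLinearMap.ext (congrFun this)

/-- Beyond time 1 an extension is obtained by composing the extension at time 1 with the semigroup.
Density makes extensions unique, and the composition of `S s` with an extension of `S r` is one for
`S (s + r)`. -/
lemma isOrbit_extendAlong (hι : DenseRange ι) (hS : IsC0Semigroup S)
    (h : ∀ t, 0 < t → t ≤ 1 → ∃ T, IsExtensionAlong ι (S t) T) :
    IsOrbit S fun t => extendAlong ι (S t) := by
  have hall : ∀ t, 0 < t → ∃ T, IsExtensionAlong ι (S t) T := by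
    intro t ht
    rcases le_total t 1 with h1 | h1
    · exact h t ht h1
    · obtain ⟨T, hT⟩ := h 1 one_pos le_rfl
      refine ⟨(S (t - 1)).comp T, fun x => ?_⟩
      rw [ContinuousLinearMap.comp_apply, hT, ← hS.add_apply, tsub_add_cancel_of_le h1]
  intro s r hr
  refine (IsExtensionAlong.eq_extendAlong hι fun x => ?_).symm
  rw [ContinuousLinearMap.comp_apply, extendAlong_apply (hall r hr), hS.add_apply]

lemma boundedComp_apply {B : H →L[ℝ] H} {R : H →ₗ.[ℝ] H} (h : ∃ G, IsBoundedExtension B R G)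
    (x : R.domain) : boundedComp B R x = B (R x) := by
  unfold boundedComp
  rw [dif_pos h]
  exact h.choose_spec x

lemma isOrbit_boundedComp (hS : IsC0Semigroup S) {R : H →ₗ.[ℝ] H} (hR : Dense (R.domain : Set H))
    (h : ∀ t, 0 < t → ∃ G, IsBoundedExtension (S t) R G) :
    IsOrbit S fun t => boundedComp (S t) R := by
  intro s r hr
  have hd : DenseRange ((↑) : R.domain → H) := by
    rw [DenseRange, Subtype.range_coe_subtype]; exact hR
  have : (fun x => boundedComp (S (s + r)) R x) = fun x => (S s).comp (boundedComp (S r) R) x := by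
    refine hd.equalizer (boundedComp (S (s + r)) R).continuous
      ((S s).comp (boundedComp (S r) R)).continuous (funext fun x => ?_)
    simp only [Function.comp_apply, ContinuousLinearMap.comp_apply]
    rw [boundedComp_apply (h _ (add_pos_of_nonneg_of_pos (zero_le) hr)), boundedComp_apply (h r hr),
      hS.add_apply]
  exact ContinuousLinearMap.ext (congrFun this)

end Extensions

/-! ### Integrals of orbits -/

section Drift

variable [CompleteSpace H] {K : ℝ≥0 → E →L[ℝ] H} {a : E}

lemma IsOrbit.continuousOn_toNNReal (hK : IsOrbit S K) (hS : IsC0Semigroup S) (a : E) :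
    ContinuousOn (fun r : ℝ => K r.toNNReal a) (Ioi 0) :=
  (hK.continuousOn hS a).comp continuous_real_toNNReal.continuousOn
    fun _ hr => Real.toNNReal_pos.2 hr

lemma IsOrbit.intervalIntegrable (hK : IsOrbit S K) (hS : IsC0Semigroup S)
    (ha : ∫⁻ s in Ioc (0 : ℝ) 1, ‖K s.toNNReal a‖ₑ < ∞) {s t : ℝ} (hs : 0 ≤ s) (ht : 0 ≤ t) :
    IntervalIntegrable (fun r : ℝ => K r.toNNReal a) volume s t := by
  have key : ∀ t : ℝ, 0 ≤ t → IntervalIntegrable (fun r : ℝ => K r.toNNReal a) volume 0 t := by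
    intro t ht
    have h01 : IntervalIntegrable (fun r : ℝ => K r.toNNReal a) volume 0 1 := by
      rw [intervalIntegrable_iff_integrableOn_Ioc_of_le zero_le_one]
      refine ⟨?_, ha⟩
      exact ((hK.continuousOn_toNNReal hS a).mono Ioc_subset_Ioi_self).aestronglyMeasurable
        measurableSet_Ioc
    rcases le_total t 1 with h | h
    · exact h01.mono_set (by rw [uIcc_of_le ht, uIcc_of_le zero_le_one]; exact Icc_subset_Icc_right h)
    · refine h01.trans (ContinuousOn.intervalIntegrable ?_)
      refine (hK.continuousOn_toNNReal hS a).mono fun r hr => ?_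
      rw [uIcc_of_le h] at hr
      exact lt_of_lt_of_le one_pos hr.1
  exact (key s hs).symm.trans (key t ht)

/-- The deterministic counterpart of the innovation relation, obtained by splitting the integral at
h. It lets the drift be treated together with the two stochastic convolutions. -/
lemma IsOrbit.integral_add (hK : IsOrbit S K) (hS : IsC0Semigroup S)
    (ha : ∫⁻ s in Ioc (0 : ℝ) 1, ‖K s.toNNReal a‖ₑ < ∞) (s h : ℝ≥0) :
    ∫ r in (0 : ℝ)..(s + h : ℝ≥0), K r.toNNReal a =
      S h (∫ r in (0 : ℝ)..s, K r.toNNReal a) + ∫ r in (0 : ℝ)..h, K r.toNNReal a := by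
  have h1 := hK.intervalIntegrable hS ha (s := 0) (t := h) le_rfl h.2
  have h2 := hK.intervalIntegrable hS ha (s := h) (t := (s + h : ℝ≥0)) h.2 (s + h).2
  rw [← intervalIntegral.integral_add_adjacent_intervals h1 h2, add_comm]
  congr 1
  have h3 := intervalIntegral.integral_comp_add_right (a := 0) (b := s)
    (fun r : ℝ => K r.toNNReal a) (h : ℝ)
  rw [zero_add, ← NNReal.coe_add] at h3
  rw [← h3, ← ContinuousLinearMap.intervalIntegral_comp_comm _
    (hK.intervalIntegrable hS ha (s := 0) (t := s) le_rfl s.2)]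
  refine intervalIntegral.integral_congr_ae (Eventually.of_forall fun r hr => ?_)
  rw [uIoc_of_le (NNReal.coe_nonneg s)] at hr
  rw [← hK.apply h (Real.toNNReal_pos.2 hr.1), Real.toNNReal_add hr.1.le (NNReal.coe_nonneg h), add_comm,
    Real.toNNReal_coe]

lemma IsOrbit.tendsto_integral_zero (hK : IsOrbit S K) (hS : IsC0Semigroup S)
    (ha : ∫⁻ s in Ioc (0 : ℝ) 1, ‖K s.toNNReal a‖ₑ < ∞) :
    Tendsto (fun t : ℝ≥0 => ∫ r in (0 : ℝ)..t, K r.toNNReal a) (𝓝 0) (𝓝 0) := by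
  have h1 := hK.intervalIntegrable hS ha (s := 0) (t := 1) le_rfl zero_le_one
  have h2 := intervalIntegral.continuousOn_primitive_interval
    ((intervalIntegrable_iff' (by simp)).1 h1)
  have h3 : Tendsto (fun t : ℝ => ∫ r in (0 : ℝ)..t, K r.toNNReal a) (𝓝[uIcc 0 1] 0) (𝓝 0) := by
    have h4 := h2 0 (by simp)
    rwa [ContinuousWithinAt, intervalIntegral.integral_same] at h4
  refine h3.comp (tendsto_nhdsWithin_iff.2 ⟨?_, ?_⟩)
  · exact NNReal.continuous_coe.tendsto 0
  · filter_upwards [gt_mem_nhds (show (0 : ℝ≥0) < 1 from one_pos)] with t ht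
    rw [uIcc_of_le zero_le_one]
    exact ⟨t.2, by exact_mod_cast ht.le⟩

end Drift

/-! ### Hilbert-Schmidt norms -/

section HilbertSchmidt

variable [CompleteSpace H]

/-- The index set of the complete orthonormal system used in `hilbertSchmidtSq`. -/
abbrev hsIndex (H : Type*) [NormedAddCommGroup H] [InnerProductSpace ℝ H] [CompleteSpace H] :
    Set H := (exists_hilbertBasis ℝ H).choose

/-- The complete orthonormal system used in `hilbertSchmidtSq`. -/
noncomputable def hsBasis (H : Type*) [NormedAddCommGroup H] [InnerProductSpace ℝ H]
    [CompleteSpace H] : HilbertBasis (hsIndex H) ℝ H :=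
  (exists_hilbertBasis ℝ H).choose_spec.choose

lemma hsBasis_apply (e : hsIndex H) : hsBasis H e = e :=
  congrFun (exists_hilbertBasis ℝ H).choose_spec.choose_spec e

/-- Distinct orthonormal vectors have distance √2, so the balls of radius 1/2 around them are
disjoint open sets in a separable space. -/
lemma countable_hsIndex [TopologicalSpace.SeparableSpace H] : (hsIndex H).Countable := by
  have ho := (hsBasis H).orthonormal
  have hpair : (hsIndex H).PairwiseDisjoint fun x => Metric.ball x (1 / 2) := by
    intro x hx y hy hxy
    refine Metric.ball_disjoint_ball ?_
    have h1 := ho.1 ⟨x, hx⟩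
    have h2 := ho.1 ⟨y, hy⟩
    have h3 := ho.2 (i := ⟨x, hx⟩) (j := ⟨y, hy⟩) (by simpa using hxy)
    simp only [hsBasis_apply] at h1 h2 h3
    rw [dist_eq_norm]
    have h4 := norm_sub_sq_real x y
    rw [h1, h2, h3] at h4
    nlinarith [norm_nonneg (x - y)]
  exact hpair.countable_of_isOpen (fun _ _ => Metric.isOpen_ball)
    fun x _ => ⟨x, Metric.mem_ball_self (by norm_num)⟩

lemma hilbertSchmidtSq_comp_le (B K : H →L[ℝ] H) :
    hilbertSchmidtSq (B.comp K) ≤ ‖B‖ₑ ^ 2 * hilbertSchmidtSq K := by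
  unfold hilbertSchmidtSq
  rw [← ENNReal.tsum_mul_left]
  refine ENNReal.tsum_le_tsum fun e => ?_
  rw [← mul_pow]
  gcongr
  exact B.le_opENorm _

lemma enorm_add_sq_le {V : Type*} [NormedAddCommGroup V] (x y : V) :
    ‖x + y‖ₑ ^ 2 ≤ 2 * ‖x‖ₑ ^ 2 + 2 * ‖y‖ₑ ^ 2 := by
  calc ‖x + y‖ₑ ^ 2 ≤ (‖x‖ₑ + ‖y‖ₑ) ^ 2 := by gcongr; exact enorm_add_le x y
    _ ≤ 2 * ‖x‖ₑ ^ 2 + 2 * ‖y‖ₑ ^ 2 := by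
      have := ENNReal.rpow_add_le_mul_rpow_add_rpow ‖x‖ₑ ‖y‖ₑ (p := 2) (by norm_num)
      norm_num at this
      rwa [mul_add] at this

lemma hilbertSchmidtSq_add_le (K L : H →L[ℝ] H) :
    hilbertSchmidtSq (K + L) ≤ 2 * hilbertSchmidtSq K + 2 * hilbertSchmidtSq L := by
  unfold hilbertSchmidtSq
  rw [← ENNReal.tsum_mul_left, ← ENNReal.tsum_mul_left, ← ENNReal.tsum_add]
  exact ENNReal.tsum_le_tsum fun e => enorm_add_sq_le _ _

lemma hilbertSchmidtSq_neg (K : H →L[ℝ] H) : hilbertSchmidtSq (-K) = hilbertSchmidtSq K := by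
  simp [hilbertSchmidtSq]

lemma hilbertSchmidtSq_sub_le (K L : H →L[ℝ] H) :
    hilbertSchmidtSq (K - L) ≤ 2 * hilbertSchmidtSq K + 2 * hilbertSchmidtSq L := by
  rw [sub_eq_add_neg, ← hilbertSchmidtSq_neg L]
  exact hilbertSchmidtSq_add_le _ _

/-- A finite integral over (0, 1] forces a finite Hilbert-Schmidt norm at some time c ≤ 1; after
time 1 the orbit is a bounded operator composed with `K c`. -/
lemma IsOrbit.lintegral_hilbertSchmidtSq_lt_top {K : ℝ≥0 → H →L[ℝ] H} (hK : IsOrbit S K)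
    (hS : IsC0Semigroup S)
    (h : ∫⁻ s in Ioc (0 : ℝ) 1, hilbertSchmidtSq (K s.toNNReal) < ∞) (t : ℝ≥0) :
    ∫⁻ s in Ioc (0 : ℝ) t, hilbertSchmidtSq (K s.toNNReal) < ∞ := by
  obtain ⟨c, hc0, hc1, hc⟩ : ∃ c : ℝ≥0, 0 < c ∧ c ≤ 1 ∧ hilbertSchmidtSq (K c) < ∞ := by
    by_contra! hcon
    have : ∫⁻ s in Ioc (0 : ℝ) 1, hilbertSchmidtSq (K s.toNNReal) =
        ∫⁻ s in Ioc (0 : ℝ) 1, ∞ := by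
      refine setLIntegral_congr_fun measurableSet_Ioc fun s hs => ?_
      exact top_le_iff.1 (hcon _ (Real.toNNReal_pos.2 hs.1) (Real.toNNReal_le_one.2 hs.2))
    rw [this] at h
    simp at h
  obtain ⟨M, -, hM⟩ := hS.exists_norm_le t
  have hsub : Ioc (0 : ℝ) t ⊆ Ioc 0 1 ∪ Ioc 1 t := by
    intro s hs
    rcases le_total s 1 with h1 | h1
    · exact Or.inl ⟨hs.1, h1⟩
    · rcases h1.eq_or_lt with h2 | h2
      · exact Or.inl ⟨hs.1, h2.symm.le⟩
      · exact Or.inr ⟨h2, hs.2⟩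
  refine (lintegral_mono_set hsub).trans_lt ((lintegral_union_le _ _ _).trans_lt ?_)
  refine ENNReal.add_lt_top.2 ⟨h, ?_⟩
  have hb : ∀ s ∈ Ioc (1 : ℝ) t, hilbertSchmidtSq (K s.toNNReal) ≤
      ENNReal.ofReal M ^ 2 * hilbertSchmidtSq (K c) := by
    intro s hs
    have hcs : c ≤ s.toNNReal := hc1.trans (Real.one_le_toNNReal.2 hs.1.le)
    rw [← tsub_add_cancel_of_le hcs, hK _ _ hc0]
    refine (hilbertSchmidtSq_comp_le _ _).trans ?_
    gcongr
    rw [← ofReal_norm]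
    refine ENNReal.ofReal_le_ofReal (hM _ (tsub_le_self.trans ?_))
    exact Real.toNNReal_le_iff_le_coe.2 hs.2
  refine (setLIntegral_mono measurable_const hb).trans_lt ?_
  rw [setLIntegral_const]
  exact ENNReal.mul_lt_top (ENNReal.mul_lt_top (by simp) hc) (by simp)

end HilbertSchmidt

end Semigroup

end LevySPDE

namespace LevySPDE

/-! ### Tagged partitions -/

namespace TaggedPartition

variable {c d : ℝ≥0}

lemma le_pt (π : TaggedPartition c d) (i : ℕ) : c ≤ π.pt i :=
  π.pt_zero.symm.le.trans (π.mono (Nat.zero_le i))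

lemma pt_le (π : TaggedPartition c d) {i : ℕ} (hi : i ≤ π.n) : π.pt i ≤ d :=
  (π.mono hi).trans π.pt_n.le

lemma sub_le_mesh (π : TaggedPartition c d) {i : ℕ} (hi : i < π.n) :
    π.pt (i + 1) - π.pt i ≤ π.mesh :=
  Finset.le_sup (f := fun i => π.pt (i + 1) - π.pt i) (Finset.mem_range.2 hi)

lemma mesh_le (π : TaggedPartition c d) {δ : ℝ≥0} (h : ∀ i < π.n, π.pt (i + 1) - π.pt i ≤ δ) :
    π.mesh ≤ δ :=
  Finset.sup_le fun i hi => h i (Finset.mem_range.1 hi)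

/-- The filter of tagged partitions whose mesh tends to `0`. -/
def fine (c d : ℝ≥0) : Filter (TaggedPartition c d) := comap mesh (𝓝 0)

instance : IsCountablyGenerated (fine c d) := by unfold fine; infer_instance

lemma tendsto_mesh : Tendsto mesh (fine c d) (𝓝 0) := tendsto_comap

/-- The equidistant partition with `n + 1` intervals. -/
noncomputable def uniform (hcd : c ≤ d) (n : ℕ) : TaggedPartition c d where
  n := n + 1
  pt i := min (c + i * ((d - c) / (n + 1 : ℕ))) d
  tag i := min (c + i * ((d - c) / (n + 1 : ℕ))) d
  mono := fun i j hij => min_le_min_right _ (by gcongr)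
  pt_zero := by simpa using hcd
  pt_n := by
    rw [mul_div_cancel₀ _ (by positivity), add_tsub_cancel_of_le hcd, min_self]
  tag_mem i := ⟨le_rfl, min_le_min_right _ (by gcongr; simp)⟩

lemma mesh_uniform_le (hcd : c ≤ d) (n : ℕ) :
    (uniform hcd n).mesh ≤ (d - c) / (n + 1 : ℕ) := by
  refine mesh_le _ fun i _ => ?_
  rw [tsub_le_iff_left]
  change min (c + (i + 1 : ℕ) * ((d - c) / (n + 1 : ℕ))) d ≤
    min (c + i * ((d - c) / (n + 1 : ℕ))) d + (d - c) / (n + 1 : ℕ)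
  rw [← min_add_add_right]
  refine min_le_min (le_of_eq ?_) le_self_add
  push_cast
  ring

/-- Witnessed by the equidistant partitions. Uniqueness of Stieltjes integrals rests on this. -/
lemma fine_neBot (hcd : c ≤ d) : NeBot (fine c d) := by
  have h : Tendsto (fun n => uniform hcd n) atTop (fine c d) := by
    rw [fine, tendsto_comap_iff]
    refine tendsto_of_tendsto_of_tendsto_of_le_of_le tendsto_const_nhds ?_
      (fun _ => zero_le) (mesh_uniform_le hcd)
    have : Tendsto (fun n : ℕ => (d - c) / ((n : ℝ≥0) + 1)) atTop (𝓝 0) := by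
      rw [← NNReal.tendsto_coe]
      push_cast
      exact tendsto_const_div_atTop_nhds_zero_nat ((d - c : ℝ≥0) : ℝ) |>.comp
        (tendsto_add_atTop_nat 1) |>.congr fun n => by simp
    simpa using this
  exact h.neBot

/-- The translate of a partition by `-h`. -/
def shift (h : ℝ≥0) (π : TaggedPartition (h + c) (h + d)) : TaggedPartition c d where
  n := π.n
  pt i := π.pt i - h
  tag i := π.tag i - h
  mono := fun _ _ hij => tsub_le_tsub_right (π.mono hij) _
  pt_zero := by rw [π.pt_zero, add_tsub_cancel_left]
  pt_n := by rw [π.pt_n, add_tsub_cancel_left]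
  tag_mem i := ⟨tsub_le_tsub_right (π.tag_mem i).1 _, tsub_le_tsub_right (π.tag_mem i).2 _⟩

lemma tendsto_shift (h : ℝ≥0) :
    Tendsto (shift h) (fine (h + c) (h + d)) (fine c d) := by
  rw [fine, fine, tendsto_comap_iff]
  refine tendsto_comap.congr fun π => ?_
  refine Finset.sup_congr rfl fun i _ => ?_
  have := le_self_add.trans (π.le_pt i)
  exact (tsub_tsub_tsub_cancel_right this).symm

/-- The time reversal of a partition. -/
def reverse {t : ℝ≥0} (hcd : c ≤ d) (hd : d ≤ t) (π : TaggedPartition (t - d) (t - c)) :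
    TaggedPartition c d where
  n := π.n
  pt i := t - π.pt (π.n - i)
  -- Past the last cell the truncated index would pick the tag of the first cell of π, which need
  -- not reflect to d; there the tag must be d itself.
  tag i := if i < π.n then t - π.tag (π.n - 1 - i) else d
  mono := fun i j hij => tsub_le_tsub_left (π.mono (by omega)) _
  pt_zero := by rw [Nat.sub_zero, π.pt_n, tsub_tsub_cancel_of_le (hcd.trans hd)]
  pt_n := by rw [Nat.sub_self, π.pt_zero, tsub_tsub_cancel_of_le hd]
  tag_mem i := by
    split_ifs with h
    · have := π.tag_mem (π.n - 1 - i)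
      have e1 : π.n - 1 - i + 1 = π.n - i := by omega
      have e2 : π.n - 1 - i = π.n - (i + 1) := by omega
      rw [e1] at this
      rw [← e2]
      exact ⟨tsub_le_tsub_left this.2 _, tsub_le_tsub_left this.1 _⟩
    · have e1 : π.n - i = 0 := by omega
      have e2 : π.n - (i + 1) = 0 := by omega
      rw [e1, e2, π.pt_zero, tsub_tsub_cancel_of_le hd]
      exact ⟨le_rfl, le_rfl⟩

lemma tendsto_reverse {t : ℝ≥0} (hcd : c ≤ d) (hd : d ≤ t) :
    Tendsto (reverse hcd hd) (fine (t - d) (t - c)) (fine c d) := by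
  rw [fine, fine, tendsto_comap_iff]
  refine tendsto_of_tendsto_of_tendsto_of_le_of_le tendsto_const_nhds tendsto_comap
    (fun _ => zero_le) fun π => mesh_le _ fun i hi => ?_
  change t - π.pt (π.n - (i + 1)) - (t - π.pt (π.n - i)) ≤ _
  have hi' : i < π.n := hi
  have e : π.n - i = π.n - (i + 1) + 1 := by omega
  rw [tsub_tsub_tsub_cancel_left ((π.pt_le (Nat.sub_le _ _)).trans tsub_le_self), e]
  exact π.sub_le_mesh (by omega)

/-- The part of a partition to the left of `m`. -/
def left {m : ℝ≥0} (hcm : c ≤ m) (hmd : m ≤ d) (π : TaggedPartition c d) :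
    TaggedPartition c m where
  n := π.n
  pt i := min (π.pt i) m
  tag i := min (π.tag i) m
  mono := fun _ _ hij => min_le_min_right _ (π.mono hij)
  pt_zero := by rw [π.pt_zero, min_eq_left hcm]
  pt_n := by rw [π.pt_n, min_eq_right hmd]
  tag_mem i := ⟨min_le_min_right _ (π.tag_mem i).1, min_le_min_right _ (π.tag_mem i).2⟩

/-- The part of a partition to the right of `m`. -/
def right {m : ℝ≥0} (hcm : c ≤ m) (hmd : m ≤ d) (π : TaggedPartition c d) :
    TaggedPartition m d where
  n := π.n
  pt i := max (π.pt i) m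
  tag i := max (π.tag i) m
  mono := fun _ _ hij => max_le_max_right _ (π.mono hij)
  pt_zero := by rw [π.pt_zero, max_eq_right hcm]
  pt_n := by rw [π.pt_n, max_eq_left hmd]
  tag_mem i := ⟨max_le_max_right _ (π.tag_mem i).1, max_le_max_right _ (π.tag_mem i).2⟩

lemma tendsto_left {m : ℝ≥0} (hcm : c ≤ m) (hmd : m ≤ d) :
    Tendsto (left hcm hmd) (fine c d) (fine c m) := by
  rw [fine, fine, tendsto_comap_iff]
  refine tendsto_of_tendsto_of_tendsto_of_le_of_le tendsto_const_nhds tendsto_comap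
    (fun _ => zero_le) fun π => mesh_le _ fun i hi => (?_ : _ ≤ _).trans (π.sub_le_mesh hi)
  change min (π.pt (i + 1)) m - min (π.pt i) m ≤ _
  rw [tsub_le_iff_left]
  refine (min_le_min_right m (le_add_tsub (a := π.pt (i + 1)) (b := π.pt i))).trans ?_
  rw [← min_add_add_right]
  exact min_le_min_left _ le_self_add

lemma tendsto_right {m : ℝ≥0} (hcm : c ≤ m) (hmd : m ≤ d) :
    Tendsto (right hcm hmd) (fine c d) (fine m d) := by
  rw [fine, fine, tendsto_comap_iff]
  refine tendsto_of_tendsto_of_tendsto_of_le_of_le tendsto_const_nhds tendsto_comap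
    (fun _ => zero_le) fun π => mesh_le _ fun i hi => (?_ : _ ≤ _).trans (π.sub_le_mesh hi)
  change max (π.pt (i + 1)) m - max (π.pt i) m ≤ _
  rw [tsub_le_iff_left]
  refine (max_le_max_right m (le_add_tsub (a := π.pt (i + 1)) (b := π.pt i))).trans ?_
  rw [← max_add_add_right]
  exact max_le_max_left _ le_self_add

/-- The partition with one more interval at the end. -/
def snoc {s : ℝ≥0} (hds : d ≤ s) (π : TaggedPartition c d) : TaggedPartition c s where
  n := π.n + 1
  pt i := if i ≤ π.n then π.pt i else s
  tag i := if i < π.n then π.tag i else s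
  mono := by
    intro i j hij
    simp only
    split_ifs with h1 h2 h2
    · exact π.mono hij
    · exact (π.pt_le h1).trans hds
    · omega
    · exact le_rfl
  pt_zero := by simp [π.pt_zero]
  pt_n := by simp
  tag_mem i := by
    split_ifs with h1 h2 h3 h4 h5 h6
    all_goals first | omega | skip
    · exact π.tag_mem i
    · exact ⟨(π.pt_le (by omega)).trans hds, le_rfl⟩
    · exact ⟨le_rfl, le_rfl⟩

lemma mesh_snoc_le {s : ℝ≥0} (hds : d ≤ s) (π : TaggedPartition c d) :
    (snoc hds π).mesh ≤ π.mesh + (s - d) := by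
  refine mesh_le _ fun i hi => ?_
  have hi' : i < π.n + 1 := hi
  change (if i + 1 ≤ π.n then π.pt (i + 1) else s) - (if i ≤ π.n then π.pt i else s) ≤ _
  rw [if_pos (by omega : i ≤ π.n)]
  split_ifs with h
  · exact (π.sub_le_mesh h).trans le_self_add
  · have : i = π.n := by omega
    rw [this, π.pt_n]
    exact le_add_self

end TaggedPartition

end LevySPDE

namespace LevySPDE

/-! ### Laws of sums of increments -/

section Laws

variable {Ω : Type*} {mΩ : MeasurableSpace Ω} {P : Measure Ω} [IsProbabilityMeasure P]
  {H : Type*} [NormedAddCommGroup H] [InnerProductSpace ℝ H] [CompleteSpace H]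
  [SecondCountableTopology H] [MeasurableSpace H] [BorelSpace H]
  {U : Type*} [NormedAddCommGroup U] [InnerProductSpace ℝ U] [CompleteSpace U]
  [MeasurableSpace U] [BorelSpace U] {ℱ : Filtration ℝ≥0 mΩ} {Y : ℝ≥0 → Ω → U}

lemma charFun_map_eq_integral {f : Ω → H} (hf : AEMeasurable f P) (v : H) :
    charFun (P.map f) v = ∫ ω, Complex.exp ((⟪f ω, v⟫_ℝ : ℂ) * Complex.I) ∂P := by
  rw [charFun_apply, integral_map hf]
  have : Continuous fun x : H => Complex.exp (((⟪x, v⟫_ℝ : ℝ) : ℂ) * Complex.I) := by fun_prop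
  exact this.aestronglyMeasurable

lemma map_eq_of_integral_exp {f g : Ω → H} (hf : AEMeasurable f P) (hg : AEMeasurable g P)
    (h : ∀ v, ∫ ω, Complex.exp ((⟪f ω, v⟫_ℝ : ℂ) * Complex.I) ∂P =
      ∫ ω, Complex.exp ((⟪g ω, v⟫_ℝ : ℂ) * Complex.I) ∂P) : P.map f = P.map g := by
  have := Measure.isProbabilityMeasure_map hf
  have := Measure.isProbabilityMeasure_map hg
  refine Measure.ext_of_charFun (funext fun v => ?_)
  rw [charFun_map_eq_integral hf, charFun_map_eq_integral hg, h v]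

lemma norm_exp_inner_le (v x : H) : ‖Complex.exp ((⟪x, v⟫_ℝ : ℂ) * Complex.I)‖ ≤ 1 := by
  rw [Complex.norm_exp_ofReal_mul_I]

lemma tendsto_setIntegral_exp_inner {κ : Type*} {l : Filter κ} [IsCountablyGenerated l]
    {f : κ → Ω → H} {g : Ω → H} (hf : ∀ᶠ i in l, AEStronglyMeasurable (f i) P)
    (h : TendstoInMeasure P f l g) (v : H) (A : Set Ω) :
    Tendsto (fun i => ∫ ω in A, Complex.exp ((⟪f i ω, v⟫_ℝ : ℂ) * Complex.I) ∂P) l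
      (𝓝 (∫ ω in A, Complex.exp ((⟪g ω, v⟫_ℝ : ℂ) * Complex.I) ∂P)) :=
  tendsto_setIntegral_of_tendstoInMeasure hf h
    (φ := fun x : H => Complex.exp (((⟪x, v⟫_ℝ : ℝ) : ℂ) * Complex.I)) (by fun_prop)
    (norm_exp_inner_le v) A

/-- Characteristic functions converge along limits in probability and determine a law on H. -/
lemma map_eq_of_tendstoInMeasure {κ : Type*} {l : Filter κ} [IsCountablyGenerated l] [NeBot l]
    {f f' : κ → Ω → H} {g g' : Ω → H} (hf : ∀ᶠ i in l, AEStronglyMeasurable (f i) P)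
    (hf' : ∀ᶠ i in l, AEStronglyMeasurable (f' i) P) (h : TendstoInMeasure P f l g)
    (h' : TendstoInMeasure P f' l g') (heq : ∀ᶠ i in l, P.map (f i) = P.map (f' i)) :
    P.map g = P.map g' := by
  refine map_eq_of_integral_exp (aestronglyMeasurable_of_tendstoInMeasure hf h).aemeasurable
    (aestronglyMeasurable_of_tendstoInMeasure hf' h').aemeasurable fun v => ?_
  have h1 := tendsto_setIntegral_exp_inner hf h v univ
  have h2 := tendsto_setIntegral_exp_inner hf' h' v univ
  simp only [Measure.restrict_univ] at h1 h2
  refine tendsto_nhds_unique h1 (h2.congr' ?_)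
  filter_upwards [heq, hf, hf'] with i hi hfi hfi'
  rw [← charFun_map_eq_integral hfi.aemeasurable, ← charFun_map_eq_integral hfi'.aemeasurable, hi]

lemma probNorm_eq_of_map_eq {f g : Ω → H} (hf : AEMeasurable f P) (hg : AEMeasurable g P)
    (h : P.map f = P.map g) : probNorm P f = probNorm P g := by
  rw [probNorm_map hf, probNorm_map hg, h]

lemma IsLevyProcess.hasCylindricalIncrements (hY : IsLevyProcess Y ℱ P) :
    HasCylindricalIncrements (fun t (u : U) ω => ⟪Y t ω, u⟫_ℝ) ℱ P
      fun r u => charFun (P.map (Y r)) u where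
  meas t u := ((hY.adapted t).inner stronglyMeasurable_const).measurable
  add t u u' := Eventually.of_forall fun ω => inner_add_right _ _ _
  indep s t u hst := by
    refine indep_of_indep_of_le_left (hY.indep s t hst) ?_
    rw [← measurable_iff_comap_le]
    have h3 : Measurable fun x : U => ⟪x, u⟫_ℝ :=
      (Continuous.inner continuous_id continuous_const).measurable
    have := h3.comp (comap_measurable (fun ω => Y t ω - Y s ω))
    convert! this using 1
    ext ω
    simp [inner_sub_left]
  char s t u hst := by
    have hm : AEMeasurable (fun ω => Y t ω - Y s ω) P :=
      ((hY.stronglyMeasurable t).sub (hY.stronglyMeasurable s)).measurable.aemeasurable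
    have := hY.stationary s (t - s)
    rw [add_tsub_cancel_of_le hst] at this
    have hc : Continuous fun x : U => Complex.exp (((⟪x, u⟫_ℝ : ℝ) : ℂ) * Complex.I) := by fun_prop
    rw [← this, charFun_apply, integral_map hm hc.aestronglyMeasurable]
    simp [inner_sub_left]

/-- The sum `∑ A j (Y (b j) - Y (a j))`. -/
noncomputable def levySum {J : Type*} [Fintype J] (A : J → U →L[ℝ] H) (a b : J → ℝ≥0)
    (Y : ℝ≥0 → Ω → U) (ω : Ω) : H := ∑ j, A j (Y (b j) ω - Y (a j) ω)

/-- The adjoints move the operators onto the test vector, so the results on real increment sums give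
the characteristic function of an H-valued sum. -/
lemma inner_levySum {J : Type*} [Fintype J] (A : J → U →L[ℝ] H) (a b : J → ℝ≥0) (v : H) (ω : Ω) :
    ⟪levySum A a b Y ω, v⟫_ℝ = incrementSum (fun t (u : U) ω => ⟪Y t ω, u⟫_ℝ) a b
      (fun j => (A j).adjoint v) ω := by
  simp only [levySum, incrementSum, sum_inner, ← inner_sub_left, map_sub,
    ContinuousLinearMap.adjoint_inner_right]

lemma stronglyMeasurable_levySum (hY : ∀ t, StronglyMeasurable (Y t)) {J : Type*} [Fintype J]
    (A : J → U →L[ℝ] H) (a b : J → ℝ≥0) : StronglyMeasurable (levySum A a b Y) := by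
  unfold levySum
  exact Finset.stronglyMeasurable_fun_sum _ fun j _ =>
    (A j).continuous.comp_stronglyMeasurable ((hY _).sub (hY _))

lemma IsLevyProcess.map_levySum_shift (hY : IsLevyProcess Y ℱ P) {J : Type*} [Fintype J]
    (A : J → U →L[ℝ] H) {a b : J → ℝ≥0} (hab : ∀ j, a j ≤ b j) (s : ℝ≥0) :
    P.map (levySum A (fun j => s + a j) (fun j => s + b j) Y) = P.map (levySum A a b Y) := by
  refine map_eq_of_integral_exp (stronglyMeasurable_levySum hY.stronglyMeasurable _ _ _
    |>.measurable.aemeasurable) (stronglyMeasurable_levySum hY.stronglyMeasurable _ _ _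
    |>.measurable.aemeasurable) fun v => ?_
  have := hY.hasCylindricalIncrements.integral_mul_exp_shift hab (fun j => (A j).adjoint v) s
    (ξ := fun _ => 1) measurable_const
  simpa [inner_levySum] using this

lemma IsLevyProcess.map_levySum_reverse (hY : IsLevyProcess Y ℱ P) {J : Type*} [Fintype J]
    (A : J → U →L[ℝ] H) {a b : J → ℝ≥0} (hab : ∀ j, a j ≤ b j) {t : ℝ≥0} (hb : ∀ j, b j ≤ t) :
    P.map (levySum A (fun j => t - b j) (fun j => t - a j) Y) = P.map (levySum A a b Y) := by
  refine map_eq_of_integral_exp (stronglyMeasurable_levySum hY.stronglyMeasurable _ _ _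
    |>.measurable.aemeasurable) (stronglyMeasurable_levySum hY.stronglyMeasurable _ _ _
    |>.measurable.aemeasurable) fun v => ?_
  simp only [inner_levySum]
  exact hY.hasCylindricalIncrements.integral_exp_reverse hab (fun j => (A j).adjoint v) hb

end Laws

/-! ### Stieltjes integrals -/

section Stieltjes

open TaggedPartition

variable {Ω : Type*} {mΩ : MeasurableSpace Ω} {P : Measure Ω}
  {H : Type*} [NormedAddCommGroup H] [InnerProductSpace ℝ H]
  {U : Type*} [NormedAddCommGroup U] [InnerProductSpace ℝ U]
  {Y : ℝ≥0 → Ω → U} {Φ Φ' : ℝ≥0 → U →L[ℝ] H} {c d : ℝ≥0} {I I' : Ω → H}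

/-- The filter of fine partitions is countably generated, so sequences decide convergence. The
filter form allows images under maps of partitions and products. -/
lemma isStieltjesIntegral_iff :
    IsStieltjesIntegral P Φ Y c d I ↔
      TendstoInMeasure P (stieltjesSum Φ Y) (fine c d) I := by
  constructor
  · intro h ε hε
    refine tendsto_of_seq_tendsto fun π hπ => ?_
    exact h π (tendsto_mesh.comp hπ) ε hε
  · intro h π hπ
    exact h.comp (tendsto_comap_iff.2 hπ)

lemma stieltjesSum_eq_levySum (π : TaggedPartition c d) :
    stieltjesSum Φ Y π = levySum (fun i : Fin π.n => Φ (π.tag i)) (fun i => π.pt i)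
      (fun i => π.pt (i + 1)) Y := by
  ext ω
  exact Finset.sum_range _

lemma stronglyMeasurable_stieltjesSum (hY : ∀ t, StronglyMeasurable (Y t))
    (π : TaggedPartition c d) : StronglyMeasurable (stieltjesSum Φ Y π) :=
  Finset.stronglyMeasurable_fun_sum _ fun _ _ =>
    (Φ _).continuous.comp_stronglyMeasurable ((hY _).sub (hY _))

lemma IsStieltjesIntegral.aestronglyMeasurable (hY : ∀ t, StronglyMeasurable (Y t)) (hcd : c ≤ d)
    (h : IsStieltjesIntegral P Φ Y c d I) : AEStronglyMeasurable I P := by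
  have := fine_neBot hcd
  exact (isStieltjesIntegral_iff.1 h).aestronglyMeasurable
    fun π => (stronglyMeasurable_stieltjesSum hY π).aestronglyMeasurable

lemma IsStieltjesIntegral.ae_unique (hcd : c ≤ d) (h : IsStieltjesIntegral P Φ Y c d I)
    (h' : IsStieltjesIntegral P Φ Y c d I') : I =ᵐ[P] I' := by
  have := fine_neBot hcd
  exact tendstoInMeasure_ae_unique (isStieltjesIntegral_iff.1 h) (isStieltjesIntegral_iff.1 h')

lemma stieltjesSum_congr {π : TaggedPartition c d} (h : ∀ r, c ≤ r → r ≤ d → Φ r = Φ' r) :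
    stieltjesSum Φ Y π = stieltjesSum Φ' Y π := by
  ext ω
  refine Finset.sum_congr rfl fun i hi => ?_
  rw [h _ ((π.le_pt _).trans (π.tag_mem i).1)
    ((π.tag_mem i).2.trans (π.pt_le (Finset.mem_range.1 hi)))]

lemma IsStieltjesIntegral.congr_integrand (h : IsStieltjesIntegral P Φ Y c d I)
    (hΦ : ∀ r, c ≤ r → r ≤ d → Φ r = Φ' r) : IsStieltjesIntegral P Φ' Y c d I := by
  intro π hπ
  have := h π hπ
  simpa only [stieltjesSum_congr hΦ] using this

lemma stieltjesSum_clm_comp (B : H →L[ℝ] H) (π : TaggedPartition c d) (ω : Ω) :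
    stieltjesSum (fun r => B.comp (Φ r)) Y π ω = B (stieltjesSum Φ Y π ω) := by
  simp [stieltjesSum]

lemma IsStieltjesIntegral.clm_comp (B : H →L[ℝ] H) (h : IsStieltjesIntegral P Φ Y c d I) :
    IsStieltjesIntegral P (fun r => B.comp (Φ r)) Y c d (fun ω => B (I ω)) := by
  rw [isStieltjesIntegral_iff] at *
  have := tendstoInMeasure_clm B h
  refine this.congr_left fun π => Eventually.of_forall fun ω => ?_
  exact (stieltjesSum_clm_comp B π ω).symm

/-- Existence of the Stieltjes integral when the distances of the sums are dominated by those of a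
convergent family. -/
lemma exists_isStieltjesIntegral_of_transfer [CompleteSpace H] [IsProbabilityMeasure P]
    (hY : ∀ t, StronglyMeasurable (Y t)) {c' d' : ℝ≥0} (hcd' : c' ≤ d')
    (h : IsStieltjesIntegral P Φ Y c d I)
    {L : TaggedPartition c' d' → TaggedPartition c d} (hL : Tendsto L (fine c' d') (fine c d))
    (hcd : c ≤ d)
    (hlaw : ∀ π π', probNorm P (stieltjesSum Φ' Y π - stieltjesSum Φ' Y π') ≤
      probNorm P (stieltjesSum Φ Y (L π) - stieltjesSum Φ Y (L π'))) :
    ∃ I', StronglyMeasurable I' ∧ IsStieltjesIntegral P Φ' Y c' d' I' := by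
  have := fine_neBot hcd'
  simp_rw [isStieltjesIntegral_iff] at *
  have hm := fun π => stronglyMeasurable_stieltjesSum (Φ := Φ) (c := c) (d := d) hY π
  have hm' := fun π => stronglyMeasurable_stieltjesSum (Φ := Φ') (c := c') (d := d') hY π
  have hI : AEStronglyMeasurable I P :=
    have := fine_neBot hcd
    h.aestronglyMeasurable fun π => (hm π).aestronglyMeasurable
  refine exists_tendstoInMeasure_of_cauchy
    (Eventually.of_forall fun π => (hm' π).aestronglyMeasurable) ?_
  rw [tendstoInMeasure_iff_probNorm (Eventually.of_forall fun π =>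
    (hm π).aestronglyMeasurable.sub hI)] at h
  have h1 := h.comp hL
  have h2 := (h1.comp tendsto_fst).add (h1.comp (tendsto_snd (f := fine c' d')))
  rw [add_zero] at h2
  refine tendsto_of_tendsto_of_tendsto_of_le_of_le tendsto_const_nhds h2 (fun _ => zero_le)
    fun q => (hlaw _ _).trans ?_
  refine (probNorm_sub_le (hm _).aestronglyMeasurable hI).trans ?_
  rw [probNorm_sub_comm I]
  rfl

end Stieltjes

end LevySPDE

namespace LevySPDE

/-! ### Stieltjes integrals under time shift and time reversal -/

section StieltjesTransfer

open TaggedPartition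

variable {Ω : Type*} {mΩ : MeasurableSpace Ω} {P : Measure Ω} [IsProbabilityMeasure P]
  {H : Type*} [NormedAddCommGroup H] [InnerProductSpace ℝ H] [CompleteSpace H]
  [SecondCountableTopology H] [MeasurableSpace H] [BorelSpace H]
  {U : Type*} [NormedAddCommGroup U] [InnerProductSpace ℝ U] [CompleteSpace U]
  [MeasurableSpace U] [BorelSpace U] {ℱ : Filtration ℝ≥0 mΩ} {Y : ℝ≥0 → Ω → U}
  {Φ Φ' : ℝ≥0 → U →L[ℝ] H} {c d : ℝ≥0} {I I' : Ω → H}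

/-- A difference of two sums is again a sum, over the disjoint union of the index sets. The
invariance of laws of single sums therefore covers differences, which is what Cauchy criteria need.
-/
lemma levySum_sub {J J' : Type*} [Fintype J] [Fintype J'] (A : J → U →L[ℝ] H) (a b : J → ℝ≥0)
    (A' : J' → U →L[ℝ] H) (a' b' : J' → ℝ≥0) :
    levySum A a b Y - levySum A' a' b' Y =
      levySum (Sum.elim A (-A')) (Sum.elim a a') (Sum.elim b b') Y := by
  ext ω
  simp only [levySum, Fintype.sum_sum_type, Pi.sub_apply, Sum.elim_inl, Sum.elim_inr, Pi.neg_apply,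
    neg_apply]
  rw [Finset.sum_neg_distrib, sub_eq_add_neg]

lemma IsLevyProcess.map_levySum_sub_reverse (hY : IsLevyProcess Y ℱ P) {J J' : Type*} [Fintype J]
    [Fintype J'] (A : J → U →L[ℝ] H) {a b : J → ℝ≥0} (hab : ∀ j, a j ≤ b j)
    (A' : J' → U →L[ℝ] H) {a' b' : J' → ℝ≥0} (hab' : ∀ j, a' j ≤ b' j) {t : ℝ≥0}
    (hb : ∀ j, b j ≤ t) (hb' : ∀ j, b' j ≤ t) :
    P.map (levySum A (fun j => t - b j) (fun j => t - a j) Y -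
        levySum A' (fun j => t - b' j) (fun j => t - a' j) Y) =
      P.map (levySum A a b Y - levySum A' a' b' Y) := by
  rw [levySum_sub, levySum_sub, ← hY.map_levySum_reverse (Sum.elim A (-A'))
    (a := Sum.elim a a') (b := Sum.elim b b') (t := t)]
  · congr 2 <;> ext j <;> cases j <;> rfl
  · rintro (j | j)
    exacts [hab j, hab' j]
  · rintro (j | j)
    exacts [hb j, hb' j]

lemma IsLevyProcess.map_levySum_sub_shift (hY : IsLevyProcess Y ℱ P) {J J' : Type*} [Fintype J]
    [Fintype J'] (A : J → U →L[ℝ] H) {a b : J → ℝ≥0} (hab : ∀ j, a j ≤ b j)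
    (A' : J' → U →L[ℝ] H) {a' b' : J' → ℝ≥0} (hab' : ∀ j, a' j ≤ b' j) (s : ℝ≥0) :
    P.map (levySum A (fun j => s + a j) (fun j => s + b j) Y -
        levySum A' (fun j => s + a' j) (fun j => s + b' j) Y) =
      P.map (levySum A a b Y - levySum A' a' b' Y) := by
  rw [levySum_sub, levySum_sub, ← hY.map_levySum_shift (Sum.elim A (-A'))
    (a := Sum.elim a a') (b := Sum.elim b b') _ s]
  · congr 2 <;> ext j <;> cases j <;> rfl
  · rintro (j | j)
    exacts [hab j, hab' j]

lemma stieltjesSum_reverse {t : ℝ≥0} (hcd : c ≤ d) (hd : d ≤ t)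
    (π : TaggedPartition (t - d) (t - c)) :
    stieltjesSum Φ Y (reverse hcd hd π) = levySum (fun i : Fin π.n => Φ (t - π.tag i))
      (fun i => t - π.pt (i + 1)) (fun i => t - π.pt i) Y := by
  ext ω
  unfold levySum
  rw [← Finset.sum_range (fun i => Φ (t - π.tag i) (Y (t - π.pt i) ω - Y (t - π.pt (i + 1)) ω)),
    ← Finset.sum_range_reflect]
  refine Finset.sum_congr rfl fun i hi => ?_
  have hi' : i < π.n := Finset.mem_range.1 hi
  have e1 : π.n - (i + 1) = π.n - 1 - i := by omega
  have e2 : π.n - i = π.n - 1 - i + 1 := by omega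
  simp only [reverse, if_pos hi']
  rw [e1, e2]

lemma stieltjesSum_shift (h : ℝ≥0) (hΦ : ∀ r, c ≤ r → r ≤ d → Φ' (h + r) = Φ r)
    (π : TaggedPartition (h + c) (h + d)) :
    stieltjesSum Φ Y (shift h π) = levySum (fun i : Fin π.n => Φ' (π.tag i))
      (fun i => (shift h π).pt i) (fun i => (shift h π).pt (i + 1)) Y := by
  rw [stieltjesSum_eq_levySum]
  congr 1
  funext i
  change Φ (π.tag i - h) = Φ' (π.tag i)
  rw [← hΦ, add_tsub_cancel_of_le]
  · exact le_self_add.trans ((π.le_pt i).trans (π.tag_mem i).1)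
  · exact ((shift h π).le_pt i).trans ((shift h π).tag_mem i).1
  · exact ((shift h π).tag_mem i).2.trans ((shift h π).pt_le i.2)

lemma stieltjesSum_eq_levySum_shift (h : ℝ≥0) (π : TaggedPartition (h + c) (h + d)) :
    stieltjesSum Φ' Y π = levySum (fun i : Fin π.n => Φ' (π.tag i))
      (fun i => h + (shift h π).pt i) (fun i => h + (shift h π).pt (i + 1)) Y := by
  rw [stieltjesSum_eq_levySum]
  have : ∀ i, h + (shift h π).pt i = π.pt i := fun i =>
    add_tsub_cancel_of_le (le_self_add.trans (π.le_pt i))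
  simp only [this]

lemma IsLevyProcess.map_stieltjesSum_sub_reverse (hY : IsLevyProcess Y ℱ P) {t c' d' : ℝ≥0}
    (hcd : c ≤ d) (hd : d ≤ t) (hcd' : c' ≤ d') (hd' : d' ≤ t)
    (π : TaggedPartition (t - d) (t - c)) (π' : TaggedPartition (t - d') (t - c')) :
    P.map (stieltjesSum (fun r => Φ (t - r)) Y π - stieltjesSum (fun r => Φ (t - r)) Y π') =
      P.map (stieltjesSum Φ Y (reverse hcd hd π) - stieltjesSum Φ Y (reverse hcd' hd' π')) := by
  rw [stieltjesSum_reverse, stieltjesSum_reverse, stieltjesSum_eq_levySum, stieltjesSum_eq_levySum]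
  exact (hY.map_levySum_sub_reverse _ (fun j => π.mono (Nat.le_succ _)) _
    (fun j => π'.mono (Nat.le_succ _)) (fun j => (π.pt_le j.2).trans tsub_le_self)
    (fun j => (π'.pt_le j.2).trans tsub_le_self)).symm

lemma IsLevyProcess.map_stieltjesSum_reverse (hY : IsLevyProcess Y ℱ P) {t : ℝ≥0}
    (hcd : c ≤ d) (hd : d ≤ t) (π : TaggedPartition (t - d) (t - c)) :
    P.map (stieltjesSum (fun r => Φ (t - r)) Y π) =
      P.map (stieltjesSum Φ Y (reverse hcd hd π)) := by
  rw [stieltjesSum_reverse, stieltjesSum_eq_levySum]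
  exact (hY.map_levySum_reverse _ (fun j => π.mono (Nat.le_succ _))
    (fun j => (π.pt_le j.2).trans tsub_le_self)).symm

lemma IsLevyProcess.map_stieltjesSum_sub_shift (hY : IsLevyProcess Y ℱ P) (h : ℝ≥0)
    (hΦ : ∀ r, c ≤ r → r ≤ d → Φ' (h + r) = Φ r) (π π' : TaggedPartition (h + c) (h + d)) :
    P.map (stieltjesSum Φ' Y π - stieltjesSum Φ' Y π') =
      P.map (stieltjesSum Φ Y (shift h π) - stieltjesSum Φ Y (shift h π')) := by
  rw [stieltjesSum_shift h hΦ, stieltjesSum_shift h hΦ, stieltjesSum_eq_levySum_shift,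
    stieltjesSum_eq_levySum_shift]
  exact hY.map_levySum_sub_shift _ (fun j => (shift h π).mono (Nat.le_succ _)) _
    (fun j => (shift h π').mono (Nat.le_succ _)) h

lemma aemeasurable_stieltjesSum_sub (hY : ∀ t, StronglyMeasurable (Y t)) {c' d' : ℝ≥0}
    (π : TaggedPartition c d) (π' : TaggedPartition c' d') :
    AEMeasurable (stieltjesSum Φ Y π - stieltjesSum Φ' Y π') P :=
  ((stronglyMeasurable_stieltjesSum hY π).sub
    (stronglyMeasurable_stieltjesSum hY π')).measurable.aemeasurable

/-- Differences of sums over translated partitions have the laws of the original differences, so the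
Cauchy property carries over. Only existence is asserted: the new integral is built from other
increments. -/
lemma IsLevyProcess.exists_isStieltjesIntegral_shift (hY : IsLevyProcess Y ℱ P) (h : ℝ≥0)
    (hcd : c ≤ d) (hΦ : ∀ r, c ≤ r → r ≤ d → Φ' (h + r) = Φ r)
    (hI : IsStieltjesIntegral P Φ Y c d I) :
    ∃ I', StronglyMeasurable I' ∧ IsStieltjesIntegral P Φ' Y (h + c) (h + d) I' :=
  exists_isStieltjesIntegral_of_transfer hY.stronglyMeasurable (by gcongr) hI (tendsto_shift h) hcd
    fun π π' => (probNorm_eq_of_map_eq (aemeasurable_stieltjesSum_sub hY.stronglyMeasurable _ _)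
      (aemeasurable_stieltjesSum_sub hY.stronglyMeasurable _ _)
      (hY.map_stieltjesSum_sub_shift h hΦ π π')).le

lemma IsLevyProcess.exists_isStieltjesIntegral_reverse (hY : IsLevyProcess Y ℱ P) {t : ℝ≥0}
    (hcd : c ≤ d) (hd : d ≤ t) (hI : IsStieltjesIntegral P Φ Y c d I) :
    ∃ I', StronglyMeasurable I' ∧
      IsStieltjesIntegral P (fun r => Φ (t - r)) Y (t - d) (t - c) I' :=
  exists_isStieltjesIntegral_of_transfer hY.stronglyMeasurable (tsub_le_tsub_left hcd _) hI
    (tendsto_reverse hcd hd) hcd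
    fun π π' => (probNorm_eq_of_map_eq (aemeasurable_stieltjesSum_sub hY.stronglyMeasurable _ _)
      (aemeasurable_stieltjesSum_sub hY.stronglyMeasurable _ _)
      (hY.map_stieltjesSum_sub_reverse hcd hd hcd hd π π')).le

end StieltjesTransfer

/-! ### Additivity of Stieltjes integrals and continuity in the end point -/

section StieltjesAdditivity

open TaggedPartition

variable {Ω : Type*} {mΩ : MeasurableSpace Ω} {P : Measure Ω}
  {H : Type*} [NormedAddCommGroup H] [InnerProductSpace ℝ H]
  {U : Type*} [NormedAddCommGroup U] [InnerProductSpace ℝ U]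
  {Y : ℝ≥0 → Ω → U} {Φ Φ' : ℝ≥0 → U →L[ℝ] H} {c d : ℝ≥0} {I I' : Ω → H}

lemma tendstoInMeasure_zero_of_norm_le {E V κ : Type*} [NormedAddCommGroup E]
    [NormedAddCommGroup V] {l : Filter κ} {f : κ → Ω → E} {g h : κ → Ω → V} {M : ℝ} (hM : 0 ≤ M)
    (hf : ∀ i ω, ‖f i ω‖ ≤ M * (‖g i ω‖ + ‖h i ω‖)) (hg : TendstoInMeasure P g l 0)
    (hh : TendstoInMeasure P h l 0) : TendstoInMeasure P f l 0 := by
  rw [tendstoInMeasure_iff_norm] at *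
  intro ε hε
  -- Adding 1 to M allows M = 0 and makes the final inequality strict.
  have hδ : 0 < ε / (2 * (M + 1)) := by positivity
  have := (hg _ hδ).add (hh _ hδ)
  rw [add_zero] at this
  refine tendsto_of_tendsto_of_tendsto_of_le_of_le tendsto_const_nhds this
    (fun _ => zero_le) fun i => (measure_mono ?_).trans (measure_union_le _ _)
  intro ω hω
  by_contra hc
  simp only [mem_union, not_or, mem_ofPred_eq, not_le, Pi.zero_apply, sub_zero] at hc hω
  have h1 : ‖f i ω‖ ≤ M * (ε / (2 * (M + 1)) + ε / (2 * (M + 1))) :=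
    (hf i ω).trans (mul_le_mul_of_nonneg_left (add_le_add hc.1.le hc.2.le) hM)
  have h2 : M * (ε / (2 * (M + 1)) + ε / (2 * (M + 1))) < ε := by
    have : M * (ε / (2 * (M + 1)) + ε / (2 * (M + 1))) = ε * (M / (M + 1)) := by
      field_simp; ring
    rw [this]
    have : M / (M + 1) < 1 := by rw [div_lt_one (by positivity)]; linarith
    nlinarith
  linarith

/-- A partition crosses an intermediate point in at most one interval. -/
lemma TaggedPartition.exists_crossing {m : ℝ≥0} (hcm : c ≤ m) (hmd : m ≤ d)
    (π : TaggedPartition c d) :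
    π.n = 0 ∨ ∃ k < π.n, π.pt k ≤ m ∧ m ≤ π.pt (k + 1) := by
  by_cases hn : π.n = 0
  · exact Or.inl hn
  right
  by_contra! hcon
  have hall : ∀ k, k < π.n → π.pt k ≤ m := by
    intro k
    induction k with
    | zero => intro _; rw [π.pt_zero]; exact hcm
    | succ k ih => intro hk; exact (hcon k (by omega) (ih (by omega))).le
  have h1 := hcon (π.n - 1) (by omega) (hall _ (by omega))
  rw [Nat.sub_add_cancel (by omega), π.pt_n] at h1
  exact absurd hmd (not_le.2 h1)

/-- Cutting a partition at m changes only the cell that crosses m: there the increment is cut in two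
and the tag is clamped on each side. The error is thus an operator of norm at most 2M applied to
increments of Y that start or end at m. -/
lemma norm_stieltjesSum_sub_le {m : ℝ≥0} (hcm : c ≤ m) (hmd : m ≤ d) {M : ℝ}
    (hM : ∀ r, c ≤ r → r ≤ d → ‖Φ r‖ ≤ M) (π : TaggedPartition c d) :
    ∃ α β : ℝ≥0, α ≤ m ∧ m ≤ β ∧ m - α ≤ π.mesh ∧ β - m ≤ π.mesh ∧ ∀ ω,
      ‖stieltjesSum Φ Y π ω - (stieltjesSum Φ Y (left hcm hmd π) ω +
        stieltjesSum Φ Y (right hcm hmd π) ω)‖ ≤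
        2 * M * (‖Y α ω - Y m ω‖ + ‖Y β ω - Y m ω‖) := by
  rcases π.exists_crossing hcm hmd with hn | ⟨k, hk, hk1, hk2⟩
  · refine ⟨m, m, le_rfl, le_rfl, by simp, by simp, fun ω => ?_⟩
    simp [stieltjesSum, left, right, hn]
  refine ⟨π.pt k, π.pt (k + 1), hk1, hk2,
    (tsub_le_tsub_right hk2 _).trans (π.sub_le_mesh hk),
    (tsub_le_tsub_left hk1 _).trans (π.sub_le_mesh hk), fun ω => ?_⟩
  have hkt := π.tag_mem k
  have hct : c ≤ π.tag k := (π.le_pt k).trans hkt.1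
  have htd : π.tag k ≤ d := hkt.2.trans (π.pt_le hk)
  have hsum : stieltjesSum Φ Y π ω - (stieltjesSum Φ Y (left hcm hmd π) ω +
      stieltjesSum Φ Y (right hcm hmd π) ω) =
      (Φ (π.tag k) - Φ (min (π.tag k) m)) (Y m ω - Y (π.pt k) ω) +
      (Φ (π.tag k) - Φ (max (π.tag k) m)) (Y (π.pt (k + 1)) ω - Y m ω) := by
    unfold stieltjesSum
    change ∑ i ∈ Finset.range π.n, Φ (π.tag i) (Y (π.pt (i + 1)) ω - Y (π.pt i) ω) -
      (∑ i ∈ Finset.range π.n, Φ (min (π.tag i) m)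
        (Y (min (π.pt (i + 1)) m) ω - Y (min (π.pt i) m) ω) +
      ∑ i ∈ Finset.range π.n, Φ (max (π.tag i) m)
        (Y (max (π.pt (i + 1)) m) ω - Y (max (π.pt i) m) ω)) = _
    rw [← Finset.sum_add_distrib, ← Finset.sum_sub_distrib,
      Finset.sum_eq_single_of_mem k (Finset.mem_range.2 hk)]
    · rw [min_eq_right hk2, min_eq_left hk1, max_eq_left hk2, max_eq_right hk1]
      simp only [map_sub, sub_apply]
      abel
    · intro i hi hik
      rcases lt_or_gt_of_ne hik with h | h
      · have h1 : π.pt (i + 1) ≤ m := (π.mono h).trans hk1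
        have h0 : π.pt i ≤ m := (π.mono (Nat.le_succ i)).trans h1
        have ht : π.tag i ≤ m := (π.tag_mem i).2.trans h1
        simp [min_eq_left h1, min_eq_left h0, min_eq_left ht, max_eq_right h1, max_eq_right h0]
      · have h0 : m ≤ π.pt i := hk2.trans (π.mono h)
        have h1 : m ≤ π.pt (i + 1) := h0.trans (π.mono (Nat.le_succ i))
        have ht : m ≤ π.tag i := h0.trans (π.tag_mem i).1
        simp [min_eq_right h1, min_eq_right h0, max_eq_left h1, max_eq_left h0, max_eq_left ht]
  rw [hsum]
  have hb : ∀ r, c ≤ r → r ≤ d → ∀ x, ‖(Φ (π.tag k) - Φ r) x‖ ≤ 2 * M * ‖x‖ := by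
    intro r hr1 hr2 x
    refine (ContinuousLinearMap.le_opNorm _ _).trans ?_
    gcongr
    calc ‖Φ (π.tag k) - Φ r‖ ≤ ‖Φ (π.tag k)‖ + ‖Φ r‖ := norm_sub_le _ _
      _ ≤ M + M := add_le_add (hM _ hct htd) (hM _ hr1 hr2)
      _ = 2 * M := by ring
  calc _ ≤ _ := norm_add_le _ _
    _ ≤ 2 * M * ‖Y m ω - Y (π.pt k) ω‖ + 2 * M * ‖Y (π.pt (k + 1)) ω - Y m ω‖ :=
      add_le_add (hb _ (le_min hct hcm) ((min_le_left _ _).trans htd) _)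
        (hb _ (hct.trans (le_max_left _ _)) (max_le htd hmd) _)
    _ = _ := by rw [norm_sub_rev (Y m ω)]; ring

lemma tendsto_of_tsub_le {κ : Type*} {l : Filter κ} {α : κ → ℝ≥0} {δ : κ → ℝ≥0} {m : ℝ≥0}
    (h1 : ∀ i, m - α i ≤ δ i) (h2 : ∀ i, α i - m ≤ δ i) (hδ : Tendsto δ l (𝓝 0)) :
    Tendsto α l (𝓝 m) := by
  have hl : Tendsto (fun i => m - δ i) l (𝓝 m) := by
    have := hδ.const_sub m
    simpa using this
  have hu : Tendsto (fun i => m + δ i) l (𝓝 m) := by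
    have := hδ.const_add m
    simpa using this
  exact tendsto_of_tendsto_of_tendsto_of_le_of_le hl hu
    (fun i => tsub_le_iff_tsub_le.1 (h1 i)) (fun i => tsub_le_iff_left.1 (h2 i))

lemma tendstoInMeasure_sub_self {V κ : Type*} [NormedAddCommGroup V] {Y : ℝ≥0 → Ω → V} {m : ℝ≥0}
    (hY : TendstoInMeasure P Y (𝓝 m) (Y m)) {l : Filter κ} {α : κ → ℝ≥0}
    (hα : Tendsto α l (𝓝 m)) : TendstoInMeasure P (fun i ω => Y (α i) ω - Y m ω) l 0 := by
  have := tendstoInMeasure_sub (hY.comp hα) (tendstoInMeasure_const l (Y m))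
  rw [sub_self] at this
  exact this

/-- The crossing cell shrinks with the mesh, and its contribution vanishes by stochastic continuity
of Y at m and boundedness of the integrand. -/
lemma IsStieltjesIntegral.add {m : ℝ≥0} (hcm : c ≤ m) (hmd : m ≤ d) {M : ℝ} (hM0 : 0 ≤ M)
    (hM : ∀ r, c ≤ r → r ≤ d → ‖Φ r‖ ≤ M) (hY : TendstoInMeasure P Y (𝓝 m) (Y m))
    (h : IsStieltjesIntegral P Φ Y c m I) (h' : IsStieltjesIntegral P Φ Y m d I') :
    IsStieltjesIntegral P Φ Y c d (I + I') := by
  rw [isStieltjesIntegral_iff] at *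
  have h1 := tendstoInMeasure_add (h.comp (tendsto_left hcm hmd))
    (h'.comp (tendsto_right hcm hmd))
  choose α β hα hβ hα' hβ' hle using norm_stieltjesSum_sub_le (Y := Y) hcm hmd hM
  have hαt : Tendsto α (fine c d) (𝓝 m) := tendsto_of_tsub_le hα'
    (fun π => by rw [tsub_eq_zero_of_le (hα π)]; exact zero_le) tendsto_mesh
  have hβt : Tendsto β (fine c d) (𝓝 m) := tendsto_of_tsub_le
    (fun π => by rw [tsub_eq_zero_of_le (hβ π)]; exact zero_le) hβ' tendsto_mesh
  have h2 := tendstoInMeasure_zero_of_norm_le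
    (f := fun π => stieltjesSum Φ Y π - (stieltjesSum Φ Y (left hcm hmd π) +
      stieltjesSum Φ Y (right hcm hmd π)))
    (mul_nonneg zero_le_two hM0) hle (tendstoInMeasure_sub_self hY hαt)
    (tendstoInMeasure_sub_self hY hβt)
  have h3 := tendstoInMeasure_add h1 h2
  rw [add_zero] at h3
  refine h3.congr_left fun π => Eventually.of_forall fun ω => ?_
  simp

/-- The Stieltjes integral is left-continuous in the upper end point. -/
lemma IsStieltjesIntegral.tendstoInMeasure_endpoint [IsProbabilityMeasure P] {s : ℝ≥0}
    (hYm : ∀ t, StronglyMeasurable (Y t)) (hY : TendstoInMeasure P Y (𝓝 s) (Y s))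
    {J : ℝ≥0 → Ω → H} (hJ : ∀ d < s, IsStieltjesIntegral P Φ Y 0 d (J d))
    (h : IsStieltjesIntegral P Φ Y 0 s I) : TendstoInMeasure P J (𝓝[<] s) I := by
  intro ε hε
  refine tendsto_of_seq_tendsto fun ns hns => ?_
  revert ε hε
  change TendstoInMeasure P (fun k => J (ns k)) atTop I
  obtain ⟨N, hN⟩ := eventually_atTop.1 (hns.eventually self_mem_nhdsWithin)
  suffices h : TendstoInMeasure P (fun k => J (ns (k + N))) atTop I by
    intro ε hε
    exact (tendsto_add_atTop_iff_nat N).1 (h ε hε)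
  set ds : ℕ → ℝ≥0 := fun k => ns (k + N)
  have hds : ∀ k, ds k < s := fun k => hN _ (by omega)
  have hdt : Tendsto ds atTop (𝓝 s) :=
    (tendsto_nhds_of_tendsto_nhdsWithin hns).comp (tendsto_add_atTop_nat N)
  have hJm : ∀ k, AEStronglyMeasurable (J (ds k)) P := fun k =>
    (hJ _ (hds k)).aestronglyMeasurable hYm (zero_le)
  -- A fine partition of [0, d_k] whose sum nearly equals `J (ds k)`. Appending the single cell from
  -- d_k to s gives fine partitions of [0, s], whose sums converge to I.
  have hsel : ∀ k : ℕ, ∃ π : TaggedPartition 0 (ds k), π.mesh ≤ 1 / (k + 1 : ℝ≥0) ∧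
      probNorm P (stieltjesSum Φ Y π - J (ds k)) ≤ (2⁻¹ : ℝ≥0∞) ^ k := by
    intro k
    have hne := fine_neBot (show 0 ≤ ds k from zero_le)
    have h1 := isStieltjesIntegral_iff.1 (hJ _ (hds k))
    rw [tendstoInMeasure_iff_probNorm (Eventually.of_forall fun π =>
      (stronglyMeasurable_stieltjesSum hYm π).aestronglyMeasurable.sub (hJm k)),
      ENNReal.tendsto_nhds_zero] at h1
    have h2 : ∀ᶠ π in fine 0 (ds k), π.mesh ≤ 1 / (k + 1 : ℝ≥0) :=
      (tendsto_mesh.eventually (gt_mem_nhds (by positivity))).mono fun π hπ => le_of_lt hπ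
    exact (h2.and (h1 _ (ENNReal.pow_pos (by simp) k))).exists
  choose π hπ1 hπ2 using hsel
  have ha : TendstoInMeasure P (fun k => stieltjesSum Φ Y (π k) - J (ds k)) atTop 0 := by
    rw [tendstoInMeasure_iff_probNorm (Eventually.of_forall fun k => by
      rw [sub_zero]
      exact (stronglyMeasurable_stieltjesSum hYm _).aestronglyMeasurable.sub (hJm k))]
    simp only [sub_zero]
    exact tendsto_of_tendsto_of_tendsto_of_le_of_le tendsto_const_nhds
      (ENNReal.tendsto_pow_atTop_nhds_zero_of_lt_one (by simp)) (fun _ => zero_le) hπ2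
  have hmesh : Tendsto (fun k => (snoc (hds k).le (π k)).mesh) atTop (𝓝 0) := by
    have h1 : Tendsto (fun k : ℕ => 1 / (k + 1 : ℝ≥0) + (s - ds k)) atTop (𝓝 0) := by
      have h2 : Tendsto (fun k => s - ds k) atTop (𝓝 0) := by
        have := hdt.const_sub s
        simpa using this
      have h3 : Tendsto (fun k : ℕ => 1 / (k + 1 : ℝ≥0)) atTop (𝓝 0) := by
        exact tendsto_one_div_add_atTop_nhds_zero_nat
      simpa using h3.add h2
    exact tendsto_of_tendsto_of_tendsto_of_le_of_le tendsto_const_nhds h1 (fun _ => zero_le)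
      fun k => (mesh_snoc_le _ _).trans (by gcongr; exact hπ1 k)
  have hb := h _ hmesh
  -- The contribution of the appended cell, whose tag is s, vanishes by stochastic continuity.
  have hc : TendstoInMeasure P (fun k ω => Φ s (Y (ds k) ω - Y s ω)) atTop 0 := by
    have := tendstoInMeasure_clm (Φ s) (tendstoInMeasure_sub_self hY hdt)
    refine this.congr_right (Eventually.of_forall fun ω => ?_)
    simp
  have hd := tendstoInMeasure_add (tendstoInMeasure_sub hb ha) hc
  rw [sub_zero, add_zero] at hd
  refine hd.congr_left fun k => Eventually.of_forall fun ω => ?_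
  have : stieltjesSum Φ Y (snoc (hds k).le (π k)) ω =
      stieltjesSum Φ Y (π k) ω + Φ s (Y s ω - Y (ds k) ω) := by
    simp only [stieltjesSum, snoc]
    rw [Finset.sum_range_succ]
    congr 1
    · refine Finset.sum_congr rfl fun i hi => ?_
      have hi' := Finset.mem_range.1 hi
      rw [if_pos hi', if_pos hi'.le, if_pos (Nat.succ_le_of_lt hi')]
    · simp [(π k).pt_n]
  simp only [Pi.add_apply, Pi.sub_apply, this, map_sub]
  abel

end StieltjesAdditivity

end LevySPDE

namespace LevySPDE

/-! ### The jump part of the stochastic convolution -/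

section JumpConvolution

open TaggedPartition

variable {Ω : Type*} {mΩ : MeasurableSpace Ω} {P : Measure Ω} [IsProbabilityMeasure P]
  {H : Type*} [NormedAddCommGroup H] [InnerProductSpace ℝ H] [CompleteSpace H]
  [SecondCountableTopology H] [MeasurableSpace H] [BorelSpace H]
  {U : Type*} [NormedAddCommGroup U] [InnerProductSpace ℝ U] [CompleteSpace U]
  [MeasurableSpace U] [BorelSpace U] {ℱ : Filtration ℝ≥0 mΩ} {Y : ℝ≥0 → Ω → U}
  {S : ℝ≥0 → H →L[ℝ] H} {K : ℝ≥0 → U →L[ℝ] H}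

lemma isStieltjesIntegral_self {Φ : ℝ≥0 → U →L[ℝ] H} {c : ℝ≥0} :
    IsStieltjesIntegral P Φ Y c c 0 := by
  rw [isStieltjesIntegral_iff]
  refine (tendstoInMeasure_const _ 0).congr_left fun π => Eventually.of_forall fun ω => ?_
  refine (Finset.sum_eq_zero fun i hi => ?_).symm
  have e1 : π.pt (i + 1) = c := le_antisymm (π.pt_le (Finset.mem_range.1 hi)) (π.le_pt _)
  have e2 : π.pt i = c := le_antisymm (π.pt_le (Finset.mem_range.1 hi).le) (π.le_pt _)
  rw [e1, e2, sub_self, map_zero]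

lemma IsJumpConvolution.ae_unique {t : ℝ≥0} {I I' : Ω → H} (h : IsJumpConvolution P K Y t I)
    (h' : IsJumpConvolution P K Y t I') : I =ᵐ[P] I' := by
  rcases (zero_le : 0 ≤ t).eq_or_lt with ht | ht
  · exact (h.1 ht.symm).trans (h'.1 ht.symm).symm
  · obtain ⟨J, hJ, hJt⟩ := h.2 ht
    obtain ⟨J', hJ', hJt'⟩ := h'.2 ht
    have hne : NeBot (𝓝[<] t) := nhdsLT_neBot_of_exists_lt ⟨0, ht⟩
    refine tendstoInMeasure_ae_unique hJt (hJt'.congr' ?_ EventuallyEq.rfl)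
    filter_upwards [self_mem_nhdsWithin] with d hd
    exact (hJ' d hd).ae_unique zero_le (hJ d hd)

/-- The hypothesis reaches only up to time 1. Since K(h + r) = S_h K(r) and the increments are
stationary, integrals over subintervals of (0, 1] can be shifted by h, and additivity glues them
together in steps of length 1/2. -/
lemma exists_isStieltjesIntegral (hY : IsLevyProcess Y ℱ P) (hS : IsC0Semigroup S)
    (hK : IsOrbit S K) (hI : ∀ t, 0 < t → t ≤ 1 → ∃ I, IsJumpIntegral P K Y t I) {c d : ℝ≥0}
    (hc : 0 < c) (hcd : c < d) : ∃ I, IsStieltjesIntegral P K Y c d I := by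
  have hle : ∀ {c d : ℝ≥0}, 0 < c → c < d → d ≤ 1 → ∃ I, IsStieltjesIntegral P K Y c d I := by
    intro c d hc hcd hd
    obtain ⟨I, J, hJ, -⟩ := hI d (hc.trans hcd) hd
    exact ⟨_, hJ c hc hcd⟩
  have hshift : ∀ {c d h : ℝ≥0}, 0 < c → c < d → d ≤ 1 →
      ∃ I, IsStieltjesIntegral P K Y (h + c) (h + d) I := by
    intro c d h hc hcd hd
    obtain ⟨I, hI⟩ := hle hc hcd hd
    obtain ⟨I', -, hI'⟩ := hY.exists_isStieltjesIntegral_shift h hcd.le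
      (Φ' := K) (Φ := fun r => (S h).comp (K r))
      (fun r hr _ => hK h r (hc.trans_le hr)) (hI.clm_comp (S h))
    exact ⟨I', hI'⟩
  have hind : ∀ n : ℕ, ∀ {c d : ℝ≥0}, 0 < c → c < d → d ≤ 1 + n / 2 →
      ∃ I, IsStieltjesIntegral P K Y c d I := by
    intro n
    induction n with
    | zero => intro c d hc hcd hd; exact hle hc hcd (by simpa using hd)
    | succ n ih =>
      intro c d hc hcd hd
      rcases le_or_gt d 1 with h1 | h1
      · exact hle hc hcd h1
      have hhalf : (1 / 2 : ℝ≥0) ≤ d := le_trans (by norm_num) h1.le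
      have e1 : d - 1 + 1 = d := tsub_add_cancel_of_le h1.le
      rcases lt_or_ge c (d - 1 / 2) with h2 | h2
      · have hm : 0 < d - 1 / 2 := hc.trans h2
        have hmd : d - 1 / 2 < d := tsub_lt_self (hc.trans hcd) (by norm_num)
        obtain ⟨I1, hI1⟩ := ih hc h2 (by
          rw [tsub_le_iff_right]
          refine hd.trans (le_of_eq ?_)
          push_cast
          ring)
        -- The last piece [d - 1/2, d] is the interval [1/2, 1] shifted by d - 1; the induction
        -- hypothesis covers the rest.
        obtain ⟨I2, hI2⟩ := hshift (c := 1 / 2) (d := 1) (h := d - 1) (by norm_num)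
          (by exact_mod_cast (by norm_num : (1 / 2 : ℝ≥0) < 1)) le_rfl
        have e2 : d - 1 + 1 / 2 = d - 1 / 2 := by
          rw [eq_tsub_iff_add_eq_of_le hhalf, add_assoc, add_halves, e1]
        rw [e1, e2] at hI2
        obtain ⟨M, hM0, hM⟩ := hK.exists_norm_le hS hc d
        exact ⟨_, hI1.add h2.le hmd.le hM0 hM (hY.stochContinuous _) hI2⟩
      -- Here the whole interval is shorter than 1, and it is a subinterval of (0, 1] shifted by d -
      -- 1.
      · have hdc : d - 1 < c := lt_of_lt_of_le (by
          rw [tsub_lt_iff_right h1.le, ← tsub_add_cancel_of_le hhalf]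
          calc d - 1 / 2 + 1 / 2 < d - 1 / 2 + (1/2) + (1 / 2) := by simp
            _ = d - 1 / 2 + 1 := by rw [add_assoc, add_halves]
            _ = _ := by rw [tsub_add_cancel_of_le hhalf]) h2
        have e3 : d - 1 + (c - (d - 1)) = c := add_tsub_cancel_of_le hdc.le
        have := hshift (c := c - (d - 1)) (d := 1) (h := d - 1) (tsub_pos_of_lt hdc)
          (by rw [tsub_lt_iff_left hdc.le, e1]; exact hcd) le_rfl
        rwa [e1, e3] at this
  obtain ⟨n, hn⟩ := exists_nat_ge (2 * d)
  refine hind n hc hcd ?_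
  calc d = (2 * d) / 2 := by field_simp
    _ ≤ n / 2 := by gcongr
    _ ≤ 1 + n / 2 := le_add_self

/-- For t > 1 the integral over [1, t] does not depend on the lower limit c and is added to the
limit as c ↓ 0 over [c, 1]. -/
lemma exists_isJumpIntegral (hY : IsLevyProcess Y ℱ P) (hS : IsC0Semigroup S)
    (hK : IsOrbit S K) (hI : ∀ t, 0 < t → t ≤ 1 → ∃ I, IsJumpIntegral P K Y t I) {t : ℝ≥0}
    (ht : 0 < t) : ∃ I, IsJumpIntegral P K Y t I := by
  classical
  rcases le_or_gt t 1 with h1 | h1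
  · exact hI t ht h1
  obtain ⟨I1, J, hJ, hJI⟩ := hI 1 one_pos le_rfl
  obtain ⟨I2, hI2⟩ := exists_isStieltjesIntegral hY hS hK hI one_pos h1
  have hex : ∀ c, ∃ I, 0 < c → c < t → IsStieltjesIntegral P K Y c t I := fun c => by
    by_cases h : 0 < c ∧ c < t
    · obtain ⟨I, hI⟩ := exists_isStieltjesIntegral hY hS hK hI h.1 h.2
      exact ⟨I, fun _ _ => hI⟩
    · exact ⟨0, fun h1 h2 => absurd ⟨h1, h2⟩ h⟩
  choose J' hJ' using hex
  refine ⟨I1 + I2, J', hJ', ?_⟩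
  refine (tendstoInMeasure_add hJI (tendstoInMeasure_const _ I2)).congr' ?_ EventuallyEq.rfl
  filter_upwards [self_mem_nhdsWithin, mem_nhdsWithin_of_mem_nhds (gt_mem_nhds one_pos)]
    with c hc hc1
  obtain ⟨M, hM0, hM⟩ := hK.exists_norm_le hS hc t
  exact ((hJ c hc hc1).add hc1.le h1.le hM0 hM (hY.stochContinuous _) hI2).ae_unique
    (hc1.le.trans h1.le) (hJ' c hc (hc1.trans h1))

lemma tendsto_tsub_nhdsLT {t : ℝ≥0} :
    Tendsto (fun d => t - d) (𝓝[<] t) (𝓝[>] 0) := by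
  refine tendsto_nhdsWithin_iff.2 ⟨?_, ?_⟩
  · have : Tendsto (fun d => t - d) (𝓝 t) (𝓝 (t - t)) := (continuous_sub_left t).tendsto t
    rw [tsub_self] at this
    exact this.mono_left nhdsWithin_le_nhds
  · filter_upwards [self_mem_nhdsWithin] with d hd
    exact tsub_pos_of_lt (mem_Iio.1 hd)

/-- Time reversal turns the jump integral into the jump convolution. -/
lemma IsJumpIntegral.exists_isJumpConvolution (hY : IsLevyProcess Y ℱ P) {t : ℝ≥0} (ht : 0 < t)
    {I : Ω → H} (h : IsJumpIntegral P K Y t I) :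
    ∃ I', StronglyMeasurable I' ∧ IsJumpConvolution P K Y t I' ∧ P.map I' = P.map I := by
  obtain ⟨J, hJ, hJI⟩ := h
  have hne : NeBot (𝓝[<] t) := nhdsLT_neBot_of_exists_lt ⟨0, ht⟩
  have hpos : ∀ d, d < t → 0 < t - d ∧ (0 < d → t - d < t) := fun d hd =>
    ⟨tsub_pos_of_lt hd, fun h0 => tsub_lt_self ht h0⟩
  have hex : ∀ d, ∃ I', 0 < d → d < t →
      StronglyMeasurable I' ∧ IsStieltjesIntegral P (fun s => K (t - s)) Y 0 d I' := by
    intro d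
    by_cases h : 0 < d ∧ d < t
    · have h1 := hJ (t - d) (hpos d h.2).1 ((hpos d h.2).2 h.1)
      obtain ⟨I', hm, hI'⟩ := hY.exists_isStieltjesIntegral_reverse (t := t) tsub_le_self le_rfl h1
      rw [tsub_self, tsub_tsub_cancel_of_le h.2.le] at hI'
      exact ⟨I', fun _ _ => ⟨hm, hI'⟩⟩
    · exact ⟨0, fun h1 h2 => absurd ⟨h1, h2⟩ h⟩
  choose J' hJ' using hex
  have hpos' : ∀ᶠ d in 𝓝[<] t, 0 < d ∧ d < t := by
    filter_upwards [self_mem_nhdsWithin, mem_nhdsWithin_of_mem_nhds (lt_mem_nhds ht)] with d h1 h2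
    exact ⟨h2, h1⟩
  have hJm : ∀ c, 0 < c → c < t → AEStronglyMeasurable (J c) P := fun c h1 h2 =>
    (hJ c h1 h2).aestronglyMeasurable hY.stronglyMeasurable h2.le
  -- The sums for `J' d` and the reversed sums for `J (t - d)` are indexed by one and the same
  -- filter of partitions, so that their laws can be compared partition by partition. The truncated
  -- differences stay unsimplified to keep the types of the partitions equal.
  have hlim : ∀ d, 0 < d → d < t → ∃ (l : Filter (TaggedPartition (t - t) (t - (t - d)))),
      l = fine _ _ ∧ NeBot l ∧ TendstoInMeasure P (stieltjesSum (fun s => K (t - s)) Y) l (J' d) ∧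
      TendstoInMeasure P (fun π => stieltjesSum K Y (reverse tsub_le_self le_rfl π)) l
        (J (t - d)) := by
    intro d h0 hd
    refine ⟨fine _ _, rfl, fine_neBot (tsub_le_tsub_left tsub_le_self _), ?_, ?_⟩
    · have := (hJ' d h0 hd).2
      rw [← isStieltjesIntegral_iff, tsub_self, tsub_tsub_cancel_of_le hd.le]
      exact this
    · exact (isStieltjesIntegral_iff.1 (hJ _ (hpos d hd).1 ((hpos d hd).2 h0))).comp
        (tendsto_reverse _ _)
  have hsm : ∀ {c d : ℝ≥0} {Φ : ℝ≥0 → U →L[ℝ] H} (π : TaggedPartition c d),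
      AEStronglyMeasurable (stieltjesSum Φ Y π) P := fun π =>
    (stronglyMeasurable_stieltjesSum hY.stronglyMeasurable π).aestronglyMeasurable
  have hlaw1 : ∀ d, 0 < d → d < t → P.map (J' d) = P.map (J (t - d)) := by
    intro d h0 hd
    obtain ⟨l, rfl, hl, h1, h2⟩ := hlim d h0 hd
    exact map_eq_of_tendstoInMeasure (Eventually.of_forall fun π => hsm _)
      (Eventually.of_forall fun π => hsm _) h1 h2
      (Eventually.of_forall fun π => hY.map_stieltjesSum_reverse _ _ π)
  -- Equality in law of single integrals would not suffice: the Cauchy property of `J'` as d ↑ t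
  -- needs the laws of differences, reached along the product of the two partition filters.
  have hlaw2 : ∀ d d', 0 < d → d < t → 0 < d' → d' < t →
      P.map (J' d - J' d') = P.map (J (t - d) - J (t - d')) := by
    intro d d' h0 hd h0' hd'
    obtain ⟨l, rfl, hl, h1, h2⟩ := hlim d h0 hd
    obtain ⟨l', rfl, hl', h1', h2'⟩ := hlim d' h0' hd'
    refine map_eq_of_tendstoInMeasure (l := fine _ _ ×ˢ fine _ _)
      (Eventually.of_forall fun π => (hsm _).sub (hsm _))
      (Eventually.of_forall fun π => (hsm _).sub (hsm _))
      (tendstoInMeasure_sub (h1.comp tendsto_fst) (h1'.comp tendsto_snd))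
      (tendstoInMeasure_sub (h2.comp tendsto_fst) (h2'.comp tendsto_snd))
      (Eventually.of_forall fun π => hY.map_stieltjesSum_sub_reverse _ _ _ _ π.1 π.2)
  have hIm : AEStronglyMeasurable I P := by
    refine aestronglyMeasurable_of_tendstoInMeasure ?_ (hJI.comp (tendsto_tsub_nhdsLT (t := t)))
    filter_upwards [hpos'] with d hd
    exact hJm _ (hpos d hd.2).1 ((hpos d hd.2).2 hd.1)
  obtain ⟨I', hI'm, hI'⟩ : ∃ g, StronglyMeasurable g ∧ TendstoInMeasure P J' (𝓝[<] t) g := by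
    refine exists_tendstoInMeasure_of_cauchy (hpos'.mono fun d hd =>
      (hJ' d hd.1 hd.2).1.aestronglyMeasurable) ?_
    have h1 : TendstoInMeasure P (fun d => J (t - d)) (𝓝[<] t) I :=
      hJI.comp (tendsto_tsub_nhdsLT (t := t))
    have hm : ∀ᶠ d in 𝓝[<] t, AEStronglyMeasurable (J (t - d)) P := by
      filter_upwards [hpos'] with d hd
      exact hJm _ (hpos d hd.2).1 ((hpos d hd.2).2 hd.1)
    rw [tendstoInMeasure_iff_probNorm (hm.mono fun d hd => hd.sub hIm)] at h1
    have h2 := (h1.comp tendsto_fst).add (h1.comp (tendsto_snd (f := 𝓝[<] t)))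
    rw [add_zero] at h2
    refine tendsto_of_tendsto_of_tendsto_of_le_of_le' tendsto_const_nhds h2
      (Eventually.of_forall fun _ => zero_le) ?_
    filter_upwards [hpos'.prod_mk hpos', hm.prod_mk hm] with q ⟨hq1, hq2⟩ ⟨hm1, hm2⟩
    rw [probNorm_eq_of_map_eq ((hJ' _ hq1.1 hq1.2).1.sub
      (hJ' _ hq2.1 hq2.2).1).measurable.aemeasurable (hm1.sub hm2).aemeasurable
      (hlaw2 _ _ hq1.1 hq1.2 hq2.1 hq2.2)]
    refine (probNorm_sub_le hm1 hIm).trans ?_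
    rw [probNorm_sub_comm I]
    rfl
  refine ⟨I', hI'm, ⟨fun h0 => absurd h0 ht.ne', fun _ => ?_⟩, ?_⟩
  · classical
    -- The definition asks for every d < t, including d = 0, where the integral over the degenerate
    -- interval is 0.
    refine ⟨fun d => if 0 < d then J' d else 0, fun d hd => ?_, ?_⟩
    · dsimp only
      split_ifs with h0
      · exact (hJ' d h0 hd).2
      · have h00 : d = 0 := le_antisymm (not_lt.1 h0) zero_le
        subst h00
        exact isStieltjesIntegral_self
    · refine hI'.congr' ?_ EventuallyEq.rfl
      filter_upwards [hpos'] with d hd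
      rw [if_pos hd.1]
  · refine map_eq_of_tendstoInMeasure (l := 𝓝[<] t) ?_ ?_ hI'
      (hJI.comp (tendsto_tsub_nhdsLT (t := t))) ?_
    · exact hpos'.mono fun d hd => (hJ' d hd.1 hd.2).1.aestronglyMeasurable
    · filter_upwards [hpos'] with d hd
      exact hJm _ (hpos d hd.2).1 ((hpos d hd.2).2 hd.1)
    · exact hpos'.mono fun d hd => hlaw1 d hd.1 hd.2

lemma IsJumpConvolution.aestronglyMeasurable (hY : IsLevyProcess Y ℱ P) {t : ℝ≥0} {I : Ω → H}
    (h : IsJumpConvolution P K Y t I) : AEStronglyMeasurable I P := by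
  rcases (zero_le : 0 ≤ t).eq_or_lt with ht | ht
  · exact aestronglyMeasurable_const.congr (h.1 ht.symm).symm
  · obtain ⟨J, hJ, hJI⟩ := h.2 ht
    have hne : NeBot (𝓝[<] t) := nhdsLT_neBot_of_exists_lt ⟨0, ht⟩
    refine aestronglyMeasurable_of_tendstoInMeasure ?_ hJI
    filter_upwards [self_mem_nhdsWithin] with d hd
    exact (hJ d hd).aestronglyMeasurable hY.stronglyMeasurable zero_le

/-- The jump convolution at time `s + h`, stopped before the end point, splits at time `s`. -/
lemma IsJumpConvolution.ae_eq_add (hY : IsLevyProcess Y ℱ P) (hS : IsC0Semigroup S)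
    (hK : IsOrbit S K) (hI : ∀ t, 0 < t → t ≤ 1 → ∃ I, IsJumpIntegral P K Y t I)
    {s h d : ℝ≥0} (hd : d < h) {I J J' : Ω → H} (hs : IsJumpConvolution P K Y s I)
    (hJ : IsStieltjesIntegral P (fun r => K (s + h - r)) Y s (s + d) J)
    (hJ' : IsStieltjesIntegral P (fun r => K (s + h - r)) Y 0 (s + d) J') :
    J' =ᵐ[P] (fun ω => S h (I ω)) + J := by
  have hh : 0 < h := lt_of_le_of_lt zero_le hd
  have hI1 : ∃ I1, IsStieltjesIntegral P (fun r => K (s + h - r)) Y 0 s I1 ∧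
      I1 =ᵐ[P] fun ω => S h (I ω) := by
    rcases (zero_le : 0 ≤ s).eq_or_lt with h0 | h0
    · subst h0
      refine ⟨0, isStieltjesIntegral_self, ?_⟩
      filter_upwards [hs.1 rfl] with ω hω
      simp [hω]
    · obtain ⟨I0, hI0⟩ := exists_isStieltjesIntegral hY hS hK hI (c := h) (d := s + h) hh
        (lt_add_of_pos_left h h0)
      obtain ⟨I1, -, hI1⟩ := hY.exists_isStieltjesIntegral_reverse (t := s + h)
        le_add_self le_rfl hI0
      rw [tsub_self, add_tsub_cancel_right] at hI1
      refine ⟨I1, hI1, ?_⟩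
      obtain ⟨L, hL, hLI⟩ := hs.2 h0
      have hne : NeBot (𝓝[<] s) := nhdsLT_neBot_of_exists_lt ⟨0, h0⟩
      have h1 := tendstoInMeasure_clm (S h) hLI
      -- The factorization K(s + h - r) = S_h K(s - r) needs r < s. The left side is regular up to r
      -- = s because h > 0, so its integral over [0, s] is the limit of those over [0, d], which
      -- agree with S_h applied to the integrals defining the convolution at s.
      have h2 := hI1.tendstoInMeasure_endpoint hY.stronglyMeasurable (hY.stochContinuous s)
        (J := fun d ω => S h (L d ω)) (fun r hr =>
          ((hL r hr).clm_comp (S h)).congr_integrand fun u _ hu => by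
            rw [← hK _ _ (tsub_pos_of_lt (hu.trans_lt hr)), add_comm s h,
              add_tsub_assoc_of_le (hu.trans hr.le)])
      exact tendstoInMeasure_ae_unique h2 h1
  obtain ⟨I1, hI1, hI1e⟩ := hI1
  -- Stopping at s + d with d < h keeps the arguments of K at least h - d > 0, away from the
  -- singularity.
  obtain ⟨M, hM0, hM⟩ := hK.exists_norm_le hS (tsub_pos_of_lt hd) (s + h)
  have hadd := hI1.add (M := M) zero_le le_self_add hM0 (fun r _ hr => hM _ (by
    refine le_trans ?_ (tsub_le_tsub_left hr _)
    rw [add_tsub_add_eq_tsub_left]) tsub_le_self) (hY.stochContinuous s) hJ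
  exact (hJ'.ae_unique zero_le hadd).trans (hI1e.add EventuallyEq.rfl)

/-- The jump convolution on `[0, h]` and the increment over `[s, s + h]` are limits of the same
sums of increments, up to a shift by `s`. -/
lemma exists_levySum_tendsto (hY : IsLevyProcess Y ℱ P) (hS : IsC0Semigroup S)
    (hK : IsOrbit S K) (hI : ∀ t, 0 < t → t ≤ 1 → ∃ I, IsJumpIntegral P K Y t I)
    {s h : ℝ≥0} {Is Ish Ih : Ω → H} (hs : IsJumpConvolution P K Y s Is)
    (hsh : IsJumpConvolution P K Y (s + h) Ish) (hh : IsJumpConvolution P K Y h Ih) :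
    ∃ (m : ℕ → ℕ) (A : ∀ n, Fin (m n) → U →L[ℝ] H) (a b : ∀ n, Fin (m n) → ℝ≥0),
      (∀ n j, a n j ≤ b n j) ∧
      TendstoInMeasure P (fun n => levySum (A n) (a n) (b n) Y) atTop Ih ∧
      TendstoInMeasure P (fun n => levySum (A n) (fun j => s + a n j) (fun j => s + b n j) Y) atTop
        (Ish - fun ω => S h (Is ω)) := by
  rcases (zero_le : 0 ≤ h).eq_or_lt with h0 | h0
  · subst h0
    refine ⟨fun _ => 0, fun _ => Fin.elim0, fun _ => Fin.elim0, fun _ => Fin.elim0,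
      fun _ j => j.elim0, ?_, ?_⟩
    · refine (tendstoInMeasure_const _ 0).congr (fun n => ?_) (hh.1 rfl).symm
      exact Eventually.of_forall fun ω => by simp [levySum]
    · rw [add_zero] at hsh
      refine (tendstoInMeasure_const _ 0).congr
        (fun n => Eventually.of_forall fun ω => by simp [levySum]) ?_
      filter_upwards [hsh.ae_unique hs] with ω hω
      simp [hω, hS.zero_apply]
  have hsh0 : 0 < s + h := add_pos_of_nonneg_of_pos zero_le h0
  obtain ⟨J, hJ, hJI⟩ := hh.2 h0
  obtain ⟨J', hJ', hJI'⟩ := hsh.2 hsh0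
  have hshift : ∀ d, ∃ L, d < h → IsStieltjesIntegral P (fun r => K (s + h - r)) Y (s + 0)
      (s + d) L := by
    intro d
    by_cases hd : d < h
    · obtain ⟨L, -, hL⟩ := hY.exists_isStieltjesIntegral_shift s (Φ := fun r => K (h - r))
        (Φ' := fun r => K (s + h - r)) zero_le
        (fun r _ _ => by simp only [add_tsub_add_eq_tsub_left]) (hJ d hd)
      exact ⟨L, fun _ => hL⟩
    · exact ⟨0, fun h => absurd h hd⟩
  choose L hL using hshift
  have hne : NeBot (𝓝[<] h) := nhdsLT_neBot_of_exists_lt ⟨0, h0⟩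
  -- Up to s + d, the convolution at s + h is the propagated past S_h I_s plus the integral over [s,
  -- s + d]; subtracting the past leaves `L d`.
  have hLI : TendstoInMeasure P L (𝓝[<] h) (Ish - fun ω => S h (Is ω)) := by
    have h1 : Tendsto (fun d => s + d) (𝓝[<] h) (𝓝[<] (s + h)) := by
      refine tendsto_nhdsWithin_iff.2 ⟨?_, ?_⟩
      · exact ((continuous_const_add s).tendsto h).mono_left nhdsWithin_le_nhds
      · filter_upwards [self_mem_nhdsWithin] with d hd
        exact add_lt_add_of_le_of_lt le_rfl (mem_Iio.1 hd)
    refine (tendstoInMeasure_sub (hJI'.comp h1)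
      (tendstoInMeasure_const _ (fun ω => S h (Is ω)))).congr' ?_ EventuallyEq.rfl
    filter_upwards [self_mem_nhdsWithin] with d hd
    have hd' : d < h := hd
    have hLd := hL d hd'
    rw [add_zero] at hLd
    have := hs.ae_eq_add hY hS hK hI hd' hLd (hJ' (s + d) (by gcongr))
    filter_upwards [this] with ω hω
    simp [hω]
  have hIhm := hh.aestronglyMeasurable hY
  have hIm : AEStronglyMeasurable (Ish - fun ω => S h (Is ω)) P :=
    (hsh.aestronglyMeasurable hY).sub
      ((S h).continuous.comp_aestronglyMeasurable (hs.aestronglyMeasurable hY))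
  have hsm : ∀ {c d : ℝ≥0} {Φ : ℝ≥0 → U →L[ℝ] H} (π : TaggedPartition c d),
      AEStronglyMeasurable (stieltjesSum Φ Y π) P := fun π =>
    (stronglyMeasurable_stieltjesSum hY.stronglyMeasurable π).aestronglyMeasurable
  have hJm : ∀ d, d < h → AEStronglyMeasurable (J d) P := fun d hd =>
    (hJ d hd).aestronglyMeasurable hY.stronglyMeasurable zero_le
  have hLm : ∀ d, d < h → AEStronglyMeasurable (L d) P := fun d hd =>
    (hL d hd).aestronglyMeasurable hY.stronglyMeasurable (by gcongr; exact zero_le)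
  -- First d is chosen close to h for both limits, then one partition of [s, s + d] such that its
  -- own sum is close to `L d` and the sum of its translate is close to `J d`. The same partition
  -- must serve both sides.
  have hsel : ∀ n : ℕ, ∃ (d : ℝ≥0) (π : TaggedPartition (s + 0) (s + d)),
      probNorm P (stieltjesSum (fun r => K (h - r)) Y (shift s π) - Ih) ≤
        (2⁻¹ : ℝ≥0∞) ^ n + (2⁻¹ : ℝ≥0∞) ^ n ∧
      probNorm P (stieltjesSum (fun r => K (s + h - r)) Y π - (Ish - fun ω => S h (Is ω))) ≤
        (2⁻¹ : ℝ≥0∞) ^ n + (2⁻¹ : ℝ≥0∞) ^ n := by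
    intro n
    have hpos : (0 : ℝ≥0∞) < (2⁻¹ : ℝ≥0∞) ^ n := ENNReal.pow_pos (by simp) n
    have hlt : ∀ᶠ d in 𝓝[<] h, d < h := self_mem_nhdsWithin
    have h1 := hJI
    rw [tendstoInMeasure_iff_probNorm (hlt.mono fun d hd => (hJm d hd).sub hIhm),
      ENNReal.tendsto_nhds_zero] at h1
    have h2 := hLI
    rw [tendstoInMeasure_iff_probNorm (hlt.mono fun d hd => (hLm d hd).sub hIm),
      ENNReal.tendsto_nhds_zero] at h2
    obtain ⟨d, ⟨hd, hd1⟩, hd2⟩ := ((hlt.and (h1 _ hpos)).and (h2 _ hpos)).exists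
    have hnf : NeBot (fine (s + 0) (s + d)) := fine_neBot (by gcongr; exact zero_le)
    have h3 : TendstoInMeasure P (fun π => stieltjesSum (fun r => K (h - r)) Y (shift s π))
        (fine (s + 0) (s + d)) (J d) :=
      (isStieltjesIntegral_iff.1 (hJ d hd)).comp (tendsto_shift s)
    rw [tendstoInMeasure_iff_probNorm (Eventually.of_forall fun π => (hsm _).sub (hJm d hd)),
      ENNReal.tendsto_nhds_zero] at h3
    have h4 := isStieltjesIntegral_iff.1 (hL d hd)
    rw [tendstoInMeasure_iff_probNorm (Eventually.of_forall fun π => (hsm _).sub (hLm d hd)),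
      ENNReal.tendsto_nhds_zero] at h4
    obtain ⟨π, hπ1, hπ2⟩ := ((h3 _ hpos).and (h4 _ hpos)).exists
    exact ⟨d, π, (probNorm_sub_le (hsm _) (hJm d hd)).trans (add_le_add hπ1 hd1),
      (probNorm_sub_le (hsm _) (hLm d hd)).trans (add_le_add hπ2 hd2)⟩
  choose d π hπ1 hπ2 using hsel
  have hz : Tendsto (fun n : ℕ => (2⁻¹ : ℝ≥0∞) ^ n + (2⁻¹ : ℝ≥0∞) ^ n) atTop (𝓝 0) := by
    have := ENNReal.tendsto_pow_atTop_nhds_zero_of_lt_one (r := 2⁻¹) (by simp)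
    simpa using this.add this
  refine ⟨fun n => (π n).n, fun n i => K (s + h - (π n).tag i), fun n i => (shift s (π n)).pt i,
    fun n i => (shift s (π n)).pt (i + 1), fun n j => (shift s (π n)).mono (Nat.le_succ _), ?_, ?_⟩
  · simp_rw [← stieltjesSum_shift s (Φ := fun r => K (h - r)) (Φ' := fun r => K (s + h - r))
      (fun r _ _ => by simp only [add_tsub_add_eq_tsub_left])]
    rw [tendstoInMeasure_iff_probNorm (Eventually.of_forall fun n => (hsm _).sub hIhm)]
    exact tendsto_of_tendsto_of_tendsto_of_le_of_le tendsto_const_nhds hz (fun _ => zero_le) hπ1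
  · simp_rw [← stieltjesSum_eq_levySum_shift s (Φ' := fun r => K (s + h - r))]
    rw [tendstoInMeasure_iff_probNorm (Eventually.of_forall fun n => (hsm _).sub hIm)]
    exact tendsto_of_tendsto_of_tendsto_of_le_of_le tendsto_const_nhds hz (fun _ => zero_le) hπ2

end JumpConvolution

end LevySPDE

namespace LevySPDE

/-! ### Finite sums of Wiener increments -/

section WienerIncrements

variable {Ω : Type*} {mΩ : MeasurableSpace Ω} {P : Measure Ω} {ℱ : Filtration ℝ≥0 mΩ}
  {H : Type*} [NormedAddCommGroup H] [InnerProductSpace ℝ H] {W : ℝ≥0 → H → Ω → ℝ}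

lemma IsCylindricalWiener.hasCylindricalIncrements (h : IsCylindricalWiener W ℱ P) :
    HasCylindricalIncrements W ℱ P fun r q => charFun (gaussianReal 0 (r * ‖q‖₊ ^ 2)) 1 where
  meas := h.adapted
  add t q q' := by
    filter_upwards [h.linear t 1 q q'] with ω hω
    simpa using hω
  indep := h.indep
  char s t q hst := by
    have hW : ∀ t, Measurable (W t q) := fun t => (h.adapted t q).mono (ℱ.le t) le_rfl
    have hmW : Measurable fun ω => W t q ω - W s q ω := (hW t).sub (hW s)
    rw [← h.gaussian s t q hst, charFun_apply_real,
      integral_map hmW.aemeasurable (by fun_prop)]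
    simp

lemma lintegral_cells {r : ℕ → ℝ≥0} (hr : Monotone r) (N : ℕ) (f : ℝ → ℝ≥0∞) (c : ℕ → ℝ≥0∞)
    (hf : ∀ k < N, ∀ s : ℝ, (r k : ℝ) < s → s ≤ r (k + 1) → f s = c k) :
    ∫⁻ s in Ioc (r 0 : ℝ) (r N), f s = ∑ k ∈ Finset.range N, (r (k + 1) - r k : ℝ≥0) * c k := by
  induction N with
  | zero => simp
  | succ N ih =>
    have h1 : Ioc (r 0 : ℝ) (r (N + 1)) = Ioc (r 0 : ℝ) (r N) ∪ Ioc (r N : ℝ) (r (N + 1)) :=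
      (Ioc_union_Ioc_eq_Ioc (by exact_mod_cast hr (Nat.zero_le _))
        (by exact_mod_cast hr (Nat.le_succ _))).symm
    rw [h1, lintegral_union measurableSet_Ioc (Ioc_disjoint_Ioc_of_le le_rfl),
      ih (fun k hk => hf k (by omega)), Finset.sum_range_succ]
    congr 1
    rw [setLIntegral_congr_fun measurableSet_Ioc
      (fun s hs => hf N (by omega) s hs.1 hs.2), setLIntegral_const, Real.volume_Ioc, mul_comm,
      ← NNReal.coe_sub (hr (Nat.le_succ _)), ENNReal.ofReal_coe_nnreal]

/-- The value at time `s` of the step function with directions `q j` on `(a j, b j]`. -/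
noncomputable def stepSum {V J : Type*} [AddCommMonoid V] [Fintype J] (a b : J → ℝ≥0) (q : J → V)
    (s : ℝ≥0) : V := ∑ j, (Ioc (a j) (b j)).indicator (fun _ => q j) s

lemma measurable_stepSum {V J : Type*} [AddCommGroup V] [TopologicalSpace V]
    [IsTopologicalAddGroup V] [Fintype J]
    (a b : J → ℝ≥0) (q : J → V) : StronglyMeasurable (stepSum a b q) := by
  have : stepSum a b q = fun s => ∑ j, (Ioc (a j) (b j)).indicator (fun _ => q j) s := rfl
  rw [this]
  exact Finset.stronglyMeasurable_fun_sum _ fun j _ =>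
    stronglyMeasurable_const.indicator measurableSet_Ioc

/-- A finite sum of Wiener increments is Gaussian. -/
lemma IsCylindricalWiener.map_incrementSum [IsProbabilityMeasure P]
    (hW : IsCylindricalWiener W ℱ P) {J : Type*} [Fintype J] {a b : J → ℝ≥0}
    (hab : ∀ j, a j ≤ b j) {t : ℝ≥0} (hb : ∀ j, b j ≤ t) (q : J → H) :
    ∃ v : ℝ≥0, (v : ℝ≥0∞) = ∫⁻ s in Ioc (0 : ℝ) t, ‖stepSum a b q s.toNNReal‖ₑ ^ 2 ∧
      P.map (incrementSum W a b q) = gaussianReal 0 v := by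
  have hX := hW.hasCylindricalIncrements
  obtain ⟨r₀, N₀, p₀, q₀, hr₀, -, hrt₀, hra₀, hrb₀, hpq₀, hqN₀⟩ :=
    exists_grid (s := 0) (t := t) bot_le hab (fun _ => bot_le) hb
  -- extend the grid so that it runs from `0` to `t`
  obtain ⟨r, N, p, q', hr, hr0, hrN, hra, hrb, hpq, hqN⟩ : ∃ (r : ℕ → ℝ≥0) (N : ℕ) (p q' : J → ℕ),
      Monotone r ∧ r 0 = 0 ∧ r N = t ∧ (∀ j, r (p j) = a j) ∧ (∀ j, r (q' j) = b j) ∧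
      (∀ j, p j ≤ q' j) ∧ ∀ j, q' j ≤ N := by
    -- The points 0 and t are added at the two ends, which shifts the old indices by one.
    refine ⟨fun k => if k = 0 then 0 else if k ≤ N₀ + 1 then r₀ (k - 1) else t, N₀ + 2,
      fun j => p₀ j + 1, fun j => q₀ j + 1, ?_, by simp, by simp, ?_, ?_, ?_, ?_⟩
    · refine monotone_nat_of_le_succ fun k => ?_
      rcases Nat.eq_zero_or_pos k with rfl | hk
      · simp
      · have h1 : k ≠ 0 := by omega
        have h2 : k + 1 ≠ 0 := by omega
        simp only [h1, h2, if_false]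
        by_cases h3 : k + 1 ≤ N₀ + 1
        · have h4 : k ≤ N₀ + 1 := by omega
          simp only [h3, h4, if_true]
          exact hr₀ (by omega)
        · simp only [h3, if_false]
          split_ifs
          · exact hrt₀ _
          · exact le_rfl
    · intro j
      have := hqN₀ j
      have := hpq₀ j
      have h4 : p₀ j ≤ N₀ := by omega
      simp [h4, hra₀]
    · intro j
      have h4 := hqN₀ j
      simp [h4, hrb₀]
    · intro j; have := hpq₀ j; dsimp only; omega
    · intro j; have := hqN₀ j; dsimp only; omega
  set v : ℝ≥0 := ∑ k ∈ Finset.range N, (r (k + 1) - r k) * ‖HasCylindricalIncrements.cellSum p q' q k‖₊ ^ 2 with hv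
  refine ⟨v, ?_, ?_⟩
  · have := lintegral_cells hr N (fun s => ‖stepSum a b q s.toNNReal‖ₑ ^ 2)
      (fun k => ‖HasCylindricalIncrements.cellSum p q' q k‖ₑ ^ 2) (fun k hk s hs1 hs2 => ?_)
    · rw [hr0, hrN] at this
      rw [show Ioc (0 : ℝ) t = Ioc ((0 : ℝ≥0) : ℝ) t by simp, this, hv]
      push_cast
      rfl
    · have hs0 : 0 ≤ s := (NNReal.coe_nonneg _).trans hs1.le
      lift s to ℝ≥0 using hs0
      rw [Real.toNNReal_coe]
      have hs1' : r k < s := by exact_mod_cast hs1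
      have hs2' : s ≤ r (k + 1) := by exact_mod_cast hs2
      -- On a cell the step function equals the total direction of the intervals containing that
      -- cell, because no end point of an interval lies inside a cell.
      have key : stepSum a b q s = HasCylindricalIncrements.cellSum p q' q k := ?_
      · rw [key]
      simp only [stepSum, HasCylindricalIncrements.cellSum]
      refine Finset.sum_congr rfl fun j _ => ?_
      rw [indicator_apply]
      refine if_congr ?_ rfl rfl
      rw [← hra, ← hrb, mem_Ioc, Finset.mem_Ico]
      constructor
      · rintro ⟨h1, h2⟩
        constructor
        · by_contra! hc
          exact absurd (hs2'.trans (hr hc)) (not_le.2 h1)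
        · by_contra! hc
          exact absurd (h2.trans (hr hc)) (not_le.2 hs1')
      · rintro ⟨h1, h2⟩
        exact ⟨(hr h1).trans_lt hs1', hs2'.trans (hr h2)⟩
  · have hm : ∀ q : J → H, Measurable (incrementSum W a b q) := fun q =>
      Finset.measurable_sum _ fun j _ => ((hW.adapted _ _).mono (ℱ.le _) le_rfl).sub
        ((hW.adapted _ _).mono (ℱ.le _) le_rfl)
    have : IsProbabilityMeasure (P.map (incrementSum W a b q)) :=
      Measure.isProbabilityMeasure_map (hm q).aemeasurable
    refine Measure.ext_of_charFun (funext fun l => ?_)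
    rw [charFun_gaussianReal, charFun_apply_real, integral_map (hm q).aemeasurable (by fun_prop)]
    -- Scaling all directions by l turns the characteristic function at l into the exponential
    -- moment that the grid formula computes.
    have hlin : ∀ᵐ ω ∂P, (l : ℂ) * (incrementSum W a b q ω : ℂ) =
        (incrementSum W a b (fun j => l • q j) ω : ℂ) := by
      have h0 : ∀ s (x : H), ∀ᵐ ω ∂P, W s (l • x) ω = l * W s x ω := by
        intro s x
        filter_upwards [hW.linear s l x 0, hX.zero_ae s] with ω h1 h2
        simp only [add_zero] at h1
        rw [h1, h2]
        simp
      have h1 := ae_all_iff.2 fun j => h0 (b j) (q j)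
      have h2 := ae_all_iff.2 fun j => h0 (a j) (q j)
      filter_upwards [h1, h2] with ω h1 h2
      simp only [incrementSum, h1, h2]
      push_cast
      rw [Finset.mul_sum]
      exact Finset.sum_congr rfl fun j _ => by ring
    rw [integral_congr_ae (hlin.mono fun ω h => by simp only [h] :
      (fun ω => Complex.exp ((l : ℂ) * (incrementSum W a b q ω : ℂ) * Complex.I)) =ᵐ[P] fun ω =>
        Complex.exp ((incrementSum W a b (fun j => l • q j) ω : ℂ) * Complex.I))]
    have key := hX.integral_mul_exp_grid hr hpq hqN (fun j => l • q j) (ξ := fun _ => 1)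
      measurable_const
    simp only [one_mul, integral_const, probReal_univ, one_smul, hra, hrb] at key
    rw [key]
    simp only [charFun_gaussianReal]
    rw [← Complex.exp_sum]
    congr 1
    have hc : ∀ k, HasCylindricalIncrements.cellSum p q' (fun j => l • q j) k = l • HasCylindricalIncrements.cellSum p q' q k := by
      intro k
      simp only [HasCylindricalIncrements.cellSum, Finset.smul_sum, smul_ite, smul_zero]
    simp only [hc, hv, nnnorm_smul]
    push_cast
    simp only [mul_zero, zero_mul, zero_sub, Finset.sum_mul, Finset.sum_div,
      Finset.sum_neg_distrib]
    congr 1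
    refine Finset.sum_congr rfl fun k _ => ?_
    have : ((‖l‖ : ℝ) : ℂ) ^ 2 = (l : ℂ) ^ 2 := by
      rw [← Complex.ofReal_pow, Real.norm_eq_abs, sq_abs, Complex.ofReal_pow]
    rw [mul_pow, this]
    ring

end WienerIncrements

end LevySPDE

namespace LevySPDE

/-! ### Gaussian moments -/

section GaussianMoments

lemma lintegral_enorm_sq_gaussianReal (v : ℝ≥0) :
    ∫⁻ x, ‖x‖ₑ ^ 2 ∂gaussianReal 0 v = v := by
  have h := ofReal_variance (memLp_id_gaussianReal (μ := 0) (v := v) 2)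
  rw [variance_id_gaussianReal, evariance] at h
  simpa [integral_id_gaussianReal] using h.symm

lemma gaussianReal_eq_map (v : ℝ≥0) :
    gaussianReal 0 v = (gaussianReal 0 1).map fun x : ℝ => (NNReal.sqrt v : ℝ) * x := by
  have := gaussianReal_map_const_mul (μ := 0) (v := 1) (NNReal.sqrt v : ℝ)
  rw [this]
  congr 1
  · simp
  · ext
    simp

/-- C is the q-th absolute moment of the standard Gaussian; a centred Gaussian of variance v is √v
times a standard one. -/
lemma exists_lintegral_rpow_gaussianReal {q : ℝ} (hq : 0 < q) :
    ∃ C : ℝ≥0∞, C ≠ ∞ ∧ ∀ v : ℝ≥0, ∫⁻ x, ‖x‖ₑ ^ q ∂gaussianReal 0 v = C * (v : ℝ≥0∞) ^ (q / 2) := by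
  refine ⟨∫⁻ x, ‖x‖ₑ ^ q ∂gaussianReal 0 1, ?_, fun v => ?_⟩
  · have h := memLp_id_gaussianReal (μ := 0) (v := 1) q.toNNReal
    have h2 := lintegral_rpow_enorm_lt_top_of_eLpNorm_lt_top (p := (q.toNNReal : ℝ≥0∞))
      (by simpa using hq) (by simp) h.2
    simpa [hq.le] using h2.ne
  · rw [gaussianReal_eq_map v, lintegral_map (by fun_prop) (by fun_prop)]
    simp only [enorm_mul]
    simp_rw [ENNReal.mul_rpow_of_nonneg _ _ hq.le]
    rw [lintegral_const_mul _ (by fun_prop), mul_comm]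
    congr 1
    have : ‖(NNReal.sqrt v : ℝ)‖ₑ = (v : ℝ≥0∞) ^ (1 / 2 : ℝ) := by
      rw [← ENNReal.coe_rpow_of_nonneg _ (by norm_num), ← NNReal.sqrt_eq_rpow]
      rw [enorm_eq_nnnorm, NNReal.nnnorm_eq]
    rw [this, ← ENNReal.rpow_mul]
    congr 1
    ring

/-- Minkowski's inequality for countable sums. -/
lemma lintegral_tsum_rpow_le {α ι : Type*} {mα : MeasurableSpace α} {μ : Measure α} [Countable ι]
    {r : ℝ} (hr : 1 ≤ r) {f : ι → α → ℝ≥0∞} (hf : ∀ i, AEMeasurable (f i) μ) :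
    ∫⁻ x, (∑' i, f i x) ^ r ∂μ ≤ (∑' i, (∫⁻ x, f i x ^ r ∂μ) ^ (1 / r)) ^ r := by
  have hr0 : 0 < r := one_pos.trans_le hr
  have hfin : ∀ s : Finset ι, (∫⁻ x, (∑ i ∈ s, f i x) ^ r ∂μ) ^ (1 / r) ≤
      ∑ i ∈ s, (∫⁻ x, f i x ^ r ∂μ) ^ (1 / r) := by
    classical
    intro s
    induction s using Finset.induction with
    | empty => simp [hr0]
    | insert i s hi ih =>
      simp only [Finset.sum_insert hi]
      refine (ENNReal.lintegral_Lp_add_le (hf i) (Finset.aemeasurable_fun_sum s fun i _ => hf i)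
        hr).trans ?_
      gcongr
  have h1 : ∀ x, (∑' i, f i x) ^ r = ⨆ s : Finset ι, (∑ i ∈ s, f i x) ^ r := by
    intro x
    rw [ENNReal.tsum_eq_iSup_sum]
    exact (ENNReal.orderIsoRpow r hr0).map_iSup _
  simp_rw [h1]
  rw [lintegral_iSup_directed
    (fun s => (Finset.aemeasurable_fun_sum s fun i _ => hf i).pow_const r)]
  · refine iSup_le fun s => ?_
    have h2 := ENNReal.rpow_le_rpow ((hfin s).trans (ENNReal.sum_le_tsum s)) hr0.le
    rwa [← ENNReal.rpow_mul, one_div_mul_cancel hr0.ne', ENNReal.rpow_one] at h2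
  · classical
    refine directed_of_isDirected_le fun s t hst x => ?_
    dsimp only
    gcongr

variable {H : Type*} [NormedAddCommGroup H] [InnerProductSpace ℝ H] [CompleteSpace H]

lemma enorm_sq_eq_tsum (x : H) : ‖x‖ₑ ^ 2 = ∑' e : hsIndex H, ‖⟪x, (e : H)⟫_ℝ‖ₑ ^ 2 := by
  have h := (hsBasis H).hasSum_inner_mul_inner x x
  have h2 : ∀ e : hsIndex H, ⟪x, hsBasis H e⟫_ℝ * ⟪hsBasis H e, x⟫_ℝ = ‖⟪x, (e : H)⟫_ℝ‖ ^ 2 := by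
    intro e
    rw [hsBasis_apply, real_inner_comm x, Real.norm_eq_abs, sq_abs, sq]
  simp only [h2] at h
  rw [real_inner_self_eq_norm_sq] at h
  rw [← ofReal_norm, ← ENNReal.ofReal_pow (norm_nonneg _), ← h.tsum_eq,
    ENNReal.ofReal_tsum_of_nonneg (fun _ => by positivity) h.summable]
  refine tsum_congr fun e => ?_
  rw [ENNReal.ofReal_pow (norm_nonneg _), ofReal_norm]

/-- Both sides are the double sum of the squared matrix entries. The adjoint form appears because
the coordinate of a Wiener integral along e has variance ∫ |Φ(s)* e|² ds. -/
lemma tsum_enorm_adjoint_sq (K : H →L[ℝ] H) :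
    ∑' e : hsIndex H, ‖ContinuousLinearMap.adjoint K (e : H)‖ₑ ^ 2 = hilbertSchmidtSq K := by
  unfold hilbertSchmidtSq
  rw [tsum_congr fun e : hsIndex H => enorm_sq_eq_tsum (ContinuousLinearMap.adjoint K (e : H)),
    tsum_congr fun e : hsIndex H => enorm_sq_eq_tsum (K (e : H)), ENNReal.tsum_comm]
  refine tsum_congr fun e => tsum_congr fun f => ?_
  rw [ContinuousLinearMap.adjoint_inner_left, real_inner_comm]

variable [TopologicalSpace.SeparableSpace H]
  {Ω : Type*} {mΩ : MeasurableSpace Ω} {P : Measure Ω} {Z : Ω → H} {v : hsIndex H → ℝ≥0}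

lemma lintegral_enorm_sq_of_gaussian (hZ : AEStronglyMeasurable Z P)
    (hv : ∀ e : hsIndex H, P.map (fun ω => ⟪Z ω, (e : H)⟫_ℝ) = gaussianReal 0 (v e)) :
    ∫⁻ ω, ‖Z ω‖ₑ ^ 2 ∂P = ∑' e, (v e : ℝ≥0∞) := by
  have : Countable (hsIndex H) := countable_hsIndex.to_subtype
  have hm : ∀ e : hsIndex H, AEMeasurable (fun ω => ⟪Z ω, (e : H)⟫_ℝ) P := fun e =>
    (hZ.inner aestronglyMeasurable_const).aemeasurable
  rw [lintegral_congr fun ω => enorm_sq_eq_tsum (Z ω),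
    lintegral_tsum fun e => (hm e).enorm.pow_const 2]
  refine tsum_congr fun e => ?_
  rw [← lintegral_enorm_sq_gaussianReal, ← hv e, lintegral_map' (by fun_prop) (hm e)]

/-- ‖Z‖^q is the power q/2 of the sum of the squared coordinates. Minkowski's inequality in L^{q/2},
available since q ≥ 2, reduces to single Gaussian coordinates; their joint law plays no role. -/
lemma exists_lintegral_rpow_le_of_gaussian {q : ℝ} (hq : 2 ≤ q) :
    ∃ C : ℝ≥0∞, C ≠ ∞ ∧ ∀ {Ω : Type*} {_ : MeasurableSpace Ω} {P : Measure Ω} {Z : Ω → H}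
      {v : hsIndex H → ℝ≥0}, AEStronglyMeasurable Z P →
      (∀ e : hsIndex H, P.map (fun ω => ⟪Z ω, (e : H)⟫_ℝ) = gaussianReal 0 (v e)) →
      ∫⁻ ω, ‖Z ω‖ₑ ^ q ∂P ≤ C * (∫⁻ ω, ‖Z ω‖ₑ ^ 2 ∂P) ^ (q / 2) := by
  have hq0 : 0 < q := by linarith
  obtain ⟨C, hC, hCv⟩ := exists_lintegral_rpow_gaussianReal hq0
  refine ⟨C, hC, fun {Ω _ P Z v} hZ hv => ?_⟩
  have : Countable (hsIndex H) := countable_hsIndex.to_subtype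
  have hm : ∀ e : hsIndex H, AEMeasurable (fun ω => ⟪Z ω, (e : H)⟫_ℝ) P := fun e =>
    (hZ.inner aestronglyMeasurable_const).aemeasurable
  have hsq : ∀ x : ℝ≥0∞, (x ^ 2) ^ (q / 2) = x ^ q := fun x => by
    rw [← ENNReal.rpow_natCast, ← ENNReal.rpow_mul]
    congr 1
    push_cast
    ring
  have h1 : ∀ ω, ‖Z ω‖ₑ ^ q = (∑' e : hsIndex H, ‖⟪Z ω, (e : H)⟫_ℝ‖ₑ ^ 2) ^ (q / 2) := fun ω => by
    rw [← enorm_sq_eq_tsum, hsq]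
  simp_rw [h1]
  refine (lintegral_tsum_rpow_le (by linarith) fun e => (hm e).enorm.pow_const 2).trans ?_
  have h2 : ∀ e : hsIndex H, (∫⁻ ω, (‖⟪Z ω, (e : H)⟫_ℝ‖ₑ ^ 2) ^ (q / 2) ∂P) ^ (1 / (q / 2)) =
      C ^ (1 / (q / 2)) * v e := by
    intro e
    simp_rw [hsq]
    rw [← lintegral_map' (f := fun x : ℝ => ‖x‖ₑ ^ q) (by fun_prop) (hm e), hv e, hCv,
      ENNReal.mul_rpow_of_nonneg _ _ (by positivity), ← ENNReal.rpow_mul,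
      mul_one_div_cancel (by positivity), ENNReal.rpow_one]
  simp_rw [h2]
  rw [ENNReal.tsum_mul_left, ENNReal.mul_rpow_of_nonneg _ _ (by positivity), ← ENNReal.rpow_mul,
    one_div_mul_cancel (by positivity), ENNReal.rpow_one, lintegral_enorm_sq_of_gaussian hZ hv]

end GaussianMoments

/-! ### Elementary stochastic integrals -/

section Elementary

variable {Ω : Type*} {mΩ : MeasurableSpace Ω} {P : Measure Ω} {ℱ : Filtration ℝ≥0 mΩ}
  {H : Type*} [NormedAddCommGroup H] [InnerProductSpace ℝ H] {W : ℝ≥0 → H → Ω → ℝ}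

namespace ElementaryIntegrand

lemma toFun_apply (φ : ElementaryIntegrand H) (s : ℝ≥0) (x : H) :
    φ.toFun s x = stepSum φ.a φ.b (fun i => ⟪φ.u i, x⟫_ℝ • φ.h i) s := by
  simp only [toFun, stepSum, sum_apply]
  refine Finset.sum_congr rfl fun i _ => ?_
  by_cases h : s ∈ Ioc (φ.a i) (φ.b i) <;> simp [h]

lemma measurable_toFun_apply (φ : ElementaryIntegrand H) (x : H) :
    StronglyMeasurable fun s => φ.toFun s x := by
  simp_rw [toFun_apply]
  exact measurable_stepSum _ _ _

lemma stronglyMeasurable_integral (hW : IsCylindricalWiener W ℱ P) (φ : ElementaryIntegrand H)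
    {t : ℝ≥0} (hb : ∀ i, φ.b i ≤ t) : StronglyMeasurable[ℱ t] (φ.integral W) := by
  unfold integral
  refine Finset.stronglyMeasurable_fun_sum _ fun i _ => ?_
  have h1 : Measurable[ℱ t] fun ω => W (φ.b i) (φ.u i) ω - W (φ.a i) (φ.u i) ω :=
    ((hW.adapted _ _).mono (ℱ.mono (hb i)) le_rfl).sub
      ((hW.adapted _ _).mono (ℱ.mono ((φ.le i).trans (hb i))) le_rfl)
  exact h1.stronglyMeasurable.smul_const (φ.h i)

lemma inner_integral_ae_eq (hW : IsCylindricalWiener W ℱ P) (φ : ElementaryIntegrand H) (v : H) :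
    (fun ω => ⟪φ.integral W ω, v⟫_ℝ) =ᵐ[P]
      incrementSum W φ.a φ.b (fun i => ⟪φ.h i, v⟫_ℝ • φ.u i) := by
  have h0 : ∀ s (c : ℝ) (x : H), ∀ᵐ ω ∂P, W s (c • x) ω = c * W s x ω := by
    intro s c x
    filter_upwards [hW.linear s c x 0, hW.hasCylindricalIncrements.zero_ae s] with ω h1 h2
    simp only [add_zero] at h1
    rw [h1, h2]
    simp
  filter_upwards [ae_all_iff.2 fun i => h0 (φ.b i) ⟪φ.h i, v⟫_ℝ (φ.u i),
    ae_all_iff.2 fun i => h0 (φ.a i) ⟪φ.h i, v⟫_ℝ (φ.u i)] with ω h1 h2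
  simp only [integral, incrementSum, h1, h2, sum_inner, real_inner_smul_left]
  exact Finset.sum_congr rfl fun i _ => by ring

lemma stepSum_eq_adjoint [CompleteSpace H] (φ : ElementaryIntegrand H) (s : ℝ≥0) (v : H) :
    stepSum φ.a φ.b (fun i => ⟪φ.h i, v⟫_ℝ • φ.u i) s =
      ContinuousLinearMap.adjoint (φ.toFun s) v := by
  refine ext_inner_right ℝ fun x => ?_
  rw [ContinuousLinearMap.adjoint_inner_left, toFun_apply]
  simp only [stepSum, sum_inner, inner_sum]
  refine Finset.sum_congr rfl fun i _ => ?_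
  by_cases h : s ∈ Ioc (φ.a i) (φ.b i)
  · simp only [h, indicator_of_mem, real_inner_smul_left, real_inner_smul_right]
    rw [real_inner_comm v]
    ring
  · simp [h]

variable [CompleteSpace H] [TopologicalSpace.SeparableSpace H] [IsProbabilityMeasure P]

/-- Each coordinate is a real sum of Wiener increments, hence Gaussian, and its variance is the
integral of the squared norm of the adjoint applied to e. Summing over the basis yields the
Hilbert-Schmidt integral. -/
lemma exists_map_inner_integral (hW : IsCylindricalWiener W ℱ P) (φ : ElementaryIntegrand H)
    {t : ℝ≥0} (hb : ∀ i, φ.b i ≤ t) : ∃ v : hsIndex H → ℝ≥0,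
    (∀ e : hsIndex H, P.map (fun ω => ⟪φ.integral W ω, (e : H)⟫_ℝ) = gaussianReal 0 (v e)) ∧
    ∑' e, (v e : ℝ≥0∞) = ∫⁻ s in Ioc (0 : ℝ) t, hilbertSchmidtSq (φ.toFun s.toNNReal) := by
  have : Countable (hsIndex H) := countable_hsIndex.to_subtype
  choose v hv hv' using fun e : hsIndex H =>
    hW.map_incrementSum φ.le hb (fun i => ⟪φ.h i, (e : H)⟫_ℝ • φ.u i)
  refine ⟨v, fun e => ?_, ?_⟩
  · rw [← hv', Measure.map_congr (φ.inner_integral_ae_eq hW _)]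
  · simp_rw [hv]
    rw [← lintegral_tsum]
    · refine lintegral_congr fun s => ?_
      rw [← tsum_enorm_adjoint_sq]
      simp_rw [stepSum_eq_adjoint]
    · intro e
      have := (measurable_stepSum φ.a φ.b (fun i => ⟪φ.h i, (e : H)⟫_ℝ • φ.u i)).comp_measurable
        measurable_real_toNNReal
      exact (this.enorm.pow_const 2).aemeasurable

/-- The Itô isometry. -/
lemma lintegral_enorm_integral_sq (hW : IsCylindricalWiener W ℱ P) (φ : ElementaryIntegrand H)
    {t : ℝ≥0} (hb : ∀ i, φ.b i ≤ t) :
    ∫⁻ ω, ‖φ.integral W ω‖ₑ ^ 2 ∂P =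
      ∫⁻ s in Ioc (0 : ℝ) t, hilbertSchmidtSq (φ.toFun s.toNNReal) := by
  obtain ⟨v, hv, hvs⟩ := φ.exists_map_inner_integral hW hb
  rw [← hvs]
  exact lintegral_enorm_sq_of_gaussian
    ((φ.stronglyMeasurable_integral hW hb).mono (ℱ.le t)).aestronglyMeasurable hv

lemma exists_lintegral_integral_rpow_le (H : Type*) [NormedAddCommGroup H] [InnerProductSpace ℝ H]
    [CompleteSpace H] [TopologicalSpace.SeparableSpace H] {q : ℝ} (hq : 2 ≤ q) :
    ∃ C : ℝ≥0∞, C ≠ ∞ ∧ ∀ {W : ℝ≥0 → H → Ω → ℝ}, IsCylindricalWiener W ℱ P →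
      ∀ φ : ElementaryIntegrand H,
      ∫⁻ ω, ‖φ.integral W ω‖ₑ ^ q ∂P ≤ C * (∫⁻ ω, ‖φ.integral W ω‖ₑ ^ 2 ∂P) ^ (q / 2) := by
  obtain ⟨C, hC, h⟩ := exists_lintegral_rpow_le_of_gaussian (H := H) hq
  refine ⟨C, hC, fun {W} hW φ => ?_⟩
  have hb : ∀ i, φ.b i ≤ Finset.univ.sup φ.b := fun i => Finset.le_sup (Finset.mem_univ i)
  obtain ⟨v, hv, -⟩ := φ.exists_map_inner_integral hW hb
  exact h ((φ.stronglyMeasurable_integral hW hb).mono (ℱ.le _)).aestronglyMeasurable hv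

end ElementaryIntegrand

end Elementary

end LevySPDE

namespace LevySPDE

/-! ### Operations on elementary integrands -/

section Operations

variable {Ω : Type*} {H : Type*} [NormedAddCommGroup H] [InnerProductSpace ℝ H]
  {W : ℝ≥0 → H → Ω → ℝ}

namespace ElementaryIntegrand

/-- The elementary integrand indexed by an arbitrary finite type. -/
noncomputable def ofFintype {J : Type*} [Fintype J] (a b : J → ℝ≥0) (u h : J → H)
    (hab : ∀ j, a j ≤ b j) : ElementaryIntegrand H where
  n := Fintype.card J
  a i := a ((Fintype.equivFin J).symm i)
  b i := b ((Fintype.equivFin J).symm i)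
  u i := u ((Fintype.equivFin J).symm i)
  h i := h ((Fintype.equivFin J).symm i)
  le _ := hab _

section OfFintype

variable {J : Type*} [Fintype J] (a b : J → ℝ≥0) (u h : J → H) (hab : ∀ j, a j ≤ b j)

lemma ofFintype_toFun_apply (s : ℝ≥0) (x : H) :
    (ofFintype a b u h hab).toFun s x = stepSum a b (fun j => ⟪u j, x⟫_ℝ • h j) s := by
  rw [toFun_apply]
  exact Equiv.sum_comp (Fintype.equivFin J).symm
    fun j => (Ioc (a j) (b j)).indicator (fun _ => ⟪u j, x⟫_ℝ • h j) s

lemma ofFintype_integral (ω : Ω) :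
    (ofFintype a b u h hab).integral W ω = ∑ j, (W (b j) (u j) ω - W (a j) (u j) ω) • h j :=
  Equiv.sum_comp (Fintype.equivFin J).symm fun j => (W (b j) (u j) ω - W (a j) (u j) ω) • h j

lemma ofFintype_b_le {t : ℝ≥0} (hb : ∀ j, b j ≤ t) (i) : (ofFintype a b u h hab).b i ≤ t := hb _

end OfFintype

/-- The sum of two elementary integrands. -/
noncomputable def append (φ ψ : ElementaryIntegrand H) : ElementaryIntegrand H :=
  ofFintype (Sum.elim φ.a ψ.a) (Sum.elim φ.b ψ.b) (Sum.elim φ.u ψ.u) (Sum.elim φ.h ψ.h)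
    (by rintro (i | i); exacts [φ.le i, ψ.le i])

lemma append_toFun (φ ψ : ElementaryIntegrand H) (s : ℝ≥0) :
    (φ.append ψ).toFun s = φ.toFun s + ψ.toFun s := by
  ext x
  rw [append, ofFintype_toFun_apply, add_apply, toFun_apply, toFun_apply]
  simp [stepSum]

lemma append_integral (φ ψ : ElementaryIntegrand H) (ω : Ω) :
    (φ.append ψ).integral W ω = φ.integral W ω + ψ.integral W ω := by
  rw [append, ofFintype_integral]
  simp [integral]

lemma append_b_le {φ ψ : ElementaryIntegrand H} {t : ℝ≥0} (hφ : ∀ i, φ.b i ≤ t)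
    (hψ : ∀ i, ψ.b i ≤ t) : ∀ i, (φ.append ψ).b i ≤ t :=
  ofFintype_b_le _ _ _ _ _ (by rintro (i | i); exacts [hφ i, hψ i])

/-- The composition of an elementary integrand with a bounded operator. -/
noncomputable def clm (B : H →L[ℝ] H) (φ : ElementaryIntegrand H) : ElementaryIntegrand H where
  n := φ.n
  a := φ.a
  b := φ.b
  u := φ.u
  h i := B (φ.h i)
  le := φ.le

lemma clm_toFun (B : H →L[ℝ] H) (φ : ElementaryIntegrand H) (s : ℝ≥0) :
    (φ.clm B).toFun s = B.comp (φ.toFun s) := by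
  ext x
  rw [ContinuousLinearMap.comp_apply, toFun_apply, toFun_apply]
  simp only [stepSum, map_sum]
  refine Finset.sum_congr rfl fun i _ => ?_
  simp only [clm]
  by_cases h : s ∈ Ioc (φ.a i) (φ.b i) <;> simp [h]

lemma clm_integral (B : H →L[ℝ] H) (φ : ElementaryIntegrand H) (ω : Ω) :
    (φ.clm B).integral W ω = B (φ.integral W ω) := by
  simp only [integral, map_sum, map_smul]
  rfl

/-- The difference of two elementary integrands. -/
noncomputable def sub (φ ψ : ElementaryIntegrand H) : ElementaryIntegrand H :=
  φ.append (ψ.clm (-ContinuousLinearMap.id ℝ H))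

lemma sub_toFun (φ ψ : ElementaryIntegrand H) (s : ℝ≥0) :
    (φ.sub ψ).toFun s = φ.toFun s - ψ.toFun s := by
  ext x
  simp [sub, append_toFun, clm_toFun, sub_eq_add_neg]

lemma sub_integral (φ ψ : ElementaryIntegrand H) (ω : Ω) :
    (φ.sub ψ).integral W ω = φ.integral W ω - ψ.integral W ω := by
  simp [sub, append_integral, clm_integral, sub_eq_add_neg]

lemma sub_b_le {φ ψ : ElementaryIntegrand H} {t : ℝ≥0} (hφ : ∀ i, φ.b i ≤ t)
    (hψ : ∀ i, ψ.b i ≤ t) : ∀ i, (φ.sub ψ).b i ≤ t := append_b_le hφ hψ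

/-- The time shift of an elementary integrand. -/
def shift (s : ℝ≥0) (φ : ElementaryIntegrand H) : ElementaryIntegrand H where
  n := φ.n
  a i := s + φ.a i
  b i := s + φ.b i
  u := φ.u
  h := φ.h
  le i := add_le_add le_rfl (φ.le i)

lemma shift_toFun_add (s : ℝ≥0) (φ : ElementaryIntegrand H) (r : ℝ≥0) :
    (φ.shift s).toFun (s + r) = φ.toFun r := by
  ext x
  rw [toFun_apply, toFun_apply]
  simp only [stepSum, shift]
  refine Finset.sum_congr rfl fun i _ => ?_
  simp [indicator_apply]

lemma shift_toFun_of_le (s : ℝ≥0) (φ : ElementaryIntegrand H) {r : ℝ≥0} (hr : r ≤ s) :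
    (φ.shift s).toFun r = 0 := by
  ext x
  rw [toFun_apply]
  simp only [stepSum, shift]
  refine Finset.sum_eq_zero fun i _ => indicator_of_notMem (fun h => ?_) _
  exact absurd (lt_of_le_of_lt le_self_add h.1) (not_lt.2 hr)

lemma toFun_of_lt {φ : ElementaryIntegrand H} {t : ℝ≥0} (hb : ∀ i, φ.b i ≤ t) {r : ℝ≥0}
    (hr : t < r) : φ.toFun r = 0 := by
  ext x
  rw [toFun_apply]
  simp only [stepSum]
  refine Finset.sum_eq_zero fun i _ => indicator_of_notMem (fun h => ?_) _
  exact absurd (h.2.trans (hb i)) (not_le.2 hr)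

end ElementaryIntegrand

end Operations

/-! ### Approximation by elementary integrands -/

section Approximation

/-- A continuous square integrable function on `[0, t)` is approximated by step functions. -/
lemma exists_stepSum_approx {H : Type*} [NormedAddCommGroup H] {t : ℝ≥0} {f : ℝ≥0 → H}
    (hf : ContinuousOn f (Iio t)) (hfi : ∫⁻ s in Ioc (0 : ℝ) t, ‖f s.toNNReal‖ₑ ^ 2 < ∞)
    {ε : ℝ≥0∞} (hε : 0 < ε) :
    ∃ (N : ℕ) (a b : Fin N → ℝ≥0) (h : Fin N → H), (∀ j, a j ≤ b j) ∧ (∀ j, b j ≤ t) ∧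
      ∫⁻ s in Ioc (0 : ℝ) t, ‖f s.toNNReal - stepSum a b h s.toNNReal‖ₑ ^ 2 ≤ ε := by
  rcases eq_or_ne t 0 with rfl | ht
  · exact ⟨0, Fin.elim0, Fin.elim0, Fin.elim0, fun j => j.elim0, fun j => j.elim0, by simp⟩
  have ht' : 0 < t := pos_iff_ne_zero.2 ht
  -- the tail
  obtain ⟨d, hd0, hdt, hd⟩ : ∃ d : ℝ≥0, 0 < d ∧ d < t ∧
      ∫⁻ s in Ioc (d : ℝ) t, ‖f s.toNNReal‖ₑ ^ 2 ≤ ε / 2 := by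
    -- The function may blow up at t. Absolute continuity of the integral makes (d, t] negligible,
    -- and there the step function is 0; on [0, d] uniform continuity takes over.
    obtain ⟨δ, hδ, hδ'⟩ := exists_pos_setLIntegral_lt_of_measure_lt
      (μ := volume.restrict (Ioc (0 : ℝ) t)) hfi.ne (ENNReal.half_pos hε.ne').ne'
    obtain ⟨δ', hδ0, hδδ⟩ := ENNReal.lt_iff_exists_nnreal_btwn.1 hδ
    have hδ0' : 0 < δ' := by exact_mod_cast hδ0
    refine ⟨max (t - δ') (t / 2), lt_max_of_lt_right (half_pos ht'),
      max_lt (tsub_lt_self ht' hδ0') (half_lt_self ht'), ?_⟩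
    have h1 := hδ' (Ioc ((max (t - δ') (t / 2) : ℝ≥0) : ℝ) t) ?_
    · rw [Measure.restrict_restrict measurableSet_Ioc,
        inter_eq_self_of_subset_left (Ioc_subset_Ioc_left (NNReal.coe_nonneg _))] at h1
      exact h1.le
    · refine (Measure.restrict_apply_le _ _).trans_lt ?_
      rw [Real.volume_Ioc, ← NNReal.coe_sub (max_lt (tsub_lt_self ht' hδ0') (half_lt_self ht')).le,
        ENNReal.ofReal_coe_nnreal]
      refine lt_of_le_of_lt ?_ hδδ
      exact_mod_cast tsub_le_iff_left.2 (le_trans (le_tsub_add (b := t) (a := δ'))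
        (add_le_add_left (le_max_left _ _) _))
  -- the grid
  obtain ⟨η, hη, hηε⟩ : ∃ η : ℝ, 0 < η ∧ ENNReal.ofReal η ^ 2 * d ≤ ε / 2 := by
    have : Tendsto (fun η : ℝ => ENNReal.ofReal η ^ 2 * d) (𝓝[>] 0) (𝓝 0) := by
      have h2 : Continuous fun η : ℝ => ENNReal.ofReal η ^ 2 * (d : ℝ≥0∞) :=
        (ENNReal.continuous_mul_const (by simp)).comp
          ((ENNReal.continuous_pow 2).comp ENNReal.continuous_ofReal)
      have := h2.tendsto 0
      simp only [ENNReal.ofReal_zero, ne_eq, OfNat.ofNat_ne_zero, not_false_eq_true, zero_pow,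
        zero_mul] at this
      exact this.mono_left nhdsWithin_le_nhds
    obtain ⟨η, h1, h2⟩ := ((this.eventually_le_const (ENNReal.half_pos hε.ne')).and
      self_mem_nhdsWithin).exists
    exact ⟨η, h2, h1⟩
  have hK : IsCompact (Icc 0 d) := isCompact_Icc
  have huc := hK.uniformContinuousOn_of_continuous
    (hf.mono fun s hs => lt_of_le_of_lt hs.2 hdt)
  obtain ⟨δ, hδ, hδ'⟩ := Metric.uniformContinuousOn_iff.1 huc η hη
  obtain ⟨N, hN⟩ := exists_nat_gt ((d : ℝ) / δ)
  have hNpos : 0 < (N : ℝ) := lt_of_le_of_lt (by positivity) hN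
  have hN0 : 0 < N := by exact_mod_cast hNpos
  have hNn : (0 : ℝ≥0) < N := by exact_mod_cast hN0
  set r : ℕ → ℝ≥0 := fun k => k * (d / N) with hr
  have hrm : Monotone r := fun k l hkl => by
    simp only [hr]; gcongr
  have hrN : r N = d := by
    simp only [hr]; field_simp
  have hstep : ∀ k, (r (k + 1) : ℝ) - r k < δ := by
    intro k
    simp only [hr]
    push_cast
    have : (d : ℝ) / N < δ := by
      rw [div_lt_iff₀ hNpos]; rw [div_lt_iff₀ hδ] at hN; linarith
    nlinarith
  refine ⟨N, fun j => r j, fun j => r (j + 1), fun j => f (r j), fun j => hrm (Nat.le_succ _),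
    fun j => (hrm j.2).trans (hrN.le.trans hdt.le), ?_⟩
  have hcell : ∀ k < N, ∀ s : ℝ≥0, r k < s → s ≤ r (k + 1) →
      stepSum (fun j : Fin N => r j) (fun j => r (j + 1)) (fun j => f (r j)) s = f (r k) := by
    intro k hk s hs1 hs2
    rw [stepSum, Finset.sum_eq_single ⟨k, hk⟩]
    · simp [hs1, hs2]
    · intro j _ hj
      refine indicator_of_notMem (fun h => ?_) _
      have hjk : (j : ℕ) ≠ k := fun h => hj (Fin.ext h)
      rcases lt_or_gt_of_ne hjk with h' | h'
      · exact absurd (h.2.trans (hrm h')) (not_le.2 hs1)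
      · exact absurd (lt_of_le_of_lt (hrm h') h.1) (not_lt.2 hs2)
    · simp
  have hex : ∀ s : ℝ≥0, 0 < s → s ≤ d → ∃ k < N, r k < s ∧ s ≤ r (k + 1) := by
    intro s hs0 hsd
    have hP : ∃ k, s ≤ r k := ⟨N, hsd.trans hrN.ge⟩
    classical
    have hf0 : Nat.find hP ≠ 0 := by
      intro h
      have := Nat.find_spec hP
      rw [h] at this
      simp only [hr, Nat.cast_zero, zero_mul] at this
      exact absurd this (not_le.2 hs0)
    obtain ⟨k, hk⟩ := Nat.exists_eq_succ_of_ne_zero hf0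
    refine ⟨k, ?_, not_le.1 (Nat.find_min hP (by omega)), ?_⟩
    · have := Nat.find_min' hP (hsd.trans hrN.ge); omega
    · have := Nat.find_spec hP; rwa [hk] at this
  have hsplit : Ioc (0 : ℝ) t = Ioc (0 : ℝ) d ∪ Ioc (d : ℝ) t :=
    (Ioc_union_Ioc_eq_Ioc (NNReal.coe_nonneg d) (by exact_mod_cast hdt.le)).symm
  rw [hsplit]
  refine (lintegral_union_le _ _ _).trans ?_
  rw [← ENNReal.add_halves ε]
  refine add_le_add ?_ ?_
  · refine le_trans (setLIntegral_mono measurable_const (g := fun _ => ENNReal.ofReal η ^ 2)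
      fun s hs => ?_) ?_
    · have h0 : 0 < s.toNNReal := Real.toNNReal_pos.2 hs.1
      have h1 : s.toNNReal ≤ d := Real.toNNReal_le_iff_le_coe.2 hs.2
      obtain ⟨k, hk, hk1, hk2⟩ := hex _ h0 h1
      rw [hcell k hk _ hk1 hk2, ← ofReal_norm]
      gcongr
      rw [← dist_eq_norm]
      refine (hδ' _ ⟨zero_le, h1⟩ _ ⟨zero_le, hk1.le.trans h1⟩ ?_).le
      rw [NNReal.dist_eq, abs_of_nonneg (sub_nonneg.2 (by exact_mod_cast hk1.le))]
      have : (s.toNNReal : ℝ) ≤ r (k + 1) := by exact_mod_cast hk2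
      linarith [hstep k]
    · rw [setLIntegral_const]
      simpa using hηε
  · refine le_trans (le_of_eq (setLIntegral_congr_fun measurableSet_Ioc fun s hs => ?_)) hd
    have h1 : d < s.toNNReal := Real.lt_toNNReal_iff_coe_lt.2 hs.1
    have : stepSum (fun j : Fin N => r j) (fun j => r (j + 1)) (fun j => f (r j)) s.toNNReal
        = 0 := by
      refine Finset.sum_eq_zero fun j _ => indicator_of_notMem (fun h => ?_) _
      exact absurd (h.2.trans ((hrm j.2).trans hrN.le)) (not_le.2 h1)
    rw [this, sub_zero]

variable {H : Type*} [NormedAddCommGroup H] [InnerProductSpace ℝ H] [CompleteSpace H]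
  [TopologicalSpace.SeparableSpace H]

/-- The Hilbert-Schmidt integral is the sum over the basis of the integrals of |Φ(s) e|². Finitely
many e carry all but ε/2 of it, and each of these columns is a vector-valued function approximated
by step functions. -/
lemma ElementaryIntegrand.exists_approx {t : ℝ≥0} {Φ : ℝ≥0 → H →L[ℝ] H}
    (hΦ : ∀ x, ContinuousOn (fun s => Φ s x) (Iio t))
    (hi : ∫⁻ s in Ioc (0 : ℝ) t, hilbertSchmidtSq (Φ s.toNNReal) < ∞) {ε : ℝ≥0∞} (hε : 0 < ε) :
    ∃ φ : ElementaryIntegrand H, (∀ i, φ.b i ≤ t) ∧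
      ∫⁻ s in Ioc (0 : ℝ) t, hilbertSchmidtSq (Φ s.toNNReal - φ.toFun s.toNNReal) ≤ ε := by
  classical
  have : Countable (hsIndex H) := countable_hsIndex.to_subtype
  have hmeas : ∀ x, AEStronglyMeasurable (fun s : ℝ => Φ s.toNNReal x)
      (volume.restrict (Ioc (0 : ℝ) t)) := by
    intro x
    rw [← restrict_Ioo_eq_restrict_Ioc]
    refine ContinuousOn.aestronglyMeasurable ?_ measurableSet_Ioo
    refine (hΦ x).comp continuous_real_toNNReal.continuousOn fun s hs => ?_
    exact (Real.toNNReal_lt_iff_lt_coe hs.1.le).2 hs.2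
  set w : hsIndex H → ℝ≥0∞ := fun e => ∫⁻ s in Ioc (0 : ℝ) t, ‖Φ s.toNNReal (e : H)‖ₑ ^ 2 with hw
  have hsum : ∑' e, w e = ∫⁻ s in Ioc (0 : ℝ) t, hilbertSchmidtSq (Φ s.toNNReal) :=
    (lintegral_tsum (f := fun (e : hsIndex H) (s : ℝ) => ‖Φ s.toNNReal (e : H)‖ₑ ^ 2)
      fun e => (hmeas e).enorm.pow_const 2).symm
  have hwfin : ∀ e, w e < ∞ := fun e => (ENNReal.le_tsum e).trans_lt (hsum.trans_lt hi)
  obtain ⟨E, hE⟩ : ∃ E : Finset (hsIndex H), ∑' e : {e // e ∉ E}, w e ≤ ε / 2 :=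
    ((ENNReal.tendsto_tsum_compl_atTop_zero (hsum.trans_lt hi).ne).eventually_le_const
      (ENNReal.half_pos hε.ne')).exists
  -- The extra 1 covers an empty E.
  have hεE : 0 < ε / 2 / (E.card + 1) := by
    refine ENNReal.div_pos (ENNReal.half_pos hε.ne').ne' ?_
    finiteness
  choose N a b h hab hbt hN using fun e : hsIndex H => exists_stepSum_approx (hΦ e) (hwfin e) hεE
  set φ : ElementaryIntegrand H := ElementaryIntegrand.ofFintype (J := Σ e : E, Fin (N e))
    (fun j => a j.1 j.2) (fun j => b j.1 j.2) (fun j => ((j.1 : hsIndex H) : H))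
    (fun j => h j.1 j.2) (fun j => hab _ _) with hφ
  refine ⟨φ, ElementaryIntegrand.ofFintype_b_le _ _ _ _ _ fun j => hbt _ _, ?_⟩
  have hortho : ∀ e f : hsIndex H, ⟪(e : H), (f : H)⟫_ℝ = if e = f then 1 else 0 := by
    intro e f
    have := orthonormal_iff_ite.1 (hsBasis H).orthonormal e f
    simpa only [hsBasis_apply] using this
  -- By orthonormality the integrand acts on e through its own column only, and annihilates basis
  -- vectors outside E.
  have hval : ∀ (e : hsIndex H) (s : ℝ≥0), φ.toFun s e =
      if e ∈ E then stepSum (a e) (b e) (h e) s else 0 := by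
    intro e s
    rw [hφ, ElementaryIntegrand.ofFintype_toFun_apply, stepSum, Fintype.sum_sigma]
    have h1 : ∀ f : E, ∑ j : Fin (N f), (Ioc (a f j) (b f j)).indicator
        (fun _ => ⟪((f : hsIndex H) : H), (e : H)⟫_ℝ • h f j) s =
        if (f : hsIndex H) = e then stepSum (a f) (b f) (h f) s else 0 := by
      intro f
      rw [hortho]
      split_ifs with hfe
      · simp [stepSum]
      · simp
    rw [Finset.sum_congr rfl fun f _ => h1 f]
    split_ifs with he
    · rw [Finset.sum_eq_single ⟨e, he⟩]
      · simp
      · intro f _ hf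
        rw [if_neg]
        exact fun h => hf (Subtype.ext h)
      · simp
    · refine Finset.sum_eq_zero fun f _ => if_neg ?_
      rintro rfl
      exact he f.2
  have hexp : ∫⁻ s in Ioc (0 : ℝ) t, hilbertSchmidtSq (Φ s.toNNReal - φ.toFun s.toNNReal) =
      ∑' e : hsIndex H, ∫⁻ s in Ioc (0 : ℝ) t,
        ‖Φ s.toNNReal (e : H) - φ.toFun s.toNNReal (e : H)‖ₑ ^ 2 := by
    rw [← lintegral_tsum]
    · rfl
    · intro e
      have := (φ.measurable_toFun_apply (e : H)).comp_measurable measurable_real_toNNReal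
      exact ((hmeas e).sub this.aestronglyMeasurable).enorm.pow_const 2
  rw [hexp, ← ENNReal.sum_add_tsum_compl E, ← ENNReal.add_halves ε]
  refine add_le_add ?_ ?_
  · calc _ ≤ ∑ e ∈ E, ε / 2 / (E.card + 1) := Finset.sum_le_sum fun e he => by
          simp_rw [hval, if_pos he]
          exact hN e
      _ ≤ ε / 2 := by
        rw [Finset.sum_const, nsmul_eq_mul, ← mul_div_assoc]
        refine ENNReal.div_le_of_le_mul ?_
        rw [mul_comm]
        gcongr
        exact le_self_add
  · refine le_trans (ENNReal.tsum_le_tsum fun e => ?_) hE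
    have he : (e : hsIndex H) ∉ E := e.2
    simp_rw [hval, if_neg he, sub_zero]
    exact le_rfl

end Approximation

end LevySPDE

namespace LevySPDE

/-! ### Moments and convergence in measure -/

section Moments

variable {Ω ι E : Type*} {mΩ : MeasurableSpace Ω} {P : Measure Ω} [NormedAddCommGroup E]

lemma eLpNorm_ofReal_eq {q : ℝ} (hq : 0 < q) (f : Ω → E) :
    eLpNorm f (ENNReal.ofReal q) P = (∫⁻ ω, ‖f ω‖ₑ ^ q ∂P) ^ (1 / q) := by
  rw [eLpNorm_eq_lintegral_rpow_enorm_toReal (by simpa using hq) ENNReal.ofReal_ne_top,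
    ENNReal.toReal_ofReal hq.le]

lemma lintegral_rpow_eq_eLpNorm {q : ℝ} (hq : 0 < q) (f : Ω → E) :
    ∫⁻ ω, ‖f ω‖ₑ ^ q ∂P = eLpNorm f (ENNReal.ofReal q) P ^ q := by
  rw [eLpNorm_ofReal_eq hq, ← ENNReal.rpow_mul, one_div_mul_cancel hq.ne', ENNReal.rpow_one]

lemma tendsto_rpow_zero_iff {q : ℝ} (hq : 0 < q) {l : Filter ι} {f : ι → ℝ≥0∞} :
    Tendsto (fun i => f i ^ q) l (𝓝 0) ↔ Tendsto f l (𝓝 0) := by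
  constructor
  · intro h
    have := (ENNReal.continuous_rpow_const (y := 1 / q)).tendsto 0 |>.comp h
    simpa [Function.comp_def, ← ENNReal.rpow_mul, hq.ne', hq] using this
  · intro h
    have := (ENNReal.continuous_rpow_const (y := q)).tendsto 0 |>.comp h
    simpa [Function.comp_def, hq] using this

lemma tendstoInMeasure_of_lintegral_rpow {q : ℝ} (hq : 0 < q) {l : Filter ι} {f : ι → Ω → E}
    {g : Ω → E} (hf : ∀ i, AEStronglyMeasurable (f i) P) (hg : AEStronglyMeasurable g P)
    (h : Tendsto (fun i => ∫⁻ ω, ‖f i ω - g ω‖ₑ ^ q ∂P) l (𝓝 0)) : TendstoInMeasure P f l g := by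
  refine tendstoInMeasure_of_tendsto_eLpNorm (p := ENNReal.ofReal q) (by simpa using hq) hf hg ?_
  rw [← tendsto_rpow_zero_iff hq]
  simp_rw [← lintegral_rpow_eq_eLpNorm hq]
  exact h

lemma lintegral_rpow_le_of_tendstoInMeasure {q : ℝ} (hq : 0 < q) {l : Filter ι} [NeBot l]
    [IsCountablyGenerated l] {f : ι → Ω → E} {g : Ω → E} {C : ℝ≥0∞}
    (hf : ∀ i, AEStronglyMeasurable (f i) P) (h : TendstoInMeasure P f l g)
    (hC : ∀ᶠ i in l, ∫⁻ ω, ‖f i ω‖ₑ ^ q ∂P ≤ C) : ∫⁻ ω, ‖g ω‖ₑ ^ q ∂P ≤ C := by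
  have h1 : eLpNorm g (ENNReal.ofReal q) P ≤ C ^ (1 / q) := by
    refine eLpNorm_le_of_tendstoInMeasure (hC.mono fun i hi => ?_) h hf
    rw [eLpNorm_ofReal_eq hq]
    gcongr
  rw [lintegral_rpow_eq_eLpNorm hq]
  calc _ ≤ (C ^ (1 / q)) ^ q := by gcongr
    _ = C := by rw [← ENNReal.rpow_mul, one_div_mul_cancel hq.ne', ENNReal.rpow_one]

end Moments

/-! ### The Wiener integral -/

section WienerIntegral

variable {Ω : Type*} {mΩ : MeasurableSpace Ω} {P : Measure Ω} {ℱ : Filtration ℝ≥0 mΩ}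
  {H : Type*} [NormedAddCommGroup H] [InnerProductSpace ℝ H] [CompleteSpace H]
  [TopologicalSpace.SeparableSpace H] {W : ℝ≥0 → H → Ω → ℝ} {t : ℝ≥0} {Φ : ℝ≥0 → H →L[ℝ] H}

lemma aestronglyMeasurable_of_continuousOn (hΦ : ∀ x, ContinuousOn (fun s => Φ s x) (Iio t))
    (x : H) : AEStronglyMeasurable (fun s : ℝ => Φ s.toNNReal x)
      (volume.restrict (Ioc (0 : ℝ) t)) := by
  rw [← restrict_Ioo_eq_restrict_Ioc]
  refine ContinuousOn.aestronglyMeasurable ?_ measurableSet_Ioo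
  refine (hΦ x).comp continuous_real_toNNReal.continuousOn fun s hs => ?_
  exact (Real.toNNReal_lt_iff_lt_coe hs.1.le).2 hs.2

lemma aemeasurable_hilbertSchmidtSq {μ : Measure ℝ} {K : ℝ → H →L[ℝ] H}
    (hK : ∀ x, AEStronglyMeasurable (fun s => K s x) μ) :
    AEMeasurable (fun s => hilbertSchmidtSq (K s)) μ := by
  have : Countable (hsIndex H) := countable_hsIndex.to_subtype
  exact AEMeasurable.tsum fun e : hsIndex H => (hK e).enorm.pow_const 2

lemma ElementaryIntegrand.aestronglyMeasurable_toFun {μ : Measure ℝ} (φ : ElementaryIntegrand H)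
    (x : H) : AEStronglyMeasurable (fun s : ℝ => φ.toFun s.toNNReal x) μ :=
  ((φ.measurable_toFun_apply x).comp_measurable measurable_real_toNNReal).aestronglyMeasurable

lemma hilbertSchmidtSq_sub_comm (K L : H →L[ℝ] H) :
    hilbertSchmidtSq (K - L) = hilbertSchmidtSq (L - K) := by
  rw [← hilbertSchmidtSq_neg, neg_sub]

lemma lintegral_hilbertSchmidtSq_sub_le (hΦ : ∀ x, ContinuousOn (fun s => Φ s x) (Iio t))
    (φ ψ : ElementaryIntegrand H) :
    ∫⁻ s in Ioc (0 : ℝ) t, hilbertSchmidtSq (φ.toFun s.toNNReal - ψ.toFun s.toNNReal) ≤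
      2 * (∫⁻ s in Ioc (0 : ℝ) t, hilbertSchmidtSq (Φ s.toNNReal - φ.toFun s.toNNReal)) +
      2 * ∫⁻ s in Ioc (0 : ℝ) t, hilbertSchmidtSq (Φ s.toNNReal - ψ.toFun s.toNNReal) := by
  have hm : ∀ φ : ElementaryIntegrand H,
      AEMeasurable (fun s : ℝ => hilbertSchmidtSq (Φ s.toNNReal - φ.toFun s.toNNReal))
      (volume.restrict (Ioc (0 : ℝ) t)) := fun φ => aemeasurable_hilbertSchmidtSq fun x =>
    (aestronglyMeasurable_of_continuousOn hΦ x).sub (φ.aestronglyMeasurable_toFun x)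
  rw [← lintegral_const_mul'' _ (hm φ), ← lintegral_const_mul'' _ (hm ψ),
    ← lintegral_add_left' ((hm φ).const_mul 2)]
  refine lintegral_mono fun s => ?_
  rw [hilbertSchmidtSq_sub_comm (φ.toFun _), show ψ.toFun s.toNNReal - φ.toFun s.toNNReal =
    (Φ s.toNNReal - φ.toFun s.toNNReal) - (Φ s.toNNReal - ψ.toFun s.toNNReal) by abel]
  exact hilbertSchmidtSq_sub_le _ _

lemma ElementaryIntegrand.lintegral_enorm_sub_sq [IsProbabilityMeasure P]
    (hW : IsCylindricalWiener W ℱ P) {φ ψ : ElementaryIntegrand H} (hφ : ∀ i, φ.b i ≤ t)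
    (hψ : ∀ i, ψ.b i ≤ t) :
    ∫⁻ ω, ‖φ.integral W ω - ψ.integral W ω‖ₑ ^ 2 ∂P =
      ∫⁻ s in Ioc (0 : ℝ) t, hilbertSchmidtSq (φ.toFun s.toNNReal - ψ.toFun s.toNNReal) := by
  simp_rw [← sub_integral, ← sub_toFun]
  exact (φ.sub ψ).lintegral_enorm_integral_sq hW (sub_b_le hφ hψ)

lemma tendsto_lintegral_sub_sq {f : ℕ → Ω → H} {g : ℕ → Ω → H} {k : Ω → H}
    (hf : ∀ n, AEStronglyMeasurable (f n) P) (hg : ∀ n, AEStronglyMeasurable (g n) P)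
    (h1 : Tendsto (fun n => ∫⁻ ω, ‖f n ω - g n ω‖ₑ ^ 2 ∂P) atTop (𝓝 0))
    (h2 : Tendsto (fun n => ∫⁻ ω, ‖g n ω - k ω‖ₑ ^ 2 ∂P) atTop (𝓝 0)) :
    Tendsto (fun n => ∫⁻ ω, ‖f n ω - k ω‖ₑ ^ 2 ∂P) atTop (𝓝 0) := by
  have h3 := (ENNReal.Tendsto.const_mul h1 (Or.inr (by simp : (2 : ℝ≥0∞) ≠ ∞))).add
    (ENNReal.Tendsto.const_mul h2 (Or.inr (by simp : (2 : ℝ≥0∞) ≠ ∞)))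
  simp only [mul_zero, add_zero] at h3
  refine tendsto_of_tendsto_of_tendsto_of_le_of_le tendsto_const_nhds h3 (fun _ => zero_le)
    fun n => ?_
  have hm : AEMeasurable (fun ω => ‖f n ω - g n ω‖ₑ ^ 2) P :=
    ((hf n).sub (hg n)).enorm.pow_const 2
  dsimp only
  rw [← lintegral_const_mul'' _ hm, ← lintegral_const_mul' _ _ (by simp),
    ← lintegral_add_left' (hm.const_mul 2)]
  refine lintegral_mono fun ω => ?_
  dsimp only
  rw [← sub_add_sub_cancel (f n ω) (g n ω) (k ω)]
  exact enorm_add_sq_le _ _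

variable [IsProbabilityMeasure P]

/-- The elementary integrals of every approximating sequence converge to the Wiener integral. -/
lemma IsWienerIntegral.tendsto (hW : IsCylindricalWiener W ℱ P)
    (hΦ : ∀ x, ContinuousOn (fun s => Φ s x) (Iio t)) {I : Ω → H}
    (hI : IsWienerIntegral P Φ W t I) {φ : ℕ → ElementaryIntegrand H}
    (hφ : ∀ n i, (φ n).b i ≤ t) (h : Tendsto (fun n => ∫⁻ s in Ioc (0 : ℝ) t,
      hilbertSchmidtSq (Φ s.toNNReal - (φ n).toFun s.toNNReal)) atTop (𝓝 0)) :
    Tendsto (fun n => ∫⁻ ω, ‖(φ n).integral W ω - I ω‖ₑ ^ 2 ∂P) atTop (𝓝 0) := by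
  obtain ⟨-, ψ, hψ, hψa, hψI⟩ := hI
  refine tendsto_lintegral_sub_sq
    (fun n => (((φ n).stronglyMeasurable_integral hW (hφ n)).mono (ℱ.le t)).aestronglyMeasurable)
    (fun n => (((ψ n).stronglyMeasurable_integral hW (hψ n)).mono (ℱ.le t)).aestronglyMeasurable)
    ?_ hψI
  have h3 := (ENNReal.Tendsto.const_mul h (Or.inr (by simp : (2 : ℝ≥0∞) ≠ ∞))).add
    (ENNReal.Tendsto.const_mul hψa (Or.inr (by simp : (2 : ℝ≥0∞) ≠ ∞)))
  simp only [mul_zero, add_zero] at h3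
  refine tendsto_of_tendsto_of_tendsto_of_le_of_le tendsto_const_nhds h3 (fun _ => zero_le)
    fun n => ?_
  dsimp only
  rw [ElementaryIntegrand.lintegral_enorm_sub_sq hW (hφ n) (hψ n)]
  exact lintegral_hilbertSchmidtSq_sub_le hΦ _ _

lemma IsWienerIntegral.tendstoInMeasure (hW : IsCylindricalWiener W ℱ P)
    (hΦ : ∀ x, ContinuousOn (fun s => Φ s x) (Iio t)) {I : Ω → H}
    (hI : IsWienerIntegral P Φ W t I) {φ : ℕ → ElementaryIntegrand H}
    (hφ : ∀ n i, (φ n).b i ≤ t) (h : Tendsto (fun n => ∫⁻ s in Ioc (0 : ℝ) t,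
      hilbertSchmidtSq (Φ s.toNNReal - (φ n).toFun s.toNNReal)) atTop (𝓝 0)) :
    TendstoInMeasure P (fun n => (φ n).integral W) atTop I := by
  refine tendstoInMeasure_of_lintegral_rpow two_pos
    (fun n => (((φ n).stronglyMeasurable_integral hW (hφ n)).mono (ℱ.le t)).aestronglyMeasurable)
    hI.1 ?_
  simpa only [ENNReal.rpow_two] using hI.tendsto hW hΦ hφ h

lemma ElementaryIntegrand.exists_seq_approx
    (hΦ : ∀ x, ContinuousOn (fun s => Φ s x) (Iio t))
    (hi : ∫⁻ s in Ioc (0 : ℝ) t, hilbertSchmidtSq (Φ s.toNNReal) < ∞) {ε : ℕ → ℝ≥0∞}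
    (hε : ∀ n, 0 < ε n) :
    ∃ φ : ℕ → ElementaryIntegrand H, (∀ n i, (φ n).b i ≤ t) ∧ ∀ n, ∫⁻ s in Ioc (0 : ℝ) t,
      hilbertSchmidtSq (Φ s.toNNReal - (φ n).toFun s.toNNReal) ≤ ε n := by
  choose φ h1 h2 using fun n => exists_approx hΦ hi (hε n)
  exact ⟨φ, h1, h2⟩

/-- The isometry turns approximation of the integrand into a Cauchy sequence in L², whose limit is
the integral. -/
lemma exists_isWienerIntegral (hW : IsCylindricalWiener W ℱ P)
    (hΦ : ∀ x, ContinuousOn (fun s => Φ s x) (Iio t))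
    (hi : ∫⁻ s in Ioc (0 : ℝ) t, hilbertSchmidtSq (Φ s.toNNReal) < ∞) :
    ∃ I, IsWienerIntegral P Φ W t I := by
  set B : ℕ → ℝ≥0∞ := fun n => (1 / 2) ^ n with hB
  have hBpos : ∀ n, 0 < B n := fun n => ENNReal.pow_pos (by simp) n
  have hBtop : ∀ n, B n ≠ ∞ := fun n => ENNReal.pow_ne_top (by simp)
  -- With this choice the squared distance of two elementary integrals is at most 2(B²/8) + 2(B²/8)
  -- = B²/2, strictly below B² as the completeness statement requires.
  have hε : ∀ n, 0 < B n ^ 2 / 8 := fun n => ENNReal.div_pos (pow_ne_zero 2 (hBpos n).ne') (by simp)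
  obtain ⟨φ, hφ, hφε⟩ := ElementaryIntegrand.exists_seq_approx hΦ hi hε
  have hm := fun n =>
    (((φ n).stronglyMeasurable_integral hW (hφ n)).mono (ℱ.le t)).aestronglyMeasurable (μ := P)
  have hlim : Tendsto (fun n => ∫⁻ s in Ioc (0 : ℝ) t,
      hilbertSchmidtSq (Φ s.toNNReal - (φ n).toFun s.toNNReal)) atTop (𝓝 0) := by
    refine tendsto_of_tendsto_of_tendsto_of_le_of_le tendsto_const_nhds
      (h := fun n => B n) ?_ (fun _ => zero_le) fun n => (hφε n).trans ?_
    · exact ENNReal.tendsto_pow_atTop_nhds_zero_of_lt_one (by simp)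
    · have h1 : B n ≤ 1 := pow_le_one₀ zero_le (by simp)
      calc B n ^ 2 / 8 ≤ B n ^ 2 := ENNReal.div_le_of_le_mul (by
            conv_lhs => rw [← mul_one (B n ^ 2)]
            gcongr; norm_num)
        _ ≤ B n := pow_le_of_le_one zero_le h1 two_ne_zero
  have h2 : (2 : ℝ≥0∞) = ENNReal.ofReal 2 := by simp
  have hcau : ∀ N n m : ℕ, N ≤ n → N ≤ m →
      eLpNorm ((φ n).integral W - (φ m).integral W) 2 P < B N := by
    intro N n m hn hm'
    have hBm : ∀ k, N ≤ k → B k ≤ B N := fun k hk => pow_le_pow_right_of_le_one' (by simp) hk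
    have h3 : eLpNorm ((φ n).integral W - (φ m).integral W) 2 P ^ (2 : ℝ) ≤ B N ^ 2 / 2 := by
      rw [h2, ← lintegral_rpow_eq_eLpNorm two_pos]
      simp only [ENNReal.rpow_two, Pi.sub_apply]
      rw [ElementaryIntegrand.lintegral_enorm_sub_sq hW (hφ n) (hφ m)]
      refine (lintegral_hilbertSchmidtSq_sub_le hΦ _ _).trans ?_
      calc _ ≤ 2 * (B N ^ 2 / 8) + 2 * (B N ^ 2 / 8) := by
            gcongr
            · refine (hφε n).trans ?_
              gcongr
              exact hBm n hn
            · refine (hφε m).trans ?_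
              gcongr
              exact hBm m hm'
        _ = B N ^ 2 / ENNReal.ofReal 2 := by
          rw [← h2, ← two_mul, ← mul_assoc, ENNReal.div_eq_inv_mul, ENNReal.div_eq_inv_mul, ← mul_assoc]
          congr 1
          rw [show (8 : ℝ≥0∞) = 2 * 2 * 2 by norm_num, ENNReal.mul_inv (Or.inr (by simp)) (Or.inr (by simp)),
            ← mul_assoc, ENNReal.mul_inv_cancel (by simp) (ENNReal.mul_ne_top (by simp) (by simp)),
            one_mul]
    have h4 : eLpNorm ((φ n).integral W - (φ m).integral W) 2 P ^ (2 : ℝ) < B N ^ (2 : ℝ) := by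
      refine h3.trans_lt ?_
      rw [ENNReal.rpow_two]
      exact ENNReal.half_lt_self (pow_ne_zero 2 (hBpos N).ne') (ENNReal.pow_ne_top (hBtop N))
    exact (ENNReal.rpow_lt_rpow_iff two_pos).1 h4
  have hmem : ∀ n, MemLp ((φ n).integral W) 2 P := by
    intro n
    refine ⟨hm n, ?_⟩
    have h3 : eLpNorm ((φ n).integral W) 2 P ^ (2 : ℝ) < ∞ := by
      rw [h2, ← lintegral_rpow_eq_eLpNorm two_pos]
      simp only [ENNReal.rpow_two]
      rw [(φ n).lintegral_enorm_integral_sq hW (hφ n)]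
      refine lt_of_le_of_lt (b := 2 * (∫⁻ s in Ioc (0 : ℝ) t, hilbertSchmidtSq (Φ s.toNNReal)) +
        2 * (∫⁻ s in Ioc (0 : ℝ) t, hilbertSchmidtSq (Φ s.toNNReal - (φ n).toFun s.toNNReal))) ?_ ?_
      · have hmΦ : AEMeasurable (fun s : ℝ => hilbertSchmidtSq (Φ s.toNNReal))
            (volume.restrict (Ioc (0 : ℝ) t)) := aemeasurable_hilbertSchmidtSq fun x =>
          aestronglyMeasurable_of_continuousOn hΦ x
        have hmφ : AEMeasurable (fun s : ℝ => hilbertSchmidtSq (Φ s.toNNReal -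
            (φ n).toFun s.toNNReal))
            (volume.restrict (Ioc (0 : ℝ) t)) := aemeasurable_hilbertSchmidtSq fun x =>
          (aestronglyMeasurable_of_continuousOn hΦ x).sub ((φ n).aestronglyMeasurable_toFun x)
        rw [← lintegral_const_mul'' _ hmΦ, ← lintegral_const_mul'' _ hmφ,
          ← lintegral_add_left' (hmΦ.const_mul 2)]
        refine lintegral_mono fun s => ?_
        conv_lhs => rw [← sub_sub_cancel (Φ s.toNNReal) ((φ n).toFun s.toNNReal)]
        exact hilbertSchmidtSq_sub_le _ _
      · refine ENNReal.add_lt_top.2 ⟨ENNReal.mul_lt_top (by simp) hi,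
          ENNReal.mul_lt_top (by simp) ((hφε n).trans_lt ?_)⟩
        exact ENNReal.div_lt_top (ENNReal.pow_ne_top (hBtop n)) (by simp)
    rwa [ENNReal.rpow_lt_top_iff_of_pos two_pos] at h3
  obtain ⟨I, hI, hI2⟩ := Lp.cauchy_complete_eLpNorm one_le_two hmem
    (B := B) (by simp [hB, ENNReal.tsum_geometric]) hcau
  refine ⟨I, hI.1, φ, hφ, hlim, ?_⟩
  have := (tendsto_rpow_zero_iff two_pos).2 hI2
  rw [h2] at this
  simp_rw [← lintegral_rpow_eq_eLpNorm two_pos] at this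
  simpa only [ENNReal.rpow_two, Pi.sub_apply] using this

lemma IsWienerIntegral.exists_tendsto (hW : IsCylindricalWiener W ℱ P)
    (hΦ : ∀ x, ContinuousOn (fun s => Φ s x) (Iio t)) {I : Ω → H}
    (hI : IsWienerIntegral P Φ W t I) :
    ∃ φ : ℕ → ElementaryIntegrand H, (∀ n i, (φ n).b i ≤ t) ∧
      TendstoInMeasure P (fun n => (φ n).integral W) atTop I := by
  obtain ⟨φ, hφ, hφa, -⟩ := hI.2
  exact ⟨φ, hφ, hI.tendstoInMeasure hW hΦ hφ hφa⟩

/-- Moments of Wiener integrals. -/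
lemma exists_lintegral_rpow_le_of_isWienerIntegral (hW : IsCylindricalWiener W ℱ P) {q : ℝ}
    (hq : 2 ≤ q) : ∃ C : ℝ≥0∞, C ≠ ∞ ∧ ∀ {t : ℝ≥0} {Φ : ℝ≥0 → H →L[ℝ] H} {I : Ω → H},
      (∀ x, ContinuousOn (fun s => Φ s x) (Iio t)) → IsWienerIntegral P Φ W t I →
      ∫⁻ ω, ‖I ω‖ₑ ^ q ∂P ≤
        C * (∫⁻ s in Ioc (0 : ℝ) t, hilbertSchmidtSq (Φ s.toNNReal)) ^ (q / 2) := by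
  obtain ⟨C, hC, hCφ⟩ := ElementaryIntegrand.exists_lintegral_integral_rpow_le (P := P) H hq
  -- The factor 2^(q/2) comes from bounding a squared Hilbert-Schmidt norm of a sum by twice the sum
  -- of the squares.
  refine ⟨C * 2 ^ (q / 2), ENNReal.mul_ne_top hC (by finiteness), fun {t Φ I} hΦ hI => ?_⟩
  have hq0 : 0 < q := by linarith
  obtain ⟨φ, hφ, hφa, -⟩ := hI.2
  have hmeas := hI.tendstoInMeasure hW hΦ hφ hφa
  have hm := fun n =>
    (((φ n).stronglyMeasurable_integral hW (hφ n)).mono (ℱ.le t)).aestronglyMeasurable (μ := P)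
  set V := ∫⁻ s in Ioc (0 : ℝ) t, hilbertSchmidtSq (Φ s.toNNReal) with hV
  set δ : ℕ → ℝ≥0∞ := fun n => ∫⁻ s in Ioc (0 : ℝ) t,
      hilbertSchmidtSq (Φ s.toNNReal - (φ n).toFun s.toNNReal) with hδ
  have hb : ∀ n, ∫⁻ ω, ‖(φ n).integral W ω‖ₑ ^ q ∂P ≤ C * (2 * V + 2 * δ n) ^ (q / 2) := by
    intro n
    refine (hCφ hW (φ n)).trans ?_
    gcongr
    rw [(φ n).lintegral_enorm_integral_sq hW (hφ n)]
    have hmΦ : AEMeasurable (fun s : ℝ => hilbertSchmidtSq (Φ s.toNNReal))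
        (volume.restrict (Ioc (0 : ℝ) t)) := aemeasurable_hilbertSchmidtSq fun x =>
      aestronglyMeasurable_of_continuousOn hΦ x
    have hmφ : AEMeasurable (fun s : ℝ => hilbertSchmidtSq (Φ s.toNNReal -
        (φ n).toFun s.toNNReal))
        (volume.restrict (Ioc (0 : ℝ) t)) := aemeasurable_hilbertSchmidtSq fun x =>
      (aestronglyMeasurable_of_continuousOn hΦ x).sub ((φ n).aestronglyMeasurable_toFun x)
    rw [hV, hδ, ← lintegral_const_mul'' _ hmΦ, ← lintegral_const_mul'' _ hmφ,
      ← lintegral_add_left' (hmΦ.const_mul 2)]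
    refine lintegral_mono fun s => ?_
    conv_lhs => rw [← sub_sub_cancel (Φ s.toNNReal) ((φ n).toFun s.toNNReal)]
    exact hilbertSchmidtSq_sub_le _ _
  have hlim : Tendsto (fun n => C * (2 * V + 2 * δ n) ^ (q / 2)) atTop
      (𝓝 (C * (2 * V + 2 * 0) ^ (q / 2))) := by
    refine ENNReal.Tendsto.const_mul ?_ (Or.inr hC)
    refine (ENNReal.continuous_rpow_const.tendsto _).comp ?_
    exact tendsto_const_nhds.add (ENNReal.Tendsto.const_mul hφa (Or.inr (by simp)))
  rw [mul_zero, add_zero, ENNReal.mul_rpow_of_nonneg _ _ (by positivity), ← mul_assoc] at hlim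
  refine ENNReal.le_of_forall_pos_le_add fun ε hε hfin => ?_
  refine lintegral_rpow_le_of_tendstoInMeasure hq0 hm hmeas ?_
  filter_upwards [hlim.eventually_le_const (ENNReal.lt_add_right hfin.ne
    (by simpa using hε.ne' : (ε : ℝ≥0∞) ≠ 0))] with n hn
  exact (hb n).trans hn

/-- The Wiener convolutions at the times `s`, `h` and `s + h` in terms of elementary integrals. -/
lemma IsOrbit.exists_elementaryIntegrand_tendsto {S K : ℝ≥0 → H →L[ℝ] H} (hK : IsOrbit S K)
    (hS : IsC0Semigroup S) (hW : IsCylindricalWiener W ℱ P) {s h : ℝ≥0} {Is Ih Ish : Ω → H}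
    (hs : IsWienerIntegral P (fun r => K (s - r)) W s Is)
    (hh : IsWienerIntegral P (fun r => K (h - r)) W h Ih)
    (hsh : IsWienerIntegral P (fun r => K (s + h - r)) W (s + h) Ish) :
    ∃ φ : ℕ → ElementaryIntegrand H,
      TendstoInMeasure P (fun n => (φ n).integral W) atTop Ih ∧
      TendstoInMeasure P (fun n => ((φ n).shift s).integral W) atTop
        (fun ω => Ish ω - S h (Is ω)) := by
  have hcont : ∀ t x, ContinuousOn (fun r => K (t - r) x) (Iio t) := by
    intro t x
    refine (hK.continuousOn hS x).comp (by fun_prop) fun r hr => ?_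
    exact tsub_pos_of_lt (mem_Iio.1 hr)
  obtain ⟨ψ, hψ, hψa, -⟩ := hs.2
  obtain ⟨φ, hφ, hφa, -⟩ := hh.2
  have hψI := hs.tendstoInMeasure hW (hcont s) hψ hψa
  refine ⟨φ, hh.tendstoInMeasure hW (hcont h) hφ hφa, ?_⟩
  -- On (0, s] the integrand K(s + h - r) is S_h K(s - r), approximated by S_h applied to ψ; on (s,
  -- s + h] it is the integrand for time h shifted by s. The integral of χ minus S_h times that of ψ
  -- is exactly the shifted integral of φ.
  set χ : ℕ → ElementaryIntegrand H := fun n => ((ψ n).clm (S h)).append ((φ n).shift s) with hχ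
  have hχb : ∀ n i, (χ n).b i ≤ s + h := fun n => ElementaryIntegrand.append_b_le
    (fun i => (hψ n i).trans le_self_add) fun i => add_le_add le_rfl (hφ n i)
  have hχa : Tendsto (fun n => ∫⁻ r in Ioc (0 : ℝ) (s + h : ℝ≥0),
      hilbertSchmidtSq (K (s + h - r.toNNReal) - (χ n).toFun r.toNNReal)) atTop (𝓝 0) := by
    have h3 := (ENNReal.Tendsto.const_mul hψa
      (Or.inr (by finiteness : ‖S h‖ₑ ^ 2 ≠ ∞))).add hφa
    simp only [mul_zero, add_zero] at h3
    refine tendsto_of_tendsto_of_tendsto_of_le_of_le tendsto_const_nhds h3 (fun _ => zero_le)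
      fun n => ?_
    dsimp only
    have hsplit : Ioc (0 : ℝ) (s + h : ℝ≥0) = Ioc (0 : ℝ) s ∪ Ioc (s : ℝ) (s + h : ℝ≥0) :=
      (Ioc_union_Ioc_eq_Ioc (NNReal.coe_nonneg s) (by push_cast; simp)).symm
    rw [hsplit]
    refine (lintegral_union_le _ _ _).trans (add_le_add ?_ ?_)
    -- The end point r = s is dropped, since the orbit relation does not apply at K 0.
    · rw [← lintegral_const_mul' _ _ (by finiteness), ← restrict_Ioo_eq_restrict_Ioc]
      refine setLIntegral_mono' measurableSet_Ioo fun r hr => ?_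
      have hr' : r.toNNReal < s := (Real.toNNReal_lt_iff_lt_coe hr.1.le).2 hr.2
      have h1 : s + h - r.toNNReal = h + (s - r.toNNReal) := by
        rw [add_comm s h, add_tsub_assoc_of_le hr'.le]
      rw [hχ, ElementaryIntegrand.append_toFun, ElementaryIntegrand.clm_toFun,
        ElementaryIntegrand.shift_toFun_of_le _ _ hr'.le, add_zero, h1,
        hK _ _ (tsub_pos_of_lt hr'), ← ContinuousLinearMap.comp_sub]
      exact hilbertSchmidtSq_comp_le _ _
    · have h1 := (measurePreserving_add_right volume (s : ℝ)).setLIntegral_comp_preimage_emb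
        (measurableEmbedding_addRight (s : ℝ)) (fun r : ℝ => hilbertSchmidtSq
          (K (s + h - r.toNNReal) - (χ n).toFun r.toNNReal)) (Ioc (s : ℝ) (s + h : ℝ≥0))
      rw [← h1]
      have h2 : (fun x : ℝ => x + (s : ℝ)) ⁻¹' Ioc (s : ℝ) (s + h : ℝ≥0) = Ioc (0 : ℝ) h := by
        ext x
        simp only [mem_preimage, mem_Ioc, NNReal.coe_add]
        constructor <;> rintro ⟨h1, h2⟩ <;> constructor <;> linarith
      rw [h2]
      refine setLIntegral_mono' measurableSet_Ioc fun r hr => ?_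
      have h4 : (r + s : ℝ).toNNReal = s + r.toNNReal := by
        rw [Real.toNNReal_add hr.1.le (NNReal.coe_nonneg s), Real.toNNReal_coe, add_comm]
      rw [h4, add_tsub_add_eq_tsub_left, hχ, ElementaryIntegrand.append_toFun,
        ElementaryIntegrand.clm_toFun, ElementaryIntegrand.shift_toFun_add,
        ElementaryIntegrand.toFun_of_lt (hψ n)
          (lt_add_of_pos_right s (Real.toNNReal_pos.2 hr.1)), ContinuousLinearMap.comp_zero,
        zero_add]
  have h1 := hsh.tendstoInMeasure hW (hcont (s + h)) hχb hχa
  have h2 := tendstoInMeasure_sub h1 (tendstoInMeasure_clm (S h) hψI)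
  refine h2.congr' (Eventually.of_forall fun n => Eventually.of_forall fun ω => ?_) EventuallyEq.rfl
  simp [hχ, ElementaryIntegrand.append_integral, ElementaryIntegrand.clm_integral]

end WienerIntegral

end LevySPDE

namespace LevySPDE

/-! ### The stochastic convolution at a fixed time -/

section Convolution

variable {Ω : Type*} {mΩ : MeasurableSpace Ω} {P : Measure Ω} {ℱ : Filtration ℝ≥0 mΩ}
  {H : Type*} [NormedAddCommGroup H] [InnerProductSpace ℝ H]
  {U : Type*} [NormedAddCommGroup U] [InnerProductSpace ℝ U]
  [MeasurableSpace U] [BorelSpace U]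
  {W : ℝ≥0 → H → Ω → ℝ} {Y : ℝ≥0 → Ω → U}

lemma IsCylindricalWiener.incrementSum_noisePair (hW : IsCylindricalWiener W ℱ P)
    {J J' : Type*} [Fintype J] [Fintype J'] (a b : J → ℝ≥0) (a' b' : J' → ℝ≥0) (q : J → H)
    (q' : J' → U) :
    incrementSum (noisePair W Y) (Sum.elim a a') (Sum.elim b b')
      (Sum.elim (fun j => (q j, 0)) fun j => (0, q' j)) =ᵐ[P]
      fun ω => incrementSum W a b q ω + incrementSum (fun t (u : U) ω => ⟪Y t ω, u⟫_ℝ) a' b' q' ω := by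
  have h0 := hW.hasCylindricalIncrements.zero_ae
  filter_upwards [ae_all_iff.2 fun j => h0 (b' j), ae_all_iff.2 fun j => h0 (a' j)] with ω h1 h2
  simp [incrementSum, noisePair, h1, h2]
  ring

variable [CompleteSpace H] [MeasurableSpace H]

/-- `Z` is a version of `c(t) + ∫_0^t G(t - s) dW_s + ∫_0^t T(t - s) dY_s`. -/
def IsConvolutionAt (P : Measure Ω) (c : ℝ≥0 → H) (G : ℝ≥0 → H →L[ℝ] H) (T : ℝ≥0 → U →L[ℝ] H)
    (W : ℝ≥0 → H → Ω → ℝ) (Y : ℝ≥0 → Ω → U) (t : ℝ≥0) (Z : Ω → H) : Prop :=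
  ∃ IW IY : Ω → H, IsWienerIntegral P (fun s => G (t - s)) W t IW ∧
    IsJumpConvolution P T Y t IY ∧ ∀ᵐ ω ∂P, Z ω = c t + IW ω + IY ω

variable [TopologicalSpace.SeparableSpace H] [BorelSpace H] [CompleteSpace U]
  [IsProbabilityMeasure P] {S G : ℝ≥0 → H →L[ℝ] H} {T : ℝ≥0 → U →L[ℝ] H} {c : ℝ≥0 → H}

lemma IsOrbit.continuousOn_tsub (hS : IsC0Semigroup S) (hG : IsOrbit S G) (t : ℝ≥0) (x : H) :
    ContinuousOn (fun r => G (t - r) x) (Iio t) := by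
  refine (hG.continuousOn hS x).comp (by fun_prop) fun r hr => ?_
  exact tsub_pos_of_lt (mem_Iio.1 hr)

/-- The innovation `Z(s + h) - S_h Z(s)` has the law of `Z(h)` and is independent of `ℱ s`. -/
lemma IsConvolutionAt.setIntegral_exp (hN : IsLevyNoise W Y ℱ P) (hS : IsC0Semigroup S)
    (hG : IsOrbit S G) (hT : IsOrbit S T) (hI : ∀ t, 0 < t → t ≤ 1 → ∃ I, IsJumpIntegral P T Y t I)
    {s h : ℝ≥0} (hc : c (s + h) = S h (c s) + c h) {Zs Zh Zsh : Ω → H}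
    (hs : IsConvolutionAt P c G T W Y s Zs) (hh : IsConvolutionAt P c G T W Y h Zh)
    (hsh : IsConvolutionAt P c G T W Y (s + h) Zsh) {A : Set Ω} (hA : MeasurableSet[ℱ s] A) (v : H) :
    ∫ ω in A, Complex.exp ((⟪Zsh ω - S h (Zs ω), v⟫_ℝ : ℂ) * Complex.I) ∂P =
      P.real A * ∫ ω, Complex.exp ((⟪Zh ω, v⟫_ℝ : ℂ) * Complex.I) ∂P := by
  obtain ⟨IWs, IYs, hIWs, hIYs, hZs⟩ := hs
  obtain ⟨IWh, IYh, hIWh, hIYh, hZh⟩ := hh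
  obtain ⟨IWsh, IYsh, hIWsh, hIYsh, hZsh⟩ := hsh
  obtain ⟨φ, hφ, hφs⟩ := hG.exists_elementaryIntegrand_tendsto hS hN.wiener hIWs hIWh hIWsh
  obtain ⟨m, B, a, b, hab, hB, hBs⟩ := exists_levySum_tendsto hN.levy hS hT hI hIYs hIYsh hIYh
  have hmW : ∀ φ : ElementaryIntegrand H, AEStronglyMeasurable (φ.integral W) P := fun φ =>
    ((φ.stronglyMeasurable_integral hN.wiener
      (fun i => Finset.le_sup (Finset.mem_univ i))).mono (ℱ.le _)).aestronglyMeasurable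
  have hmY : ∀ {J : Type} [Fintype J] (A : J → U →L[ℝ] H) (a b : J → ℝ≥0),
      AEStronglyMeasurable (levySum A a b Y) P := fun A a b =>
    (stronglyMeasurable_levySum hN.levy.stronglyMeasurable A a b).aestronglyMeasurable
  have h1 : TendstoInMeasure P (fun n => (fun _ => c h) +
      ((φ n).integral W + levySum (B n) (a n) (b n) Y)) atTop Zh :=
    (tendstoInMeasure_add (tendstoInMeasure_const _ _) (tendstoInMeasure_add hφ hB)).congr'
      (Eventually.of_forall fun n => EventuallyEq.rfl) (by
        filter_upwards [hZh] with ω h1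
        simp [h1, add_assoc])
  have h2 : TendstoInMeasure P (fun n => (fun _ => c h) + (((φ n).shift s).integral W +
      levySum (B n) (fun j => s + a n j) (fun j => s + b n j) Y)) atTop
      (fun ω => Zsh ω - S h (Zs ω)) :=
    (tendstoInMeasure_add (tendstoInMeasure_const _ _) (tendstoInMeasure_add hφs hBs)).congr'
      (Eventually.of_forall fun n => EventuallyEq.rfl) (by
        filter_upwards [hZs, hZsh] with ω h1 h2
        simp only [h1, h2, hc, Pi.add_apply, Pi.sub_apply, map_add]
        abel)
  have l1 := tendsto_setIntegral_exp_inner (Eventually.of_forall fun n =>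
    aestronglyMeasurable_const.add ((hmW (φ n)).add (hmY _ _ _))) h1 v univ
  have l2 := tendsto_setIntegral_exp_inner (Eventually.of_forall fun n =>
    aestronglyMeasurable_const.add ((hmW ((φ n).shift s)).add (hmY _ _ _))) h2 v A
  simp only [setIntegral_univ] at l1
  refine tendsto_nhds_unique l2 ((l1.const_mul (P.real A : ℂ)).congr fun n => ?_)
  have hX := hN.hasCylindricalIncrements
  set J := Fin (φ n).n ⊕ Fin (m n)
  set a' : J → ℝ≥0 := Sum.elim (φ n).a (a n) with ha'
  set b' : J → ℝ≥0 := Sum.elim (φ n).b (b n) with hb'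
  set q : J → H × U := Sum.elim (fun i => (⟪(φ n).h i, v⟫_ℝ • (φ n).u i, 0))
    (fun j => (0, (B n j).adjoint v)) with hq
  have e1 : ∀ᵐ ω ∂P, ⟪((fun _ => c h) + ((φ n).integral W + levySum (B n) (a n) (b n) Y) : Ω → H) ω, v⟫_ℝ =
      ⟪c h, v⟫_ℝ + incrementSum (noisePair W Y) a' b' q ω := by
    filter_upwards [(φ n).inner_integral_ae_eq hN.wiener v, hN.wiener.incrementSum_noisePair (Y := Y)
      (φ n).a (φ n).b (a n) (b n) (fun i => ⟪(φ n).h i, v⟫_ℝ • (φ n).u i)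
      (fun j => (B n j).adjoint v)] with ω h1 h2
    rw [h2, ← h1, ← inner_levySum]
    simp [inner_add_left]
  have e2 : ∀ᵐ ω ∂P, ⟪((fun _ => c h) + (((φ n).shift s).integral W +
      levySum (B n) (fun j => s + a n j) (fun j => s + b n j) Y) : Ω → H) ω, v⟫_ℝ =
      ⟪c h, v⟫_ℝ + incrementSum (noisePair W Y) (fun j => s + a' j) (fun j => s + b' j) q ω := by
    have ea : (fun j => s + a' j) = Sum.elim ((φ n).shift s).a (fun j => s + a n j) := by
      funext j; rcases j with j | j <;> rfl
    have eb : (fun j => s + b' j) = Sum.elim ((φ n).shift s).b (fun j => s + b n j) := by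
      funext j; rcases j with j | j <;> rfl
    rw [ea, eb]
    filter_upwards [((φ n).shift s).inner_integral_ae_eq hN.wiener v,
      hN.wiener.incrementSum_noisePair (Y := Y)
      ((φ n).shift s).a ((φ n).shift s).b (fun j => s + a n j) (fun j => s + b n j)
      (fun i => ⟪(φ n).h i, v⟫_ℝ • (φ n).u i) (fun j => (B n j).adjoint v)] with ω h1 h2
    refine Eq.trans ?_ (congrArg (⟪c h, v⟫_ℝ + ·) h2.symm)
    refine Eq.trans ?_ (congrArg₂ (fun x y => ⟪c h, v⟫_ℝ + (x + y)) h1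
      (inner_levySum (B n) (fun j => s + a n j) (fun j => s + b n j) v ω))
    simp [inner_add_left]
  rw [integral_congr_ae (e1.mono fun ω h =>
      congrArg (fun x : ℝ => Complex.exp ((x : ℂ) * Complex.I)) h),
    integral_congr_ae ((ae_restrict_of_ae e2).mono fun ω h =>
      congrArg (fun x : ℝ => Complex.exp ((x : ℂ) * Complex.I)) h)]
  -- The event A and the deterministic phase of the drift together form the past factor.
  have key := hX.integral_mul_exp_shift (a := a') (b := b')
    (by rintro (i | j); exacts [(φ n).le i, hab n j]) q s
    (ξ := A.indicator fun _ => Complex.exp ((⟪c h, v⟫_ℝ : ℂ) * Complex.I))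
    (measurable_const.indicator hA)
  rw [← integral_indicator (ℱ.le s A hA)]
  rw [integral_indicator (ℱ.le s A hA), setIntegral_const] at key
  simp only [Complex.ofReal_add, add_mul, Complex.exp_add]
  rw [integral_const_mul, ← mul_assoc]
  refine Eq.trans ?_ (key.symm.trans ?_)
  · simp
  · refine integral_congr_ae (Eventually.of_forall fun ω => ?_)
    dsimp only
    by_cases hω : ω ∈ A <;> simp [hω]

variable {Zs Zh Zsh : Ω → H} {s h : ℝ≥0}

/-- Characteristic functions determine finite measures. Letting A range over `ℱ s` gives the law of
the innovation and its independence of `ℱ s` at the same time. -/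
lemma IsConvolutionAt.restrict_map (hN : IsLevyNoise W Y ℱ P) (hS : IsC0Semigroup S)
    (hG : IsOrbit S G) (hT : IsOrbit S T) (hI : ∀ t, 0 < t → t ≤ 1 → ∃ I, IsJumpIntegral P T Y t I)
    (hc : c (s + h) = S h (c s) + c h)
    (hs : IsConvolutionAt P c G T W Y s Zs) (hh : IsConvolutionAt P c G T W Y h Zh)
    (hsh : IsConvolutionAt P c G T W Y (s + h) Zsh) (hms : AEStronglyMeasurable Zs P)
    (hmh : AEStronglyMeasurable Zh P)
    (hmsh : AEStronglyMeasurable Zsh P) {A : Set Ω} (hA : MeasurableSet[ℱ s] A) :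
    (P.restrict A).map (fun ω => Zsh ω - S h (Zs ω)) = P A • P.map Zh := by
  have hm : AEMeasurable (fun ω => Zsh ω - S h (Zs ω)) P :=
    (hmsh.sub ((S h).continuous.comp_aestronglyMeasurable hms)).aemeasurable
  have : IsFiniteMeasure (P A • P.map Zh) := Measure.smul_finite _ (measure_ne_top _ _)
  refine Measure.ext_of_charFun (funext fun v => ?_)
  have hcont : Continuous fun x : H => Complex.exp (((⟪x, v⟫_ℝ : ℝ) : ℂ) * Complex.I) := by fun_prop
  rw [charFun_apply, integral_map hm.restrict hcont.aestronglyMeasurable,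
    setIntegral_exp hN hS hG hT hI hc hs hh hsh hA v, charFun_apply, integral_smul_measure,
    integral_map hmh.aemeasurable hcont.aestronglyMeasurable]
  simp [Measure.real]

lemma IsConvolutionAt.map_sub (hN : IsLevyNoise W Y ℱ P) (hS : IsC0Semigroup S)
    (hG : IsOrbit S G) (hT : IsOrbit S T) (hI : ∀ t, 0 < t → t ≤ 1 → ∃ I, IsJumpIntegral P T Y t I)
    (hc : c (s + h) = S h (c s) + c h)
    (hs : IsConvolutionAt P c G T W Y s Zs) (hh : IsConvolutionAt P c G T W Y h Zh)
    (hsh : IsConvolutionAt P c G T W Y (s + h) Zsh) (hms : AEStronglyMeasurable Zs P)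
    (hmh : AEStronglyMeasurable Zh P)
    (hmsh : AEStronglyMeasurable Zsh P) :
    P.map (fun ω => Zsh ω - S h (Zs ω)) = P.map Zh := by
  simpa using restrict_map hN hS hG hT hI hc hs hh hsh hms hmh hmsh MeasurableSet.univ

lemma IsConvolutionAt.indep (hN : IsLevyNoise W Y ℱ P) (hS : IsC0Semigroup S)
    (hG : IsOrbit S G) (hT : IsOrbit S T) (hI : ∀ t, 0 < t → t ≤ 1 → ∃ I, IsJumpIntegral P T Y t I)
    (hc : c (s + h) = S h (c s) + c h)
    (hs : IsConvolutionAt P c G T W Y s Zs) (hh : IsConvolutionAt P c G T W Y h Zh)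
    (hsh : IsConvolutionAt P c G T W Y (s + h) Zsh) (hms : StronglyMeasurable Zs)
    (hmh : AEStronglyMeasurable Zh P) (hmsh : StronglyMeasurable Zsh) :
    Indep (MeasurableSpace.comap (fun ω => Zsh ω - S h (Zs ω)) inferInstance) (ℱ s) P := by
  have hm : Measurable fun ω => Zsh ω - S h (Zs ω) :=
    (hmsh.sub ((S h).continuous.comp_stronglyMeasurable hms)).measurable
  rw [Indep_iff]
  rintro t₁ A ⟨B, hB, rfl⟩ hA
  have h1 := restrict_map hN hS hG hT hI hc hs hh hsh hms.aestronglyMeasurable hmh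
    hmsh.aestronglyMeasurable hA
  have h2 := map_sub hN hS hG hT hI hc hs hh hsh hms.aestronglyMeasurable hmh
    hmsh.aestronglyMeasurable
  have h3 := congrArg (fun μ => μ B) h1
  simp only [Measure.smul_apply, smul_eq_mul] at h3
  rw [← h2, Measure.map_apply hm hB, Measure.map_apply hm hB, Measure.restrict_apply (hm hB)] at h3
  rw [h3, mul_comm]

end Convolution

end LevySPDE

namespace LevySPDE

/-! ### Processes with independent stationary innovations -/

section PowerMoments

variable {Ω ι E : Type*} {mΩ : MeasurableSpace Ω} {P : Measure Ω} [NormedAddCommGroup E]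

/-- The sum is at most twice the maximum. The constant is crude but serves all p > 0, also p < 1,
where there is no triangle inequality in L^p. -/
lemma ennreal_add_rpow_le {p : ℝ} (hp : 0 < p) (a b : ℝ≥0∞) :
    (a + b) ^ p ≤ 2 ^ p * (a ^ p + b ^ p) := by
  rcases le_total a b with h | h
  · calc (a + b) ^ p ≤ (2 * b) ^ p := by rw [two_mul]; gcongr
      _ = 2 ^ p * b ^ p := ENNReal.mul_rpow_of_nonneg _ _ hp.le
      _ ≤ _ := by gcongr; exact le_add_self
  · calc (a + b) ^ p ≤ (2 * a) ^ p := by rw [two_mul]; gcongr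
      _ = 2 ^ p * a ^ p := ENNReal.mul_rpow_of_nonneg _ _ hp.le
      _ ≤ _ := by gcongr; exact le_self_add

lemma lintegral_enorm_add_rpow_le {p : ℝ} (hp : 0 < p) {f g : Ω → E}
    (hf : AEStronglyMeasurable f P) :
    ∫⁻ ω, ‖f ω + g ω‖ₑ ^ p ∂P ≤
      2 ^ p * (∫⁻ ω, ‖f ω‖ₑ ^ p ∂P + ∫⁻ ω, ‖g ω‖ₑ ^ p ∂P) := by
  have hfm : AEMeasurable (fun ω => ‖f ω‖ₑ ^ p) P := hf.enorm.pow_const p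
  rw [← lintegral_add_left' hfm, ← lintegral_const_mul' _ _ (by finiteness)]
  refine lintegral_mono fun ω => ?_
  refine le_trans ?_ (ennreal_add_rpow_le hp _ _)
  gcongr
  exact enorm_add_le _ _

lemma lintegral_enorm_sub_rpow_le {p : ℝ} (hp : 0 < p) {f g : Ω → E}
    (hf : AEStronglyMeasurable f P) :
    ∫⁻ ω, ‖f ω - g ω‖ₑ ^ p ∂P ≤
      2 ^ p * (∫⁻ ω, ‖f ω‖ₑ ^ p ∂P + ∫⁻ ω, ‖g ω‖ₑ ^ p ∂P) := by
  simpa [sub_eq_add_neg] using lintegral_enorm_add_rpow_le hp (g := -g) hf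

lemma lintegral_rpow_le_rpow_lintegral [IsProbabilityMeasure P] {p q : ℝ} (hp : 0 < p)
    (hpq : p ≤ q) {f : Ω → E} (hf : AEStronglyMeasurable f P) :
    ∫⁻ ω, ‖f ω‖ₑ ^ p ∂P ≤ (∫⁻ ω, ‖f ω‖ₑ ^ q ∂P) ^ (p / q) := by
  have hq : 0 < q := hp.trans_le hpq
  have h := eLpNorm_le_eLpNorm_of_exponent_le (ENNReal.ofReal_le_ofReal hpq) hf
  rw [eLpNorm_ofReal_eq hp, eLpNorm_ofReal_eq hq] at h
  have h2 := ENNReal.rpow_le_rpow h hp.le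
  rw [← ENNReal.rpow_mul, ← ENNReal.rpow_mul, one_div_mul_cancel hp.ne', ENNReal.rpow_one] at h2
  rwa [one_div_mul_eq_div] at h2

end PowerMoments

/-! ### The variance of the Wiener convolution -/

section WienerVariance

variable {H : Type*} [NormedAddCommGroup H] [InnerProductSpace ℝ H] [CompleteSpace H]

lemma lintegral_reflect (G : ℝ≥0 → H →L[ℝ] H) (t : ℝ≥0) :
    ∫⁻ s in Ioc (0 : ℝ) t, hilbertSchmidtSq (G (t - s.toNNReal)) =
      ∫⁻ s in Ioc (0 : ℝ) t, hilbertSchmidtSq (G s.toNNReal) := by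
  rw [← restrict_Ioo_eq_restrict_Ioc]
  have h1 := (Measure.measurePreserving_sub_left volume (t : ℝ)).setLIntegral_comp_preimage_emb
    ((MeasurableEquiv.subLeft (t : ℝ)).measurableEmbedding)
    (fun r : ℝ => hilbertSchmidtSq (G r.toNNReal)) (Ioo (0 : ℝ) t)
  rw [← h1]
  have h2 : (fun x : ℝ => (t : ℝ) - x) ⁻¹' Ioo (0 : ℝ) t = Ioo (0 : ℝ) t := by
    ext x
    simp only [mem_preimage, mem_Ioo]
    constructor <;> rintro ⟨h1, h2⟩ <;> constructor <;> linarith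
  rw [h2]
  refine setLIntegral_congr_fun measurableSet_Ioo fun r hr => ?_
  have : t - r.toNNReal = ((t : ℝ) - r).toNNReal := by
    rw [NNReal.sub_def, Real.coe_toNNReal _ hr.1.le]
  simp only [this]

lemma tendsto_lintegral_Ioc_zero {f : ℝ → ℝ≥0∞} (hf : ∫⁻ s in Ioc (0 : ℝ) 1, f s < ∞) :
    Tendsto (fun t : ℝ≥0 => ∫⁻ s in Ioc (0 : ℝ) t, f s) (𝓝 0) (𝓝 0) := by
  have h1 := tendsto_setLIntegral_zero (μ := volume.restrict (Ioc (0 : ℝ) 1)) (f := f) hf.ne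
    (l := 𝓝 (0 : ℝ≥0)) (s := fun t : ℝ≥0 => Ioc (0 : ℝ) t) ?_
  · refine h1.congr' ?_
    filter_upwards [gt_mem_nhds (show (0 : ℝ≥0) < 1 from one_pos)] with t ht
    rw [Measure.restrict_restrict measurableSet_Ioc, inter_eq_self_of_subset_left
      (Ioc_subset_Ioc_right (by exact_mod_cast ht.le))]
  · refine tendsto_of_tendsto_of_tendsto_of_le_of_le tendsto_const_nhds
      (h := fun t : ℝ≥0 => (t : ℝ≥0∞)) ?_ (fun _ => zero_le) fun t => ?_
    · exact_mod_cast ENNReal.continuous_coe.tendsto (0 : ℝ≥0)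
    · refine (Measure.restrict_apply_le _ _).trans ?_
      rw [Real.volume_Ioc]
      simp

end WienerVariance

/-! ### Innovations, p-th moments and continuity in mean -/

section Innovations

variable {Ω : Type*} {mΩ : MeasurableSpace Ω}
  {H : Type*} [NormedAddCommGroup H] [InnerProductSpace ℝ H] [MeasurableSpace H]

/-- An adapted process `Z` whose innovations `Z (s + h) - S h (Z s)` are independent of `ℱ s` and
have the law of `Z h`, with finite `p`-th moments that vanish as `h ↓ 0`. -/
structure HasInnovations (S : ℝ≥0 → H →L[ℝ] H) (ℱ : Filtration ℝ≥0 mΩ) (P : Measure Ω) (p : ℝ)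
    (Z : ℝ≥0 → Ω → H) : Prop where
  adapted : StronglyAdapted ℱ Z
  indep : ∀ s h, Indep (MeasurableSpace.comap (fun ω => Z (s + h) ω - S h (Z s ω)) inferInstance)
    (ℱ s) P
  map_eq : ∀ s h, P.map (fun ω => Z (s + h) ω - S h (Z s ω)) = P.map (Z h)
  moment : ∀ t, ∫⁻ ω, ‖Z t ω‖ₑ ^ p ∂P < ∞
  moment_zero : Tendsto (fun t => ∫⁻ ω, ‖Z t ω‖ₑ ^ p ∂P) (𝓝 0) (𝓝 0)

variable {P : Measure Ω} [IsProbabilityMeasure P] {ℱ : Filtration ℝ≥0 mΩ}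
  {S : ℝ≥0 → H →L[ℝ] H} {p : ℝ} {Z : ℝ≥0 → Ω → H}
  [CompleteSpace H] [TopologicalSpace.SeparableSpace H] [BorelSpace H]

lemma nhds_zero_tendsto_of_nhdsGT {f : ℝ≥0 → ℝ≥0∞} (h0 : f 0 = 0)
    (h : Tendsto f (𝓝[>] 0) (𝓝 0)) : Tendsto f (𝓝 0) (𝓝 0) := by
  have h1 : ContinuousWithinAt f (Ioi 0) 0 := by rwa [ContinuousWithinAt, h0]
  rw [continuousWithinAt_Ioi_iff_Ici] at h1
  have h2 : Ici (0 : ℝ≥0) = univ := Ici_bot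
  rw [h2, continuousWithinAt_univ] at h1
  rwa [ContinuousAt, h0] at h1

/-- The stochastic convolution has independent stationary innovations with vanishing moments. -/
lemma hasInnovations_of_isConvolutionAt {U : Type*} [NormedAddCommGroup U] [InnerProductSpace ℝ U]
    [MeasurableSpace U] [BorelSpace U] [CompleteSpace U] {W : ℝ≥0 → H → Ω → ℝ} {Y : ℝ≥0 → Ω → U}
    {G : ℝ≥0 → H →L[ℝ] H} {T : ℝ≥0 → U →L[ℝ] H} {c : ℝ≥0 → H}
    (hN : IsLevyNoise W Y ℱ P) (hS : IsC0Semigroup S)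
    (hG : IsOrbit S G) (hT : IsOrbit S T) (hp : 0 < p)
    {I : ℝ≥0 → Ω → H} (hI : ∀ t, 0 < t → t ≤ 1 → IsJumpIntegral P T Y t (I t))
    (hIp : ∀ t, 0 < t → t ≤ 1 → ∫⁻ ω, ‖I t ω‖ₑ ^ p ∂P < ∞)
    (hI0 : Tendsto (fun t => ∫⁻ ω, ‖I t ω‖ₑ ^ p ∂P) (𝓝[>] 0) (𝓝 0))
    (hc : ∀ s h, c (s + h) = S h (c s) + c h) (hc0 : Tendsto c (𝓝 0) (𝓝 0))
    (hi : ∫⁻ s in Ioc (0 : ℝ) 1, hilbertSchmidtSq (G s.toNNReal) < ∞)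
    (hZ : ∀ t, IsConvolutionAt P c G T W Y t (Z t)) (hZm : StronglyAdapted ℱ Z) :
    HasInnovations S ℱ P p Z := by
  have hm : ∀ t, StronglyMeasurable (Z t) := fun t => (hZm t).mono (ℱ.le t)
  have hI' : ∀ t, 0 < t → t ≤ 1 → ∃ I, IsJumpIntegral P T Y t I := fun t h0 h1 => ⟨_, hI t h0 h1⟩
  have hmap : ∀ s h, P.map (fun ω => Z (s + h) ω - S h (Z s ω)) = P.map (Z h) := fun s h =>
    IsConvolutionAt.map_sub hN hS hG hT hI' (hc s h) (hZ s) (hZ h) (hZ (s + h))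
      (hm s).aestronglyMeasurable (hm h).aestronglyMeasurable (hm _).aestronglyMeasurable
  have hind : ∀ s h, Indep (MeasurableSpace.comap (fun ω => Z (s + h) ω - S h (Z s ω))
      inferInstance) (ℱ s) P := fun s h =>
    IsConvolutionAt.indep hN hS hG hT hI' (hc s h) (hZ s) (hZ h) (hZ (s + h))
      (hm s) (hm h).aestronglyMeasurable (hm _)
  have hpow : ∀ {f g : Ω → H}, Measurable f → Measurable g → P.map f = P.map g →
      ∫⁻ ω, ‖f ω‖ₑ ^ p ∂P = ∫⁻ ω, ‖g ω‖ₑ ^ p ∂P := by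
    intro f g hf hg hfg
    have h1 := lintegral_map (μ := P) (f := fun x : H => ‖x‖ₑ ^ p) (by fun_prop) hf
    have h2 := lintegral_map (μ := P) (f := fun x : H => ‖x‖ₑ ^ p) (by fun_prop) hg
    rw [← h1, ← h2, hfg]
  -- The innovation for s = h = 0 is identically 0 and has the law of `Z 0`.
  have hZ0 : ∫⁻ ω, ‖Z 0 ω‖ₑ ^ p ∂P = 0 := by
    have h1 := hmap 0 0
    have h2 : (fun ω => Z (0 + 0) ω - S 0 (Z 0 ω)) = fun _ => 0 := by
      funext ω
      rw [hS.zero, add_zero]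
      simp
    rw [h2] at h1
    rw [← hpow measurable_const (hm 0).measurable h1]
    simp [hp]
  -- the moments for small times
  set q : ℝ := max p 2 with hq
  -- The Gaussian moment comparison needs an exponent at least 2; Hölder's inequality leads back to
  -- p.
  have hq2 : 2 ≤ q := le_max_right _ _
  have hpq : p ≤ q := le_max_left _ _
  have hq0 : 0 < q := by linarith
  obtain ⟨C, hC, hCI⟩ := exists_lintegral_rpow_le_of_isWienerIntegral hN.wiener hq2
  set V : ℝ≥0 → ℝ≥0∞ := fun t => ∫⁻ s in Ioc (0 : ℝ) t, hilbertSchmidtSq (G s.toNNReal) with hV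
  have hbound : ∀ t, 0 < t → t ≤ 1 → ∫⁻ ω, ‖Z t ω‖ₑ ^ p ∂P ≤
      2 ^ p * (2 ^ p * (‖c t‖ₑ ^ p + (C * V t ^ (q / 2)) ^ (p / q)) +
        ∫⁻ ω, ‖I t ω‖ₑ ^ p ∂P) := by
    intro t h0 h1
    obtain ⟨IW, IY, hIW, hIY, hZt⟩ := hZ t
    have e1 : ∫⁻ ω, ‖IY ω‖ₑ ^ p ∂P = ∫⁻ ω, ‖I t ω‖ₑ ^ p ∂P := by
      obtain ⟨I', hI'm, hI'c, hI'map⟩ := (hI t h0 h1).exists_isJumpConvolution hN.levy h0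
      -- The image measure under a map that is not a.e. measurable is 0 by convention, which cannot
      -- equal the law of I'.
      have hIm : AEMeasurable (I t) P := by
        by_contra hne
        rw [Measure.map_of_not_aemeasurable hne] at hI'map
        have := Measure.isProbabilityMeasure_map (μ := P) hI'm.measurable.aemeasurable
        rw [hI'map] at this
        exact IsProbabilityMeasure.ne_zero (0 : Measure H) rfl
      have h3 := lintegral_map' (μ := P) (f := fun x : H => ‖x‖ₑ ^ p) (by fun_prop) hIm
      have h4 := lintegral_map (μ := P) (f := fun x : H => ‖x‖ₑ ^ p) (by fun_prop)
        hI'm.measurable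
      rw [← h3, ← hI'map, h4]
      refine lintegral_congr_ae ?_
      filter_upwards [hIY.ae_unique hI'c] with ω hω
      rw [hω]
    have e2 : ∫⁻ ω, ‖IW ω‖ₑ ^ p ∂P ≤ (C * V t ^ (q / 2)) ^ (p / q) := by
      refine (lintegral_rpow_le_rpow_lintegral hp hpq hIW.1).trans ?_
      gcongr
      refine (hCI (hG.continuousOn_tsub hS t) hIW).trans ?_
      rw [lintegral_reflect]
    rw [lintegral_congr_ae (hZt.mono fun ω h => by simp only [h] :
      (fun ω => ‖Z t ω‖ₑ ^ p) =ᵐ[P] fun ω => ‖c t + IW ω + IY ω‖ₑ ^ p)]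
    refine (lintegral_enorm_add_rpow_le hp (aestronglyMeasurable_const.add hIW.1)).trans ?_
    rw [e1]
    gcongr
    refine (lintegral_enorm_add_rpow_le hp aestronglyMeasurable_const).trans ?_
    simp only [lintegral_const, measure_univ, mul_one]
    gcongr
  have hVfin : ∀ t ≤ 1, V t < ∞ := fun t ht =>
    (lintegral_mono_set (Ioc_subset_Ioc_right (by exact_mod_cast ht))).trans_lt hi
  have hfin1 : ∀ t ≤ 1, ∫⁻ ω, ‖Z t ω‖ₑ ^ p ∂P < ∞ := by
    intro t ht
    rcases (zero_le : 0 ≤ t).eq_or_lt with h0 | h0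
    · rw [← h0, hZ0]; exact ENNReal.zero_lt_top
    · refine (hbound t h0 ht).trans_lt ?_
      have a1 := hVfin t ht
      have a2 := hIp t h0 ht
      have a3 : C * V t ^ (q / 2) ≠ ∞ :=
        ENNReal.mul_ne_top hC (ENNReal.rpow_ne_top_of_nonneg (by positivity) a1.ne)
      have a4 : (C * V t ^ (q / 2)) ^ (p / q) ≠ ∞ := ENNReal.rpow_ne_top_of_nonneg (by positivity) a3
      have a5 : (‖c t‖ₑ ^ p) ≠ ∞ := ENNReal.rpow_ne_top_of_nonneg hp.le enorm_ne_top
      have a6 : (2 : ℝ≥0∞) ^ p < ∞ := ENNReal.rpow_lt_top_of_nonneg hp.le (by simp)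
      exact ENNReal.mul_lt_top a6 (ENNReal.add_lt_top.2 ⟨ENNReal.mul_lt_top a6
        (ENNReal.add_lt_top.2 ⟨a5.lt_top, a4.lt_top⟩), a2⟩)
  refine ⟨hZm, hind, hmap, fun t => ?_, ?_⟩
  -- Past time 1 the process is S_1 applied to its value one unit earlier plus an innovation with
  -- the law of `Z 1`, so finiteness propagates by unit steps.
  · have key : ∀ n : ℕ, ∀ t : ℝ≥0, t ≤ n → ∫⁻ ω, ‖Z t ω‖ₑ ^ p ∂P < ∞ := by
      intro n
      induction n with
      | zero => intro t ht; exact hfin1 t (ht.trans (by simp))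
      | succ n ih =>
        intro t ht
        rcases le_total t 1 with h1 | h1
        · exact hfin1 t h1
        · obtain ⟨s, rfl⟩ := exists_add_of_le h1
          have hs : s ≤ n := by
            push_cast at ht
            rw [add_comm] at ht
            exact le_of_add_le_add_right ht
          have e : ∀ ω, Z (1 + s) ω = S 1 (Z s ω) + (Z (s + 1) ω - S 1 (Z s ω)) := fun ω => by
            rw [add_comm 1 s]; abel
          simp_rw [e]
          have hmS : StronglyMeasurable fun ω => S 1 (Z s ω) :=
            (S 1).continuous.comp_stronglyMeasurable (hm s)
          refine (lintegral_enorm_add_rpow_le hp hmS.aestronglyMeasurable).trans_lt ?_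
          rw [hpow (f := fun ω => Z (s + 1) ω - S 1 (Z s ω)) ((hm _).sub hmS).measurable
            (hm 1).measurable (hmap s 1)]
          refine ENNReal.mul_lt_top (by finiteness) (ENNReal.add_lt_top.2 ⟨?_, hfin1 1 le_rfl⟩)
          refine lt_of_le_of_lt (b := ‖S 1‖ₑ ^ p * ∫⁻ ω, ‖Z s ω‖ₑ ^ p ∂P) ?_
            (ENNReal.mul_lt_top (by finiteness) (ih s hs))
          rw [← lintegral_const_mul' _ _ (by finiteness)]
          refine lintegral_mono fun ω => ?_
          rw [← ENNReal.mul_rpow_of_nonneg _ _ hp.le]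
          gcongr
          exact (S 1).le_opENorm _
    obtain ⟨n, hn⟩ := exists_nat_ge t
    exact key n t hn
  · refine nhds_zero_tendsto_of_nhdsGT hZ0 ?_
    have hlim : Tendsto (fun t => 2 ^ p * (2 ^ p * (‖c t‖ₑ ^ p + (C * V t ^ (q / 2)) ^ (p / q)) +
        ∫⁻ ω, ‖I t ω‖ₑ ^ p ∂P)) (𝓝[>] 0) (𝓝 (2 ^ p * (2 ^ p * (0 + 0) + 0))) := by
      have h2p : (2 : ℝ≥0∞) ^ p ≠ ∞ := by finiteness
      refine ENNReal.Tendsto.const_mul (Tendsto.add ?_ hI0) (Or.inr h2p)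
      refine ENNReal.Tendsto.const_mul (Tendsto.add ?_ ?_) (Or.inr h2p)
      · refine (tendsto_rpow_zero_iff hp).2 ?_
        have := (continuous_enorm.tendsto (0 : H)).comp (hc0.mono_left
          (nhdsWithin_le_nhds (s := Ioi 0)))
        simpa [Function.comp_def] using this
      · refine (tendsto_rpow_zero_iff (by positivity)).2 ?_
        have h1 : Tendsto (fun t => V t ^ (q / 2)) (𝓝[>] 0) (𝓝 0) :=
          (tendsto_rpow_zero_iff (by positivity)).2
            ((tendsto_lintegral_Ioc_zero hi).mono_left nhdsWithin_le_nhds)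
        simpa using ENNReal.Tendsto.const_mul h1 (Or.inr hC)
    simp only [mul_zero, add_zero] at hlim
    refine tendsto_of_tendsto_of_tendsto_of_le_of_le' tendsto_const_nhds hlim
      (Eventually.of_forall fun _ => zero_le) ?_
    filter_upwards [self_mem_nhdsWithin, mem_nhdsWithin_of_mem_nhds
      (gt_mem_nhds (show (0 : ℝ≥0) < 1 from one_pos))] with t h0 h1
    exact hbound t h0 h1.le

namespace HasInnovations

lemma stronglyMeasurable (h : HasInnovations S ℱ P p Z) (t : ℝ≥0) : StronglyMeasurable (Z t) :=
  (h.adapted t).mono (ℱ.le t)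

lemma stronglyMeasurable_sub (hZ : HasInnovations S ℱ P p Z) (s h : ℝ≥0) :
    StronglyMeasurable fun ω => Z (s + h) ω - S h (Z s ω) :=
  (hZ.stronglyMeasurable _).sub ((S h).continuous.comp_stronglyMeasurable (hZ.stronglyMeasurable s))

lemma lintegral_sub (hZ : HasInnovations S ℱ P p Z) (s h : ℝ≥0) :
    ∫⁻ ω, ‖Z (s + h) ω - S h (Z s ω)‖ₑ ^ p ∂P = ∫⁻ ω, ‖Z h ω‖ₑ ^ p ∂P := by
  have h1 := lintegral_map (μ := P) (f := fun x : H => ‖x‖ₑ ^ p) (by fun_prop)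
    (hZ.stronglyMeasurable_sub s h).measurable
  have h2 := lintegral_map (μ := P) (f := fun x : H => ‖x‖ₑ ^ p) (by fun_prop)
    (hZ.stronglyMeasurable h).measurable
  rw [← h1, ← h2, hZ.map_eq]

lemma zero_ae (hZ : HasInnovations S ℱ P p Z) (hS : IsC0Semigroup S) (hp : 0 < p) :
    Z 0 =ᵐ[P] 0 := by
  have h1 := hZ.lintegral_sub 0 0
  simp only [add_zero, hS.zero, ContinuousLinearMap.id_apply, sub_self, enorm_zero,
    ENNReal.zero_rpow_of_pos hp, lintegral_zero] at h1
  rw [eq_comm, lintegral_eq_zero_iff' ((hZ.stronglyMeasurable 0).enorm.pow_const p).aemeasurable]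
    at h1
  filter_upwards [h1] with ω hω
  simpa [hp, hp.le, hp.not_gt] using hω

/-- Continuity in `p`-th mean. -/
lemma tendsto_lintegral_sub (hZ : HasInnovations S ℱ P p Z) (hS : IsC0Semigroup S) (hp : 0 < p)
    (t : ℝ≥0) : Tendsto (fun s => ∫⁻ ω, ‖Z s ω - Z t ω‖ₑ ^ p ∂P) (𝓝 t) (𝓝 0) := by
  rcases (zero_le : 0 ≤ t).eq_or_lt with rfl | ht
  · refine hZ.moment_zero.congr fun s => lintegral_congr_ae ?_
    filter_upwards [hZ.zero_ae hS hp] with ω hω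
    rw [hω]
    simp
  have h2p : (2 : ℝ≥0∞) ^ p ≠ ∞ := by finiteness
  refine ENNReal.tendsto_nhds_zero.2 fun ε hε => ?_
  -- a small moment bound
  obtain ⟨κ, hκ, hκε⟩ : ∃ κ : ℝ≥0∞, 0 < κ ∧ 2 ^ p * (κ + 2 ^ p * (κ + κ)) ≤ ε := by
    have h1 : Tendsto (fun κ : ℝ≥0∞ => 2 ^ p * (κ + 2 ^ p * (κ + κ))) (𝓝[>] 0) (𝓝 0) := by
      have h0 : Tendsto (fun κ : ℝ≥0∞ => κ) (𝓝 0) (𝓝 0) := tendsto_id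
      have := ENNReal.Tendsto.const_mul (a := 2 ^ p) (h0.add (ENNReal.Tendsto.const_mul (a := 2 ^ p)
        (h0.add h0) (Or.inr h2p))) (Or.inr h2p)
      simp only [add_zero, mul_zero] at this
      exact this.mono_left nhdsWithin_le_nhds
    obtain ⟨κ, h2, h3⟩ := ((h1.eventually_le_const hε).and self_mem_nhdsWithin).exists
    exact ⟨κ, h3, h2⟩
  obtain ⟨η, hη, hηκ⟩ : ∃ η : ℝ≥0, 0 < η ∧ ∀ h < η, ∫⁻ ω, ‖Z h ω‖ₑ ^ p ∂P ≤ κ := by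
    have h1 := hZ.moment_zero.eventually_le_const hκ
    rw [NNReal.nhds_zero_basis.eventually_iff] at h1
    obtain ⟨η, hη, h2⟩ := h1
    exact ⟨η, hη, fun h hh => h2 hh⟩
  -- A fixed starting time shortly before t. Both Z(s) and Z(t) are compared with their propagations
  -- from s₀, so s may lie on either side of t, and both innovations last less than η.
  obtain ⟨s₀, hs₀t, hts₀⟩ : ∃ s₀ : ℝ≥0, s₀ < t ∧ t < s₀ + η := by
    rcases le_or_gt t (η / 2) with h | h
    · exact ⟨0, ht, by rw [zero_add]; exact h.trans_lt (half_lt_self hη)⟩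
    · refine ⟨t - η / 2, tsub_lt_self ht (half_pos hη), ?_⟩
      rw [← tsub_lt_iff_left]
      · rw [tsub_tsub_cancel_of_le h.le]; exact half_lt_self hη
      · exact tsub_le_self
  -- the regular part
  have hreg : Tendsto (fun s => ∫⁻ ω, ‖S (s - s₀) (Z s₀ ω) - S (t - s₀) (Z s₀ ω)‖ₑ ^ p ∂P) (𝓝 t)
      (𝓝 0) := by
    obtain ⟨M, hM1, hM⟩ := hS.exists_norm_le (t + 1)
    have hmS : ∀ s, StronglyMeasurable fun ω => S s (Z s₀ ω) := fun s =>
      (S s).continuous.comp_stronglyMeasurable (hZ.stronglyMeasurable s₀)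
    have h1 := tendsto_lintegral_filter_of_dominated_convergence (μ := P) (l := 𝓝 t)
      (F := fun s ω => ‖S (s - s₀) (Z s₀ ω) - S (t - s₀) (Z s₀ ω)‖ₑ ^ p) (f := fun _ => 0)
      (fun ω => ENNReal.ofReal (M + M) ^ p * ‖Z s₀ ω‖ₑ ^ p)
      (Eventually.of_forall fun s => ((hmS _).sub (hmS _)).enorm.pow_const p) ?_ ?_ ?_
    · simpa using h1
    · filter_upwards [gt_mem_nhds (show t < t + 1 from lt_add_of_pos_right t one_pos)] with s hs
      refine Eventually.of_forall fun ω => ?_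
      rw [← ENNReal.mul_rpow_of_nonneg _ _ hp.le, ← sub_apply]
      gcongr
      refine ((S (s - s₀) - S (t - s₀)).le_opENorm _).trans ?_
      gcongr
      rw [← ofReal_norm]
      refine ENNReal.ofReal_le_ofReal ((norm_sub_le _ _).trans (add_le_add
        (hM _ (tsub_le_self.trans hs.le)) (hM _ (tsub_le_self.trans le_self_add))))
    · rw [lintegral_const_mul' _ _ (by finiteness)]
      exact ENNReal.mul_ne_top (by finiteness) (hZ.moment s₀).ne
    · refine Eventually.of_forall fun ω => ?_
      refine (tendsto_rpow_zero_iff hp).2 ?_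
      have h2 : Continuous fun s => ‖S (s - s₀) (Z s₀ ω) - S (t - s₀) (Z s₀ ω)‖ₑ := by
        have := hS.continuous (Z s₀ ω)
        fun_prop
      simpa using h2.tendsto t
  filter_upwards [hreg.eventually_le_const hκ, lt_mem_nhds hs₀t, gt_mem_nhds hts₀] with s h1 h2 h3
  have hle : ∀ r, s₀ < r → r < s₀ + η →
      ∫⁻ ω, ‖Z r ω - S (r - s₀) (Z s₀ ω)‖ₑ ^ p ∂P ≤ κ := by
    intro r hr1 hr2
    have := hZ.lintegral_sub s₀ (r - s₀)
    rw [add_tsub_cancel_of_le hr1.le] at this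
    rw [this]
    exact hηκ _ ((tsub_lt_iff_left hr1.le).2 hr2)
  have e : ∀ ω, Z s ω - Z t ω = (S (s - s₀) (Z s₀ ω) - S (t - s₀) (Z s₀ ω)) +
      ((Z s ω - S (s - s₀) (Z s₀ ω)) - (Z t ω - S (t - s₀) (Z s₀ ω))) := fun ω => by abel
  simp_rw [e]
  have hmS : ∀ s, StronglyMeasurable fun ω => S s (Z s₀ ω) := fun s =>
    (S s).continuous.comp_stronglyMeasurable (hZ.stronglyMeasurable s₀)
  have b1 := lintegral_enorm_add_rpow_le (P := P) hp
    (f := fun ω => S (s - s₀) (Z s₀ ω) - S (t - s₀) (Z s₀ ω))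
    (g := fun ω => (Z s ω - S (s - s₀) (Z s₀ ω)) - (Z t ω - S (t - s₀) (Z s₀ ω)))
    ((hmS _).sub (hmS _)).aestronglyMeasurable
  have b2 := lintegral_enorm_sub_rpow_le (P := P) hp (f := fun ω => Z s ω - S (s - s₀) (Z s₀ ω))
    (g := fun ω => Z t ω - S (t - s₀) (Z s₀ ω))
    ((hZ.stronglyMeasurable _).sub (hmS _)).aestronglyMeasurable
  refine b1.trans (le_trans ?_ hκε)
  gcongr
  refine b2.trans ?_
  gcongr
  · exact hle s h2 h3
  · exact hle t hs₀t hts₀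

end HasInnovations

end Innovations

end LevySPDE

namespace LevySPDE

/-! ### Predictable processes -/

section Predictable

variable {Ω : Type*} {mΩ : MeasurableSpace Ω} {P : Measure Ω} {ℱ : Filtration ℝ≥0 mΩ}

/-- The last point of the grid of mesh `δ` that is smaller than `t` (and `0` if `t = 0`). -/
noncomputable def leftPt (δ t : ℝ≥0) : ℝ≥0 := δ * ((⌈t / δ⌉₊ - 1 : ℕ) : ℝ≥0)

lemma leftPt_zero (δ : ℝ≥0) : leftPt δ 0 = 0 := by simp [leftPt]

lemma mem_Ioc_iff_leftPt {δ t : ℝ≥0} (hδ : 0 < δ) (ht : 0 < t) :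
    leftPt δ t < t ∧ t ≤ leftPt δ t + δ := by
  have h1 : 0 < ⌈t / δ⌉₊ := Nat.ceil_pos.2 (div_pos ht hδ)
  obtain ⟨k, hk⟩ := Nat.exists_eq_succ_of_ne_zero h1.ne'
  have e : leftPt δ t = δ * k := by simp [leftPt, hk]
  rw [e]
  constructor
  · have : (k : ℝ≥0) < t / δ := Nat.lt_ceil.1 (by omega)
    rw [lt_div_iff₀ hδ] at this
    rwa [mul_comm]
  · have : t / δ ≤ (k + 1 : ℕ) := by
      have := Nat.le_ceil (t / δ)
      rwa [hk] at this
    rw [div_le_iff₀ hδ] at this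
    push_cast at this
    calc t ≤ (k + 1) * δ := this
      _ = δ * k + δ := by ring

lemma leftPt_le (δ t : ℝ≥0) (hδ : 0 < δ) : leftPt δ t ≤ t := by
  rcases (zero_le : 0 ≤ t).eq_or_lt with rfl | ht
  · rw [leftPt_zero]
  · exact (mem_Ioc_iff_leftPt hδ ht).1.le

lemma le_leftPt_add (δ t : ℝ≥0) (hδ : 0 < δ) : t ≤ leftPt δ t + δ := by
  rcases (zero_le : 0 ≤ t).eq_or_lt with rfl | ht
  · exact zero_le
  · exact (mem_Ioc_iff_leftPt hδ ht).2

variable {E : Type*} [NormedAddCommGroup E] [SecondCountableTopology E]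

/-- The left grid point is constant on intervals open on the left, so preimages are countable unions
of predictable rectangles together with a rectangle at time 0. -/
lemma isStronglyPredictable_leftPt {Z : ℝ≥0 → Ω → E} (hZ : StronglyAdapted ℱ Z) {δ : ℝ≥0}
    (hδ : 0 < δ) : IsStronglyPredictable ℱ fun t => Z (leftPt δ t) := by
  borelize E
  unfold IsStronglyPredictable
  refine Measurable.stronglyMeasurable fun B hB => ?_
  have e : Function.uncurry (fun t => Z (leftPt δ t)) ⁻¹' B = ({⊥} : Set ℝ≥0) ×ˢ (Z 0 ⁻¹' B) ∪
      ⋃ k : ℕ, Ioc (δ * k) (δ * (k + 1)) ×ˢ (Z (δ * k) ⁻¹' B) := by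
    ext ⟨t, ω⟩
    simp only [mem_preimage, Function.uncurry_apply_pair, mem_union, mem_prod, mem_singleton_iff,
      mem_iUnion, mem_Ioc]
    constructor
    · intro h
      rcases (zero_le : 0 ≤ t).eq_or_lt with rfl | ht
      · rw [leftPt_zero] at h
        exact Or.inl ⟨rfl, h⟩
      · obtain ⟨h1, h2⟩ := mem_Ioc_iff_leftPt hδ ht
        refine Or.inr ⟨⌈t / δ⌉₊ - 1, ⟨h1, ?_⟩, h⟩
        rw [mul_add, mul_one]
        exact h2
    · rintro (⟨h1, h2⟩ | ⟨k, ⟨h1, h2⟩, h3⟩)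
      · have : t = 0 := h1
        rw [this, leftPt_zero]
        exact h2
      · have : ⌈t / δ⌉₊ = k + 1 := by
          rw [Nat.ceil_eq_iff (by omega)]
          constructor
          · rw [lt_div_iff₀ hδ, mul_comm]
            simpa using h1
          · rw [div_le_iff₀ hδ, mul_comm]
            simpa using h2
        simpa [leftPt, this] using h3
  rw [e]
  refine MeasurableSet.union ?_ (MeasurableSet.iUnion fun k => ?_)
  · exact measurableSet_predictable_singleton_bot_prod ((hZ 0).measurable hB)
  · exact measurableSet_predictable_Ioc_prod _ _ ((hZ _).measurable hB)

lemma tendsto_leftPt {δ : ℕ → ℝ≥0} (hδ : ∀ n, 0 < δ n) (h : Tendsto δ atTop (𝓝 0)) (t : ℝ≥0) :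
    Tendsto (fun n => leftPt (δ n) t) atTop (𝓝 t) := by
  refine tendsto_of_tendsto_of_tendsto_of_le_of_le (g := fun n => t - δ n) ?_ tendsto_const_nhds
    (fun n => tsub_le_iff_right.2 (le_leftPt_add _ _ (hδ n))) fun n => leftPt_le _ _ (hδ n)
  have := (tendsto_const_nhds (x := t)).sub h
  simpa using this

/-- Continuous adapted processes are predictable. -/
lemma isStronglyPredictable_of_continuous {Z : ℝ≥0 → Ω → E} (hZ : StronglyAdapted ℱ Z)
    (hc : ∀ ω, Continuous fun t => Z t ω) : IsStronglyPredictable ℱ Z := by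
  have hδ : ∀ n : ℕ, (0 : ℝ≥0) < 1 / ((n : ℝ≥0) + 1) := fun n => by positivity
  refine stronglyMeasurable_of_tendsto (u := atTop)
    (f := fun n : ℕ => Function.uncurry fun t => Z (leftPt (1 / ((n : ℝ≥0) + 1)) t))
    (fun n => isStronglyPredictable_leftPt hZ (hδ n)) ?_
  rw [tendsto_pi_nhds]
  rintro ⟨t, ω⟩
  exact ((hc ω).tendsto t).comp (tendsto_leftPt hδ tendsto_one_div_add_atTop_nhds_zero_nat t)

/-- Along an almost surely convergent sequence the pointwise limit, with a default value where there
is none, is measurable for the given σ-algebra. It is used with `ℱ t` to obtain adapted versions. -/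
lemma exists_stronglyMeasurable_of_tendstoInMeasure [CompleteSpace E] {m : MeasurableSpace Ω}
    {ι : Type*} {l : Filter ι} [NeBot l] [IsCountablyGenerated l] {f : ι → Ω → E} {g : Ω → E}
    (hf : ∀ᶠ i in l, ∃ f', StronglyMeasurable[m] f' ∧ f' =ᵐ[P] f i) (h : TendstoInMeasure P f l g) :
    ∃ g', StronglyMeasurable[m] g' ∧ g' =ᵐ[P] g := by
  obtain ⟨ns, hns, hae⟩ := h.exists_seq_tendsto_ae'
  obtain ⟨N, hN⟩ := eventually_atTop.1 (hns.eventually hf)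
  choose f' hf'm hf' using fun n => hN (n + N) (by omega)
  refine ⟨fun ω => limUnder atTop fun n => f' n ω, StronglyMeasurable.limUnder hf'm, ?_⟩
  filter_upwards [hae, ae_all_iff.2 hf'] with ω h1 h2
  refine Tendsto.limUnder_eq ?_
  simp_rw [h2]
  exact (tendsto_add_atTop_iff_nat N).2 h1

/-- Uniform stochastic continuity on compact time intervals. -/
lemma exists_probNorm_sub_le [IsProbabilityMeasure P] {Z : ℝ≥0 → Ω → E}
    (hm : ∀ t, AEStronglyMeasurable (Z t) P) (hc : ∀ t, TendstoInMeasure P Z (𝓝 t) (Z t))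
    (N : ℝ≥0) {ε : ℝ≥0∞} (hε : 0 < ε) :
    ∃ δ : ℝ≥0, 0 < δ ∧ ∀ s t, s ≤ t → t ≤ N → t ≤ s + δ → probNorm P (Z t - Z s) ≤ ε := by
  by_contra! hcon
  choose s t hst htN hts hbad using fun n : ℕ => hcon (1 / ((n : ℝ≥0) + 1)) (by positivity)
  obtain ⟨a, -, φ, hφ, hta⟩ := isCompact_Icc.tendsto_subseq (x := t) (s := Icc 0 N)
    fun n => ⟨zero_le, htN n⟩
  have hsa : Tendsto (s ∘ φ) atTop (𝓝 a) := by
    refine tendsto_of_tendsto_of_tendsto_of_le_of_le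
      (g := fun n => t (φ n) - 1 / ((φ n : ℝ≥0) + 1)) ?_ hta
      (fun n => tsub_le_iff_right.2 (hts _)) fun n => hst _
    have := hta.sub ((tendsto_one_div_add_atTop_nhds_zero_nat (𝕜 := ℝ≥0)).comp hφ.tendsto_atTop)
    simpa using this
  have hp : ∀ {u : ℕ → ℝ≥0}, Tendsto u atTop (𝓝 a) →
      Tendsto (fun n => probNorm P (Z (u n) - Z a)) atTop (𝓝 0) := by
    intro u hu
    have h1 := (tendstoInMeasure_iff_probNorm
      (Eventually.of_forall fun s => (hm s).sub (hm a))).1 (hc a)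
    exact h1.comp hu
  have h2 := (hp hta).add (hp hsa)
  rw [add_zero] at h2
  obtain ⟨n, hn⟩ := (h2.eventually_le_const hε).exists
  refine absurd (hbad (φ n)) (not_lt.2 (le_trans ?_ hn))
  refine (probNorm_sub_le (hm _) (hm a)).trans (add_le_add le_rfl ?_)
  rw [probNorm_sub_comm]
  exact le_rfl

/-- A stochastically continuous adapted process has a predictable modification. -/
lemma exists_predictable_modification [CompleteSpace E] [IsProbabilityMeasure P] {Z : ℝ≥0 → Ω → E}
    (hZ : StronglyAdapted ℱ Z) (hc : ∀ t, TendstoInMeasure P Z (𝓝 t) (Z t)) :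
    ∃ Z' : ℝ≥0 → Ω → E, IsStronglyPredictable ℱ Z' ∧ ∀ t, Z' t =ᵐ[P] Z t := by
  have hm : ∀ t, AEStronglyMeasurable (Z t) P := fun t =>
    ((hZ t).mono (ℱ.le t)).aestronglyMeasurable
  have hε : ∀ n : ℕ, (0 : ℝ≥0∞) < (1 / 2) ^ n := fun n => ENNReal.pow_pos (by simp) n
  -- The mesh δ_n works on [0, n] with error 2^{-n}; summability turns stochastic continuity into
  -- almost sure convergence at each fixed time.
  choose δ hδ hδZ using fun n : ℕ => exists_probNorm_sub_le hm hc n (hε n)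
  set A : ℕ → ℝ≥0 → Ω → E := fun n t => Z (leftPt (δ n) t) with hA
  -- Where the limit fails to exist the value is a default, so the process is predictable
  -- everywhere, while convergence is needed only almost surely for each t.
  refine ⟨fun t ω => limUnder atTop fun n => A n t ω, ?_, fun t => ?_⟩
  · have h : ∀ n, StronglyMeasurable[ℱ.predictable] (Function.uncurry (A n)) := fun n =>
      isStronglyPredictable_leftPt hZ (hδ n)
    exact @StronglyMeasurable.limUnder _ _ _ ℱ.predictable _ _ atTop _ _ _ _ h
  · obtain ⟨N, hN⟩ := exists_nat_ge t
    have hd : ∀ n, probNorm P (A (n + N) t - Z t) ≤ (1 / 2) ^ n := by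
      intro n
      rw [probNorm_sub_comm]
      refine (hδZ (n + N) _ _ (leftPt_le _ _ (hδ _)) (hN.trans (by simp))
        (le_leftPt_add _ _ (hδ _))).trans ?_
      exact pow_le_pow_right_of_le_one' (by simp) (by omega)
    have hgeo : Tendsto (fun n : ℕ => (1 / 2 : ℝ≥0∞) ^ n) atTop (𝓝 0) :=
      ENNReal.tendsto_pow_atTop_nhds_zero_of_lt_one (by simp)
    have hlim : TendstoInMeasure P (fun n => A (n + N) t) atTop (Z t) := by
      rw [tendstoInMeasure_iff_probNorm (Eventually.of_forall fun n => (hm _).sub (hm t))]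
      exact tendsto_of_tendsto_of_tendsto_of_le_of_le tendsto_const_nhds hgeo
        (fun _ => zero_le) hd
    have hae := tendsto_ae_of_tsum_probNorm (P := P) (f := fun n => A (n + N) t) (fun n => hm _) ?_
    · obtain ⟨ns, hns, hns'⟩ := hlim.exists_seq_tendsto_ae
      filter_upwards [hae, hns'] with ω h1 h2
      obtain ⟨x, hx⟩ := h1
      have hxZ : x = Z t ω := tendsto_nhds_unique (hx.comp hns.tendsto_atTop) h2
      refine Tendsto.limUnder_eq ?_
      rw [← hxZ]
      exact (tendsto_add_atTop_iff_nat N).1 hx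
    · have hle : ∀ n, probNorm P (A (n + 1 + N) t - A (n + N) t) ≤ 2 * (1 / 2) ^ n := by
        intro n
        refine (probNorm_sub_le (hm _) (hm t)).trans ?_
        rw [two_mul]
        refine add_le_add ((hd (n + 1)).trans (pow_le_pow_right_of_le_one' (by simp) (by omega))) ?_
        rw [probNorm_sub_comm]
        exact hd n
      refine ne_top_of_le_ne_top ?_ (ENNReal.tsum_le_tsum hle)
      rw [ENNReal.tsum_mul_left, ENNReal.tsum_geometric]
      refine ENNReal.mul_ne_top (by simp) ?_
      simp

end Predictable

end LevySPDE

namespace LevySPDE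

/-! ### Existence of the stochastic convolution -/

section StochasticConvolution

variable {Ω : Type*} {mΩ : MeasurableSpace Ω} {P : Measure Ω} [IsProbabilityMeasure P]
  {ℱ : Filtration ℝ≥0 mΩ}
  {H : Type*} [NormedAddCommGroup H] [InnerProductSpace ℝ H] [CompleteSpace H]
  [TopologicalSpace.SeparableSpace H] [MeasurableSpace H] [BorelSpace H]
  {U : Type*} [NormedAddCommGroup U] [InnerProductSpace ℝ U] [CompleteSpace U]
  [MeasurableSpace U] [BorelSpace U]
  {W : ℝ≥0 → H → Ω → ℝ} {Y : ℝ≥0 → Ω → U} {S : ℝ≥0 → H →L[ℝ] H}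

lemma stronglyMeasurable_stieltjesSum_of_adapted (hY : StronglyAdapted ℱ Y) (Φ : ℝ≥0 → U →L[ℝ] H) {c d t : ℝ≥0}
    (hd : d ≤ t) (π : TaggedPartition c d) : StronglyMeasurable[ℱ t] (stieltjesSum Φ Y π) := by
  refine Finset.stronglyMeasurable_fun_sum _ fun i hi => ?_
  have hle : ∀ j ≤ π.n, π.pt j ≤ t := fun j hj => (π.mono hj).trans (π.pt_n.le.trans hd)
  have hi' := Finset.mem_range.1 hi
  exact (Φ _).continuous.comp_stronglyMeasurable
    (((hY _).mono (ℱ.mono (hle _ hi'))).sub ((hY _).mono (ℱ.mono (hle _ hi'.le))))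

/-- Jump convolutions have adapted versions. -/
lemma IsJumpConvolution.exists_adapted {K : ℝ≥0 → U →L[ℝ] H} (hY : StronglyAdapted ℱ Y)
    {t : ℝ≥0} {I : Ω → H} (h : IsJumpConvolution P K Y t I) :
    ∃ I', StronglyMeasurable[ℱ t] I' ∧ I' =ᵐ[P] I := by
  rcases (zero_le : 0 ≤ t).eq_or_lt with ht | ht
  · exact ⟨0, stronglyMeasurable_zero, (h.1 ht.symm).symm⟩
  obtain ⟨J, hJ, hJI⟩ := h.2 ht
  have hne : NeBot (𝓝[<] t) := nhdsLT_neBot_of_exists_lt ⟨0, ht⟩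
  refine exists_stronglyMeasurable_of_tendstoInMeasure ?_ hJI
  filter_upwards [self_mem_nhdsWithin] with d hd
  have := TaggedPartition.fine_neBot (zero_le : 0 ≤ d)
  exact exists_stronglyMeasurable_of_tendstoInMeasure (Eventually.of_forall fun π =>
    ⟨_, stronglyMeasurable_stieltjesSum_of_adapted hY _ (mem_Iio.1 hd).le π, EventuallyEq.rfl⟩)
    (isStieltjesIntegral_iff.1 (hJ d hd))

/-- Wiener integrals have adapted versions. -/
lemma IsWienerIntegral.exists_adapted (hW : IsCylindricalWiener W ℱ P) {Φ : ℝ≥0 → H →L[ℝ] H}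
    {t : ℝ≥0} (hΦ : ∀ x, ContinuousOn (fun s => Φ s x) (Iio t)) {I : Ω → H}
    (h : IsWienerIntegral P Φ W t I) : ∃ I', StronglyMeasurable[ℱ t] I' ∧ I' =ᵐ[P] I := by
  obtain ⟨φ, hφ, hφI⟩ := h.exists_tendsto hW hΦ
  exact exists_stronglyMeasurable_of_tendstoInMeasure (Eventually.of_forall fun n =>
    ⟨_, (φ n).stronglyMeasurable_integral hW (hφ n), EventuallyEq.rfl⟩) hφI

lemma IsWienerIntegral.congr {Φ : ℝ≥0 → H →L[ℝ] H} {t : ℝ≥0} {I I' : Ω → H}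
    (h : IsWienerIntegral P Φ W t I) (hI : I =ᵐ[P] I') : IsWienerIntegral P Φ W t I' := by
  refine ⟨h.1.congr hI, ?_⟩
  obtain ⟨φ, h1, h2, h3⟩ := h.2
  refine ⟨φ, h1, h2, h3.congr fun n => lintegral_congr_ae ?_⟩
  filter_upwards [hI] with ω hω
  simp only [hω]

lemma IsJumpConvolution.congr {K : ℝ≥0 → U →L[ℝ] H} {t : ℝ≥0} {I I' : Ω → H}
    (h : IsJumpConvolution P K Y t I) (hI : I =ᵐ[P] I') : IsJumpConvolution P K Y t I' := by
  refine ⟨fun ht => hI.symm.trans (h.1 ht), fun ht => ?_⟩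
  obtain ⟨J, hJ, hJI⟩ := h.2 ht
  exact ⟨J, hJ, hJI.congr' (Eventually.of_forall fun _ => EventuallyEq.rfl) hI⟩

lemma exists_isConvolutionAt {G : ℝ≥0 → H →L[ℝ] H} {T : ℝ≥0 → U →L[ℝ] H} (c : ℝ≥0 → H)
    (hN : IsLevyNoise W Y ℱ P) (hS : IsC0Semigroup S) (hG : IsOrbit S G) (hT : IsOrbit S T)
    (hI : ∀ t, 0 < t → t ≤ 1 → ∃ I, IsJumpIntegral P T Y t I)
    (hi : ∫⁻ s in Ioc (0 : ℝ) 1, hilbertSchmidtSq (G s.toNNReal) < ∞) (t : ℝ≥0) :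
    ∃ Z, StronglyMeasurable[ℱ t] Z ∧ IsConvolutionAt P c G T W Y t Z := by
  have hc := hG.continuousOn_tsub hS t
  obtain ⟨IW, hIW⟩ := exists_isWienerIntegral hN.wiener hc
    ((lintegral_reflect G t).trans_lt (hG.lintegral_hilbertSchmidtSq_lt_top hS hi t))
  obtain ⟨IY, hIY⟩ : ∃ IY, IsJumpConvolution P T Y t IY := by
    rcases (zero_le : 0 ≤ t).eq_or_lt with ht | ht
    · exact ⟨0, fun _ => EventuallyEq.rfl, fun h => absurd ht h.ne⟩
    · obtain ⟨I, hI⟩ := exists_isJumpIntegral hN.levy hS hT hI ht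
      obtain ⟨I', -, h, -⟩ := hI.exists_isJumpConvolution hN.levy ht
      exact ⟨I', h⟩
  obtain ⟨IW', hW', hWe⟩ := hIW.exists_adapted hN.wiener hc
  obtain ⟨IY', hY', hYe⟩ := hIY.exists_adapted hN.levy.adapted
  exact ⟨fun ω => c t + IW' ω + IY' ω, (stronglyMeasurable_const.add hW').add hY', IW', IY',
    hIW.congr hWe.symm, hIY.congr hYe.symm, Eventually.of_forall fun _ => rfl⟩

lemma IsConvolutionAt.congr {G : ℝ≥0 → H →L[ℝ] H} {T : ℝ≥0 → U →L[ℝ] H} {c : ℝ≥0 → H} {t : ℝ≥0}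
    {Z Z' : Ω → H} (h : IsConvolutionAt P c G T W Y t Z) (hZ : Z' =ᵐ[P] Z) :
    IsConvolutionAt P c G T W Y t Z' := by
  obtain ⟨IW, IY, h1, h2, h3⟩ := h
  exact ⟨IW, IY, h1, h2, hZ.trans h3⟩

variable {ι : H →L[ℝ] U} {a : U} {Q R : H →ₗ.[ℝ] H} {p : ℝ} {ZA : ℝ≥0 → Ω → H}

lemma hasInnovations_stochasticConvolution (hι : DenseRange ι) (hS : IsC0Semigroup S)
    (hR : IsSqrtOf R Q) (hN : IsLevyNoise W Y ℱ P) (h1 : SemigroupHypothesis ι S a R) (hp : 0 < p)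
    (h2 : JumpHypothesis P ι S Y p) (hm : StronglyAdapted ℱ ZA)
    (hZ : ∀ t, IsConvolutionAt P (fun t => ∫ s in (0 : ℝ)..t, extendAlong ι (S s.toNNReal) a)
      (fun s => boundedComp (S s) R) (fun s => extendAlong ι (S s)) W Y t (ZA t)) :
    HasInnovations S ℱ P p ZA := by
  have hT := isOrbit_extendAlong hι hS h1.exists_extension
  have hG := isOrbit_boundedComp hS hR.nonnegSelfAdjoint.selfAdjoint.dense_domain
    h1.exists_boundedComp
  obtain ⟨I, hI, hIp, hI0⟩ := h2
  refine hasInnovations_of_isConvolutionAt hN hS hG hT hp hI (fun t h0 h1 => ?_) hI0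
    (hT.integral_add hS h1.drift_integrable) (hT.tendsto_integral_zero hS h1.drift_integrable)
    h1.hilbertSchmidt_integrable hZ hm
  exact (le_iSup₂ (f := fun t (_ : t ∈ Ioc (0 : ℝ≥0) 1) => ∫⁻ ω, ‖I t ω‖ₑ ^ p ∂P) t
    ⟨h0, h1⟩).trans_lt hIp

lemma IsStochasticConvolution.hasInnovations (hZA : IsStochasticConvolution ℱ P ι S a R W Y ZA)
    (hι : DenseRange ι) (hS : IsC0Semigroup S) (hR : IsSqrtOf R Q) (hN : IsLevyNoise W Y ℱ P)
    (h1 : SemigroupHypothesis ι S a R) (hp : 0 < p) (h2 : JumpHypothesis P ι S Y p) :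
    HasInnovations S ℱ P p ZA :=
  hasInnovations_stochasticConvolution hι hS hR hN h1 hp h2 hZA.predictable.stronglyAdapted hZA.eq

/-- Adapted versions at each fixed time already have innovations, hence are continuous in p-th mean
and in probability; this provides the predictable modification, for which the defining relations
persist. -/
lemma exists_isStochasticConvolution (hι : DenseRange ι) (hS : IsC0Semigroup S)
    (hR : IsSqrtOf R Q) (hN : IsLevyNoise W Y ℱ P) (h1 : SemigroupHypothesis ι S a R) (hp : 0 < p)
    (h2 : JumpHypothesis P ι S Y p) : ∃ ZA, IsStochasticConvolution ℱ P ι S a R W Y ZA := by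
  have hT := isOrbit_extendAlong hι hS h1.exists_extension
  have hG := isOrbit_boundedComp hS hR.nonnegSelfAdjoint.selfAdjoint.dense_domain
    h1.exists_boundedComp
  obtain ⟨I, hI, hI'⟩ := id h2
  choose Z hZm hZ using exists_isConvolutionAt
    (fun t => ∫ s in (0 : ℝ)..t, extendAlong ι (S s.toNNReal) a) hN hS hG hT
    (fun t h0 h1 => ⟨_, hI t h0 h1⟩) h1.hilbertSchmidt_integrable
  have hin := hasInnovations_stochasticConvolution hι hS hR hN h1 hp h2 hZm hZ
  obtain ⟨Z', hZ'p, hZ'⟩ := exists_predictable_modification hZm fun t =>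
    tendstoInMeasure_of_lintegral_rpow hp (fun i => (hin.stronglyMeasurable i).aestronglyMeasurable)
      (hin.stronglyMeasurable t).aestronglyMeasurable (hin.tendsto_lintegral_sub hS hp t)
  exact ⟨Z', hZ'p, fun t => (hZ t).congr (hZ' t)⟩

end StochasticConvolution

end LevySPDE

namespace LevySPDE

/-! ### Deterministic convolutions with the semigroup -/

section DriftConvolution

variable {H : Type*} [NormedAddCommGroup H] [InnerProductSpace ℝ H]
  {S : ℝ≥0 → H →L[ℝ] H} {u v : ℝ≥0 → H} {C M : ℝ}

/-- The convolution `∫_0^t S_{t-s} u(s) ds`. -/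
noncomputable def driftConv (S : ℝ≥0 → H →L[ℝ] H) (u : ℝ≥0 → H) (t : ℝ≥0) : H :=
  ∫ s in (0 : ℝ)..t, S (t - s.toNNReal) (u s.toNNReal)

variable [CompleteSpace H]

lemma stronglyMeasurable_driftConv_integrand (hS : IsC0Semigroup S) (hu : StronglyMeasurable u)
    (t : ℝ≥0) : StronglyMeasurable fun s : ℝ => S (t - s.toNNReal) (u s.toNNReal) := by
  refine hS.continuous_uncurry.comp_stronglyMeasurable
    (f := fun s : ℝ => (t - s.toNNReal, u s.toNNReal)) (StronglyMeasurable.prodMk ?_ ?_)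
  · exact (by fun_prop : Measurable fun s : ℝ => t - s.toNNReal).stronglyMeasurable
  · exact hu.comp_measurable measurable_real_toNNReal

lemma intervalIntegrable_driftConv (hS : IsC0Semigroup S) (hu : StronglyMeasurable u)
    (hC : ∀ s, ‖u s‖ ≤ C) (t : ℝ≥0) (α β : ℝ) :
    IntervalIntegrable (fun s : ℝ => S (t - s.toNNReal) (u s.toNNReal)) volume α β := by
  obtain ⟨M, hM1, hM⟩ := hS.exists_norm_le t
  refine (intervalIntegrable_const (c := M * C)).mono_fun
    (stronglyMeasurable_driftConv_integrand hS hu t).aestronglyMeasurable ?_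
  refine Eventually.of_forall fun s => ?_
  refine le_trans ?_ (le_abs_self _)
  exact ((S _).le_opNorm _).trans (mul_le_mul (hM _ tsub_le_self) (hC _) (norm_nonneg _)
    (by linarith))

lemma norm_driftConv_le {t : ℝ≥0} (hM : ∀ s ≤ t, ‖S s‖ ≤ M) (hC : ∀ s, ‖u s‖ ≤ C) :
    ‖driftConv S u t‖ ≤ M * C * t := by
  have hM0 : 0 ≤ M := (norm_nonneg _).trans (hM 0 zero_le)
  refine (intervalIntegral.norm_integral_le_of_norm_le_const fun s _ => ?_).trans_eq
    (by rw [sub_zero, abs_of_nonneg (NNReal.coe_nonneg t)])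
  exact ((S _).le_opNorm _).trans (mul_le_mul (hM _ tsub_le_self) (hC _) (norm_nonneg _) hM0)

lemma enorm_driftConv_sub_le (hS : IsC0Semigroup S) (hu : StronglyMeasurable u)
    (hv : StronglyMeasurable v) (hCu : ∀ s, ‖u s‖ ≤ C) (hCv : ∀ s, ‖v s‖ ≤ C) {t : ℝ≥0}
    (hM : ∀ s ≤ t, ‖S s‖ ≤ M) :
    ‖driftConv S u t - driftConv S v t‖ₑ ≤
      ENNReal.ofReal M * ∫⁻ s in Ioc (0 : ℝ) t, ‖u s.toNNReal - v s.toNNReal‖ₑ := by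
  rw [driftConv, driftConv, ← intervalIntegral.integral_sub
    (intervalIntegrable_driftConv hS hu hCu _ _ _) (intervalIntegrable_driftConv hS hv hCv _ _ _),
    intervalIntegral.integral_of_le (NNReal.coe_nonneg t)]
  refine (enorm_integral_le_lintegral_enorm _).trans ?_
  rw [← lintegral_const_mul' _ _ ENNReal.ofReal_ne_top]
  refine lintegral_mono fun s => ?_
  rw [← map_sub]
  refine ((S _).le_opENorm _).trans ?_
  gcongr
  rw [← ofReal_norm]
  exact ENNReal.ofReal_le_ofReal (hM _ tsub_le_self)

/-- Over a fixed interval, with the upper limit written as an indicator, the integrands converge at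
every s ≠ t and are bounded. No continuity of u is needed. -/
lemma continuous_driftConv (hS : IsC0Semigroup S) (hu : StronglyMeasurable u)
    (hC : ∀ s, ‖u s‖ ≤ C) : Continuous (driftConv S u) := by
  rw [continuous_iff_continuousAt]
  intro t
  obtain ⟨M, hM1, hM⟩ := hS.exists_norm_le (t + 1)
  have hlt : ∀ᶠ t' : ℝ≥0 in 𝓝 t, t' < t + 1 := gt_mem_nhds (lt_add_one t)
  have heq : ∀ t' : ℝ≥0, t' < t + 1 → driftConv S u t' = ∫ s in Ioc (0 : ℝ) (t + 1),
      (Iic (t' : ℝ)).indicator (fun s : ℝ => S (t' - s.toNNReal) (u s.toNNReal)) s := by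
    intro t' ht'
    rw [setIntegral_indicator measurableSet_Iic, Ioc_inter_Iic, min_eq_right (by exact_mod_cast ht'.le),
      driftConv, intervalIntegral.integral_of_le (NNReal.coe_nonneg t')]
  rw [ContinuousAt, heq t (lt_add_one t)]
  refine Tendsto.congr' (hlt.mono fun t' ht' => (heq t' ht').symm) ?_
  refine tendsto_integral_filter_of_dominated_convergence (fun _ => M * C) ?_ ?_
    (integrable_const _) ?_
  · exact Eventually.of_forall fun t' => ((stronglyMeasurable_driftConv_integrand hS hu
      t').indicator measurableSet_Iic).aestronglyMeasurable
  · filter_upwards [hlt] with t' ht'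
    refine Eventually.of_forall fun s => (norm_indicator_le_norm_self _ _).trans ?_
    exact ((S _).le_opNorm _).trans (mul_le_mul (hM _ (tsub_le_self.trans ht'.le)) (hC _)
      (norm_nonneg _) (by linarith))
  · have hne : ∀ᵐ s : ℝ, s ≠ t := by simp [ae_iff]
    filter_upwards [ae_restrict_of_ae hne] with s hs
    rcases lt_or_gt_of_ne hs with h | h
    · rw [indicator_of_mem (mem_Iic.2 h.le)]
      have h1 : ∀ᶠ t' : ℝ≥0 in 𝓝 t, s < t' :=
        NNReal.continuous_coe.continuousAt.eventually (lt_mem_nhds h)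
      have h2 : Tendsto (fun t' => S (t' - s.toNNReal) (u s.toNNReal)) (𝓝 t)
          (𝓝 (S (t - s.toNNReal) (u s.toNNReal))) :=
        ((hS.continuous (u s.toNNReal)).comp (continuous_sub_right s.toNNReal)).tendsto t
      refine h2.congr' (h1.mono fun t' ht' => ?_)
      exact (indicator_of_mem (M := H) (mem_Iic.2 ht'.le)
        fun s : ℝ => S (t' - s.toNNReal) (u s.toNNReal)).symm
    · rw [indicator_of_notMem (by simpa using h)]
      have h1 : ∀ᶠ t' : ℝ≥0 in 𝓝 t, (t' : ℝ) < s :=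
        NNReal.continuous_coe.continuousAt.eventually (gt_mem_nhds h)
      refine tendsto_const_nhds.congr' (h1.mono fun t' ht' => ?_)
      exact (indicator_of_notMem (fun h => absurd (mem_Iic.1 h) (not_le.2 ht')) _).symm

lemma driftConv_add (hS : IsC0Semigroup S) (hu : StronglyMeasurable u)
    (hC : ∀ s, ‖u s‖ ≤ C) (s h : ℝ≥0) :
    driftConv S u (s + h) = S h (driftConv S u s) + driftConv S (fun r => u (s + r)) h := by
  rw [driftConv, ← intervalIntegral.integral_add_adjacent_intervals
    (intervalIntegrable_driftConv hS hu hC _ 0 s) (intervalIntegrable_driftConv hS hu hC _ s _)]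
  congr 1
  · rw [driftConv, ← ContinuousLinearMap.intervalIntegral_comp_comm _
      (intervalIntegrable_driftConv hS hu hC _ _ _)]
    refine intervalIntegral.integral_congr fun r hr => ?_
    rw [uIcc_of_le (NNReal.coe_nonneg s)] at hr
    have hr' : r.toNNReal ≤ s := Real.toNNReal_le_iff_le_coe.2 hr.2
    rw [← hS.add_apply, add_comm s h, add_tsub_assoc_of_le hr']
  · have h3 := intervalIntegral.integral_comp_add_left (a := 0) (b := h)
      (fun r : ℝ => S (s + h - r.toNNReal) (u r.toNNReal)) (s : ℝ)
    rw [add_zero, ← NNReal.coe_add] at h3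
    rw [← h3, driftConv]
    refine intervalIntegral.integral_congr fun r hr => ?_
    rw [uIcc_of_le (NNReal.coe_nonneg h)] at hr
    rw [Real.toNNReal_add (NNReal.coe_nonneg s) hr.1, Real.toNNReal_coe, add_tsub_add_eq_tsub_left]

/-- The rate 2K, twice the constant of the integral operator, produces the factor 1/2. It is the
contraction constant both for Gronwall's lemma and for successive approximation. -/
lemma lintegral_ofReal_exp_le {K : ℝ} (hK : 0 ≤ K) (t : ℝ≥0) :
    ENNReal.ofReal K * ∫⁻ s in Ioc (0 : ℝ) t, ENNReal.ofReal (Real.exp (2 * K * s)) ≤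
      ENNReal.ofReal (Real.exp (2 * K * t)) / 2 := by
  have hc : Continuous fun s : ℝ => K * Real.exp (2 * K * s) := by fun_prop
  have hi : IntegrableOn (fun s : ℝ => K * Real.exp (2 * K * s)) (Ioc 0 t) :=
    (hc.integrableOn_Icc).mono_set Ioc_subset_Icc_self
  rw [← lintegral_const_mul' _ _ ENNReal.ofReal_ne_top]
  simp_rw [← ENNReal.ofReal_mul hK]
  rw [← ofReal_integral_eq_lintegral_ofReal hi
    (Eventually.of_forall fun s => mul_nonneg hK (Real.exp_nonneg _)),
    ← intervalIntegral.integral_of_le (NNReal.coe_nonneg t),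
    intervalIntegral.integral_eq_sub_of_hasDerivAt (f := fun s => Real.exp (2 * K * s) / 2)
      (fun s _ => ?_) (hc.intervalIntegrable _ _)]
  · rw [show (2 : ℝ≥0∞) = ENNReal.ofReal 2 by simp, ← ENNReal.ofReal_div_of_pos two_pos]
    refine ENNReal.ofReal_le_ofReal (sub_le_self _ (by positivity))
  · have h1 : HasDerivAt (fun s : ℝ => 2 * K * s) (2 * K * 1) s := (hasDerivAt_id s).const_mul _
    refine (h1.exp.div_const 2).congr_deriv ?_
    ring

lemma lintegral_le_of_le_exp {K : ℝ} (hK : 0 ≤ K) {f : ℝ≥0 → ℝ≥0∞} {A : ℝ≥0∞} {t : ℝ≥0} (hA : A ≠ ∞)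
    (h : ∀ s ≤ t, f s ≤ A * ENNReal.ofReal (Real.exp (2 * K * s))) :
    ENNReal.ofReal K * ∫⁻ s in Ioc (0 : ℝ) t, f s.toNNReal ≤
      A / 2 * ENNReal.ofReal (Real.exp (2 * K * t)) := by
  calc ENNReal.ofReal K * ∫⁻ s in Ioc (0 : ℝ) t, f s.toNNReal
      ≤ ENNReal.ofReal K * ∫⁻ s in Ioc (0 : ℝ) t, A * ENNReal.ofReal (Real.exp (2 * K * s)) := by
        refine mul_le_mul' le_rfl (setLIntegral_mono' measurableSet_Ioc fun s hs => ?_)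
        refine (h _ (Real.toNNReal_le_iff_le_coe.2 hs.2)).trans_eq ?_
        rw [Real.coe_toNNReal _ hs.1.le]
    _ = A * (ENNReal.ofReal K * ∫⁻ s in Ioc (0 : ℝ) t, ENNReal.ofReal (Real.exp (2 * K * s))) := by
        rw [lintegral_const_mul' _ _ hA]; ring
    _ ≤ A * (ENNReal.ofReal (Real.exp (2 * K * t)) / 2) := by
        gcongr
        exact lintegral_ofReal_exp_le hK t
    _ = _ := by rw [div_eq_mul_inv, div_eq_mul_inv]; ring

/-- Gronwall's lemma for bounded functions without continuity. -/
lemma le_of_le_add_lintegral {K : ℝ} (hK : 0 ≤ K) {f : ℝ≥0 → ℝ≥0∞} {b B : ℝ≥0∞} {t : ℝ≥0}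
    (hB : B ≠ ∞) (hfB : ∀ s ≤ t, f s ≤ B)
    (h : ∀ s ≤ t, f s ≤ b + ENNReal.ofReal K * ∫⁻ r in Ioc (0 : ℝ) s, f r.toNNReal) :
    f t ≤ 2 * b * ENNReal.ofReal (Real.exp (2 * K * t)) := by
  set e : ℝ≥0 → ℝ≥0∞ := fun s => ENNReal.ofReal (Real.exp (2 * K * s)) with he
  have he1 : ∀ s, 1 ≤ e s := fun s => by
    rw [he, ← ENNReal.ofReal_one]
    exact ENNReal.ofReal_le_ofReal (Real.one_le_exp (by positivity))
  have he0 : ∀ s, e s ≠ 0 := fun s => (one_pos.trans_le (he1 s)).ne'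
  have het : ∀ s, e s ≠ ∞ := fun s => ENNReal.ofReal_ne_top
  -- The weighted supremum is finite by the a priori bound B, so φ / 2 may be subtracted from φ ≤ b
  -- + φ / 2.
  set φ : ℝ≥0∞ := ⨆ s ∈ Iic t, f s / e s with hφ
  have hφB : φ ≤ B := iSup₂_le fun s hs => ENNReal.div_le_of_le_mul
    ((hfB s hs).trans (le_mul_of_one_le_right' (he1 s)))
  have hφt : φ ≠ ∞ := ne_top_of_le_ne_top hB hφB
  have hf : ∀ s ≤ t, f s ≤ φ * e s := fun s hs =>
    (ENNReal.div_le_iff (he0 s) (het s)).1 (le_iSup₂ (f := fun s (_ : s ∈ Iic t) => f s / e s) s hs)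
  have hle : φ ≤ b + φ / 2 := iSup₂_le fun s hs => by
    rw [ENNReal.div_le_iff (he0 s) (het s), add_mul]
    refine (h s hs).trans (add_le_add (le_mul_of_one_le_right' (he1 s)) ?_)
    exact lintegral_le_of_le_exp hK hφt fun r hr => hf r (hr.trans hs)
  have hφ2 : φ / 2 ≤ b := by
    rw [← ENNReal.add_halves φ] at hle
    refine (ENNReal.add_le_add_iff_right (a := φ / 2) (ENNReal.div_ne_top hφt two_ne_zero)).1 ?_
    exact (hle.trans (by rw [ENNReal.add_halves]))
  have hφb : φ ≤ 2 * b := by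
    rw [mul_comm]
    exact (ENNReal.div_le_iff two_ne_zero ENNReal.ofNat_ne_top).1 hφ2
  exact (hf t le_rfl).trans (by gcongr)

end DriftConvolution

end LevySPDE

namespace LevySPDE

/-! ### Mild solutions -/

section Mild

variable {H : Type*} [NormedAddCommGroup H] [InnerProductSpace ℝ H] [CompleteSpace H]
  {S : ℝ≥0 → H →L[ℝ] H} {F : H → H} {L : ℝ≥0} {C M : ℝ}

lemma enorm_driftConv_comp_sub_le (hS : IsC0Semigroup S) (hF : LipschitzWith L F)
    (hC : ∀ x, ‖F x‖ ≤ C) {x y : ℝ≥0 → H} (hx : StronglyMeasurable x) (hy : StronglyMeasurable y)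
    {t : ℝ≥0} (hM : ∀ s ≤ t, ‖S s‖ ≤ M) :
    ‖driftConv S (fun s => F (x s)) t - driftConv S (fun s => F (y s)) t‖ₑ ≤
      ENNReal.ofReal (M * L) * ∫⁻ s in Ioc (0 : ℝ) t, ‖x s.toNNReal - y s.toNNReal‖ₑ := by
  have hM0 : 0 ≤ M := (norm_nonneg _).trans (hM 0 zero_le)
  refine (enorm_driftConv_sub_le hS (hF.continuous.comp_stronglyMeasurable hx)
    (hF.continuous.comp_stronglyMeasurable hy) (fun _ => hC _) (fun _ => hC _) hM).trans ?_
  rw [ENNReal.ofReal_mul hM0, ENNReal.ofReal_coe_nnreal, mul_assoc]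
  gcongr
  rw [← lintegral_const_mul' _ _ ENNReal.coe_ne_top]
  refine lintegral_mono fun s => ?_
  simpa [edist_eq_enorm_sub] using hF (x s.toNNReal) (y s.toNNReal)

/-- Stability of solutions of the mild equation. -/
lemma enorm_sub_le_of_mild (hS : IsC0Semigroup S) (hF : LipschitzWith L F)
    (hC : ∀ x, ‖F x‖ ≤ C) {x y g h : ℝ≥0 → H} (hx : StronglyMeasurable x)
    (hy : StronglyMeasurable y) {t : ℝ≥0} (hM : ∀ s ≤ t, ‖S s‖ ≤ M)
    (hxg : ∀ s ≤ t, x s = g s + driftConv S (fun r => F (x r)) s)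
    (hyh : ∀ s ≤ t, y s = h s + driftConv S (fun r => F (y r)) s) {b : ℝ≥0∞} (hb : b ≠ ∞)
    (hgh : ∀ s ≤ t, ‖g s - h s‖ₑ ≤ b) :
    ‖x t - y t‖ₑ ≤ 2 * b * ENNReal.ofReal (Real.exp (2 * (M * L) * t)) := by
  have hM0 : 0 ≤ M := (norm_nonneg _).trans (hM 0 zero_le)
  have hC0 : 0 ≤ C := (norm_nonneg _).trans (hC 0)
  have hsub : ∀ s ≤ t, ‖x s - y s‖ₑ ≤ b +
      ‖driftConv S (fun r => F (x r)) s - driftConv S (fun r => F (y r)) s‖ₑ := fun s hs => by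
    rw [hxg s hs, hyh s hs, add_sub_add_comm]
    exact (enorm_add_le _ _).trans (add_le_add (hgh s hs) le_rfl)
  refine le_of_le_add_lintegral (f := fun s => ‖x s - y s‖ₑ) (by positivity)
    (B := b + ENNReal.ofReal (2 * (M * C * t))) (by finiteness) (fun s hs => ?_) fun s hs => ?_
  · refine (hsub s hs).trans (add_le_add le_rfl ?_)
    rw [← ofReal_norm]
    refine ENNReal.ofReal_le_ofReal ((norm_sub_le _ _).trans ?_)
    have h1 : ∀ z : ℝ≥0 → H, ‖driftConv S (fun r => F (z r)) s‖ ≤ M * C * t := fun z =>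
      (norm_driftConv_le (fun r hr => hM r (hr.trans hs)) fun _ => hC _).trans (by gcongr)
    linarith [h1 x, h1 y]
  · exact (hsub s hs).trans (add_le_add le_rfl
      (enorm_driftConv_comp_sub_le hS hF hC hx hy fun r hr => hM r (hr.trans hs)))

lemma eq_of_mild (hS : IsC0Semigroup S) (hF : LipschitzWith L F)
    (hC : ∀ x, ‖F x‖ ≤ C) {x y g : ℝ≥0 → H} (hx : StronglyMeasurable x)
    (hy : StronglyMeasurable y) (hxg : ∀ s, x s = g s + driftConv S (fun r => F (x r)) s)
    (hyg : ∀ s, y s = g s + driftConv S (fun r => F (y r)) s) (t : ℝ≥0) : x t = y t := by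
  obtain ⟨M, -, hM⟩ := hS.exists_norm_le t
  have h := enorm_sub_le_of_mild hS hF hC hx hy hM (fun s _ => hxg s) (fun s _ => hyg s)
    ENNReal.zero_ne_top (by simp)
  simpa [sub_eq_zero] using h

variable {Ω : Type*} {mΩ : MeasurableSpace Ω} {ℱ : Filtration ℝ≥0 mΩ}

lemma predictable_le_prod (ℱ : Filtration ℝ≥0 mΩ) : ℱ.predictable ≤ Prod.instMeasurableSpace := by
  refine MeasurableSpace.generateFrom_le ?_
  rintro s (⟨A, hA, rfl⟩ | ⟨i, A, hA, rfl⟩)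
  · exact (measurableSet_singleton _).prod (ℱ.le _ _ hA)
  · exact measurableSet_Ioi.prod (ℱ.le _ _ hA)

lemma stronglyMeasurable_uncurry_of_predictable {u : ℝ≥0 → Ω → H}
    (hu : IsStronglyPredictable ℱ u) : StronglyMeasurable (Function.uncurry u) :=
  StronglyMeasurable.mono hu (predictable_le_prod ℱ)

lemma stronglyMeasurable_path {u : ℝ≥0 → Ω → H}
    (hu : IsStronglyPredictable ℱ u) (ω : Ω) : StronglyMeasurable fun t => u t ω :=
  (stronglyMeasurable_uncurry_of_predictable hu).comp_measurable measurable_prodMk_right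

/-- Stated for an arbitrary σ-algebra on Ω, to be applied with `ℱ t`. Clamping the time by t makes
the integrand a function on the whole line without changing it on (0, t]. -/
lemma stronglyMeasurable_setIntegral_semigroup {Ω : Type*} [MeasurableSpace Ω]
    (hS : IsC0Semigroup S) {t : ℝ≥0} {v : Iic t × Ω → H} (hv : StronglyMeasurable v) :
    StronglyMeasurable fun ω => ∫ s in Ioc (0 : ℝ) t,
      S (t - s.toNNReal) (v (⟨min s.toNNReal t, mem_Iic.2 (min_le_right _ _)⟩, ω)) := by
  refine StronglyMeasurable.integral_prod_left' (f := fun q : ℝ × Ω => S (t - q.1.toNNReal)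
    (v (⟨min q.1.toNNReal t, mem_Iic.2 (min_le_right _ _)⟩, q.2))) ?_
  refine hS.continuous_uncurry.comp_stronglyMeasurable (f := fun q : ℝ × Ω => (t - q.1.toNNReal,
    v (⟨min q.1.toNNReal t, mem_Iic.2 (min_le_right _ _)⟩, q.2))) (StronglyMeasurable.prodMk ?_ ?_)
  · exact (by fun_prop : Measurable fun q : ℝ × Ω => t - q.1.toNNReal).stronglyMeasurable
  · refine hv.comp_measurable (Measurable.prodMk (Measurable.subtype_mk ?_) measurable_snd)
    fun_prop

lemma stronglyAdapted_driftConv (hS : IsC0Semigroup S) {u : ℝ≥0 → Ω → H}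
    (hu : IsStronglyProgressive ℱ u) :
    StronglyAdapted ℱ fun t ω => driftConv S (fun s => u s ω) t := by
  intro t
  have h := @stronglyMeasurable_setIntegral_semigroup H _ _ _ S Ω (ℱ t) hS t _ (hu t)
  have heq : (fun ω => driftConv S (fun s => u s ω) t) = fun ω => ∫ s in Ioc (0 : ℝ) t,
      S (t - s.toNNReal) (u (min s.toNNReal t) ω) := by
    funext ω
    rw [driftConv, intervalIntegral.integral_of_le (NNReal.coe_nonneg t)]
    refine setIntegral_congr_fun measurableSet_Ioc fun s hs => ?_
    rw [min_eq_left (Real.toNNReal_le_iff_le_coe.2 hs.2)]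
  exact Eq.mpr (congrArg (fun f => StronglyMeasurable[ℱ t] f) heq) h

variable [SecondCountableTopology H]

lemma isStronglyPredictable_driftConv (hS : IsC0Semigroup S) {u : ℝ≥0 → Ω → H}
    (hu : IsStronglyPredictable ℱ u) (hC : ∀ s ω, ‖u s ω‖ ≤ C) :
    IsStronglyPredictable ℱ fun t ω => driftConv S (fun s => u s ω) t :=
  isStronglyPredictable_of_continuous (stronglyAdapted_driftConv hS hu.isStronglyProgressive)
    fun ω => continuous_driftConv hS (stronglyMeasurable_path hu ω) fun s => hC s ω

/-- Existence for the mild equation by successive approximation. -/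
lemma exists_mild (hS : IsC0Semigroup S) (hF : LipschitzWith L F) (hC : ∀ x, ‖F x‖ ≤ C)
    {g : ℝ≥0 → Ω → H} (hg : IsStronglyPredictable ℱ g) :
    ∃ X : ℝ≥0 → Ω → H, IsStronglyPredictable ℱ X ∧
      ∀ ω t, X t ω = g t ω + driftConv S (fun s => F (X s ω)) t := by
  have hC0 : 0 ≤ C := (norm_nonneg _).trans (hC 0)
  -- Successive approximations starting from g itself. They converge at every time and every
  -- outcome, so the limit is predictable and solves the equation without exceptional sets.
  let A : ℕ → ℝ≥0 → Ω → H := fun n => Nat.rec g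
    (fun _ X t ω => g t ω + driftConv S (fun s => F (X s ω)) t) n
  have hA0 : A 0 = g := rfl
  have hAs : ∀ n t ω, A (n + 1) t ω = g t ω + driftConv S (fun s => F (A n s ω)) t :=
    fun _ _ _ => rfl
  have hFA : ∀ {X : ℝ≥0 → Ω → H}, IsStronglyPredictable ℱ X →
      IsStronglyPredictable ℱ fun s ω => F (X s ω) := fun hX =>
    hF.continuous.comp_stronglyMeasurable hX
  have hA : ∀ n, IsStronglyPredictable ℱ (A n) := by
    intro n
    induction n with
    | zero => exact hg
    | succ n ih => exact hg.add (isStronglyPredictable_driftConv hS (hFA ih) fun _ _ => hC _)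
  have hpath := fun n => stronglyMeasurable_path (hA n)
  have hdiff : ∀ T : ℝ≥0, ∀ M : ℝ, (∀ s ≤ T, ‖S s‖ ≤ M) → ∀ ω n, ∀ t ≤ T,
      ‖A n t ω - A (n + 1) t ω‖ₑ ≤ ENNReal.ofReal (M * C * T) / 2 ^ n *
        ENNReal.ofReal (Real.exp (2 * (M * L) * t)) := by
    intro T M hM ω n
    have hM0 : 0 ≤ M := (norm_nonneg _).trans (hM 0 zero_le)
    induction n with
    | zero =>
      intro t ht
      rw [hAs, hA0, pow_zero, div_one, sub_add_cancel_left, enorm_neg, ← ofReal_norm]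
      refine le_trans (ENNReal.ofReal_le_ofReal ?_) (le_mul_of_one_le_right' ?_)
      · exact (norm_driftConv_le (fun r hr => hM r (hr.trans ht)) fun _ => hC _).trans (by gcongr)
      · rw [← ENNReal.ofReal_one]
        exact ENNReal.ofReal_le_ofReal (Real.one_le_exp (by positivity))
    | succ n ih =>
      intro t ht
      rw [hAs n, hAs (n + 1), add_sub_add_left_eq_sub]
      refine (enorm_driftConv_comp_sub_le hS hF hC (hpath n ω) (hpath (n + 1) ω)
        fun r hr => hM r (hr.trans ht)).trans ?_
      refine (lintegral_le_of_le_exp (f := fun s => ‖A n s ω - A (n + 1) s ω‖ₑ) (by positivity)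
        (A := ENNReal.ofReal (M * C * T) / 2 ^ n) ?_ fun r hr => ih r (hr.trans ht)).trans_eq ?_
      · exact ENNReal.div_ne_top ENNReal.ofReal_ne_top (pow_ne_zero _ two_ne_zero)
      · rw [pow_succ, ENNReal.div_eq_inv_mul, ENNReal.div_eq_inv_mul, ENNReal.div_eq_inv_mul,
          ENNReal.mul_inv (by simp) (by simp)]
        ring
  have hcau : ∀ ω t, ∃ x, Tendsto (fun n => A n t ω) atTop (𝓝 x) := by
    intro ω t
    obtain ⟨M, -, hM⟩ := hS.exists_norm_le t
    refine cauchySeq_tendsto_of_complete (cauchySeq_of_edist_le_geometric_two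
      (ENNReal.ofReal (M * C * t) * ENNReal.ofReal (Real.exp (2 * (M * L) * t))) (by finiteness)
      fun n => ?_)
    rw [edist_eq_enorm_sub]
    refine (hdiff t M hM ω n t le_rfl).trans_eq ?_
    rw [div_eq_mul_inv, div_eq_mul_inv]
    ring
  choose X hX using hcau
  have hXp : IsStronglyPredictable ℱ fun t ω => X ω t :=
    stronglyMeasurable_of_tendsto (u := atTop) (f := fun n => Function.uncurry (A n)) (hf := hA)
      (lim := tendsto_pi_nhds.2 fun q => hX q.2 q.1)
  refine ⟨fun t ω => X ω t, hXp, fun ω t => ?_⟩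
  refine tendsto_nhds_unique ((hX ω t).comp (tendsto_add_atTop_nat 1)) ?_
  refine Tendsto.add (tendsto_const_nhds (x := g t ω)) ?_
  obtain ⟨M, hM1, hM⟩ := hS.exists_norm_le t
  refine intervalIntegral.tendsto_integral_filter_of_dominated_convergence (fun _ => M * C)
    (Eventually.of_forall fun n => ?_) (Eventually.of_forall fun n => ?_) (by simp) ?_
  · exact (stronglyMeasurable_driftConv_integrand hS
      (stronglyMeasurable_path (hFA (hA n)) ω) t).aestronglyMeasurable
  · refine Eventually.of_forall fun s _ => ?_
    exact ((S _).le_opNorm _).trans (mul_le_mul (hM _ tsub_le_self) (hC _) (norm_nonneg _)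
      (by linarith))
  · refine Eventually.of_forall fun s _ => ?_
    exact ((S _).continuous.comp hF.continuous).continuousAt.tendsto.comp (hX ω s.toNNReal)

end Mild

end LevySPDE

namespace LevySPDE

/-! ### Existence and uniqueness of mild solutions -/

section Solutions

variable {H : Type*} [NormedAddCommGroup H] [InnerProductSpace ℝ H] [CompleteSpace H]
  [SecondCountableTopology H] {S : ℝ≥0 → H →L[ℝ] H} {F : H → H} {L : ℝ≥0} {C : ℝ}
  {Ω : Type*} {mΩ : MeasurableSpace Ω} {ℱ : Filtration ℝ≥0 mΩ} {P : Measure Ω}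
  {ZA X X' : ℝ≥0 → Ω → H} {x : H}

/-- A predictable process that satisfies the mild equation for all times and all outcomes. -/
structure IsStrictMildSolution (ℱ : Filtration ℝ≥0 mΩ) (S : ℝ≥0 → H →L[ℝ] H) (F : H → H)
    (ZA : ℝ≥0 → Ω → H) (x : H) (X : ℝ≥0 → Ω → H) : Prop where
  predictable : IsStronglyPredictable ℱ X
  eq : ∀ ω t, X t ω = S t x + ZA t ω + driftConv S (fun s => F (X s ω)) t

lemma IsC0Semigroup.isStronglyPredictable_apply (hS : IsC0Semigroup S) (x : H) :
    IsStronglyPredictable ℱ fun t (_ : Ω) => S t x :=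
  isStronglyPredictable_of_continuous (fun _ => stronglyMeasurable_const) fun _ => hS.continuous x

lemma exists_isStrictMildSolution (hS : IsC0Semigroup S) (hF : LipschitzWith L F)
    (hC : ∀ x, ‖F x‖ ≤ C) (hZ : IsStronglyPredictable ℱ ZA) (x : H) :
    ∃ X, IsStrictMildSolution ℱ S F ZA x X := by
  obtain ⟨X, hX, h⟩ := exists_mild hS hF hC (g := fun t ω => S t x + ZA t ω)
    ((hS.isStronglyPredictable_apply x).add hZ)
  exact ⟨X, hX, fun ω t => h ω t⟩

lemma IsStrictMildSolution.isPathwiseMildSolution (h : IsStrictMildSolution ℱ S F ZA x X)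
    (hS : IsC0Semigroup S) (hF : LipschitzWith L F) (hC : ∀ x, ‖F x‖ ≤ C) :
    IsPathwiseMildSolution ℱ P S F ZA x X := by
  refine ⟨h.predictable, Eventually.of_forall fun ω t => ⟨?_, ?_⟩⟩
  · exact intervalIntegrable_driftConv hS (u := fun s => F (X s ω))
      (hF.continuous.comp_stronglyMeasurable (stronglyMeasurable_path h.predictable ω))
      (fun _ => hC _) t _ _
  · rw [h.eq ω t, driftConv]
    abel

lemma IsStrictMildSolution.eq_of_path (h : IsStrictMildSolution ℱ S F ZA x X)
    (hS : IsC0Semigroup S) (hF : LipschitzWith L F) (hC : ∀ x, ‖F x‖ ≤ C) {y : ℝ≥0 → H} {ω : Ω}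
    (hy : StronglyMeasurable y)
    (heq : ∀ t, y t = S t x + ZA t ω + driftConv S (fun s => F (y s)) t) (t : ℝ≥0) :
    y t = X t ω :=
  eq_of_mild hS hF hC hy (stronglyMeasurable_path h.predictable ω) heq (h.eq ω) t

lemma IsStrictMildSolution.ae_eq_of_isPathwiseMildSolution
    (h : IsStrictMildSolution ℱ S F ZA x X) (hS : IsC0Semigroup S) (hF : LipschitzWith L F)
    (hC : ∀ x, ‖F x‖ ≤ C) (h' : IsPathwiseMildSolution ℱ P S F ZA x X') :
    ∀ᵐ ω ∂P, ∀ t, X' t ω = X t ω := by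
  filter_upwards [h'.eq] with ω hω
  refine h.eq_of_path hS hF hC (stronglyMeasurable_path h'.predictable ω) fun t => ?_
  rw [(hω t).2, driftConv]
  abel

/-- The equation for X' fails on a null set that may depend on t. The right-hand side X'' formed
with X' agrees with X' almost surely at each time; by Fubini, almost every path agrees at almost
every time, so both give the same drift integral and X'' solves the equation for all t. Pathwise
uniqueness then applies to X''. -/
lemma IsStrictMildSolution.ae_eq_of_isMildSolution [SFinite P]
    (h : IsStrictMildSolution ℱ S F ZA x X) (hZ : IsStronglyPredictable ℱ ZA)
    (hS : IsC0Semigroup S) (hF : LipschitzWith L F)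
    (hC : ∀ x, ‖F x‖ ≤ C) (h' : IsMildSolution ℱ P S F ZA x X') (t : ℝ≥0) :
    X' t =ᵐ[P] X t := by
  set X'' : ℝ≥0 → Ω → H := fun t ω => S t x + ZA t ω + driftConv S (fun s => F (X' s ω)) t with hX''
  have hF' : IsStronglyPredictable ℱ fun s ω => F (X' s ω) :=
    hF.continuous.comp_stronglyMeasurable h'.predictable
  have hp : IsStronglyPredictable ℱ X'' := ((hS.isStronglyPredictable_apply x).add hZ).add
    (isStronglyPredictable_driftConv hS hF' fun _ _ => hC _)
  have hae : ∀ t, ∀ᵐ ω ∂P, X' t ω = X'' t ω := fun t => by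
    filter_upwards [h'.eq t] with ω hω
    rw [hω.2]
    simp only [hX'', driftConv]
    abel
  have hmeas : MeasurableSet {q : ℝ × Ω | X' q.1.toNNReal q.2 = X'' q.1.toNNReal q.2} := by
    have hq : Measurable fun q : ℝ × Ω => (q.1.toNNReal, q.2) := by fun_prop
    exact StronglyMeasurable.measurableSet_eq_fun
      ((stronglyMeasurable_uncurry_of_predictable h'.predictable).comp_measurable hq)
      ((stronglyMeasurable_uncurry_of_predictable hp).comp_measurable hq)
  have hswap : ∀ᵐ ω ∂P, ∀ᵐ s : ℝ, X' s.toNNReal ω = X'' s.toNNReal ω :=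
    (Measure.ae_ae_comm (p := fun (s : ℝ) ω => X' s.toNNReal ω = X'' s.toNNReal ω) hmeas).1
      (Eventually.of_forall fun s => hae _)
  filter_upwards [hae t, hswap] with ω h1 h2
  rw [h1]
  refine h.eq_of_path (y := fun t => X'' t ω) hS hF hC (stronglyMeasurable_path hp ω) (fun t => ?_) t
  have h3 : driftConv S (fun s => F (X' s ω)) t = driftConv S (fun s => F (X'' s ω)) t := by
    refine intervalIntegral.integral_congr_ae ?_
    filter_upwards [h2] with s hs _
    rw [hs]
  rw [← h3]

end Solutions

end LevySPDE

namespace LevySPDE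

/-! ### Moments, continuity in mean, and dependence on the initial state -/

section Moments

variable {H : Type*} [NormedAddCommGroup H] [InnerProductSpace ℝ H] [CompleteSpace H]
  [SecondCountableTopology H] [MeasurableSpace H] [BorelSpace H]
  {S : ℝ≥0 → H →L[ℝ] H} {F : H → H} {L : ℝ≥0} {C p : ℝ}
  {Ω : Type*} {mΩ : MeasurableSpace Ω} {ℱ : Filtration ℝ≥0 mΩ} {P : Measure Ω}
  [IsProbabilityMeasure P] {ZA X X' : ℝ≥0 → Ω → H} {x y : H}

namespace IsStrictMildSolution

lemma stronglyMeasurable (h : IsStrictMildSolution ℱ S F ZA x X) (t : ℝ≥0) :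
    StronglyMeasurable (X t) :=
  (h.predictable.stronglyAdapted t).mono (ℱ.le t)

lemma stronglyMeasurable_comp (h : IsStrictMildSolution ℱ S F ZA x X) (hF : LipschitzWith L F)
    (ω : Ω) : StronglyMeasurable fun s => F (X s ω) :=
  hF.continuous.comp_stronglyMeasurable (stronglyMeasurable_path h.predictable ω)

/-- The difference of the solution and the stochastic convolution. -/
lemma sub_eq (h : IsStrictMildSolution ℱ S F ZA x X) (t : ℝ≥0) (ω : Ω) :
    X t ω - ZA t ω = S t x + driftConv S (fun s => F (X s ω)) t := by
  rw [h.eq ω t]; abel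

lemma continuous_sub (h : IsStrictMildSolution ℱ S F ZA x X) (hS : IsC0Semigroup S)
    (hF : LipschitzWith L F) (hC : ∀ x, ‖F x‖ ≤ C) (ω : Ω) :
    Continuous fun t => X t ω - ZA t ω := by
  simp_rw [h.sub_eq]
  exact (hS.continuous x).add (continuous_driftConv hS (h.stronglyMeasurable_comp hF ω)
    fun _ => hC _)

lemma exists_norm_sub_le (h : IsStrictMildSolution ℱ S F ZA x X) (hS : IsC0Semigroup S)
    (hC : ∀ x, ‖F x‖ ≤ C) (T : ℝ≥0) : ∃ B : ℝ, ∀ t ≤ T, ∀ ω, ‖X t ω - ZA t ω‖ ≤ B := by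
  obtain ⟨M, hM1, hM⟩ := hS.exists_norm_le T
  have hC0 : 0 ≤ C := (norm_nonneg _).trans (hC 0)
  refine ⟨M * ‖x‖ + M * C * T, fun t ht ω => ?_⟩
  rw [h.sub_eq]
  refine (norm_add_le _ _).trans (add_le_add ((S t).le_of_opNorm_le (hM t ht) x) ?_)
  exact (norm_driftConv_le (fun r hr => hM r (hr.trans ht)) fun _ => hC _).trans (by gcongr)

lemma lintegral_rpow_lt_top (h : IsStrictMildSolution ℱ S F ZA x X) (hS : IsC0Semigroup S)
    (hC : ∀ x, ‖F x‖ ≤ C) (hp : 0 < p) (hZ : HasInnovations S ℱ P p ZA) (t : ℝ≥0) :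
    ∫⁻ ω, ‖X t ω‖ₑ ^ p ∂P < ∞ := by
  obtain ⟨B, hB⟩ := h.exists_norm_sub_le hS hC t
  have he : ∀ ω, X t ω = ZA t ω + (X t ω - ZA t ω) := fun ω => by abel
  rw [lintegral_congr fun ω => congrArg (fun v => ‖v‖ₑ ^ p) (he ω)]
  refine (lintegral_enorm_add_rpow_le hp (hZ.stronglyMeasurable t).aestronglyMeasurable).trans_lt ?_
  refine ENNReal.mul_lt_top (by finiteness) (ENNReal.add_lt_top.2 ⟨hZ.moment t, ?_⟩)
  refine lt_of_le_of_lt (b := ∫⁻ _, ENNReal.ofReal B ^ p ∂P) ?_ (by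
    rw [lintegral_const, measure_univ, mul_one]; finiteness)
  refine lintegral_mono fun ω => ?_
  rw [← ofReal_norm]
  gcongr
  exact hB t le_rfl ω

/-- Outside Z_A the solution is continuous in time and bounded on [0, t + 1] uniformly in the
outcome, so dominated convergence handles this part; Z_A contributes its own continuity in mean. -/
lemma tendsto_lintegral_sub (h : IsStrictMildSolution ℱ S F ZA x X) (hS : IsC0Semigroup S)
    (hF : LipschitzWith L F) (hC : ∀ x, ‖F x‖ ≤ C) (hp : 0 < p) (hZ : HasInnovations S ℱ P p ZA)
    (t : ℝ≥0) : Tendsto (fun s => ∫⁻ ω, ‖X s ω - X t ω‖ₑ ^ p ∂P) (𝓝 t) (𝓝 0) := by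
  obtain ⟨B, hB⟩ := h.exists_norm_sub_le hS hC (t + 1)
  have hZm := hZ.stronglyMeasurable
  have hXm := h.stronglyMeasurable
  set D : ℝ≥0 → Ω → H := fun s ω => X s ω - ZA s ω with hD
  have he : ∀ s ω, X s ω - X t ω = (ZA s ω - ZA t ω) + (D s ω - D t ω) := fun s ω => by
    simp only [hD]; abel
  have hD0 : Tendsto (fun s => ∫⁻ ω, ‖D s ω - D t ω‖ₑ ^ p ∂P) (𝓝 t) (𝓝 0) := by
    have h0 : (0 : ℝ≥0∞) = ∫⁻ _ : Ω, 0 ∂P := by simp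
    rw [h0]
    refine tendsto_lintegral_filter_of_dominated_convergence
      (fun _ => ENNReal.ofReal (2 * B) ^ p) (Eventually.of_forall fun s => ?_) ?_
      (by rw [lintegral_const, measure_univ, mul_one]; finiteness) (Eventually.of_forall fun ω => ?_)
    · exact ((((hXm s).sub (hZm s)).sub ((hXm t).sub (hZm t))).measurable.enorm.pow_const p)
    · filter_upwards [gt_mem_nhds (lt_add_one t)] with s hs
      refine Eventually.of_forall fun ω => ?_
      rw [← ofReal_norm]
      gcongr
      refine (norm_sub_le _ _).trans ?_
      linarith [hB s hs.le ω, hB t (by simp) ω]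
    · refine (tendsto_rpow_zero_iff hp).2 ?_
      have h1 := ((h.continuous_sub hS hF hC ω).sub (continuous_const
        (y := X t ω - ZA t ω))).enorm.tendsto t
      simpa using h1
  have hlim := ENNReal.Tendsto.const_mul (a := 2 ^ p)
    ((hZ.tendsto_lintegral_sub hS hp t).add hD0) (Or.inr (by finiteness))
  rw [add_zero, mul_zero] at hlim
  refine tendsto_of_tendsto_of_tendsto_of_le_of_le tendsto_const_nhds hlim (fun _ => zero_le)
    fun s => ?_
  simp_rw [he]
  exact lintegral_enorm_add_rpow_le hp ((hZm s).sub (hZm t)).aestronglyMeasurable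

lemma tendstoInMeasure (h : IsStrictMildSolution ℱ S F ZA x X) (hS : IsC0Semigroup S)
    (hF : LipschitzWith L F) (hC : ∀ x, ‖F x‖ ≤ C) (hp : 0 < p) (hZ : HasInnovations S ℱ P p ZA)
    (t : ℝ≥0) : TendstoInMeasure P X (𝓝 t) (X t) :=
  tendstoInMeasure_of_lintegral_rpow hp (fun s => (h.stronglyMeasurable s).aestronglyMeasurable)
    (h.stronglyMeasurable t).aestronglyMeasurable (h.tendsto_lintegral_sub hS hF hC hp hZ t)

/-- Solutions depend Lipschitz continuously on the initial state. -/
lemma enorm_sub_le (h : IsStrictMildSolution ℱ S F ZA x X) (h' : IsStrictMildSolution ℱ S F ZA y X')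
    (hS : IsC0Semigroup S) (hF : LipschitzWith L F) (hC : ∀ x, ‖F x‖ ≤ C) {M : ℝ} {t : ℝ≥0}
    (hM : ∀ s ≤ t, ‖S s‖ ≤ M) (ω : Ω) :
    ‖X t ω - X' t ω‖ₑ ≤ 2 * (ENNReal.ofReal M * ‖x - y‖ₑ) *
      ENNReal.ofReal (Real.exp (2 * (M * L) * t)) := by
  refine enorm_sub_le_of_mild hS hF hC (stronglyMeasurable_path h.predictable ω)
    (stronglyMeasurable_path h'.predictable ω) hM (fun s _ => h.eq ω s) (fun s _ => h'.eq ω s)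
    (by finiteness) fun s hs => ?_
  rw [add_sub_add_right_eq_sub, ← map_sub]
  refine ((S s).le_opENorm _).trans ?_
  gcongr
  rw [← ofReal_norm]
  exact ENNReal.ofReal_le_ofReal (hM s hs)

end IsStrictMildSolution

/-- For each outcome the solution is Lipschitz in the initial state, and bounded continuous
functions pass to expectations by dominated convergence. -/
lemma isFellerFamily_of_isStrictMildSolution {X : H → ℝ≥0 → Ω → H} (hS : IsC0Semigroup S)
    (hF : LipschitzWith L F) (hC : ∀ x, ‖F x‖ ≤ C)
    (h : ∀ x, IsStrictMildSolution ℱ S F ZA x (X x)) : IsFellerFamily P X := by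
  intro t f
  obtain ⟨M, -, hM⟩ := hS.exists_norm_le t
  rw [continuous_iff_continuousAt]
  intro x
  refine tendsto_integral_filter_of_dominated_convergence (fun _ => ‖f‖)
    (Eventually.of_forall fun y => ?_) (Eventually.of_forall fun y => ?_) (integrable_const _)
    (Eventually.of_forall fun ω => ?_)
  · exact (f.continuous.comp_stronglyMeasurable ((h y).stronglyMeasurable t)).aestronglyMeasurable
  · exact Eventually.of_forall fun ω => f.norm_coe_le_norm _
  · refine (f.continuous.tendsto _).comp (tendsto_iff_edist_tendsto_0.2 ?_)
    simp_rw [edist_eq_enorm_sub]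
    refine tendsto_of_tendsto_of_tendsto_of_le_of_le tendsto_const_nhds (h := fun y =>
      2 * (ENNReal.ofReal M * ‖y - x‖ₑ) * ENNReal.ofReal (Real.exp (2 * (M * L) * t))) ?_
      (fun _ => zero_le) fun y => (h y).enorm_sub_le (h x) hS hF hC hM ω
    have h0 : Tendsto (fun y => ‖y - x‖ₑ) (𝓝 x) (𝓝 0) := by
      have := (continuous_id.sub (continuous_const (y := x))).enorm.tendsto x
      simpa using this
    have h1 := ENNReal.Tendsto.mul_const (b := ENNReal.ofReal (Real.exp (2 * (M * L) * t)))
      (ENNReal.Tendsto.const_mul (a := 2) (ENNReal.Tendsto.const_mul (a := ENNReal.ofReal M) h0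
      (Or.inr (by finiteness))) (Or.inr (by finiteness))) (Or.inr (by finiteness))
    simpa using h1

end Moments

end LevySPDE

namespace LevySPDE

/-! ### The exponential Euler scheme -/

section Euler

variable {H : Type*} [NormedAddCommGroup H] [InnerProductSpace ℝ H]
  {S : ℝ≥0 → H →L[ℝ] H} {F : H → H} {L M : ℝ≥0} {C : ℝ}

/-- One step `y ↦ S_δ y + ∫_0^δ S_{δ-r} F(y) dr` of the exponential Euler scheme. -/
noncomputable def eulerMap (S : ℝ≥0 → H →L[ℝ] H) (F : H → H) (δ : ℝ≥0) (y : H) : H :=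
  S δ y + driftConv S (fun _ => F y) δ

/-- The exponential Euler scheme with noise `ζ`. -/
noncomputable def eulerScheme (S : ℝ≥0 → H →L[ℝ] H) (F : H → H) (δ : ℝ≥0) (ζ : ℕ → H) (y : H) :
    ℕ → H
  | 0 => y
  | k + 1 => eulerMap S F δ (eulerScheme S F δ ζ y k) + ζ k

/-- Unrolling the recursion propagates each r_j by a single semigroup operator, since the steps
compose. The bound therefore carries one factor M and not a power of M. -/
lemma enorm_le_sum_of_step (hS : IsC0Semigroup S) {δ t : ℝ≥0} (hM : ∀ s ≤ t, ‖S s‖ ≤ M)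
    {D r : ℕ → H} (h0 : D 0 = 0) (hD : ∀ k, D (k + 1) = S δ (D k) + r k) :
    ∀ (k : ℕ) (s : ℝ≥0), s + k * δ ≤ t → ‖S s (D k)‖ₑ ≤ M * ∑ j ∈ Finset.range k, ‖r j‖ₑ := by
  intro k
  induction k with
  | zero => intro s _; simp [h0]
  | succ k ih =>
    intro s hs
    push_cast at hs
    have hs' : s + δ + k * δ ≤ t := le_of_eq_of_le (by ring) hs
    have hS' : ‖S s‖ₑ ≤ M := by
      rw [← ofReal_norm, ← ENNReal.ofReal_coe_nnreal]
      exact ENNReal.ofReal_le_ofReal (hM s (le_trans le_self_add hs))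
    rw [hD, map_add, ← hS.add_apply, Finset.sum_range_succ, mul_add]
    refine (enorm_add_le _ _).trans (add_le_add (ih _ hs') ?_)
    exact ((S s).le_opENorm _).trans (by gcongr)

/-- Discrete Gronwall: A(1 + c)^k solves the recursion with equality. -/
lemma le_mul_pow_of_le_add_sum {a : ℕ → ℝ≥0∞} {A c : ℝ≥0∞} {N : ℕ}
    (h : ∀ k ≤ N, a k ≤ A + c * ∑ j ∈ Finset.range k, a j) : ∀ k ≤ N, a k ≤ A * (1 + c) ^ k := by
  have hb : ∀ k : ℕ, A + c * ∑ j ∈ Finset.range k, A * (1 + c) ^ j = A * (1 + c) ^ k := by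
    intro k
    induction k with
    | zero => simp
    | succ k ih =>
      rw [Finset.sum_range_succ, mul_add, ← add_assoc, ih, pow_succ]
      ring
  intro k
  induction k using Nat.strong_induction_on with
  | _ k ih =>
    intro hk
    rw [← hb]
    refine (h k hk).trans ?_
    gcongr with j hj
    exact ih j (Finset.mem_range.1 hj) ((Finset.mem_range.1 hj).le.trans hk)

variable [CompleteSpace H]

/-- The error of the exponential Euler scheme along a path. -/
lemma enorm_sub_eulerScheme_le (hS : IsC0Semigroup S) (hF : LipschitzWith L F)
    (hC : ∀ x, ‖F x‖ ≤ C) {U : ℝ≥0 → H} (hU : StronglyMeasurable U) {ζ : ℕ → H} {δ : ℝ≥0}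
    (hstep : ∀ j : ℕ, U ((j + 1 : ℕ) * δ) =
      S δ (U (j * δ)) + driftConv S (fun r => F (U (j * δ + r))) δ + ζ j) {N : ℕ}
    (hM : ∀ s ≤ N * δ, ‖S s‖ ≤ M) (hN : N ≠ 0) :
    ‖U (N * δ) - eulerScheme S F δ ζ (U 0) N‖ₑ ≤
      M * M * (∑ j ∈ Finset.range N,
        ∫⁻ r in Ioc (0 : ℝ) δ, ‖F (U (j * δ + r.toNNReal)) - F (U (j * δ))‖ₑ) *
        ENNReal.ofReal (Real.exp (M * M * L * (N * δ : ℝ≥0))) := by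
  set V := eulerScheme S F δ ζ (U 0) with hV
  set D : ℕ → H := fun k => U (k * δ) - V k with hD
  set η : ℕ → ℝ≥0∞ := fun j =>
    ∫⁻ r in Ioc (0 : ℝ) δ, ‖F (U (j * δ + r.toNNReal)) - F (U (j * δ))‖ₑ with hη
  set ρ : ℕ → H := fun j => driftConv S (fun r => F (U (j * δ + r))) δ -
    driftConv S (fun _ => F (V j)) δ with hρ
  have hVs : ∀ k, V (k + 1) = S δ (V k) + driftConv S (fun _ => F (V k)) δ + ζ k := fun k => rfl
  have hδ : ∀ s ≤ δ, ‖S s‖ ≤ M := fun s hs => hM s (hs.trans (by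
    calc δ = 1 * δ := (one_mul _).symm
      _ ≤ N * δ := by gcongr; exact_mod_cast Nat.one_le_iff_ne_zero.2 hN))
  have hD0 : D 0 = 0 := by simp [hD, hV, eulerScheme]
  have hDs : ∀ k, D (k + 1) = S δ (D k) + ρ k := fun k => by
    simp only [hD, hρ]
    rw [hstep, hVs, map_sub]
    abel
  have hmU : ∀ j : ℕ, StronglyMeasurable fun r => F (U (j * δ + r)) := fun j =>
    hF.continuous.comp_stronglyMeasurable (hU.comp_measurable (by fun_prop))
  have hρn : ∀ j, ‖ρ j‖ₑ ≤ M * (η j + L * δ * ‖D j‖ₑ) := by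
    intro j
    have h1 := enorm_driftConv_sub_le hS (hmU j) (stronglyMeasurable_const (b := F (V j)))
      (fun _ => hC _) (fun _ => hC _) hδ
    rw [ENNReal.ofReal_coe_nnreal] at h1
    refine h1.trans (mul_le_mul' le_rfl ?_)
    have h2 : ∀ r : ℝ, ‖F (U (j * δ + r.toNNReal)) - F (V j)‖ₑ ≤
        ‖F (U (j * δ + r.toNNReal)) - F (U (j * δ))‖ₑ + L * ‖D j‖ₑ := fun r => by
      rw [← sub_add_sub_cancel _ (F (U (j * δ))) (F (V j))]
      refine (enorm_add_le _ _).trans (add_le_add le_rfl ?_)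
      simpa [edist_eq_enorm_sub] using hF (U (j * δ)) (V j)
    refine (lintegral_mono h2).trans_eq ?_
    rw [lintegral_add_right _ measurable_const, setLIntegral_const, Real.volume_Ioc, sub_zero,
      ENNReal.ofReal_coe_nnreal]
    ring
  -- One factor M comes from the drift within a step, the other from propagating the step error.
  have hrec : ∀ k ≤ N, ‖D k‖ₑ ≤ M * M * ∑ j ∈ Finset.range N, η j +
      (M * M * L * δ : ℝ≥0) * ∑ j ∈ Finset.range k, ‖D j‖ₑ := by
    intro k hk
    have h1 := enorm_le_sum_of_step hS hM hD0 hDs k 0 (by rw [zero_add]; gcongr)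
    rw [hS.zero_apply] at h1
    refine h1.trans ?_
    calc (M : ℝ≥0∞) * ∑ j ∈ Finset.range k, ‖ρ j‖ₑ
        ≤ M * ∑ j ∈ Finset.range k, M * (η j + L * δ * ‖D j‖ₑ) := by
          gcongr with j hj; exact hρn j
      _ = M * M * ∑ j ∈ Finset.range k, η j + (M * M * L * δ : ℝ≥0) *
            ∑ j ∈ Finset.range k, ‖D j‖ₑ := by
          rw [← Finset.mul_sum, Finset.sum_add_distrib, ← Finset.mul_sum]
          push_cast
          ring
      _ ≤ _ := by
          gcongr
  refine (le_mul_pow_of_le_add_sum (a := fun k => ‖D k‖ₑ) hrec N le_rfl).trans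
    (mul_le_mul' le_rfl ?_)
  rw [← ENNReal.coe_one, ← ENNReal.coe_add, ← ENNReal.ofReal_coe_nnreal,
    ← ENNReal.ofReal_pow (NNReal.coe_nonneg _)]
  refine ENNReal.ofReal_le_ofReal ?_
  have h1 : ((1 + M * M * L * δ : ℝ≥0) : ℝ) ≤ Real.exp (M * M * L * δ) := by
    push_cast
    rw [add_comm]
    exact Real.add_one_le_exp _
  refine (pow_le_pow_left₀ (NNReal.coe_nonneg _) h1 N).trans_eq ?_
  rw [← Real.exp_nat_mul]
  push_cast
  ring_nf

variable [SecondCountableTopology H] [MeasurableSpace H] [BorelSpace H]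
  {Ω : Type*} {mΩ : MeasurableSpace Ω} {ℱ : Filtration ℝ≥0 mΩ} {P : Measure Ω}
  [IsProbabilityMeasure P] {ZA X : ℝ≥0 → Ω → H} {x : H} {p : ℝ}

/-- Boundedness and the Lipschitz property combine into a truncated distance, so that continuity of
X in probability controls the Euler error and no moment of order 1 is required. -/
lemma enorm_sub_le_mul_min (hF : LipschitzWith L F) (hC : ∀ x, ‖F x‖ ≤ C) (u v : H) :
    ‖F u - F v‖ₑ ≤ (ENNReal.ofReal (2 * C) + L) * min 1 ‖u - v‖ₑ := by
  rcases le_total 1 ‖u - v‖ₑ with h | h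
  · rw [min_eq_left h, mul_one]
    refine le_trans ?_ le_self_add
    rw [← ofReal_norm]
    refine ENNReal.ofReal_le_ofReal ((norm_sub_le _ _).trans ?_)
    linarith [hC u, hC v]
  · rw [min_eq_right h]
    calc ‖F u - F v‖ₑ ≤ L * ‖u - v‖ₑ := by simpa [edist_eq_enorm_sub] using hF u v
      _ ≤ _ := by gcongr; exact le_add_self

lemma IsStrictMildSolution.eq_step (h : IsStrictMildSolution ℱ S F ZA x X) (hS : IsC0Semigroup S)
    (hF : LipschitzWith L F) (hC : ∀ x, ‖F x‖ ≤ C) (ω : Ω) (s r : ℝ≥0) :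
    X (s + r) ω = S r (X s ω) + driftConv S (fun v => F (X (s + v) ω)) r +
      (ZA (s + r) ω - S r (ZA s ω)) := by
  rw [h.eq ω (s + r), h.eq ω s, driftConv_add hS (h.stronglyMeasurable_comp hF ω) fun _ => hC _,
    map_add, map_add, add_comm s r, hS.add_apply]
  abel

/-- The Euler scheme for the solution restarted at time `s` converges in mean. -/
lemma IsStrictMildSolution.tendsto_eulerScheme (h : IsStrictMildSolution ℱ S F ZA x X)
    (hS : IsC0Semigroup S) (hF : LipschitzWith L F) (hC : ∀ x, ‖F x‖ ≤ C)
    (hX : ∀ t, TendstoInMeasure P X (𝓝 t) (X t)) (s t : ℝ≥0) :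
    Tendsto (fun N : ℕ => ∫⁻ ω, ‖X (s + t) ω - eulerScheme S F (t / (N + 1 : ℕ))
      (fun j => ZA (s + (j + 1 : ℕ) * (t / (N + 1 : ℕ))) ω -
        S (t / (N + 1 : ℕ)) (ZA (s + j * (t / (N + 1 : ℕ))) ω)) (X s ω) (N + 1)‖ₑ ∂P)
      atTop (𝓝 0) := by
  obtain ⟨M, hM1, hM⟩ := hS.exists_norm_le t
  lift M to ℝ≥0 using by linarith
  set c : ℝ≥0∞ := M * M * ENNReal.ofReal (Real.exp (M * M * L * t)) *
    (t * (ENNReal.ofReal (2 * C) + L)) with hc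
  have hct : c ≠ ∞ := by finiteness
  refine ENNReal.tendsto_nhds_zero.2 fun ε hε => ?_
  -- The error is at most c times the modulus of stochastic continuity of X over one step, uniformly
  -- on [0, s + t]; hence the level ε / c.
  obtain ⟨δ₀, hδ₀, hmod⟩ := exists_probNorm_sub_le
    (fun t => (h.stronglyMeasurable t).aestronglyMeasurable) hX (s + t)
    (ENNReal.div_pos hε.ne' hct)
  have hlim : Tendsto (fun N : ℕ => t / ((N + 1 : ℕ) : ℝ≥0)) atTop (𝓝 0) :=
    (tendsto_const_div_atTop_nhds_zero_nat t).comp (tendsto_add_atTop_nat 1)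
  filter_upwards [hlim.eventually (gt_mem_nhds hδ₀)] with N hN
  set δ := t / ((N + 1 : ℕ) : ℝ≥0) with hδ
  have hNδ : ((N + 1 : ℕ) : ℝ≥0) * δ = t := by
    rw [hδ, mul_div_cancel₀]
    positivity
  have hXu := stronglyMeasurable_uncurry_of_predictable h.predictable
  have hpath : ∀ ω, ‖X (s + t) ω - eulerScheme S F δ
      (fun j => ZA (s + (j + 1 : ℕ) * δ) ω - S δ (ZA (s + j * δ) ω)) (X s ω) (N + 1)‖ₑ ≤
      M * M * ENNReal.ofReal (Real.exp (M * M * L * t)) * (∑ j ∈ Finset.range (N + 1),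
        ∫⁻ r in Ioc (0 : ℝ) δ, ‖F (X (s + (j * δ + r.toNNReal)) ω) - F (X (s + j * δ) ω)‖ₑ) := by
    intro ω
    have h1 := enorm_sub_eulerScheme_le (U := fun r => X (s + r) ω) (δ := δ) (N := N + 1)
      (ζ := fun j => ZA (s + (j + 1 : ℕ) * δ) ω - S δ (ZA (s + j * δ) ω)) (M := M) hS hF hC
      ((stronglyMeasurable_path h.predictable ω).comp_measurable (by fun_prop)) (fun j => ?_)
      (fun r hr => hM r (hr.trans hNδ.le)) (Nat.succ_ne_zero N)
    · rw [hNδ, add_zero] at h1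
      refine h1.trans_eq ?_
      ring
    · have h2 := h.eq_step hS hF hC ω (s + j * δ) δ
      have h3 : s + ((j + 1 : ℕ) : ℝ≥0) * δ = s + j * δ + δ := by push_cast; ring
      rw [h3, h2]
      simp only [add_assoc]
  refine (lintegral_mono hpath).trans ?_
  have hmj : ∀ j : ℕ, Measurable fun q : Ω × ℝ =>
      ‖F (X (s + (j * δ + q.2.toNNReal)) q.1) - F (X (s + j * δ) q.1)‖ₑ := fun j => by
    refine StronglyMeasurable.enorm (StronglyMeasurable.sub ?_ ?_)
    · exact hF.continuous.comp_stronglyMeasurable (hXu.comp_measurable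
        (by fun_prop : Measurable fun q : Ω × ℝ => (s + (j * δ + q.2.toNNReal), q.1)))
    · exact hF.continuous.comp_stronglyMeasurable (hXu.comp_measurable
        (by fun_prop : Measurable fun q : Ω × ℝ => (s + j * δ, q.1)))
  rw [lintegral_const_mul' _ _ (by finiteness), lintegral_finsetSum _
    fun j _ => (hmj j).lintegral_prod_right']
  have hj : ∀ j ∈ Finset.range (N + 1), ∫⁻ ω, (∫⁻ r in Ioc (0 : ℝ) δ,
      ‖F (X (s + (j * δ + r.toNNReal)) ω) - F (X (s + j * δ) ω)‖ₑ) ∂P ≤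
      δ * ((ENNReal.ofReal (2 * C) + L) * (ε / c)) := by
    intro j hj
    rw [lintegral_lintegral_swap (hmj j).aemeasurable]
    have hle : ∀ r ∈ Ioc (0 : ℝ) δ,
        ∫⁻ ω, ‖F (X (s + (j * δ + r.toNNReal)) ω) - F (X (s + j * δ) ω)‖ₑ ∂P ≤
        (ENNReal.ofReal (2 * C) + L) * (ε / c) := by
      intro r hr
      have hrδ : r.toNNReal ≤ δ := Real.toNNReal_le_iff_le_coe.2 hr.2
      refine (lintegral_mono fun ω => enorm_sub_le_mul_min hF hC _ _).trans ?_
      rw [lintegral_const_mul' _ _ (by finiteness)]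
      refine mul_le_mul' le_rfl (hmod _ _ ?_ ?_ ?_)
      · gcongr; exact le_self_add
      · gcongr
        calc j * δ + r.toNNReal ≤ j * δ + δ := by gcongr
          _ = ((j + 1 : ℕ) : ℝ≥0) * δ := by push_cast; ring
          _ ≤ ((N + 1 : ℕ) : ℝ≥0) * δ := by
            gcongr; exact Nat.lt_succ_iff.1 (Finset.mem_range.1 hj)
          _ = t := hNδ
      · rw [← add_assoc]
        gcongr
        exact hrδ.trans hN.le
    refine (setLIntegral_mono' measurableSet_Ioc hle).trans_eq ?_
    rw [setLIntegral_const, Real.volume_Ioc, sub_zero, ENNReal.ofReal_coe_nnreal, mul_comm]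
  refine (mul_le_mul' le_rfl (Finset.sum_le_sum hj)).trans ?_
  rw [Finset.sum_const, Finset.card_range, nsmul_eq_mul, ← mul_assoc ((N + 1 : ℕ) : ℝ≥0∞)]
  have hNδ' : ((N + 1 : ℕ) : ℝ≥0∞) * δ = t := by
    rw [← hNδ]; push_cast; rfl
  rw [hNδ', ← mul_assoc (t : ℝ≥0∞), ← mul_assoc, ← hc]
  exact ENNReal.mul_div_le

end Euler

end LevySPDE

namespace LevySPDE

/-! ### The Markov property -/

section Markov

variable {H : Type*} [NormedAddCommGroup H] [InnerProductSpace ℝ H] [CompleteSpace H]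
  [SecondCountableTopology H] [MeasurableSpace H] [BorelSpace H]
  {S : ℝ≥0 → H →L[ℝ] H} {F : H → H} {L : ℝ≥0} {C p : ℝ}
  {Ω : Type*} {mΩ : MeasurableSpace Ω} {ℱ : Filtration ℝ≥0 mΩ} {P : Measure Ω}
  [IsProbabilityMeasure P] {ZA : ℝ≥0 → Ω → H} {X : H → ℝ≥0 → Ω → H}

/-- Integrating out a variable that is independent of the past. -/
lemma setIntegral_eq_of_indep {Ω : Type*} {m mΩ : MeasurableSpace Ω} {P : Measure Ω}
    [IsProbabilityMeasure P] (hm : m ≤ mΩ) {V ζ : Ω → H}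
    (hV : Measurable[m] V) (hζ : Measurable ζ)
    (hind : Indep (MeasurableSpace.comap ζ inferInstance) m P) {A : Set Ω} (hA : MeasurableSet[m] A)
    {g : H × H → ℝ} (hg : Continuous g) {B : ℝ} (hB : ∀ q, ‖g q‖ ≤ B) :
    ∫ ω in A, g (V ω, ζ ω) ∂P = ∫ ω in A, (∫ z, g (V ω, z) ∂(P.map ζ)) ∂P := by
  have hV' : Measurable V := hV.mono hm le_rfl
  have := Measure.isProbabilityMeasure_map (μ := P) hζ.aemeasurable
  -- Checked on rectangles: A and the event for V both belong to m, of which ζ is independent.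
  have hprod : ((P.restrict A).map V).prod (P.map ζ) = (P.restrict A).map fun ω => (V ω, ζ ω) := by
    refine Measure.prod_eq fun s t hs ht => ?_
    rw [Measure.map_apply (hV'.prodMk hζ) (hs.prod ht), Measure.map_apply hV' hs,
      Measure.map_apply hζ ht, Measure.restrict_apply (hV'.prodMk hζ (hs.prod ht)),
      Measure.restrict_apply (hV' hs)]
    have h1 := (Indep_iff _ _ P).1 hind (ζ ⁻¹' t) (V ⁻¹' s ∩ A) ⟨t, ht, rfl⟩ ((hV hs).inter hA)
    rw [mul_comm, ← h1]
    congr 1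
    ext ω
    simp only [mem_inter_iff, mem_preimage, mem_prod]
    tauto
  have h1 := integral_map (μ := P.restrict A) (hV'.prodMk hζ).aemeasurable
    (hg.stronglyMeasurable.aestronglyMeasurable (f := g))
  rw [← h1, ← hprod, integral_prod _ (Integrable.of_bound
    hg.stronglyMeasurable.aestronglyMeasurable B (Eventually.of_forall hB))]
  refine integral_map hV'.aemeasurable ?_
  exact (hg.stronglyMeasurable.integral_prod_right').aestronglyMeasurable

lemma continuous_eulerMap (hS : IsC0Semigroup S) (hF : LipschitzWith L F) (hC : ∀ x, ‖F x‖ ≤ C)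
    (δ : ℝ≥0) : Continuous (eulerMap S F δ) := by
  obtain ⟨M, -, hM⟩ := hS.exists_norm_le δ
  refine (S δ).continuous.add (continuous_iff_continuousAt.2 fun y => ?_)
  refine tendsto_iff_edist_tendsto_0.2 ?_
  simp_rw [edist_eq_enorm_sub]
  have h0 : Tendsto (fun z => ‖z - y‖ₑ) (𝓝 y) (𝓝 0) := by
    have := (continuous_id.sub (continuous_const (y := y))).enorm.tendsto y
    simpa using this
  have h1 := ENNReal.Tendsto.const_mul (a := ENNReal.ofReal (M * L))
    (ENNReal.Tendsto.mul_const (b := (δ : ℝ≥0∞)) h0 (Or.inr (by finiteness)))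
    (Or.inr (by finiteness))
  rw [zero_mul, mul_zero] at h1
  refine tendsto_of_tendsto_of_tendsto_of_le_of_le tendsto_const_nhds h1 (fun _ => zero_le)
    fun z => ?_
  refine (enorm_driftConv_comp_sub_le hS hF hC (x := fun _ => z) (y := fun _ => y)
    stronglyMeasurable_const stronglyMeasurable_const hM).trans_eq ?_
  rw [setLIntegral_const, Real.volume_Ioc, sub_zero, ENNReal.ofReal_coe_nnreal]

/-- The transition operator of the Euler scheme. -/
noncomputable def eulerOp (S : ℝ≥0 → H →L[ℝ] H) (F : H → H) (ν : Measure H) (δ : ℝ≥0) (f : H → ℝ)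
    (y : H) : ℝ :=
  ∫ z, f (eulerMap S F δ y + z) ∂ν

section EulerOp

variable {ν : Measure H} [IsProbabilityMeasure ν] {δ : ℝ≥0} {f : H → ℝ} {B : ℝ}

lemma norm_eulerOp_le (hB : ∀ y, ‖f y‖ ≤ B) (y : H) : ‖eulerOp S F ν δ f y‖ ≤ B := by
  refine (norm_integral_le_of_norm_le_const (Eventually.of_forall fun z => hB _)).trans_eq ?_
  simp

lemma continuous_eulerOp (hS : IsC0Semigroup S) (hF : LipschitzWith L F) (hC : ∀ x, ‖F x‖ ≤ C)
    (hf : Continuous f) (hB : ∀ y, ‖f y‖ ≤ B) : Continuous (eulerOp S F ν δ f) := by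
  refine continuous_of_dominated (bound := fun _ => B) (fun y => ?_)
    (fun y => Eventually.of_forall fun z => hB _) (integrable_const _)
    (Eventually.of_forall fun z => ?_)
  · exact (hf.comp (by fun_prop)).stronglyMeasurable.aestronglyMeasurable
  · exact hf.comp ((continuous_eulerMap hS hF hC δ).add continuous_const)

end EulerOp

lemma HasInnovations.isProbabilityMeasure_map (hZ : HasInnovations S ℱ P p ZA) (t : ℝ≥0) :
    IsProbabilityMeasure (P.map (ZA t)) :=
  Measure.isProbabilityMeasure_map (hZ.stronglyMeasurable t).measurable.aemeasurable

lemma stronglyMeasurable_eulerScheme (hS : IsC0Semigroup S) (hF : LipschitzWith L F)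
    (hC : ∀ x, ‖F x‖ ≤ C) (hZ : HasInnovations S ℱ P p ZA) {s δ : ℝ≥0} {V₀ : Ω → H}
    (hV : StronglyMeasurable[ℱ s] V₀) (k : ℕ) :
    StronglyMeasurable[ℱ (s + k * δ)] fun ω => eulerScheme S F δ
      (fun j => ZA (s + (j + 1 : ℕ) * δ) ω - S δ (ZA (s + j * δ) ω)) (V₀ ω) k := by
  induction k with
  | zero => exact hV.mono (ℱ.mono (by simp))
  | succ k ih =>
    have hle : s + (k : ℝ≥0) * δ ≤ s + ((k + 1 : ℕ) : ℝ≥0) * δ := by gcongr; simp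
    refine StronglyMeasurable.add ?_ (StronglyMeasurable.sub (hZ.adapted _) ?_)
    · exact (continuous_eulerMap hS hF hC δ).comp_stronglyMeasurable (ih.mono (ℱ.mono hle))
    · exact (S δ).continuous.comp_stronglyMeasurable ((hZ.adapted _).mono (ℱ.mono hle))

/-- The last innovation is integrated out first: it is independent of the σ-algebra one step
earlier, which contains A and the scheme so far, and its law is that of Z_A(δ) at every step. This
replaces f by its image under the transition operator. -/
lemma setIntegral_eulerScheme (hS : IsC0Semigroup S) (hF : LipschitzWith L F)
    (hC : ∀ x, ‖F x‖ ≤ C) (hZ : HasInnovations S ℱ P p ZA) {s δ : ℝ≥0} {V₀ : Ω → H}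
    (hV : StronglyMeasurable[ℱ s] V₀) {A : Set Ω} (hA : MeasurableSet[ℱ s] A) {B : ℝ} (k : ℕ) :
    ∀ f : H → ℝ, Continuous f → (∀ y, ‖f y‖ ≤ B) →
    ∫ ω in A, f (eulerScheme S F δ (fun j => ZA (s + (j + 1 : ℕ) * δ) ω -
      S δ (ZA (s + j * δ) ω)) (V₀ ω) k) ∂P =
    ∫ ω in A, ((eulerOp S F (P.map (ZA δ)) δ)^[k] f) (V₀ ω) ∂P := by
  have := hZ.isProbabilityMeasure_map δ
  induction k with
  | zero => intro f _ _; rfl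
  | succ k ih =>
    intro f hf hB
    rw [Function.iterate_succ_apply, ← ih _ (continuous_eulerOp hS hF hC hf hB)
      (norm_eulerOp_le hB)]
    have hVk := stronglyMeasurable_eulerScheme (δ := δ) hS hF hC hZ hV k
    have hs : s + ((k + 1 : ℕ) : ℝ≥0) * δ = s + k * δ + δ := by push_cast; ring
    have h1 := setIntegral_eq_of_indep (P := P) (ℱ.le (s + k * δ)) hVk.measurable
      (hZ.stronglyMeasurable_sub (s + k * δ) δ).measurable (hZ.indep (s + k * δ) δ)
      (A := A) (ℱ.mono le_self_add _ hA) (g := fun q => f (eulerMap S F δ q.1 + q.2)) (B := B)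
      (hf.comp (((continuous_eulerMap hS hF hC δ).comp continuous_fst).add continuous_snd))
      fun q => hB _
    rw [hZ.map_eq, ← hs] at h1
    exact h1

lemma norm_iterate_eulerOp_le {ν : Measure H} [IsProbabilityMeasure ν] {δ : ℝ≥0} {f : H → ℝ} {B : ℝ}
    (hB : ∀ y, ‖f y‖ ≤ B) (k : ℕ) (y : H) : ‖((eulerOp S F ν δ)^[k] f) y‖ ≤ B := by
  induction k generalizing f with
  | zero => exact hB y
  | succ k ih => exact ih (norm_eulerOp_le hB)

lemma continuous_iterate_eulerOp {ν : Measure H} [IsProbabilityMeasure ν] {δ : ℝ≥0} {f : H → ℝ}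
    {B : ℝ} (hS : IsC0Semigroup S) (hF : LipschitzWith L F) (hC : ∀ x, ‖F x‖ ≤ C)
    (hf : Continuous f) (hB : ∀ y, ‖f y‖ ≤ B) (k : ℕ) :
    Continuous ((eulerOp S F ν δ)^[k] f) := by
  induction k generalizing f with
  | zero => exact hf
  | succ k ih => exact ih (continuous_eulerOp hS hF hC hf hB) (norm_eulerOp_le hB)

lemma tendsto_setIntegral_iterate_eulerOp (hS : IsC0Semigroup S) (hF : LipschitzWith L F)
    (hC : ∀ x, ‖F x‖ ≤ C) (hp : 0 < p) (hZ : HasInnovations S ℱ P p ZA)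
    (hX : ∀ x, IsStrictMildSolution ℱ S F ZA x (X x)) (x : H) (s t : ℝ≥0) {A : Set Ω}
    (hA : MeasurableSet[ℱ s] A) {f : H → ℝ} {B : ℝ} (hf : Continuous f) (hB : ∀ y, ‖f y‖ ≤ B) :
    Tendsto (fun N : ℕ => ∫ ω in A, ((eulerOp S F (P.map (ZA (t / (N + 1 : ℕ))))
      (t / (N + 1 : ℕ)))^[N + 1] f) (X x s ω) ∂P) atTop (𝓝 (∫ ω in A, f (X x (s + t) ω) ∂P)) := by
  have hXs := (hX x).predictable.stronglyAdapted
  have hV := fun N : ℕ => (stronglyMeasurable_eulerScheme (δ := t / (N + 1 : ℕ)) hS hF hC hZ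
    (hXs s) (N + 1)).mono (ℱ.le _)
  have h1 : TendstoInMeasure P (fun N : ℕ => fun ω => eulerScheme S F (t / (N + 1 : ℕ))
      (fun j => ZA (s + (j + 1 : ℕ) * (t / (N + 1 : ℕ))) ω -
        S (t / (N + 1 : ℕ)) (ZA (s + j * (t / (N + 1 : ℕ))) ω)) (X x s ω) (N + 1))
      atTop (X x (s + t)) := by
    refine tendstoInMeasure_of_lintegral_rpow one_pos (fun N => (hV N).aestronglyMeasurable)
      ((hX x).stronglyMeasurable _).aestronglyMeasurable ?_
    refine ((hX x).tendsto_eulerScheme hS hF hC (P := P) (fun t =>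
      (hX x).tendstoInMeasure hS hF hC hp hZ t) s t).congr fun N => lintegral_congr fun ω => ?_
    rw [ENNReal.rpow_one, enorm_sub_rev]
  refine (tendsto_setIntegral_of_tendstoInMeasure
    (Eventually.of_forall fun N => (hV N).aestronglyMeasurable) h1 hf hB A).congr fun N => ?_
  exact setIntegral_eulerScheme hS hF hC hZ (hXs s) hA _ f hf hB

lemma ae_eq_initial (hS : IsC0Semigroup S) (hp : 0 < p) (hZ : HasInnovations S ℱ P p ZA)
    (hX : ∀ x, IsStrictMildSolution ℱ S F ZA x (X x)) (x : H) : X x 0 =ᵐ[P] fun _ => x := by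
  filter_upwards [hZ.zero_ae hS hp] with ω hω
  rw [(hX x).eq, hω, hS.zero_apply, driftConv]
  simp

/-- The Markov property, tested with bounded continuous functions. -/
lemma setIntegral_markov (hS : IsC0Semigroup S) (hF : LipschitzWith L F)
    (hC : ∀ x, ‖F x‖ ≤ C) (hp : 0 < p) (hZ : HasInnovations S ℱ P p ZA)
    (hX : ∀ x, IsStrictMildSolution ℱ S F ZA x (X x))
    (x : H) (s t : ℝ≥0) {A : Set Ω} (hA : MeasurableSet[ℱ s] A) {f : H → ℝ}
    {B : ℝ} (hf : Continuous f) (hB : ∀ y, ‖f y‖ ≤ B) :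
    ∫ ω in A, f (X x (s + t) ω) ∂P = ∫ ω in A, (∫ ω', f (X (X x s ω) t ω') ∂P) ∂P := by
  have hpr := fun N : ℕ => hZ.isProbabilityMeasure_map (t / (N + 1 : ℕ))
  refine tendsto_nhds_unique (tendsto_setIntegral_iterate_eulerOp hS hF hC hp hZ hX x s t hA hf hB)
    ?_
  -- The same convergence with s = 0, the whole space as event and initial state y; since X^y_0 = y
  -- almost surely, it identifies the pointwise limit of the iterates, which no longer refers to s
  -- or A.
  have hpt : ∀ y, Tendsto (fun N : ℕ => ((eulerOp S F (P.map (ZA (t / (N + 1 : ℕ))))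
      (t / (N + 1 : ℕ)))^[N + 1] f) y) atTop (𝓝 (∫ ω, f (X y t ω) ∂P)) := fun y => by
    have h1 := tendsto_setIntegral_iterate_eulerOp hS hF hC hp hZ hX y 0 t MeasurableSet.univ hf hB
    simp only [Measure.restrict_univ, zero_add] at h1
    refine h1.congr fun N => ?_
    rw [integral_congr_ae (g := fun _ => ((eulerOp S F (P.map (ZA (t / (N + 1 : ℕ))))
      (t / (N + 1 : ℕ)))^[N + 1] f) y)]
    · simp
    · filter_upwards [ae_eq_initial hS hp hZ hX y] with ω hω
      rw [hω]
  refine tendsto_integral_of_dominated_convergence (fun _ => B) (fun N => ?_)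
    (integrable_const _) (fun N => Eventually.of_forall fun ω => norm_iterate_eulerOp_le hB _ _)
    (Eventually.of_forall fun ω => hpt _)
  exact ((continuous_iterate_eulerOp hS hF hC hf hB _).comp_stronglyMeasurable
    ((hX x).stronglyMeasurable s)).aestronglyMeasurable

end Markov

end LevySPDE

namespace LevySPDE

/-! ### The transition semigroup -/

section Transition

variable {H : Type*} [NormedAddCommGroup H] [InnerProductSpace ℝ H] [CompleteSpace H]
  [SecondCountableTopology H] [MeasurableSpace H] [BorelSpace H]
  {S : ℝ≥0 → H →L[ℝ] H} {F : H → H} {L : ℝ≥0} {C p : ℝ}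
  {Ω : Type*} {mΩ : MeasurableSpace Ω} {ℱ : Filtration ℝ≥0 mΩ} {P : Measure Ω}
  [IsProbabilityMeasure P] {ZA : ℝ≥0 → Ω → H} {X : H → ℝ≥0 → Ω → H}

lemma setLIntegral_coe_boundedContinuous {Y : Ω → H} (hY : StronglyMeasurable Y) (A : Set Ω)
    (g : BoundedContinuousFunction H ℝ≥0) :
    ∫⁻ ω in A, g (Y ω) ∂P = ENNReal.ofReal (∫ ω in A, (g (Y ω) : ℝ) ∂P) := by
  have hg : Continuous fun y => (g y : ℝ) := NNReal.continuous_coe.comp g.continuous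
  rw [ofReal_integral_eq_lintegral_ofReal]
  · simp
  · refine Integrable.of_bound (hg.comp_stronglyMeasurable hY).aestronglyMeasurable (nndist g 0)
      (Eventually.of_forall fun ω => ?_)
    simpa [NNReal.dist_eq] using g.dist_coe_le_dist (g := 0) (Y ω)
  · exact Eventually.of_forall fun ω => NNReal.coe_nonneg _

/-- A family of laws is a kernel if it is continuous on bounded continuous functions. -/
lemma measurable_map_of_isFellerFamily (hX : ∀ x t, StronglyMeasurable (X x t))
    (hf : IsFellerFamily P X) (t : ℝ≥0) : Measurable fun x => P.map (X x t) := by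
  have := fun x => Measure.isProbabilityMeasure_map (μ := P) (hX x t).measurable.aemeasurable
  -- Closed sets form a π-system generating the Borel sets, and the measure of a closed set is a
  -- limit of integrals of bounded continuous functions, which are continuous in x by the Feller
  -- property.
  refine Measurable.measure_of_isPiSystem_of_isProbabilityMeasure
    (S := {s | IsClosed s}) (by rw [← borel_eq_generateFrom_isClosed]; exact BorelSpace.measurable_eq)
    isPiSystem_isClosed fun s hs => ?_
  have hs' : IsClosed s := hs
  refine measurable_of_tendsto_metrizable (f := fun n x =>
    ∫⁻ y, hs'.apprSeq n y ∂(P.map (X x t))) (fun n => ?_)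
    (tendsto_pi_nhds.2 fun x => HasOuterApproxClosed.tendsto_lintegral_apprSeq hs' _)
  set g := hs'.apprSeq n
  have h1 := hf t (BoundedContinuousFunction.ofNormedAddCommGroup (fun y => (g y : ℝ))
    (NNReal.continuous_coe.comp g.continuous) 1 fun y => by
      simpa using HasOuterApproxClosed.apprSeq_apply_le_one hs' n y)
  have h2 : ∀ x, ∫⁻ y, g y ∂(P.map (X x t)) = ENNReal.ofReal (∫ ω, (g (X x t ω) : ℝ) ∂P) :=
    fun x => by
    rw [lintegral_map (by fun_prop) (hX x t).measurable]
    simpa using setLIntegral_coe_boundedContinuous (P := P) (hX x t) univ g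
  simp_rw [h2]
  exact (ENNReal.continuous_ofReal.comp h1).measurable

/-- Bounded continuous functions determine finite measures, so the tested Markov property becomes an
identity of measures, valid on all Borel sets. -/
lemma map_restrict_eq_bind (hS : IsC0Semigroup S) (hF : LipschitzWith L F)
    (hC : ∀ x, ‖F x‖ ≤ C) (hp : 0 < p) (hZ : HasInnovations S ℱ P p ZA)
    (hX : ∀ x, IsStrictMildSolution ℱ S F ZA x (X x)) (κ : ℝ≥0 → Kernel H H)
    (hκ : ∀ t x, κ t x = P.map (X x t)) (x : H) (s t : ℝ≥0) {A : Set Ω} (hA : MeasurableSet[ℱ s] A) :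
    (P.restrict A).map (X x (s + t)) = ((P.restrict A).map (X x s)).bind (κ t) := by
  have hm := fun x t => (hX x).stronglyMeasurable t
  have hκp : IsMarkovKernel (κ t) := ⟨fun y => by
    rw [hκ]
    exact Measure.isProbabilityMeasure_map (hm y t).measurable.aemeasurable⟩
  refine ext_of_forall_lintegral_eq_of_IsFiniteMeasure fun g => ?_
  have hg : Continuous fun y => (g y : ℝ) := NNReal.continuous_coe.comp g.continuous
  have hgB : ∀ y, ‖(g y : ℝ)‖ ≤ nndist g 0 := fun y => by
    simpa [NNReal.dist_eq] using g.dist_coe_le_dist (g := 0) y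
  have hu : ∀ y, ∫⁻ z, g z ∂(κ t y) = ENNReal.ofReal (∫ ω, (g (X y t ω) : ℝ) ∂P) := fun y => by
    rw [hκ, lintegral_map (by fun_prop) (hm y t).measurable]
    simpa using setLIntegral_coe_boundedContinuous (P := P) (hm y t) univ g
  rw [lintegral_map (by fun_prop) (hm x _).measurable,
    Measure.lintegral_bind (κ t).aemeasurable (by fun_prop),
    lintegral_map (Measurable.lintegral_kernel (by fun_prop)) (hm x s).measurable,
    setLIntegral_coe_boundedContinuous (hm x _),
    setIntegral_markov hS hF hC hp hZ hX x s t hA hg hgB]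
  simp_rw [hu]
  have hfe := isFellerFamily_of_isStrictMildSolution (P := P) hS hF hC hX t
    (BoundedContinuousFunction.ofNormedAddCommGroup (fun y => (g y : ℝ)) hg _ hgB)
  refine ofReal_integral_eq_lintegral_ofReal (Integrable.of_bound
    (hfe.comp_stronglyMeasurable (hm x s)).aestronglyMeasurable (nndist g 0)
    (Eventually.of_forall fun ω => ?_)) (Eventually.of_forall fun ω => ?_)
  · refine (norm_integral_le_of_norm_le_const (Eventually.of_forall fun ω' => hgB _)).trans_eq ?_
    simp
  · exact integral_nonneg fun ω' => NNReal.coe_nonneg _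

/-- The identity of measures over the whole space is the semigroup law; over a general event of `ℱ
s` it characterizes the conditional probability. -/
lemma isMarkovFamily_of_isStrictMildSolution (hS : IsC0Semigroup S) (hF : LipschitzWith L F)
    (hC : ∀ x, ‖F x‖ ≤ C) (hp : 0 < p) (hZ : HasInnovations S ℱ P p ZA)
    (hX : ∀ x, IsStrictMildSolution ℱ S F ZA x (X x)) : IsMarkovFamily ℱ P X := by
  have hm := fun x t => (hX x).stronglyMeasurable t
  set κ : ℝ≥0 → Kernel H H := fun t => ⟨fun x => P.map (X x t),
    measurable_map_of_isFellerFamily hm (isFellerFamily_of_isStrictMildSolution hS hF hC hX) t⟩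
    with hκdef
  have hκ : ∀ t x, κ t x = P.map (X x t) := fun _ _ => rfl
  have hbind := fun x s t {A : Set Ω} (hA : MeasurableSet[ℱ s] A) =>
    map_restrict_eq_bind hS hF hC hp hZ hX κ hκ x s t hA
  have hκp : ∀ t, IsMarkovKernel (κ t) := fun t => ⟨fun y =>
    Measure.isProbabilityMeasure_map (hm y t).measurable.aemeasurable⟩
  refine ⟨κ, hκ, ?_, fun s t => ?_, fun x s t B hB => ?_⟩
  · ext1 x
    rw [hκ, Measure.map_congr (ae_eq_initial hS hp hZ hX x), Kernel.id_apply]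
    simp
  · ext1 x
    have h1 := hbind x s t MeasurableSet.univ
    rw [Measure.restrict_univ] at h1
    rw [Kernel.comp_apply, hκ, hκ, h1]
  · have hκm : Measurable fun y => (κ t y).real B := ((κ t).measurable_coe hB).ennreal_toReal
    have hκs : StronglyMeasurable[ℱ s] fun ω => (κ t (X x s ω)).real B :=
      (hκm.comp ((hX x).predictable.stronglyAdapted s).measurable).stronglyMeasurable
    have hκi : Integrable (fun ω => (κ t (X x s ω)).real B) P :=
      Integrable.of_bound (hκs.mono (ℱ.le s)).aestronglyMeasurable 1
        (Eventually.of_forall fun ω => by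
          rw [Real.norm_of_nonneg measureReal_nonneg]
          exact measureReal_le_one)
    refine (ae_eq_condExp_of_forall_setIntegral_eq (ℱ.le s) ?_ (fun _ _ _ => hκi.integrableOn)
      (fun A hA _ => ?_) hκs.aestronglyMeasurable).symm
    · exact (integrable_const _).indicator ((hm x (s + t)).measurable hB)
    · have h1 := congrArg (fun μ : Measure H => μ B) (hbind x s t hA)
      rw [Measure.bind_apply hB (κ t).aemeasurable, lintegral_map ((κ t).measurable_coe hB)
        (hm x s).measurable, Measure.map_apply (hm x _).measurable hB] at h1
      rw [integral_indicator ((hm x (s + t)).measurable hB), setIntegral_const, smul_eq_mul, mul_one,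
        Measure.real, h1]
      refine integral_toReal ?_ (Eventually.of_forall fun ω => measure_lt_top _ _)
      exact (((κ t).measurable_coe hB).comp (hm x s).measurable).aemeasurable

end Transition

/-! ### Invariance under modification -/

section Congr

variable {Ω : Type*} {mΩ : MeasurableSpace Ω} {P : Measure Ω} {ℱ : Filtration ℝ≥0 mΩ}
  {H : Type*} [NormedAddCommGroup H] [InnerProductSpace ℝ H] [MeasurableSpace H]
  {X X' : H → ℝ≥0 → Ω → H}

lemma IsMarkovFamily.congr (h : IsMarkovFamily ℱ P X) (hX : ∀ x t, X' x t =ᵐ[P] X x t) :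
    IsMarkovFamily ℱ P X' := by
  obtain ⟨κ, h1, h2, h3, h4⟩ := h
  refine ⟨κ, fun t x => (h1 t x).trans (Measure.map_congr (hX x t)).symm, h2, h3,
    fun x s t B hB => ?_⟩
  refine EventuallyEq.trans (condExp_congr_ae ?_) ((h4 x s t B hB).trans ?_)
  · filter_upwards [hX x (s + t)] with ω hω
    have h5 : ω ∈ X' x (s + t) ⁻¹' B ↔ ω ∈ X x (s + t) ⁻¹' B := by
      rw [mem_preimage, mem_preimage, hω]
    by_cases h6 : ω ∈ X x (s + t) ⁻¹' B
    · rw [indicator_of_mem h6, indicator_of_mem (h5.2 h6)]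
    · rw [indicator_of_notMem h6, indicator_of_notMem (mt h5.1 h6)]
  · filter_upwards [hX x s] with ω hω
    rw [hω]

lemma IsFellerFamily.congr (h : IsFellerFamily P X) (hX : ∀ x t, X' x t =ᵐ[P] X x t) :
    IsFellerFamily P X' := by
  intro t f
  refine (h t f).congr fun x => integral_congr_ae ?_
  filter_upwards [hX x t] with ω hω
  rw [hω]

end Congr

end LevySPDE

/-! ### The theorem -/

theorem proposition2p5
    {H : Type*} [NormedAddCommGroup H] [InnerProductSpace ℝ H] [CompleteSpace H]
    [TopologicalSpace.SeparableSpace H] [MeasurableSpace H] [BorelSpace H]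
    {U : Type*} [NormedAddCommGroup U] [InnerProductSpace ℝ U] [CompleteSpace U]
    [MeasurableSpace U] [BorelSpace U]
    (ι : H →L[ℝ] U) (hι_inj : Function.Injective ι) (hι_dense : DenseRange ι)
    {Ω : Type*} {mΩ : MeasurableSpace Ω} (P : Measure Ω) [IsProbabilityMeasure P]
    (ℱ : Filtration ℝ≥0 mΩ) (hℱ : UsualConditions ℱ P)
    (S : ℝ≥0 → H →L[ℝ] H) (hS : IsC0Semigroup S)
    (A : H →ₗ.[ℝ] H) (hA : IsGenerator S A)
    (a : U)
    (Q : H →ₗ.[ℝ] H) (hQ : IsNonnegSelfAdjoint Q)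
    (R : H →ₗ.[ℝ] H) (hR : IsSqrtOf R Q)
    (W : ℝ≥0 → H → Ω → ℝ) (Y : ℝ≥0 → Ω → U) (hWY : IsLevyNoise W Y ℱ P)
    (h1 : SemigroupHypothesis ι S a R)
    (p : ℝ) (hp : 0 < p) (h2 : JumpHypothesis P ι S Y p)
    (F : H → H) (hF_lip : ∃ K : ℝ≥0, LipschitzWith K F) (hF_bdd : ∃ C : ℝ, ∀ x, ‖F x‖ ≤ C) :
    -- the stochastic convolution exists and has a predictable version
    (∃ ZA, IsStochasticConvolution ℱ P ι S a R W Y ZA) ∧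
    ∀ ZA, IsStochasticConvolution ℱ P ι S a R W Y ZA →
      -- existence and uniqueness of the mild solution, for every initial state
      (∀ x : H, ∃ X : ℝ≥0 → Ω → H,
        IsPathwiseMildSolution ℱ P S F ZA x X ∧
        (∀ X', IsPathwiseMildSolution ℱ P S F ZA x X' → ∀ᵐ ω ∂P, ∀ t, X' t ω = X t ω) ∧
        (∀ X', IsMildSolution ℱ P S F ZA x X' → ∀ t, X' t =ᵐ[P] X t)) ∧
      -- properties of the solutions
      ∀ X : H → ℝ≥0 → Ω → H, (∀ x, IsMildSolution ℱ P S F ZA x (X x)) →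
        IsMarkovFamily ℱ P X ∧
        IsFellerFamily P X ∧
        (∀ x t, ∫⁻ ω, ‖X x t ω‖ₑ ^ p ∂P < ∞) ∧
        (∀ x t, Tendsto (fun s => ∫⁻ ω, ‖X x s ω - X x t ω‖ₑ ^ p ∂P) (𝓝 t) (𝓝 0)) := by
  obtain ⟨L, hL⟩ := hF_lip
  obtain ⟨C, hC⟩ := hF_bdd
  refine ⟨exists_isStochasticConvolution hι_dense hS hR hWY h1 hp h2, fun ZA hZA => ?_⟩
  have hZ := hZA.hasInnovations hι_dense hS hR hWY h1 hp h2
  choose X₀ hX₀ using exists_isStrictMildSolution hS hL hC hZA.predictable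
  refine ⟨fun x => ⟨X₀ x, (hX₀ x).isPathwiseMildSolution hS hL hC,
    fun X' hX' => (hX₀ x).ae_eq_of_isPathwiseMildSolution hS hL hC hX',
    fun X' hX' => (hX₀ x).ae_eq_of_isMildSolution hZA.predictable hS hL hC hX'⟩,
    fun X hX => ?_⟩
  -- Any mild solution is a modification of the strict one, and the remaining claims involve the
  -- process only at one or two fixed times, so they may be proved for the strict solutions.
  have hXX : ∀ x t, X x t =ᵐ[P] X₀ x t := fun x =>
    (hX₀ x).ae_eq_of_isMildSolution hZA.predictable hS hL hC (hX x)
  refine ⟨(isMarkovFamily_of_isStrictMildSolution hS hL hC hp hZ hX₀).congr hXX,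
    (isFellerFamily_of_isStrictMildSolution hS hL hC hX₀).congr hXX, fun x t => ?_, fun x t => ?_⟩
  · refine (lintegral_congr_ae ?_).trans_lt ((hX₀ x).lintegral_rpow_lt_top hS hC hp hZ t)
    filter_upwards [hXX x t] with ω hω
    rw [hω]
  · refine ((hX₀ x).tendsto_lintegral_sub hS hL hC hp hZ t).congr fun s => lintegral_congr_ae ?_
    filter_upwards [hXX x t, hXX x s] with ω h3 h4
    rw [h3, h4]
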